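/- Let $M$ be an $(n+1)$-dimensional smooth Riemannian manifold without boundary; smooth means $C^\infty$, $\mathcal H^n$ is the $n$-dimensional Hausdorff measure and $\mathrm{Vol}=\mathcal H^{n+1}$. *Generalized smooth families.* Let $T=[0,1]^k$. A family $\{\Gamma_t\}_{t\in T}$ of closed subsets of $M$ with finite $\mathcal H^n$-measure is a generalized smooth family, with finite exceptional sets $P_t\subset M$, if - (s1) $\Gamma_t$ is a smooth embedded hypersurface in $M\setminus P_t$ for each $t$; - (s2) $\mathcal H^n(\Gamma_t)$ depends smoothly on $t\in T$, and $t\mapsto\Gamma_t$ is continuous in the Hausdorff sense; - (s3) for every $t_0$ and every open $V\subset\subset M\setminus P_{t_0}$, $\Gamma_t\to\Gamma_{t_0}$ smoothly in $V$ as $t\to t_0$. That is: near each point of $\Gamma_{t_0}\setminus P_{t_0}$, for $t$ close to $t_0$, $\Gamma_t$ is the graph over $\Gamma_{t_0}$ of a smooth function $g_t$, with $\|g_t\|_{C^j}\to0$ for every $j$; each point outside $\Gamma_{t_0}\cup P_{t_0}$ has a neighbourhood which $\Gamma_t$ does not meet for $t$ close to $t_0$. *Families of boundaries.* A one-parameter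 family of boundaries $\{\partial\Omega_t\}_{t\in[0,1]}$ consists of open sets $\Omega_t\subset M$ and a generalized smooth family $\{\Gamma_t\}_{t\in[0,1]}$, with exceptional sets $P_t$, such that $\Gamma_t$ is the topological boundary of $\Omega_t$ together with at most some points of $P_t$, and $\mathrm{Vol}(\Omega_t\setminus\Omega_s)+\mathrm{Vol}(\Omega_s\setminus\Omega_t)\to0$ as $t\to s$. Following the usual abuse of notation, below $\partial\Omega_t$ stands for the surface $\Gamma_t$. The family is a *sweepout* if in addition $\Omega_0=\emptyset$ and $\Omega_1=M$. Two sweepouts $\{\Gamma^0_t\}$ and $\{\Gamma^1_t\}$ are *homotopic* if there is a generalized smooth family $\{\Gamma_{(s,t)}\}_{(s,t)\in[0,1]^2}$ with $\Gamma_{(0,t)}=\Gamma^0_t$ and $\Gamma_{(1,t)}=\Gamma^1_t$ for all $t$. **Lemma.** Let $U,U'\subset M$ be open sets such that $\overline U$ is compact and contained in $U'$, let $\{\partial\Xi_t\}_{t\in[0,1]}$ be a sweepout, and let $\varepsilon>0$ and $t_0\in[0,1]$. Suppose that $\{\partial\Omega_s\}_{s\in[0,1]}$ is a one-parameter family of boundaries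 such that - $\Omega_0=\Xi_{t_0}$ and $\partial\Omega_0=\partial\Xi_{t_0}$, and, for every $s$, $\Omega_s\setminus U=\Xi_{t_0}\setminus U$ and $\partial\Omega_s\setminus\overline U=\partial\Xi_{t_0}\setminus\overline U$; - $\mathcal H^n(\partial\Omega_s)\le\mathcal H^n(\partial\Xi_{t_0})+\varepsilon/8$ for every $s\in[0,1]$; - $\mathcal H^n(\partial\Omega_1)\le\mathcal H^n(\partial\Xi_{t_0})-\varepsilon$. Then there is $\eta>0$ such that for all $a,a',b',b$ with $t_0-\eta\le a<a'<b'<b\le t_0+\eta$ there is a sweepout $\{\partial\Xi'_t\}_{t\in[0,1]}$, homotopic to $\{\partial\Xi_t\}$, with the following properties: - (a) $\Xi'_t=\Xi_t$ and $\partial\Xi'_t=\partial\Xi_t$ for $t\in[0,a]\cup[b,1]$; $\Xi'_t\setminus U'=\Xi_t\setminus U'$ and $\partial\Xi'_t\setminus U'=\partial\Xi_t\setminus U'$ for $t\in(a,b)$; - (b) $\mathcal H^n(\partial\Xi'_t)\le\mathcal H^n(\partial\Xi_t)+\varepsilon/4$ for every $t\in[0,1]$; - (c) $\mathcal H^n(\partial\Xi'_t)\le\mathcal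 H^n(\partial\Xi_t)-\varepsilon/2$ for $t\in(a',b')$. -/

import Mathlib

open Set Filter Topology MeasureTheory
open scoped Manifold ContDiff Bundle

noncomputable section

namespace MinMax

/-- The first `n` coordinates of a point of `ℝⁿ⁺¹`. -/
def horiz {n : ℕ} (x : EuclideanSpace ℝ (Fin (n + 1))) : EuclideanSpace ℝ (Fin n) :=
  WithLp.toLp 2 fun i => x i.castSucc

/-- The last coordinate of a point of `ℝⁿ⁺¹`. -/
def vert {n : ℕ} (x : EuclideanSpace ℝ (Fin (n + 1))) : ℝ := x (Fin.last n)

/-- The open cylinder of radius and half-height `r` centred at the origin of `ℝⁿ⁺¹`. -/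
def cyl (n : ℕ) (r : ℝ) : Set (EuclideanSpace ℝ (Fin (n + 1))) :=
  {x | ‖horiz x‖ < r ∧ |vert x| < r}

/-- The `n`-dimensional area `ℋⁿ(Γ)` as a real number. It is only used for sets of finite
`ℋⁿ`-measure. The normalization is the one for which `ℋⁿ` is Lebesgue measure on `ℝⁿ`. -/
def area {M : Type*} [EMetricSpace M] [MeasurableSpace M] [BorelSpace M]
    (n : ℕ) (Γ : Set M) : ℝ :=
  (μHE[n] Γ).toReal

/-- `Γ ∩ W` is a smooth embedded hypersurface of the open set `W`: near each of its points there
is a smooth chart of `M` in which `Γ` is the slice where the last coordinate vanishes. -/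
def IsSmoothHypersurfaceIn {M : Type*} [EMetricSpace M] (n : ℕ)
    [ChartedSpace (EuclideanSpace ℝ (Fin (n + 1))) M] (Γ W : Set M) : Prop :=
  ∀ p ∈ Γ ∩ W, ∃ e ∈ IsManifold.maximalAtlas (𝓡 (n + 1)) ∞ M,
    p ∈ e.source ∧ ∀ q ∈ e.source, q ∈ Γ ↔ vert (e q) = 0

/-- Smooth graphical convergence `Γ t → Γ t₀` near a point `p` of `Γ t₀`, as `t → t₀` in `T`:
in a cylinder of a smooth chart centred at `p` in which `Γ t₀` is the slice
where the last coordinate vanishes, `Γ t` is, for `t` close to `t₀`, the graph over that slice of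
a smooth function `g t`, and all derivatives of `g t` converge uniformly to zero, i.e.
`‖g t‖` tends to zero in `C^k` for every `k`. By compactness, having this near every point of
`Γ t₀ ∩ closure V` amounts to smooth convergence in `V`, for `V` relatively compact. -/
def ConvergesSmoothlyAt {M : Type*} [EMetricSpace M] (n : ℕ)
    [ChartedSpace (EuclideanSpace ℝ (Fin (n + 1))) M]
    {E : Type*} [TopologicalSpace E] (T : Set E) (Γ : E → Set M) (t₀ : E) (p : M) : Prop :=
  ∃ e ∈ IsManifold.maximalAtlas (𝓡 (n + 1)) ∞ M,
    ∃ r : ℝ, 0 < r ∧ ∃ g : E → EuclideanSpace ℝ (Fin n) → ℝ,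
      p ∈ e.source ∧ e p = 0 ∧ cyl n r ⊆ e.target ∧
      (∀ x ∈ cyl n r, e.symm x ∈ Γ t₀ ↔ vert x = 0) ∧
      (∀ᶠ t in 𝓝[T] t₀, ContDiffOn ℝ ∞ (g t) (Metric.ball 0 r) ∧
        ∀ x ∈ cyl n r, e.symm x ∈ Γ t ↔ vert x = g t (horiz x)) ∧
      ∀ k : ℕ, TendstoUniformlyOn (fun t y => iteratedFDeriv ℝ k (g t) y) (fun _ => 0)
        (𝓝[T] t₀) (Metric.ball 0 r)

/-- `{Γ t}_{t ∈ T}` is a generalized smooth family of hypersurfaces, with finite exceptional sets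
`P t`. The parameter sets used are `T = [0,1]` and `T = [0,1]²`. -/
structure IsGeneralizedSmoothFamily {M : Type*} [EMetricSpace M] [MeasurableSpace M]
    [BorelSpace M] (n : ℕ) [ChartedSpace (EuclideanSpace ℝ (Fin (n + 1))) M]
    {E : Type*} [NormedAddCommGroup E] [NormedSpace ℝ E]
    (T : Set E) (Γ P : E → Set M) : Prop where
  isClosed : ∀ t ∈ T, IsClosed (Γ t)
  measure_lt_top : ∀ t ∈ T, μHE[n] (Γ t) < ⊤
  finite_exceptional : ∀ t ∈ T, (P t).Finite
  smooth_off : ∀ t ∈ T, IsSmoothHypersurfaceIn n (Γ t) (P t)ᶜ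
  area_smooth : ContDiffOn ℝ ∞ (fun t => area n (Γ t)) T
  hausdorff_continuous : ∀ t₀ ∈ T,
    Tendsto (fun t => Metric.hausdorffEDist (Γ t) (Γ t₀)) (𝓝[T] t₀) (𝓝 0)
  converges_on : ∀ t₀ ∈ T, ∀ p ∈ Γ t₀ \ P t₀, ConvergesSmoothlyAt n T Γ t₀ p
  converges_off : ∀ t₀ ∈ T, ∀ p, p ∉ Γ t₀ → p ∉ P t₀ →
    ∃ W ∈ 𝓝 p, ∀ᶠ t in 𝓝[T] t₀, Disjoint W (Γ t)

/-- A one-parameter family of boundaries `{∂Ω t}_{t ∈ [0,1]}`. The surface at time `t` is `Γ t`: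
it is the topological boundary of the open set `Ω t`, up to adding points of the finite
exceptional set `P t`. (For instance, a family of spheres shrinking to a point `p` may end
with `Γ t = {p}` and `Ω t = ∅`.) The sets `Ω t` vary continuously in volume. -/
def IsBoundaryFamily {M : Type*} [EMetricSpace M] [MeasurableSpace M] [BorelSpace M]
    (n : ℕ) [ChartedSpace (EuclideanSpace ℝ (Fin (n + 1))) M] (Γ Ω : ℝ → Set M) : Prop :=
  ∃ P : ℝ → Set M,
    IsGeneralizedSmoothFamily n (Icc (0 : ℝ) 1) Γ P ∧
    (∀ t ∈ Icc (0 : ℝ) 1, IsOpen (Ω t)) ∧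
    (∀ t ∈ Icc (0 : ℝ) 1, frontier (Ω t) ⊆ Γ t ∧ Γ t \ frontier (Ω t) ⊆ P t) ∧
    ∀ s ∈ Icc (0 : ℝ) 1,
      Tendsto (fun t => μHE[n + 1] (Ω t \ Ω s) + μHE[n + 1] (Ω s \ Ω t))
        (𝓝[Icc (0 : ℝ) 1] s) (𝓝 0)

/-- A sweepout `{Γ t} = {∂Ω t}` of `M`: a family of boundaries going from `Ω 0 = ∅` to
`Ω 1 = M`. -/
def IsSweepout {M : Type*} [EMetricSpace M] [MeasurableSpace M] [BorelSpace M]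
    (n : ℕ) [ChartedSpace (EuclideanSpace ℝ (Fin (n + 1))) M] (Γ Ω : ℝ → Set M) : Prop :=
  IsBoundaryFamily n Γ Ω ∧ Ω 0 = ∅ ∧ Ω 1 = univ

/-- Two one-parameter families of surfaces are homotopic if they are opposite sides of a
generalized smooth family parametrized by `[0,1]²`. -/
def AreHomotopic {M : Type*} [EMetricSpace M] [MeasurableSpace M] [BorelSpace M]
    (n : ℕ) [ChartedSpace (EuclideanSpace ℝ (Fin (n + 1))) M] (Γ₀ Γ₁ : ℝ → Set M) : Prop :=
  ∃ G P : ℝ × ℝ → Set M,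
    IsGeneralizedSmoothFamily n (Icc (0 : ℝ) 1 ×ˢ Icc (0 : ℝ) 1) G P ∧
    ∀ t ∈ Icc (0 : ℝ) 1, G (0, t) = Γ₀ t ∧ G (1, t) = Γ₁ t

/-- `{S s} = {∂Ω s}` is a deformation of the boundary `Γ₀ = ∂Ω₀` inside `U` which never gains more
than `ε / 8` in area and in the end loses at least `ε`. -/
structure IsLoweringDeformation {M : Type*} [EMetricSpace M] [MeasurableSpace M] [BorelSpace M]
    (n : ℕ) [ChartedSpace (EuclideanSpace ℝ (Fin (n + 1))) M] (U : Set M) (ε : ℝ)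
    (Γ₀ Ω₀ : Set M) (S Ω : ℝ → Set M) : Prop where
  isBoundaryFamily : IsBoundaryFamily n S Ω
  start_surface : S 0 = Γ₀
  start_set : Ω 0 = Ω₀
  surface_off : ∀ s ∈ Icc (0 : ℝ) 1, S s \ closure U = Γ₀ \ closure U
  set_off : ∀ s ∈ Icc (0 : ℝ) 1, Ω s \ U = Ω₀ \ U
  area_le : ∀ s ∈ Icc (0 : ℝ) 1, area n (S s) ≤ area n Γ₀ + ε / 8
  area_end : area n (S 1) ≤ area n Γ₀ - ε

end MinMax

end

set_option linter.unusedSectionVars false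
set_option linter.overlappingInstances false

noncomputable section

namespace MinMax

open Metric

section SmoothConvergence

variable {Y : Type*} {X F G : Type} [NormedAddCommGroup X] [NormedSpace ℝ X]
  [NormedAddCommGroup F] [NormedSpace ℝ F] [NormedAddCommGroup G] [NormedSpace ℝ G]

/-- Continuous convergence at `x₀` of the maps `u y` and of their derivatives up to order `k`. -/
def CvK {Y : Type*} {X : Type} [NormedAddCommGroup X] [NormedSpace ℝ X] (l : Filter Y) (x₀ : X) :
    ℕ → ∀ (F : Type) [NormedAddCommGroup F] [NormedSpace ℝ F], (Y → X → F) → (X → F) → Prop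
  | 0, _, _, _, u, u₀ => Tendsto (fun p : Y × X => u p.1 p.2) (l ×ˢ 𝓝 x₀) (𝓝 (u₀ x₀))
  | k + 1, F, _, _, u, u₀ => Tendsto (fun p : Y × X => u p.1 p.2) (l ×ˢ 𝓝 x₀) (𝓝 (u₀ x₀)) ∧
      CvK l x₀ k (X →L[ℝ] F) (fun y => fderiv ℝ (u y)) (fderiv ℝ u₀)

/-- The maps `u y` are smooth near `x₀`, for `y` far in the filter, and so is the limit. -/
structure SmoothNear (l : Filter Y) (u : Y → X → F) (u₀ : X → F) (x₀ : X) : Prop where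
  left : ∀ᶠ p : Y × X in l ×ˢ 𝓝 x₀, ContDiffAt ℝ ∞ (u p.1) p.2
  right : ∀ᶠ x in 𝓝 x₀, ContDiffAt ℝ ∞ u₀ x

/-- Smooth convergence `u y → u₀` at `x₀`. -/
structure Cv (l : Filter Y) (u : Y → X → F) (u₀ : X → F) (x₀ : X) : Prop where
  smooth : SmoothNear l u u₀ x₀
  conv : ∀ k, CvK l x₀ k F u u₀

theorem eventually_prod_eventually {l : Filter Y} {x₀ : X} {Q : Y × X → Prop}
    (h : ∀ᶠ p in l ×ˢ 𝓝 x₀, Q p) : ∀ᶠ p in l ×ˢ 𝓝 x₀, ∀ᶠ x in 𝓝 p.2, Q (p.1, x) := by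
  obtain ⟨pa, ha, pb, hb, hab⟩ := eventually_prod_iff.1 h
  exact eventually_prod_iff.2 ⟨pa, ha, _, eventually_eventually_nhds.2 hb,
    fun hy _ hx => hx.mono fun _ hz => hab hy hz⟩

theorem CvK.tendsto {l : Filter Y} {x₀ : X} {k : ℕ} {u : Y → X → F} {u₀ : X → F}
    (h : CvK l x₀ k F u u₀) : Tendsto (fun p : Y × X => u p.1 p.2) (l ×ˢ 𝓝 x₀) (𝓝 (u₀ x₀)) := by
  cases k with
  | zero => exact h
  | succ k => exact h.1

theorem CvK.of_succ {l : Filter Y} {x₀ : X} {k : ℕ} {u : Y → X → F} {u₀ : X → F}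
    (h : CvK l x₀ (k + 1) F u u₀) : CvK l x₀ k F u u₀ := by
  induction k generalizing F with
  | zero => exact h.1
  | succ k ih => exact ⟨h.1, ih h.2⟩

theorem CvK.congr {l : Filter Y} {x₀ : X} {k : ℕ} {u v : Y → X → F} {u₀ v₀ : X → F}
    (h : CvK l x₀ k F u u₀) (huv : ∀ᶠ p : Y × X in l ×ˢ 𝓝 x₀, u p.1 p.2 = v p.1 p.2)
    (h₀ : u₀ =ᶠ[𝓝 x₀] v₀) : CvK l x₀ k F v v₀ := by
  induction k generalizing F with
  | zero =>
    unfold CvK at h ⊢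
    rw [← h₀.eq_of_nhds]
    exact h.congr' huv
  | succ k ih =>
    refine ⟨?_, ih h.2 ?_ h₀.fderiv⟩
    · rw [← h₀.eq_of_nhds]
      exact h.1.congr' huv
    · filter_upwards [eventually_prod_eventually huv] with p hp
      exact EventuallyEq.fderiv_eq hp

theorem CvK.comp_param {Y' : Type*} {l : Filter Y} {l' : Filter Y'} {φ : Y' → Y}
    (hφ : Tendsto φ l' l) {x₀ : X} {k : ℕ} {u : Y → X → F} {u₀ : X → F}
    (h : CvK l x₀ k F u u₀) : CvK l' x₀ k F (fun y => u (φ y)) u₀ := by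
  induction k generalizing F with
  | zero => exact Tendsto.comp h (hφ.prodMap tendsto_id)
  | succ k ih => exact ⟨h.1.comp (hφ.prodMap tendsto_id), ih h.2⟩

theorem contDiffAt_fderiv {u : X → F} {x : X} (h : ContDiffAt ℝ ∞ u x) :
    ContDiffAt ℝ ∞ (fderiv ℝ u) x := h.fderiv_right (by simp)

theorem SmoothNear.fderiv {l : Filter Y} {x₀ : X} {u : Y → X → F} {u₀ : X → F}
    (h : SmoothNear l u u₀ x₀) : SmoothNear l (fun y => fderiv ℝ (u y)) (fderiv ℝ u₀) x₀ :=
  ⟨h.left.mono fun _ hp => contDiffAt_fderiv hp, h.right.mono fun _ hp => contDiffAt_fderiv hp⟩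

theorem CvK.clm_apply {l : Filter Y} {x₀ : X} {k : ℕ} {u : Y → X → F} {u₀ : X → F}
    (L : F →L[ℝ] G) (hs : SmoothNear l u u₀ x₀) (h : CvK l x₀ k F u u₀) :
    CvK l x₀ k G (fun y x => L (u y x)) (fun x => L (u₀ x)) := by
  induction k generalizing F G with
  | zero => exact (L.continuous.tendsto _).comp h
  | succ k ih =>
    refine ⟨(L.continuous.tendsto _).comp h.1, ?_⟩
    refine (ih (ContinuousLinearMap.compL ℝ X F G L) hs.fderiv h.2).congr ?_ ?_
    · filter_upwards [hs.left] with p hp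
      have := (L.hasFDerivAt.comp p.2 (hp.differentiableAt (by simp)).hasFDerivAt).fderiv
      simpa [Function.comp_def] using this.symm
    · filter_upwards [hs.right] with x hp
      have := (L.hasFDerivAt.comp x (hp.differentiableAt (by simp)).hasFDerivAt).fderiv
      simpa [Function.comp_def] using this.symm

theorem SmoothNear.prodMk {l : Filter Y} {x₀ : X} {u : Y → X → F} {u₀ : X → F}
    {v : Y → X → G} {v₀ : X → G} (h : SmoothNear l u u₀ x₀) (h' : SmoothNear l v v₀ x₀) :
    SmoothNear l (fun y x => (u y x, v y x)) (fun x => (u₀ x, v₀ x)) x₀ :=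
  ⟨(h.left.and h'.left).mono fun _ hp => hp.1.prodMk hp.2, (h.right.and h'.right).mono fun _ hp => hp.1.prodMk hp.2⟩

theorem CvK.prodMk {l : Filter Y} {x₀ : X} {k : ℕ} {u : Y → X → F} {u₀ : X → F}
    {v : Y → X → G} {v₀ : X → G} (hu : SmoothNear l u u₀ x₀) (hv : SmoothNear l v v₀ x₀)
    (h : CvK l x₀ k F u u₀) (h' : CvK l x₀ k G v v₀) :
    CvK l x₀ k (F × G) (fun y x => (u y x, v y x)) (fun x => (u₀ x, v₀ x)) := by
  induction k generalizing F G with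
  | zero => exact Tendsto.prodMk_nhds h h'
  | succ k ih =>
    refine ⟨h.1.prodMk_nhds h'.1, ?_⟩
    refine ((ih hu.fderiv hv.fderiv h.2 h'.2).clm_apply
      (ContinuousLinearMap.prodₗᵢ (𝕜 := ℝ) ℝ (E := X) (F := F) (G := G)).toContinuousLinearEquiv.toContinuousLinearMap
      (hu.fderiv.prodMk hv.fderiv)).congr ?_ ?_
    · filter_upwards [hu.left, hv.left] with p hp hp'
      exact ((hp.differentiableAt (by simp)).hasFDerivAt.prodMk
        (hp'.differentiableAt (by simp)).hasFDerivAt).fderiv.symm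
    · filter_upwards [hu.right, hv.right] with p hp hp'
      exact ((hp.differentiableAt (by simp)).hasFDerivAt.prodMk
        (hp'.differentiableAt (by simp)).hasFDerivAt).fderiv.symm

theorem SmoothNear.const {l : Filter Y} {x₀ : X} {u₀ : X → F}
    (h : ∀ᶠ x in 𝓝 x₀, ContDiffAt ℝ ∞ u₀ x) : SmoothNear l (fun _ => u₀) u₀ x₀ :=
  ⟨tendsto_snd.eventually h, h⟩

theorem CvK.const {l : Filter Y} {x₀ : X} {k : ℕ} {u₀ : X → F}
    (h : ∀ᶠ x in 𝓝 x₀, ContDiffAt ℝ ∞ u₀ x) : CvK l x₀ k F (fun _ => u₀) u₀ := by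
  induction k generalizing F with
  | zero => exact h.self_of_nhds.continuousAt.tendsto.comp tendsto_snd
  | succ k ih =>
    exact ⟨h.self_of_nhds.continuousAt.tendsto.comp tendsto_snd, ih (h.mono fun _ => contDiffAt_fderiv)⟩

theorem tendsto_prodMk_comp {l : Filter Y} {x₀ : X} {g : Y → X → F} {g₀ : X → F}
    (h : Tendsto (fun p : Y × X => g p.1 p.2) (l ×ˢ 𝓝 x₀) (𝓝 (g₀ x₀))) :
    Tendsto (fun p : Y × X => (p.1, g p.1 p.2)) (l ×ˢ 𝓝 x₀) (l ×ˢ 𝓝 (g₀ x₀)) :=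
  tendsto_fst.prodMk h

theorem SmoothNear.comp {l : Filter Y} {x₀ : X} {U : Y → F → G} {U₀ : F → G} {g : Y → X → F}
    {g₀ : X → F} (hU : SmoothNear l U U₀ (g₀ x₀)) (hg : SmoothNear l g g₀ x₀)
    (h : Tendsto (fun p : Y × X => g p.1 p.2) (l ×ˢ 𝓝 x₀) (𝓝 (g₀ x₀))) :
    SmoothNear l (fun y x => U y (g y x)) (fun x => U₀ (g₀ x)) x₀ := by
  refine ⟨?_, ?_⟩
  · filter_upwards [(tendsto_prodMk_comp h).eventually hU.left, hg.left] with p h1 h2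
    exact ContDiffAt.comp p.2 h1 h2
  · filter_upwards [hg.right.self_of_nhds.continuousAt.eventually hU.right, hg.right] with x h1 h2
    exact ContDiffAt.comp x h1 h2

theorem CvK.comp {l : Filter Y} {x₀ : X} {k : ℕ} {U : Y → F → G} {U₀ : F → G} {g : Y → X → F}
    {g₀ : X → F} (hU : SmoothNear l U U₀ (g₀ x₀)) (hg : SmoothNear l g g₀ x₀)
    (h : CvK l (g₀ x₀) k G U U₀) (h' : CvK l x₀ k F g g₀) :
    CvK l x₀ k G (fun y x => U y (g y x)) (fun x => U₀ (g₀ x)) := by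
  induction k generalizing F G with
  | zero => exact Tendsto.comp h (tendsto_prodMk_comp h')
  | succ k ih =>
    refine ⟨h.1.comp (tendsto_prodMk_comp h'.1), ?_⟩
    have h1 := ih hU.fderiv hg h.2 h'.of_succ
    have h2 := h1.prodMk (hU.fderiv.comp hg h'.1) hg.fderiv h'.2
    have hB : ContDiff ℝ ∞ (fun q : (F →L[ℝ] G) × (X →L[ℝ] F) => q.1.comp q.2) := contDiff_fst.clm_comp contDiff_snd
    have hB' : ∀ z, ∀ᶠ x in 𝓝 z, ContDiffAt ℝ ∞
        (fun q : (F →L[ℝ] G) × (X →L[ℝ] F) => q.1.comp q.2) x :=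
      fun z => Eventually.of_forall fun x => hB.contDiffAt
    have h3 := ih (U := fun _ q => q.1.comp q.2) (SmoothNear.const (l := l) (hB' _))
      ((hU.fderiv.comp hg h'.1).prodMk hg.fderiv) (CvK.const (hB' _)) h2
    refine h3.congr ?_ ?_
    · filter_upwards [(tendsto_prodMk_comp h'.1).eventually hU.left, hg.left] with p h4 h5
      exact ((h4.differentiableAt (by simp)).hasFDerivAt.comp p.2
        (h5.differentiableAt (by simp)).hasFDerivAt).fderiv.symm
    · filter_upwards [hg.right.self_of_nhds.continuousAt.eventually hU.right, hg.right]
        with x h4 h5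
      exact ((h4.differentiableAt (by simp)).hasFDerivAt.comp x
        (h5.differentiableAt (by simp)).hasFDerivAt).fderiv.symm

namespace Cv

variable {l : Filter Y} {x₀ : X} {u v : Y → X → F} {u₀ v₀ : X → F}

theorem tendsto (h : Cv l u u₀ x₀) : Tendsto (fun p : Y × X => u p.1 p.2) (l ×ˢ 𝓝 x₀) (𝓝 (u₀ x₀)) := h.conv 0

theorem congr (h : Cv l u u₀ x₀) (huv : ∀ᶠ p : Y × X in l ×ˢ 𝓝 x₀, u p.1 p.2 = v p.1 p.2)
    (h₀ : u₀ =ᶠ[𝓝 x₀] v₀) : Cv l v v₀ x₀ := by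
  refine ⟨⟨?_, ?_⟩, fun k => (h.conv k).congr huv h₀⟩
  · filter_upwards [eventually_prod_eventually huv, h.smooth.left] with p hp hq
    exact hq.congr_of_eventuallyEq (hp.mono fun _ => Eq.symm)
  · filter_upwards [h₀.eventuallyEq_nhds, h.smooth.right] with x hp hq
    exact hq.congr_of_eventuallyEq hp.symm

theorem comp_param {Y' : Type*} {l' : Filter Y'} {φ : Y' → Y} (h : Cv l u u₀ x₀)
    (hφ : Tendsto φ l' l) : Cv l' (fun y => u (φ y)) u₀ x₀ :=
  ⟨⟨(hφ.prodMap tendsto_id).eventually h.smooth.left, h.smooth.right⟩, fun k => (h.conv k).comp_param hφ⟩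

theorem mono {l' : Filter Y} (h : Cv l u u₀ x₀) (hl : l' ≤ l) : Cv l' u u₀ x₀ := h.comp_param (φ := id) hl

theorem const (h : ∀ᶠ x in 𝓝 x₀, ContDiffAt ℝ ∞ u₀ x) : Cv l (fun _ => u₀) u₀ x₀ :=
  ⟨SmoothNear.const h, fun _ => CvK.const h⟩

theorem of_contDiff (h : ContDiff ℝ ∞ u₀) : Cv l (fun _ => u₀) u₀ x₀ :=
  const (Eventually.of_forall fun _ => h.contDiffAt)

theorem prodMk {w : Y → X → G} {w₀ : X → G} (h : Cv l u u₀ x₀) (h' : Cv l w w₀ x₀) :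
    Cv l (fun y x => (u y x, w y x)) (fun x => (u₀ x, w₀ x)) x₀ :=
  ⟨h.smooth.prodMk h'.smooth, fun k => (h.conv k).prodMk h.smooth h'.smooth (h'.conv k)⟩

theorem comp {U : Y → F → G} {U₀ : F → G} (hU : Cv l U U₀ (u₀ x₀)) (h : Cv l u u₀ x₀) :
    Cv l (fun y x => U y (u y x)) (fun x => U₀ (u₀ x)) x₀ :=
  ⟨hU.smooth.comp h.smooth h.tendsto, fun k => (hU.conv k).comp hU.smooth h.smooth (h.conv k)⟩

theorem map {U : F → G} (h : Cv l u u₀ x₀) (hU : ContDiff ℝ ∞ U) :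
    Cv l (fun y x => U (u y x)) (fun x => U (u₀ x)) x₀ :=
  (of_contDiff hU).comp h

theorem fderivs (h : Cv l u u₀ x₀) : Cv l (fun y => fderiv ℝ (u y)) (fderiv ℝ u₀) x₀ :=
  ⟨h.smooth.fderiv, fun k => (h.conv (k + 1)).2⟩

/-- Scalars which converge define constant functions which converge smoothly. -/
theorem of_tendsto {c : Y → F} {c₀ : F} (h : Tendsto c l (𝓝 c₀)) : Cv l (fun y (_ : X) => c y) (fun _ => c₀) x₀ := by
  refine ⟨⟨Eventually.of_forall fun _ => contDiffAt_const,
    Eventually.of_forall fun _ => contDiffAt_const⟩, fun k => ?_⟩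
  cases k with
  | zero => exact h.comp tendsto_fst
  | succ k =>
    refine ⟨h.comp tendsto_fst, ?_⟩
    simp only [fderiv_fun_const]
    exact CvK.const (Eventually.of_forall fun _ => contDiffAt_const)

end Cv

theorem tendsto_iff_iteratedFDeriv_zero {l : Filter Y} {x₀ : X} {u : Y → X → F} {u₀ : X → F} :
    Tendsto (fun p : Y × X => u p.1 p.2) (l ×ˢ 𝓝 x₀) (𝓝 (u₀ x₀)) ↔
      Tendsto (fun p : Y × X => iteratedFDeriv ℝ 0 (u p.1) p.2)
        (l ×ˢ 𝓝 x₀) (𝓝 (iteratedFDeriv ℝ 0 u₀ x₀)) := by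
  simp only [iteratedFDeriv_zero_eq_comp, Function.comp_apply]
  exact (continuousMultilinearCurryFin0 ℝ X F).symm.toHomeomorph.isEmbedding.tendsto_nhds_iff

theorem cvK_iff_iteratedFDeriv {l : Filter Y} {x₀ : X} {k : ℕ} {u : Y → X → F} {u₀ : X → F} :
    CvK l x₀ k F u u₀ ↔ ∀ j ≤ k, Tendsto (fun p : Y × X => iteratedFDeriv ℝ j (u p.1) p.2)
      (l ×ˢ 𝓝 x₀) (𝓝 (iteratedFDeriv ℝ j u₀ x₀)) := by
  induction k generalizing F with
  | zero =>
    constructor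
    · intro h j hj
      obtain rfl := Nat.le_zero.1 hj
      exact tendsto_iff_iteratedFDeriv_zero.1 h
    · intro h
      exact tendsto_iff_iteratedFDeriv_zero.2 (h 0 le_rfl)
  | succ k ih =>
    have succ : ∀ j, Tendsto (fun p : Y × X => iteratedFDeriv ℝ (j + 1) (u p.1) p.2)
          (l ×ˢ 𝓝 x₀) (𝓝 (iteratedFDeriv ℝ (j + 1) u₀ x₀)) ↔
        Tendsto (fun p : Y × X => iteratedFDeriv ℝ j (fderiv ℝ (u p.1)) p.2)
          (l ×ˢ 𝓝 x₀) (𝓝 (iteratedFDeriv ℝ j (fderiv ℝ u₀) x₀)) := by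
      intro j
      simp only [iteratedFDeriv_succ_eq_comp_right, Function.comp_apply]
      exact ((continuousMultilinearCurryRightEquiv' ℝ j X F).symm.toHomeomorph.isEmbedding.tendsto_nhds_iff
        (f := fun p : Y × X => iteratedFDeriv ℝ j (fderiv ℝ (u p.1)) p.2)
        (l := l ×ˢ 𝓝 x₀) (y := iteratedFDeriv ℝ j (fderiv ℝ u₀) x₀)).symm
    unfold CvK
    rw [ih]
    constructor
    · rintro ⟨h, h'⟩ j hj
      cases j with
      | zero => exact tendsto_iff_iteratedFDeriv_zero.1 h
      | succ j => exact (succ j).2 (h' j (by omega))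
    · intro h
      exact ⟨tendsto_iff_iteratedFDeriv_zero.2 (h 0 (by omega)),
        fun j hj => (succ j).1 (h (j + 1) (by omega))⟩

theorem cv_zero_of_tendstoUniformlyOn {l : Filter Y} {V : Set X} (hV : IsOpen V)
    {g : Y → X → F} (hs : ∀ᶠ y in l, ContDiffOn ℝ ∞ (g y) V)
    (h : ∀ k : ℕ, TendstoUniformlyOn (fun y x => iteratedFDeriv ℝ k (g y) x) (fun _ => 0) l V)
    {x : X} (hx : x ∈ V) : Cv l g (fun _ => 0) x := by
  refine ⟨⟨?_, Eventually.of_forall fun _ => contDiffAt_const⟩, fun k => ?_⟩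
  · filter_upwards [hs.prod_mk (hV.mem_nhds hx)] with p hp
    exact (hp.1 _ hp.2).contDiffAt (hV.mem_nhds hp.2)
  · rw [cvK_iff_iteratedFDeriv]
    intro j _
    have h0 : iteratedFDeriv ℝ j (fun _ : X => (0 : F)) x = 0 := by
      simp
    rw [h0]
    rw [Metric.tendsto_nhds]
    intro ε hε
    filter_upwards [((tendstoUniformlyOn_iff.1 (h j)) ε hε).prod_mk (hV.mem_nhds hx)]
      with p hp
    rw [dist_comm]
    exact hp.1 _ hp.2

theorem tendstoUniformlyOn_of_cv_zero {l : Filter Y} {K : Set X} (hK : IsCompact K)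
    {g : Y → X → F} (h : ∀ x ∈ K, Cv l g (fun _ => 0) x) (k : ℕ) :
    TendstoUniformlyOn (fun y x => iteratedFDeriv ℝ k (g y) x) (fun _ => 0) l K := by
  rw [← tendstoLocallyUniformlyOn_iff_tendstoUniformlyOn_of_compact hK, tendstoLocallyUniformlyOn_iff]
  intro ε hε x hx
  have h1 := cvK_iff_iteratedFDeriv.1 ((h x hx).conv k) k le_rfl
  have h0 : iteratedFDeriv ℝ k (fun _ : X => (0 : F)) x = 0 := by
    simp
  rw [h0] at h1
  obtain ⟨pa, ha, pb, hb, hab⟩ := eventually_prod_iff.1 (Metric.tendsto_nhds.1 h1 ε hε)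
  refine ⟨{z | pb z}, mem_nhdsWithin_of_mem_nhds hb, ha.mono fun y hy z hz => ?_⟩
  rw [dist_comm]
  exact hab hy hz

theorem _root_.IsCompact.eventually_forall_filter {Z : Type*} [TopologicalSpace Z] {l : Filter Y}
    {K : Set Z} (hK : IsCompact K) {Q : Y → Z → Prop}
    (h : ∀ x ∈ K, ∀ᶠ z : Y × Z in l ×ˢ 𝓝 x, Q z.1 z.2) : ∀ᶠ y in l, ∀ x ∈ K, Q y x := by
  refine hK.induction_on (p := fun s => ∀ᶠ y in l, ∀ x ∈ s, Q y x) (by simp)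
    (fun s t hst ht => ht.mono fun y hy x hx => hy x (hst hx))
    (fun s t hs ht => (hs.and ht).mono fun y hy x hx => hx.elim (hy.1 x) (hy.2 x)) ?_
  intro x hx
  obtain ⟨pa, ha, pb, hb, hab⟩ := eventually_prod_iff.1 (h x hx)
  exact ⟨{z | pb z}, mem_nhdsWithin_of_mem_nhds hb, ha.mono fun y hy z hz => hab hy hz⟩

theorem eventually_contDiffOn_of_smoothNear {l : Filter Y} {K : Set X} (hK : IsCompact K)
    {g : Y → X → F} {g₀ : X → F} (h : ∀ x ∈ K, SmoothNear l g g₀ x) : ∀ᶠ y in l, ∀ x ∈ K, ContDiffAt ℝ ∞ (g y) x :=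
  hK.eventually_forall_filter fun x hx => (h x hx).left

end SmoothConvergence

section Coordinates

variable {n : ℕ}

/-- The horizontal hyperplane. -/
abbrev Hor (n : ℕ) : Type := EuclideanSpace ℝ (Fin n)

/-- The model space. -/
abbrev Amb (n : ℕ) : Type := EuclideanSpace ℝ (Fin (n + 1))

/-- The possible charts of an `n + 1`-dimensional manifold. -/
abbrev Chart (n : ℕ) (M : Type*) [TopologicalSpace M] := OpenPartialHomeomorph M (Amb n)

/-- The smooth charts of an `n + 1`-dimensional manifold. -/
abbrev MaxAtlas (n : ℕ) (M : Type*) [TopologicalSpace M] [ChartedSpace (Amb n) M] : Set (Chart n M) :=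
  IsManifold.maximalAtlas (𝓡 (n + 1)) ∞ M

/-- The point with given horizontal part and height. -/
def join (x : Hor n) (v : ℝ) : Amb n := WithLp.toLp 2 (Fin.snoc (α := fun _ => ℝ) (fun i => x i) v)

@[simp] theorem horiz_join (x : Hor n) (v : ℝ) : horiz (join x v) = x := by
  ext i; simp [horiz, join]

@[simp] theorem vert_join (x : Hor n) (v : ℝ) : vert (join x v) = v := by
  simp [vert, join]

@[simp] theorem join_horiz_vert (x : Amb n) : join (horiz x) (vert x) = x := by
  ext i
  refine Fin.lastCases ?_ (fun j => ?_) i <;> simp [horiz, vert, join]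

theorem amb_ext {x y : Amb n} (h : horiz x = horiz y) (h' : vert x = vert y) : x = y := by
  rw [← join_horiz_vert x, ← join_horiz_vert y, h, h']

/-- The horizontal projection as a continuous linear map. -/
def horizL (n : ℕ) : Amb n →L[ℝ] Hor n :=
  LinearMap.toContinuousLinearMap
    { toFun := horiz
      map_add' := fun x y => by ext i; simp [horiz]
      map_smul' := fun c x => by ext i; simp [horiz] }

/-- The height as a continuous linear map. -/
def vertL (n : ℕ) : Amb n →L[ℝ] ℝ :=
  LinearMap.toContinuousLinearMap
    { toFun := vert
      map_add' := fun x y => by simp [vert]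
      map_smul' := fun c x => by simp [vert] }

@[simp] theorem horizL_apply (x : Amb n) : horizL n x = horiz x := rfl
@[simp] theorem vertL_apply (x : Amb n) : vertL n x = vert x := rfl

/-- `join` as a continuous linear map. -/
def joinL (n : ℕ) : Hor n × ℝ →L[ℝ] Amb n :=
  LinearMap.toContinuousLinearMap
    { toFun := fun p => join p.1 p.2
      map_add' := fun p q => by
        apply amb_ext
        · rw [← horizL_apply (join p.1 p.2 + _), map_add]; simp
        · rw [← vertL_apply (join p.1 p.2 + _), map_add]; simp
      map_smul' := fun c p => by
        apply amb_ext
        · rw [← horizL_apply (_ • join p.1 p.2), map_smul]; simp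
        · rw [← vertL_apply (_ • join p.1 p.2), map_smul]; simp }

@[simp] theorem joinL_apply (p : Hor n × ℝ) : joinL n p = join p.1 p.2 := rfl

@[simp] theorem horiz_add (x y : Amb n) : horiz (x + y) = horiz x + horiz y := (horizL n).map_add x y
@[simp] theorem horiz_sub (x y : Amb n) : horiz (x - y) = horiz x - horiz y := (horizL n).map_sub x y
@[simp] theorem horiz_smul (c : ℝ) (x : Amb n) : horiz (c • x) = c • horiz x := (horizL n).map_smul c x
@[simp] theorem horiz_zero : horiz (0 : Amb n) = 0 := (horizL n).map_zero
@[simp] theorem vert_add (x y : Amb n) : vert (x + y) = vert x + vert y := (vertL n).map_add x y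
@[simp] theorem vert_sub (x y : Amb n) : vert (x - y) = vert x - vert y := (vertL n).map_sub x y
@[simp] theorem vert_smul (c : ℝ) (x : Amb n) : vert (c • x) = c * vert x := (vertL n).map_smul c x
@[simp] theorem vert_zero : vert (0 : Amb n) = 0 := (vertL n).map_zero

theorem contDiff_horiz : ContDiff ℝ ∞ (horiz : Amb n → Hor n) := (horizL n).contDiff
theorem contDiff_vert : ContDiff ℝ ∞ (vert : Amb n → ℝ) := (vertL n).contDiff
theorem contDiff_join : ContDiff ℝ ∞ (fun p : Hor n × ℝ => join p.1 p.2) := (joinL n).contDiff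
@[fun_prop] theorem continuous_horiz : Continuous (horiz : Amb n → Hor n) := (horizL n).continuous
@[fun_prop] theorem continuous_vert : Continuous (vert : Amb n → ℝ) := (vertL n).continuous
theorem continuous_join : Continuous (fun p : Hor n × ℝ => join p.1 p.2) := (joinL n).continuous

theorem norm_sq_eq (x : Amb n) : ‖x‖ ^ 2 = ‖horiz x‖ ^ 2 + vert x ^ 2 := by
  rw [EuclideanSpace.norm_sq_eq, EuclideanSpace.norm_sq_eq, Fin.sum_univ_castSucc]
  simp [horiz, vert]

theorem norm_horiz_le (x : Amb n) : ‖horiz x‖ ≤ ‖x‖ :=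
  abs_le_of_sq_le_sq' (by rw [norm_sq_eq x]; nlinarith [sq_nonneg (vert x)]) (norm_nonneg _) |>.2

theorem abs_vert_le (x : Amb n) : |vert x| ≤ ‖x‖ := by
  apply abs_le_of_sq_le_sq _ (norm_nonneg _)
  rw [norm_sq_eq x]; nlinarith [sq_nonneg ‖horiz x‖]

theorem norm_le_add (x : Amb n) : ‖x‖ ≤ ‖horiz x‖ + |vert x| := by
  apply abs_le_of_sq_le_sq' _ (by positivity) |>.2
  rw [norm_sq_eq x, ← sq_abs (vert x)]
  nlinarith [norm_nonneg (horiz x), abs_nonneg (vert x)]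

/-- The upward unit vector. -/
def up (n : ℕ) : Amb n := join 0 1

theorem join_eq (x : Hor n) (v : ℝ) : join x v = join x 0 + v • up n := by
  apply amb_ext <;> simp [up]

@[simp] theorem norm_up : ‖up n‖ = 1 := by
  have := norm_sq_eq (up n)
  simp only [up, horiz_join, norm_zero, vert_join] at this
  have h0 := norm_nonneg (up n)
  simp only [up] at h0 ⊢
  nlinarith

end Coordinates

section Implicit

variable {n : ℕ} {Y : Type*}

/-- The linear isomorphism `w ↦ (w', L w)`. -/
def heightEquiv (L : Amb n →L[ℝ] ℝ) (hL : L (up n) ≠ 0) : Amb n ≃L[ℝ] Amb n :=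
  ContinuousLinearEquiv.equivOfInverse
    ((joinL n).comp ((horizL n).prod L))
    ((joinL n).comp ((horizL n).prod
      ((L (up n))⁻¹ • (vertL n - L.comp ((joinL n).comp ((horizL n).prod 0))))))
    (fun x => by
      apply amb_ext
      · simp
      · have : L x = L (join (horiz x) 0) + vert x * L (up n) := by
          conv_lhs => rw [← join_horiz_vert x, join_eq, map_add, map_smul, smul_eq_mul]
        simp [this]
        field_simp)
    (fun x => by
      apply amb_ext
      · simp
      · simp only [ContinuousLinearMap.comp_apply, ContinuousLinearMap.prod_apply, joinL_apply,
          vert_join, horizL_apply]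
        rw [join_eq (horiz x), map_add, map_smul]
        simp
        field_simp
        ring)

theorem contDiffAt_of_implicit {u : Amb n → ℝ} {g : Hor n → ℝ} {x : Hor n}
    (hu : ContDiffAt ℝ ∞ u (join x (g x))) (hd : fderiv ℝ u (join x (g x)) (up n) ≠ 0)
    (hc : ContinuousAt g x) (h0 : ∀ᶠ z in 𝓝 x, u (join z (g z)) = 0) : ContDiffAt ℝ ∞ g x := by
  set a := join x (g x) with ha
  let f : Amb n → Amb n := fun z => join (horiz z) (u z)
  have hf : ContDiffAt ℝ ∞ f a := contDiff_join.contDiffAt.comp a (contDiff_horiz.contDiffAt.prodMk hu)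
  have hf' : HasFDerivAt f (heightEquiv (fderiv ℝ u a) hd : Amb n →L[ℝ] Amb n) a := by
    have h1 := (joinL n).hasFDerivAt.comp a
      ((horizL n).hasFDerivAt.prodMk (hu.differentiableAt (by simp)).hasFDerivAt)
    exact h1
  have hinv := hf.to_localInverse hf' (by simp)
  have hleft := (hf.hasStrictFDerivAt' hf' (by simp)).eventually_left_inverse
  have hfa : f a = join x 0 := by
    simp only [f, ha, horiz_join]
    rw [h0.self_of_nhds]
  rw [hfa] at hinv
  have hcg : ContinuousAt (fun z => join z (g z)) x := continuous_join.continuousAt.comp (continuousAt_id.prodMk hc)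
  have hev : ∀ᶠ z in 𝓝 x, g z = vert (hf.localInverse hf' (by simp) (join z 0)) := by
    filter_upwards [hcg.eventually hleft, h0] with z h1 h2
    have h3 : f (join z (g z)) = join z 0 := by simp [f, h2]
    have h4 : hf.localInverse hf' (by simp) (f (join z (g z))) = join z (g z) := h1
    rw [h3] at h4
    rw [h4, vert_join]
  refine ContDiffAt.congr_of_eventuallyEq ?_ hev
  have hj : ContDiffAt ℝ ∞ (fun z : Hor n => join z 0) x :=
    (contDiff_join.comp (contDiff_id.prodMk contDiff_const)).contDiffAt
  exact contDiff_vert.contDiffAt.comp x (ContDiffAt.comp x hinv hj)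

/-- The derivative of an implicit function in terms of the derivative of the defining function. -/
def implicitSlope (L : Amb n →L[ℝ] ℝ) : Hor n →L[ℝ] ℝ :=
  (-(L (up n))⁻¹) • L.comp ((joinL n).comp (ContinuousLinearMap.inl ℝ (Hor n) ℝ))

theorem contDiffAt_implicitSlope {L : Amb n →L[ℝ] ℝ} (hL : L (up n) ≠ 0) :
    ContDiffAt ℝ ∞ (implicitSlope (n := n)) L := by
  have h1 : ContDiffAt ℝ ∞ (fun L : Amb n →L[ℝ] ℝ => L (up n)) L := by fun_prop
  have h2 : ContDiffAt ℝ ∞ (fun L : Amb n →L[ℝ] ℝ =>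
      L.comp ((joinL n).comp (ContinuousLinearMap.inl ℝ (Hor n) ℝ))) L := by fun_prop
  exact (h1.inv hL).neg.smul h2

theorem fderiv_of_implicit {u : Amb n → ℝ} {g : Hor n → ℝ} {x : Hor n}
    (hu : ContDiffAt ℝ ∞ u (join x (g x))) (hd : fderiv ℝ u (join x (g x)) (up n) ≠ 0)
    (hg : ContDiffAt ℝ ∞ g x) (h0 : ∀ᶠ z in 𝓝 x, u (join z (g z)) = 0) :
    fderiv ℝ g x = implicitSlope (fderiv ℝ u (join x (g x))) := by
  have h1 : HasFDerivAt (fun z => u (join z (g z)))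
      ((fderiv ℝ u (join x (g x))).comp
        ((joinL n).comp ((ContinuousLinearMap.id ℝ (Hor n)).prod (fderiv ℝ g x)))) x :=
    HasFDerivAt.comp x (hu.differentiableAt (by simp)).hasFDerivAt
      ((joinL n).hasFDerivAt.comp x
        ((hasFDerivAt_id x).prodMk (hg.differentiableAt (by simp)).hasFDerivAt))
  have h2 : HasFDerivAt (fun z => u (join z (g z))) (0 : Hor n →L[ℝ] ℝ) x :=
    (hasFDerivAt_const (0 : ℝ) x).congr_of_eventuallyEq h0
  have h3 := h1.unique h2
  ext w
  have h4 := congrArg (fun L => L w) h3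
  simp only [ContinuousLinearMap.comp_apply, ContinuousLinearMap.prod_apply, joinL_apply,
    ContinuousLinearMap.id_apply, zero_apply] at h4
  rw [join_eq w, map_add, map_smul, smul_eq_mul] at h4
  simp only [implicitSlope, smul_apply, ContinuousLinearMap.comp_apply,
    ContinuousLinearMap.inl_apply, joinL_apply, smul_eq_mul]
  field_simp
  linarith

theorem Cv.implicit {l : Filter Y} {u : Y → Amb n → ℝ} {u₀ : Amb n → ℝ} {g : Y → Hor n → ℝ}
    {g₀ : Hor n → ℝ} {x : Hor n} (hu : Cv l u u₀ (join x (g₀ x)))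
    (hd : fderiv ℝ u₀ (join x (g₀ x)) (up n) ≠ 0)
    (hg : Tendsto (fun p : Y × Hor n => g p.1 p.2) (l ×ˢ 𝓝 x) (𝓝 (g₀ x)))
    (hc : ∀ᶠ p : Y × Hor n in l ×ˢ 𝓝 x, ContinuousAt (g p.1) p.2)
    (h0 : ∀ᶠ p : Y × Hor n in l ×ˢ 𝓝 x, u p.1 (join p.2 (g p.1 p.2)) = 0)
    (hc₀ : ∀ᶠ z in 𝓝 x, ContinuousAt g₀ z)
    (h0₀ : ∀ᶠ z in 𝓝 x, u₀ (join z (g₀ z)) = 0) : Cv l g g₀ x := by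
  have hjt : Tendsto (fun p : Y × Hor n => (p.1, join p.2 (g p.1 p.2))) (l ×ˢ 𝓝 x)
      (l ×ˢ 𝓝 (join x (g₀ x))) :=
    tendsto_fst.prodMk ((continuous_join.tendsto (x, g₀ x)).comp
      (tendsto_snd.prodMk_nhds hg))
  have hjt₀ : ContinuousAt (fun z => join z (g₀ z)) x :=
    continuous_join.continuousAt.comp (continuousAt_id.prodMk hc₀.self_of_nhds)
  have hopen : ∀ᶠ L in 𝓝 (fderiv ℝ u₀ (join x (g₀ x))), L (up n) ≠ 0 :=
    (isOpen_ne.preimage (by fun_prop : Continuous fun L : Amb n →L[ℝ] ℝ => L (up n))).mem_nhds hd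
  have hdu := hu.fderivs.tendsto.eventually hopen
  have hdu₀ : ∀ᶠ z in 𝓝 (join x (g₀ x)), fderiv ℝ u₀ z (up n) ≠ 0 :=
    (contDiffAt_fderiv hu.smooth.right.self_of_nhds).continuousAt.eventually hopen
  have hs : SmoothNear l g g₀ x := by
    refine ⟨?_, ?_⟩
    · filter_upwards [hjt.eventually hu.smooth.left, hjt.eventually hdu, hc,
        eventually_prod_eventually h0] with p h1 h2 h3 h4
      exact contDiffAt_of_implicit h1 h2 h3 h4
    · filter_upwards [hjt₀.eventually hu.smooth.right, hjt₀.eventually hdu₀, hc₀,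
        h0₀.eventually_nhds] with p h1 h2 h3 h4
      exact contDiffAt_of_implicit h1 h2 h3 h4
  refine ⟨hs, fun k => ?_⟩
  induction k with
  | zero => exact hg
  | succ k ih =>
    refine ⟨hg, ?_⟩
    have hid : Cv l (fun (_ : Y) (z : Hor n) => z) (fun z => z) x := Cv.of_contDiff contDiff_id
    have hpk := (hid.conv k).prodMk hid.smooth hs ih
    have hps := hid.smooth.prodMk hs
    have hj : Cv l (fun (_ : Y) (p : Hor n × ℝ) => join p.1 p.2) (fun p => join p.1 p.2)
        (x, g₀ x) := Cv.of_contDiff contDiff_join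
    have h1 := CvK.comp (g₀ := fun z => (z, g₀ z)) (x₀ := x) hj.smooth hps (hj.conv k) hpk
    have h1s := SmoothNear.comp (g₀ := fun z => (z, g₀ z)) (x₀ := x) hj.smooth hps hpk.tendsto
    have h2 := CvK.comp (g₀ := fun z => join z (g₀ z)) (x₀ := x) hu.fderivs.smooth h1s
      (hu.fderivs.conv k) h1
    have h2s := SmoothNear.comp (g₀ := fun z => join z (g₀ z)) (x₀ := x) hu.fderivs.smooth h1s
      h1.tendsto
    have hT : Cv l (fun (_ : Y) => implicitSlope (n := n)) implicitSlope
        (fderiv ℝ u₀ (join x (g₀ x))) :=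
      Cv.const (hopen.mono fun L hL => contDiffAt_implicitSlope hL)
    have h3 := CvK.comp (g₀ := fun z => fderiv ℝ u₀ (join z (g₀ z))) (x₀ := x) hT.smooth h2s
      (hT.conv k) h2
    refine h3.congr ?_ ?_
    · filter_upwards [hjt.eventually hu.smooth.left, hjt.eventually hdu, hs.left,
        eventually_prod_eventually h0] with p h1 h2 h3 h4
      exact (fderiv_of_implicit h1 h2 h3 h4).symm
    · filter_upwards [hjt₀.eventually hu.smooth.right, hjt₀.eventually hdu₀, hs.right,
        h0₀.eventually_nhds] with p h1 h2 h3 h4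
      exact (fderiv_of_implicit h1 h2 h3 h4).symm

end Implicit

section ChartMaps

variable {n : ℕ}

/-- The open box of horizontal radius `δ` and half-height `ρ` around `x₀`. -/
def box (x₀ : Amb n) (δ ρ : ℝ) : Set (Amb n) :=
  {x | ‖horiz x - horiz x₀‖ < δ ∧ |vert x - vert x₀| < ρ}

theorem cyl_eq_box (r : ℝ) : cyl n r = box 0 r r := by simp [cyl, box]

theorem isOpen_box (x₀ : Amb n) (δ ρ : ℝ) : IsOpen (box x₀ δ ρ) :=
  (isOpen_lt (f := fun x : Amb n => ‖horiz x - horiz x₀‖) (g := fun _ => δ)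
    (by fun_prop) continuous_const).inter
    (isOpen_lt (f := fun x : Amb n => |vert x - vert x₀|) (g := fun _ => ρ)
      (by fun_prop) continuous_const)

theorem mem_box_self {x₀ : Amb n} {δ ρ : ℝ} (hδ : 0 < δ) (hρ : 0 < ρ) : x₀ ∈ box x₀ δ ρ := by
  simp [box, hδ, hρ]

theorem box_mono {x₀ : Amb n} {δ ρ δ' ρ' : ℝ} (h : δ ≤ δ') (h' : ρ ≤ ρ') :
    box x₀ δ ρ ⊆ box x₀ δ' ρ' := fun _ hx => ⟨hx.1.trans_le h, hx.2.trans_le h'⟩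

/-- The closed box of horizontal radius `δ` and half-height `ρ` around `x₀`. -/
def cbox (x₀ : Amb n) (δ ρ : ℝ) : Set (Amb n) :=
  {x | ‖horiz x - horiz x₀‖ ≤ δ ∧ |vert x - vert x₀| ≤ ρ}

theorem box_subset_cbox {x₀ : Amb n} {δ ρ : ℝ} : box x₀ δ ρ ⊆ cbox x₀ δ ρ := fun _ hx => ⟨hx.1.le, hx.2.le⟩

theorem cbox_subset_closedBall (x₀ : Amb n) (δ ρ : ℝ) : cbox x₀ δ ρ ⊆ closedBall x₀ (δ + ρ) := by
  intro x hx
  rw [mem_closedBall_iff_norm]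
  refine (norm_le_add _).trans ?_
  rw [horiz_sub, vert_sub]
  exact add_le_add hx.1 hx.2

theorem isClosed_cbox (x₀ : Amb n) (δ ρ : ℝ) : IsClosed (cbox x₀ δ ρ) :=
  (isClosed_le (f := fun x : Amb n => ‖horiz x - horiz x₀‖) (g := fun _ => δ)
    (by fun_prop) continuous_const).inter
    (isClosed_le (f := fun x : Amb n => |vert x - vert x₀|) (g := fun _ => ρ)
      (by fun_prop) continuous_const)

theorem isCompact_cbox (x₀ : Amb n) (δ ρ : ℝ) : IsCompact (cbox x₀ δ ρ) :=
  (isCompact_closedBall x₀ (δ + ρ)).of_isClosed_subset (isClosed_cbox _ _ _)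
    (cbox_subset_closedBall _ _ _)

theorem exists_cbox_subset {x₀ : Amb n} {s : Set (Amb n)} (hs : s ∈ 𝓝 x₀) :
    ∃ R > 0, ∀ δ ≤ R, ∀ ρ ≤ R, cbox x₀ δ ρ ⊆ s := by
  obtain ⟨r, hr, hrs⟩ := nhds_basis_closedBall.mem_iff.1 hs
  refine ⟨r / 2, by positivity, fun δ hδ ρ hρ => ?_⟩
  exact (cbox_subset_closedBall _ _ _).trans
    ((closedBall_subset_closedBall (by linarith)).trans hrs)

theorem mem_contDiffGroupoid_of_contDiffOn {φ : OpenPartialHomeomorph (Amb n) (Amb n)}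
    (h : ContDiffOn ℝ ∞ φ φ.source) (h' : ContDiffOn ℝ ∞ φ.symm φ.target) : φ ∈ contDiffGroupoid ∞ (𝓡 (n + 1)) := by
  rw [contDiffGroupoid, mem_groupoid_of_pregroupoid, contDiffPregroupoid]
  constructor
  · simpa [Function.comp_def] using h
  · simpa [Function.comp_def] using h'

variable {M : Type*} [EMetricSpace M] [ChartedSpace (Amb n) M]

theorem trans_mem_maximalAtlas {e : Chart n M}
    (he : e ∈ MaxAtlas n M)
    {φ : OpenPartialHomeomorph (Amb n) (Amb n)} (h : ContDiffOn ℝ ∞ φ φ.source)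
    (h' : ContDiffOn ℝ ∞ φ.symm φ.target) : e.trans φ ∈ MaxAtlas n M := by
  have hφ := mem_contDiffGroupoid_of_contDiffOn h h'
  intro e' he'
  constructor
  · rw [OpenPartialHomeomorph.trans_symm_eq_symm_trans_symm, OpenPartialHomeomorph.trans_assoc]
    exact StructureGroupoid.trans _ (StructureGroupoid.symm _ hφ) (he e' he').1
  · rw [← OpenPartialHomeomorph.trans_assoc]
    exact StructureGroupoid.trans _ (he e' he').2 hφ

theorem contDiffAt_transition [IsManifold (𝓡 (n + 1)) ∞ M] {e e' : Chart n M}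
    (he : e ∈ MaxAtlas n M)
    (he' : e' ∈ MaxAtlas n M) {x : Amb n} (hx : x ∈ e.target)
    (hx' : e.symm x ∈ e'.source) : ContDiffAt ℝ ∞ (fun z => e' (e.symm z)) x := by
  have h := StructureGroupoid.compatible_of_mem_maximalAtlas he he'
  rw [contDiffGroupoid, mem_groupoid_of_pregroupoid, contDiffPregroupoid] at h
  have h1 : ContDiffOn ℝ ∞ (fun z => e' (e.symm z)) (e.symm.trans e').source := by
    simpa [Function.comp_def] using h.1
  exact (h1 x ⟨hx, hx'⟩).contDiffAt ((e.symm.trans e').open_source.mem_nhds ⟨hx, hx'⟩)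

/-- The diffeomorphism of a cylinder which flattens the graph of `g` and moves the point of
the graph over `c` to the origin. -/
def flattenGraph (c : Hor n) (r : ℝ) (g : Hor n → ℝ) (hg : ContDiffOn ℝ ∞ g (ball c r)) :
    OpenPartialHomeomorph (Amb n) (Amb n) where
  toFun x := join (horiz x - c) (vert x - g (horiz x))
  invFun x := join (horiz x + c) (vert x + g (horiz x + c))
  source := {x | horiz x ∈ ball c r}
  target := {x | horiz x ∈ ball 0 r}
  map_source' x hx := by
    simpa [dist_eq_norm] using hx
  map_target' x hx := by
    simpa [dist_eq_norm] using hx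
  left_inv' x hx := by simp
  right_inv' x hx := by simp
  open_source := isOpen_ball.preimage continuous_horiz
  open_target := isOpen_ball.preimage continuous_horiz
  continuousOn_toFun := by
    refine continuous_join.comp_continuousOn (ContinuousOn.prodMk (by fun_prop) ?_)
    exact continuous_vert.continuousOn.sub
      (hg.continuousOn.comp continuous_horiz.continuousOn fun x hx => hx)
  continuousOn_invFun := by
    refine continuous_join.comp_continuousOn (ContinuousOn.prodMk (by fun_prop) ?_)
    exact continuous_vert.continuousOn.add
      (hg.continuousOn.comp (by fun_prop) fun x hx => by simpa [dist_eq_norm] using hx)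

theorem contDiffOn_flattenGraph {c : Hor n} {r : ℝ} {g : Hor n → ℝ}
    (hg : ContDiffOn ℝ ∞ g (ball c r)) : ContDiffOn ℝ ∞ (flattenGraph c r g hg) (flattenGraph c r g hg).source ∧
      ContDiffOn ℝ ∞ (flattenGraph c r g hg).symm (flattenGraph c r g hg).target := by
  constructor
  · refine contDiff_join.comp_contDiffOn (ContDiffOn.prodMk
      (contDiff_horiz.sub contDiff_const).contDiffOn ?_)
    exact contDiff_vert.contDiffOn.sub (hg.comp contDiff_horiz.contDiffOn fun x hx => hx)
  · refine contDiff_join.comp_contDiffOn (ContDiffOn.prodMk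
      (contDiff_horiz.add contDiff_const).contDiffOn ?_)
    refine contDiff_vert.contDiffOn.add (hg.comp (contDiff_horiz.add contDiff_const).contDiffOn ?_)
    intro x hx
    have hx' : horiz x ∈ ball (0 : Hor n) r := hx
    simpa [dist_eq_norm] using hx'

end ChartMaps

section GraphConv

variable {n : ℕ} {M : Type*} [EMetricSpace M] [ChartedSpace (Amb n) M]
  {Y : Type*}

/-- Smooth graphical convergence of `Γ y` to `Γ₀` near `p`, along a filter. -/
def GraphConv (l : Filter Y) (Γ : Y → Set M) (Γ₀ : Set M) (p : M) : Prop :=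
  ∃ e ∈ MaxAtlas n M, ∃ r : ℝ, 0 < r ∧ ∃ g : Y → EuclideanSpace ℝ (Fin n) → ℝ,
      p ∈ e.source ∧ e p = 0 ∧ cyl n r ⊆ e.target ∧ (∀ x ∈ cyl n r, e.symm x ∈ Γ₀ ↔ vert x = 0) ∧
      (∀ᶠ y in l, ContDiffOn ℝ ∞ (g y) (ball 0 r) ∧ ∀ x ∈ cyl n r, e.symm x ∈ Γ y ↔ vert x = g y (horiz x)) ∧
      ∀ k : ℕ, TendstoUniformlyOn (fun y x => iteratedFDeriv ℝ k (g y) x) (fun _ => 0)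
        l (ball 0 r)

theorem GraphConv.comp_param {Y' : Type*} {l : Filter Y} {l' : Filter Y'} {φ : Y' → Y}
    {Γ : Y → Set M} {Γ₀ : Set M} {p : M} (h : GraphConv (n := n) l Γ Γ₀ p)
    (hφ : Tendsto φ l' l) : GraphConv (n := n) l' (fun y => Γ (φ y)) Γ₀ p := by
  obtain ⟨e, he, r, hr, g, h1, h2, h3, h4, h5, h6⟩ := h
  refine ⟨e, he, r, hr, fun y => g (φ y), h1, h2, h3, h4, hφ.eventually h5, fun k => ?_⟩
  intro u hu
  exact hφ.eventually (h6 k u hu)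

theorem GraphConv.mem {l : Filter Y} {Γ : Y → Set M} {Γ₀ : Set M} {p : M}
    (h : GraphConv (n := n) l Γ Γ₀ p) : p ∈ Γ₀ := by
  obtain ⟨e, he, r, hr, g, h1, h2, h3, h4, h5, h6⟩ := h
  have h7 : (0 : Amb n) ∈ cyl n r := by simp [cyl, hr]
  have := (h4 0 h7).2 (by simp)
  rwa [← h2, e.left_inv h1] at this

theorem cyl_mono {r r' : ℝ} (h : r ≤ r') : cyl n r ⊆ cyl n r' := fun _ hx => ⟨hx.1.trans_le h, hx.2.trans_le h⟩

theorem exists_cyl_subset {s : Set (Amb n)} (hs : s ∈ 𝓝 0) : ∃ R > 0, ∀ r ≤ R, cyl n r ⊆ s := by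
  obtain ⟨R, hR, h⟩ := exists_cbox_subset hs
  exact ⟨R, hR, fun r hr => by
    rw [cyl_eq_box]; exact box_subset_cbox.trans (h r hr r hr)⟩

theorem symm_preimage_mem_nhds {e : Chart n M} {p : M} (hp : p ∈ e.source)
    {V : Set M} (hV : V ∈ 𝓝 p) : e.symm ⁻¹' V ∈ 𝓝 (e p) := by
  apply (e.continuousAt_symm (e.map_source hp)).preimage_mem_nhds
  rwa [e.left_inv hp]

theorem GraphConv.congr {l : Filter Y} {Γ Γ' : Y → Set M} {Γ₀ Γ₀' : Set M} {p : M}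
    (h : GraphConv (n := n) l Γ Γ₀ p) {V : Set M} (hV : V ∈ 𝓝 p)
    (h0 : ∀ z ∈ V, z ∈ Γ₀ ↔ z ∈ Γ₀') (hy : ∀ᶠ y in l, ∀ z ∈ V, z ∈ Γ y ↔ z ∈ Γ' y) :
    GraphConv (n := n) l Γ' Γ₀' p := by
  obtain ⟨e, he, r, hr, g, h1, h2, h3, h4, h5, h6⟩ := h
  have := symm_preimage_mem_nhds h1 hV
  rw [h2] at this
  obtain ⟨R, hR, hRV⟩ := exists_cyl_subset this
  have hb : ball (0 : Hor n) (min r R) ⊆ ball 0 r := ball_subset_ball (min_le_left _ _)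
  refine ⟨e, he, min r R, lt_min hr hR, g, h1, h2, (cyl_mono (min_le_left _ _)).trans h3, ?_, ?_,
    fun k => (h6 k).mono hb⟩
  · intro x hx
    rw [← h0 _ (hRV _ (min_le_right _ _) hx)]
    exact h4 x (cyl_mono (min_le_left _ _) hx)
  · filter_upwards [h5, hy] with y hy1 hy2
    refine ⟨hy1.1.mono hb, fun x hx => ?_⟩
    rw [← hy2 _ (hRV _ (min_le_right _ _) hx)]
    exact hy1.2 x (cyl_mono (min_le_left _ _) hx)

theorem GraphConv.isSmooth {l : Filter Y} {Γ : Y → Set M} {Γ₀ : Set M} {p : M}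
    [IsManifold (𝓡 (n + 1)) ∞ M] (h : GraphConv (n := n) l Γ Γ₀ p) : ∃ e ∈ MaxAtlas n M,
      p ∈ e.source ∧ ∀ q ∈ e.source, q ∈ Γ₀ ↔ vert (e q) = 0 := by
  obtain ⟨e, he, r, hr, g, h1, h2, h3, h4, h5, h6⟩ := h
  have ho : IsOpen (e.source ∩ e ⁻¹' cyl n r) := by
    rw [cyl_eq_box]; exact e.isOpen_inter_preimage (isOpen_box _ _ _)
  refine ⟨e.restr (e.source ∩ e ⁻¹' cyl n r), restr_mem_maximalAtlas _ he ho, ?_, ?_⟩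
  · rw [e.restr_source, ho.interior_eq]
    refine ⟨h1, h1, ?_⟩
    simp [h2, cyl, hr]
  · intro q hq
    rw [e.restr_source, ho.interior_eq] at hq
    have := h4 (e q) hq.2.2
    rw [e.left_inv hq.1] at this
    simpa using this

theorem graphConv_of_graph {l : Filter Y} {Γ : Y → Set M} {Γ₀ : Set M}
    {e : Chart n M} (he : e ∈ MaxAtlas n M)
    {x₀ : Amb n} (hx₀ : x₀ ∈ e.target) {δ ρ : ℝ} (hδ : 0 < δ) (hρ : 0 < ρ)
    {g : Y → Hor n → ℝ} {g₀ : Hor n → ℝ}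
    (hΓ : ∀ᶠ y in l, ∀ x ∈ box x₀ δ ρ, e.symm x ∈ Γ y ↔ vert x = g y (horiz x))
    (hΓ₀ : ∀ x ∈ box x₀ δ ρ, e.symm x ∈ Γ₀ ↔ vert x = g₀ (horiz x))
    (hg₀ : vert x₀ = g₀ (horiz x₀)) (hs : ContDiffOn ℝ ∞ g₀ (ball (horiz x₀) δ))
    (hcv : ∀ x ∈ ball (horiz x₀) δ, Cv l g g₀ x) : GraphConv (n := n) l Γ Γ₀ (e.symm x₀) := by
  set c := horiz x₀
  set φ := flattenGraph c δ g₀ hs with hφ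
  have hφs := contDiffOn_flattenGraph hs
  have hx₀φ : x₀ ∈ φ.source := mem_ball_self hδ
  have hφ0 : φ x₀ = 0 := by
    change join (horiz x₀ - c) (vert x₀ - g₀ (horiz x₀)) = 0
    apply amb_ext <;> simp [c, hg₀]
  have h0t : (0 : Amb n) ∈ φ.target := by rw [← hφ0]; exact φ.map_source hx₀φ
  have hsymm0 : φ.symm 0 = x₀ := by rw [← hφ0, φ.left_inv hx₀φ]
  have hsymm : ∀ x, φ.symm x = join (horiz x + c) (vert x + g₀ (horiz x + c)) := fun x => rfl
  have hnhds : φ.target ∩ φ.symm ⁻¹' (box x₀ δ ρ ∩ e.target) ∈ 𝓝 (0 : Amb n) := by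
    refine (φ.isOpen_inter_preimage_symm ((isOpen_box _ _ _).inter e.open_target)).mem_nhds ?_
    refine ⟨h0t, ?_⟩
    rw [mem_preimage, hsymm0]
    exact ⟨mem_box_self hδ hρ, hx₀⟩
  obtain ⟨R, hR, hcyl⟩ := exists_cyl_subset hnhds
  set r := min R (δ / 2)
  have hr : 0 < r := lt_min hR (by positivity)
  have hcr := hcyl r (min_le_left _ _)
  have hball : ∀ z ∈ closedBall (0 : Hor n) r, z + c ∈ ball c δ := by
    intro z hz
    rw [mem_ball_iff_norm, add_sub_cancel_right]
    have := mem_closedBall_zero_iff.1 hz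
    linarith [min_le_right R (δ / 2)]
  have hcv' : ∀ z ∈ closedBall (0 : Hor n) r, Cv l (fun y z => g y (z + c) - g₀ (z + c)) (fun _ => 0) z := by
    intro z hz
    have h1 := hcv (z + c) (hball z hz)
    have hid : Cv l (fun _ z => z + c) (fun z : Hor n => z + c) z := Cv.of_contDiff (contDiff_id.add contDiff_const)
    have h2 := Cv.comp (u₀ := fun z : Hor n => z + c) (x₀ := z) h1 hid
    have h3 := Cv.comp (u₀ := fun z : Hor n => z + c) (x₀ := z)
      (Cv.const (l := l) h1.smooth.right) hid
    refine ((h2.prodMk h3).map (contDiff_fst.sub contDiff_snd)).congr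
      (Eventually.of_forall fun _ => rfl) (Eventually.of_forall fun _ => by simp)
  refine ⟨e.trans φ, trans_mem_maximalAtlas he hφs.1 hφs.2, r, hr,
    fun y z => g y (z + c) - g₀ (z + c), ?_, ?_, ?_, ?_, ?_, ?_⟩
  · rw [OpenPartialHomeomorph.trans_source]
    exact ⟨e.map_target hx₀, by rw [mem_preimage, e.right_inv hx₀]; exact hx₀φ⟩
  · simp [e.right_inv hx₀, hφ0]
  · rw [OpenPartialHomeomorph.trans_target]
    exact fun x hx => ⟨(hcr hx).1, (hcr hx).2.2⟩
  · intro x hx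
    rw [OpenPartialHomeomorph.coe_trans_symm, Function.comp_apply, hΓ₀ _ (hcr hx).2.1, hsymm]
    simp
  · have h7 := eventually_contDiffOn_of_smoothNear (isCompact_closedBall (0 : Hor n) r)
      fun z hz => (hcv' z hz).smooth
    filter_upwards [hΓ, h7] with y hy h7
    refine ⟨fun z hz => (h7 z (ball_subset_closedBall hz)).contDiffWithinAt, fun x hx => ?_⟩
    rw [OpenPartialHomeomorph.coe_trans_symm, Function.comp_apply, hy _ (hcr hx).2.1, hsymm]
    simp only [vert_join, horiz_join]
    constructor <;> intro h <;> linarith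
  · exact fun k => (tendstoUniformlyOn_of_cv_zero (isCompact_closedBall (0 : Hor n) r) hcv' k).mono
      ball_subset_closedBall

end GraphConv

section ChangeOfChart

variable {n : ℕ} {M : Type*} [EMetricSpace M] [ChartedSpace (Amb n) M]
  {Y : Type*}

theorem tendsto_root {Z : Type*} {l : Filter Z} {w : Z → ℝ → ℝ} {γ : Z → ℝ} {w₀ : ℝ → ℝ}
    {v₁ a b : ℝ} (hw : ∀ᶠ z in l, StrictMonoOn (w z) (Icc a b))
    (hγ : ∀ᶠ z in l, γ z ∈ Ioo a b ∧ w z (γ z) = 0) (hv₁ : v₁ ∈ Ioo a b)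
    (hw₀ : StrictMonoOn w₀ (Icc a b)) (h₀ : w₀ v₁ = 0)
    (hlim : ∀ v ∈ Icc a b, Tendsto (fun z => w z v) l (𝓝 (w₀ v))) : Tendsto γ l (𝓝 v₁) := by
  rw [tendsto_order]
  constructor
  · intro c hc
    set c' := max c ((a + v₁) / 2)
    have hc' : c' < v₁ := max_lt hc (by linarith [hv₁.1])
    have hc'' : c' ∈ Icc a b :=
      ⟨by linarith [hv₁.1, le_max_right c ((a + v₁) / 2)], by linarith [hv₁.2]⟩
    have h1 : w₀ c' < 0 := by
      rw [← h₀]; exact hw₀ hc'' ⟨hv₁.1.le, hv₁.2.le⟩ hc'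
    filter_upwards [hw, hγ, (hlim c' hc'').eventually_lt_const h1] with z h2 h3 h4
    refine (le_max_left _ _).trans_lt (?_ : c' < γ z)
    rw [← h3.2] at h4
    exact (h2.lt_iff_lt hc'' ⟨h3.1.1.le, h3.1.2.le⟩).1 h4
  · intro c hc
    set c' := min c ((b + v₁) / 2)
    have hc' : v₁ < c' := lt_min hc (by linarith [hv₁.2])
    have hc'' : c' ∈ Icc a b :=
      ⟨by linarith [hv₁.1], by linarith [hv₁.2, min_le_right c ((b + v₁) / 2)]⟩
    have h1 : 0 < w₀ c' := by
      rw [← h₀]; exact hw₀ ⟨hv₁.1.le, hv₁.2.le⟩ hc'' hc'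
    filter_upwards [hw, hγ, (hlim c' hc'').eventually_const_lt h1] with z h2 h3 h4
    refine (?_ : γ z < c').trans_le (min_le_left _ _)
    rw [← h3.2] at h4
    exact (h2.lt_iff_lt ⟨h3.1.1.le, h3.1.2.le⟩ hc'').1 h4

theorem hasDerivAt_vertical {u : Amb n → ℝ} {x : Hor n} {v : ℝ}
    (hu : DifferentiableAt ℝ u (join x v)) : HasDerivAt (fun v => u (join x v)) (fderiv ℝ u (join x v) (up n)) v := by
  have h1 : HasDerivAt (fun v => join x v) (up n) v := by
    have : (fun v => join x v) = fun v => join x 0 + v • up n := by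
      ext1 v; exact join_eq x v
    rw [this]
    simpa using ((hasDerivAt_id v).smul_const (up n)).const_add (join x 0)
  exact hu.hasFDerivAt.comp_hasDerivAt v h1

/-- A family of functions which converges smoothly near `x₀` and is strictly increasing in the
vertical direction has zero sets which are graphs, and the graphs converge smoothly. -/
theorem exists_graph_of_increasing {l : Filter Y} {u : Y → Amb n → ℝ} {u₀ : Amb n → ℝ}
    {x₀ : Amb n} {s : Set (Amb n)} (hs : s ∈ 𝓝 x₀) (hu : ∀ x ∈ s, Cv l u u₀ x)
    (h0 : u₀ x₀ = 0) (hpos : 0 < fderiv ℝ u₀ x₀ (up n)) {g₀ : Hor n → ℝ}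
    (hg₀ : ∀ x ∈ s, u₀ x = 0 ↔ vert x = g₀ (horiz x)) :
    ∃ R > 0, ∀ ρ, 0 < ρ → ρ ≤ R → ∃ δ₀ > 0, ∀ δ, 0 < δ → δ ≤ δ₀ → cbox x₀ δ ρ ⊆ s ∧ ∃ g : Y → Hor n → ℝ,
      (∀ᶠ y in l, ∀ x ∈ box x₀ δ ρ, u y x = 0 ↔ vert x = g y (horiz x)) ∧
      (∀ᶠ y in l, ∀ z ∈ ball (horiz x₀) δ, |g y z - vert x₀| < ρ) ∧ (∀ z ∈ ball (horiz x₀) δ, |g₀ z - vert x₀| < ρ) ∧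
      (∀ z ∈ ball (horiz x₀) δ, Cv l g g₀ z) := by
  have hx₀s := mem_of_mem_nhds hs
  have hopen : ∀ᶠ x in 𝓝 x₀, 0 < fderiv ℝ u₀ x (up n) := by
    have h1 : ContinuousAt (fderiv ℝ u₀) x₀ := (contDiffAt_fderiv (hu x₀ hx₀s).smooth.right.self_of_nhds).continuousAt
    exact (h1.clm_apply continuousAt_const).eventually_const_lt hpos
  obtain ⟨R, hR, hRs⟩ := exists_cbox_subset (inter_mem hs hopen)
  refine ⟨R, hR, fun ρ hρ hρR => ?_⟩
  set c := horiz x₀ with hc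
  set v₀ := vert x₀ with hv₀
  have hx₀ : join c v₀ = x₀ := join_horiz_vert x₀
  have hsub : ∀ z ∈ closedBall c R, ∀ v ∈ Icc (v₀ - ρ) (v₀ + ρ), join z v ∈ cbox x₀ R ρ := by
    intro z hz v hv
    refine ⟨by simpa [dist_eq_norm] using hz, ?_⟩
    rw [vert_join, abs_le]
    constructor <;> linarith [hv.1, hv.2]
  have hmono₀ : ∀ z ∈ closedBall c R, StrictMonoOn (fun v => u₀ (join z v)) (Icc (v₀ - ρ) (v₀ + ρ)) := by
    intro z hz
    have hd : ∀ v ∈ Icc (v₀ - ρ) (v₀ + ρ), HasDerivAt (fun v => u₀ (join z v))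
        (fderiv ℝ u₀ (join z v) (up n)) v := fun v hv => hasDerivAt_vertical ((hu _ (hRs R le_rfl ρ hρR
        (hsub z hz v hv)).1).smooth.right.self_of_nhds.differentiableAt (by simp))
    refine strictMonoOn_of_deriv_pos (convex_Icc _ _)
      (fun v hv => (hd v hv).continuousAt.continuousWithinAt) fun v hv => ?_
    rw [interior_Icc] at hv
    rw [(hd v ⟨hv.1.le, hv.2.le⟩).deriv]
    exact (hRs R le_rfl ρ hρR (hsub z hz v ⟨hv.1.le, hv.2.le⟩)).2
  have hcR : c ∈ closedBall c R := mem_closedBall_self hR.le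
  have htop : 0 < u₀ (join c (v₀ + ρ)) := by
    rw [← h0, ← hx₀]
    exact hmono₀ c hcR ⟨by linarith, by linarith⟩ ⟨by linarith, by linarith⟩ (by linarith)
  have hbot : u₀ (join c (v₀ - ρ)) < 0 := by
    rw [← h0, ← hx₀]
    exact hmono₀ c hcR ⟨by linarith, by linarith⟩ ⟨by linarith, by linarith⟩ (by linarith)
  have hcj : ∀ v, ContinuousAt (fun z => join z v) c := fun v =>
    (continuous_join.comp (continuous_id.prodMk continuous_const)).continuousAt
  have hcu₀ : ∀ v ∈ Icc (v₀ - ρ) (v₀ + ρ), ContinuousAt (fun z => u₀ (join z v)) c := fun v hv =>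
    ContinuousAt.comp (g := u₀) (hu _ (hRs R le_rfl ρ hρR
        (hsub c hcR v hv)).1).smooth.right.self_of_nhds.continuousAt (hcj v)
  have h1 : ∀ᶠ z in 𝓝 c, 0 < u₀ (join z (v₀ + ρ)) :=
    (hcu₀ _ ⟨by linarith, le_rfl⟩).eventually_const_lt htop
  have h2 : ∀ᶠ z in 𝓝 c, u₀ (join z (v₀ - ρ)) < 0 :=
    (hcu₀ _ ⟨le_rfl, by linarith⟩).eventually_lt_const hbot
  obtain ⟨δ₁, hδ₁, hδ₁s⟩ := nhds_basis_closedBall.mem_iff.1 (h1.and h2)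
  refine ⟨min δ₁ R, lt_min hδ₁ hR, fun δ hδ hδδ => ?_⟩
  have hball : closedBall c δ ⊆ closedBall c R := closedBall_subset_closedBall (hδδ.trans (min_le_right _ _))
  have hbox : cbox x₀ δ ρ ⊆ cbox x₀ R ρ := fun x hx => ⟨hx.1.trans (hδδ.trans (min_le_right _ _)), hx.2⟩
  have hboxs : cbox x₀ δ ρ ⊆ s ∩ {x | 0 < fderiv ℝ u₀ x (up n)} := hbox.trans (hRs R le_rfl ρ hρR)
  have hjbox : ∀ z ∈ closedBall c δ, ∀ v ∈ Icc (v₀ - ρ) (v₀ + ρ), join z v ∈ cbox x₀ δ ρ := by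
    intro z hz v hv
    refine ⟨by simpa [dist_eq_norm] using hz, ?_⟩
    rw [vert_join, abs_le]
    constructor <;> linarith [hv.1, hv.2]
  refine ⟨fun x hx => (hboxs hx).1, ?_⟩
  have hsgn : ∀ z ∈ closedBall c δ, 0 < u₀ (join z (v₀ + ρ)) ∧ u₀ (join z (v₀ - ρ)) < 0 :=
    fun z hz => hδ₁s (closedBall_subset_closedBall (hδδ.trans (min_le_left _ _)) hz)
  have hsmooth : ∀ᶠ y in l, ∀ x ∈ cbox x₀ δ ρ, ContDiffAt ℝ ∞ (u y) x ∧ 0 < fderiv ℝ (u y) x (up n) := by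
    refine (isCompact_cbox x₀ δ ρ).eventually_forall_filter fun x hx => ?_
    have h3 := hu x (hboxs hx).1
    have h4 : Tendsto (fun p : Y × Amb n => fderiv ℝ (u p.1) p.2 (up n)) (l ×ˢ 𝓝 x)
        (𝓝 (fderiv ℝ u₀ x (up n))) := ((ContinuousLinearMap.apply ℝ ℝ (up n)).continuous.tendsto _).comp h3.fderivs.tendsto
    exact h3.smooth.left.and (h4.eventually_const_lt (hboxs hx).2)
  have hjt : ∀ z : Hor n, ∀ v : ℝ, Tendsto (fun p : Y × Hor n => (p.1, join p.2 v)) (l ×ˢ 𝓝 z)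
      (l ×ˢ 𝓝 (join z v)) := fun z v => tendsto_fst.prodMk
    (((continuous_join.comp (continuous_id.prodMk continuous_const)).tendsto z).comp tendsto_snd)
  have hsgny : ∀ᶠ y in l, ∀ z ∈ closedBall c δ, 0 < u y (join z (v₀ + ρ)) ∧ u y (join z (v₀ - ρ)) < 0 := by
    refine (isCompact_closedBall c δ).eventually_forall_filter fun z hz => ?_
    have h3 := (hu _ (hboxs (hjbox z hz (v₀ + ρ) ⟨by linarith, le_rfl⟩)).1).tendsto
    have h4 := (hu _ (hboxs (hjbox z hz (v₀ - ρ) ⟨le_rfl, by linarith⟩)).1).tendsto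
    exact ((h3.comp (hjt z _)).eventually_const_lt (hsgn z hz).1).and
      ((h4.comp (hjt z _)).eventually_lt_const (hsgn z hz).2)
  have hmono : ∀ᶠ y in l, ∀ z ∈ closedBall c δ, StrictMonoOn (fun v => u y (join z v)) (Icc (v₀ - ρ) (v₀ + ρ)) := by
    filter_upwards [hsmooth] with y hy z hz
    have hd : ∀ v ∈ Icc (v₀ - ρ) (v₀ + ρ), HasDerivAt (fun v => u y (join z v))
        (fderiv ℝ (u y) (join z v) (up n)) v := fun v hv =>
      hasDerivAt_vertical ((hy _ (hjbox z hz v hv)).1.differentiableAt (by simp))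
    refine strictMonoOn_of_deriv_pos (convex_Icc _ _)
      (fun v hv => (hd v hv).continuousAt.continuousWithinAt) fun v hv => ?_
    rw [interior_Icc] at hv
    rw [(hd v ⟨hv.1.le, hv.2.le⟩).deriv]
    exact (hy _ (hjbox z hz v ⟨hv.1.le, hv.2.le⟩)).2
  have root : ∀ w : ℝ → ℝ, ContinuousOn w (Icc (v₀ - ρ) (v₀ + ρ)) → 0 < w (v₀ + ρ) →
      w (v₀ - ρ) < 0 → ∃ v ∈ Ioo (v₀ - ρ) (v₀ + ρ), w v = 0 := by
    intro w hw ht hb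
    exact intermediate_value_Ioo (by linarith) hw ⟨hb, ht⟩
  have hroot₀ : ∀ z ∈ closedBall c δ, g₀ z ∈ Ioo (v₀ - ρ) (v₀ + ρ) ∧ u₀ (join z (g₀ z)) = 0 := by
    intro z hz
    obtain ⟨v, hv, hv0⟩ := root (fun v => u₀ (join z v)) (fun v hv => (hasDerivAt_vertical ((hu _ (hboxs
        (hjbox z hz v hv)).1).smooth.right.self_of_nhds.differentiableAt
          (by simp))).continuousAt.continuousWithinAt) (hsgn z hz).1 (hsgn z hz).2
    have := (hg₀ _ (hboxs (hjbox z hz v ⟨hv.1.le, hv.2.le⟩)).1).1 hv0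
    simp only [vert_join, horiz_join] at this
    rw [← this]
    exact ⟨hv, hv0⟩
  have hrooty : ∀ᶠ y in l, ∀ z ∈ closedBall c δ, ∃ v ∈ Ioo (v₀ - ρ) (v₀ + ρ), u y (join z v) = 0 := by
    filter_upwards [hsmooth, hsgny] with y hy hy' z hz
    exact root (fun v => u y (join z v)) (fun v hv =>
      (hasDerivAt_vertical ((hy _ (hjbox z hz v hv)).1.differentiableAt
          (by simp))).continuousAt.continuousWithinAt) (hy' z hz).1 (hy' z hz).2
  classical
  let g : Y → Hor n → ℝ := fun y z => if h : ∃ v ∈ Ioo (v₀ - ρ) (v₀ + ρ), u y (join z v) = 0 then h.choose else 0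
  have hg : ∀ᶠ y in l, ∀ z ∈ closedBall c δ, g y z ∈ Ioo (v₀ - ρ) (v₀ + ρ) ∧ u y (join z (g y z)) = 0 := by
    filter_upwards [hrooty] with y hy z hz
    simp only [g, dif_pos (hy z hz)]
    exact (hy z hz).choose_spec
  have hprod : ∀ {Q : Y → Hor n → Prop}, (∀ᶠ y in l, ∀ z ∈ closedBall c δ, Q y z) →
      ∀ z ∈ ball c δ, ∀ᶠ p : Y × Hor n in l ×ˢ 𝓝 z, Q p.1 p.2 := by
    intro Q hQ z hz
    filter_upwards [hQ.prod_mk (isOpen_ball.mem_nhds hz)] with p hp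
    exact hp.1 _ (ball_subset_closedBall hp.2)
  refine ⟨g, ?_, ?_, ?_, ?_⟩
  · filter_upwards [hg, hmono] with y hy hm x hx
    have hz : horiz x ∈ closedBall c δ := by
      rw [mem_closedBall_iff_norm]; exact hx.1.le
    have hv : vert x ∈ Icc (v₀ - ρ) (v₀ + ρ) := by
      have := abs_lt.1 hx.2
      constructor <;> linarith [this.1, this.2]
    have h5 := hy _ hz
    constructor
    · intro h6
      refine (hm _ hz).injOn hv ⟨h5.1.1.le, h5.1.2.le⟩ ?_
      simp [h5.2, h6]
    · intro h6
      rw [← join_horiz_vert x, h6]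
      exact h5.2
  · filter_upwards [hg] with y hy z hz
    have := (hy z (ball_subset_closedBall hz)).1
    rw [abs_lt]
    constructor <;> linarith [this.1, this.2]
  · intro z hz
    have := (hroot₀ z (ball_subset_closedBall hz)).1
    rw [abs_lt]
    constructor <;> linarith [this.1, this.2]
  · intro z hz
    have hz' := ball_subset_closedBall hz
    have hin : join z (g₀ z) ∈ cbox x₀ δ ρ := hjbox z hz' _ ⟨(hroot₀ z hz').1.1.le, (hroot₀ z hz').1.2.le⟩
    have hnear : ∀ᶠ w in 𝓝 z, w ∈ ball c δ := isOpen_ball.mem_nhds hz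
    refine Cv.implicit (hu _ (hboxs hin).1) (hboxs hin).2.ne' ?_ ?_ ?_ ?_ ?_
    · refine tendsto_root (w := fun p v => u p.1 (join p.2 v)) (w₀ := fun v => u₀ (join z v))
        (hprod hmono z hz) (hprod hg z hz) (hroot₀ z hz').1 (hmono₀ z (hball hz')) (hroot₀ z hz').2 ?_
      intro v hv
      exact (hu _ (hboxs (hjbox z hz' v hv)).1).tendsto.comp (hjt z v)
    · refine hprod (Q := fun y z => z ∈ ball c δ → ContinuousAt (g y) z) ?_ z hz |>.and
        (tendsto_snd.eventually hnear) |>.mono fun p hp => hp.1 hp.2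
      filter_upwards [hg, hmono, hsmooth] with y hy hm hsm w hw hw'
      have hnear' : ∀ᶠ w' in 𝓝 w, w' ∈ closedBall c δ :=
        mem_of_superset (isOpen_ball.mem_nhds hw') ball_subset_closedBall
      refine tendsto_root (w := fun w' v => u y (join w' v)) (w₀ := fun v => u y (join w v))
        (hnear'.mono fun w' h => hm w' h) (hnear'.mono fun w' h => hy w' h) (hy w hw).1 (hm w hw)
        (hy w hw).2 ?_
      intro v hv
      exact ContinuousAt.comp (g := u y) (f := fun z => join z v)
        (hsm _ (hjbox w hw v hv)).1.continuousAt
        (continuous_join.comp (continuous_id.prodMk continuous_const)).continuousAt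
    · exact (hprod hg z hz).mono fun p hp => hp.2
    · filter_upwards [hnear] with w hw
      have hw' := ball_subset_closedBall hw
      have hnear' : ∀ᶠ w' in 𝓝 w, w' ∈ closedBall c δ :=
        mem_of_superset (isOpen_ball.mem_nhds hw) ball_subset_closedBall
      refine tendsto_root (w := fun w' v => u₀ (join w' v)) (w₀ := fun v => u₀ (join w v))
        (hnear'.mono fun w' h => hmono₀ w' (hball h)) (hnear'.mono fun w' h => hroot₀ w' h)
        (hroot₀ w hw').1 (hmono₀ w (hball hw')) (hroot₀ w hw').2 ?_
      intro v hv
      exact ContinuousAt.comp (g := u₀) (f := fun z => join z v)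
        (hu _ (hboxs (hjbox w hw' v hv)).1).smooth.right.self_of_nhds.continuousAt
        (continuous_join.comp (continuous_id.prodMk continuous_const)).continuousAt
    · filter_upwards [hnear] with w hw
      exact (hroot₀ w (ball_subset_closedBall hw)).2

/-- Graphical convergence can be read in any chart in which the limit is a graph. -/
theorem GraphConv.graph [IsManifold (𝓡 (n + 1)) ∞ M] {l : Filter Y} {Γ : Y → Set M} {Γ₀ : Set M}
    {p : M} (h : GraphConv (n := n) l Γ Γ₀ p) {e : Chart n M}
    (he : e ∈ MaxAtlas n M) (hp : p ∈ e.source) {g₀ : Hor n → ℝ}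
    (hg₀ : ContDiffAt ℝ ∞ g₀ (horiz (e p)))
    (hΓ₀ : ∀ᶠ x in 𝓝 (e p), e.symm x ∈ Γ₀ ↔ vert x = g₀ (horiz x))
    {s : Set (Amb n)} (hs : s ∈ 𝓝 (e p)) : ∃ R > 0, ∀ ρ, 0 < ρ → ρ ≤ R → ∃ δ₀ > 0, ∀ δ, 0 < δ → δ ≤ δ₀ →
      cbox (e p) δ ρ ⊆ s ∩ e.target ∧ ∃ g : Y → Hor n → ℝ,
      (∀ᶠ y in l, ∀ x ∈ box (e p) δ ρ, e.symm x ∈ Γ y ↔ vert x = g y (horiz x)) ∧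
      (∀ x ∈ box (e p) δ ρ, e.symm x ∈ Γ₀ ↔ vert x = g₀ (horiz x)) ∧
      (∀ᶠ y in l, ∀ z ∈ ball (horiz (e p)) δ, |g y z - vert (e p)| < ρ) ∧
      (∀ z ∈ ball (horiz (e p)) δ, |g₀ z - vert (e p)| < ρ) ∧ (∀ z ∈ ball (horiz (e p)) δ, Cv l g g₀ z) := by
  have hpΓ := h.mem
  obtain ⟨e₁, he₁, r, hr, g₁, hp₁, hp₁0, hcyl, hΓ₁, hΓy, hunif⟩ := h
  set x₀ := e p with hx₀
  have hx₀t : x₀ ∈ e.target := e.map_source hp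
  have hx₀s : e.symm x₀ = p := e.left_inv hp
  set κ : Amb n → Amb n := fun z => e₁ (e.symm z) with hκ
  have hκ0 : κ x₀ = 0 := by simp [hκ, hx₀s, hp₁0]
  let W : Set (Amb n) := (e.symm.trans e₁).source ∩ (e.symm.trans e₁) ⁻¹' cyl n r
  have hW : IsOpen W := by
    refine (e.symm.trans e₁).isOpen_inter_preimage ?_
    rw [cyl_eq_box]; exact isOpen_box _ _ _
  have hWmem : ∀ x ∈ W, x ∈ e.target ∧ e.symm x ∈ e₁.source ∧ κ x ∈ cyl n r := fun x hx => ⟨hx.1.1, hx.1.2, hx.2⟩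
  have hx₀W : x₀ ∈ W := by
    refine ⟨⟨hx₀t, ?_⟩, ?_⟩
    · change e.symm x₀ ∈ e₁.source
      rw [hx₀s]; exact hp₁
    · change κ x₀ ∈ cyl n r
      rw [hκ0]; simp [cyl, hr]
  have hκs : ∀ x ∈ W, ContDiffAt ℝ ∞ κ x := fun x hx => contDiffAt_transition he he₁ (hWmem x hx).1 (hWmem x hx).2.1
  have hsym : ∀ x ∈ W, e₁.symm (κ x) = e.symm x := fun x hx => e₁.left_inv (hWmem x hx).2.1
  let u : Y → Amb n → ℝ := fun y x => vert (κ x) - g₁ y (horiz (κ x))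
  let u₀ : Amb n → ℝ := fun x => vert (κ x)
  have hu : ∀ x ∈ W, Cv l u u₀ x := by
    intro x hx
    have h1 : Cv l (fun _ => κ) κ x := Cv.const (mem_of_superset (hW.mem_nhds hx) hκs)
    have h2 := h1.map contDiff_horiz
    have h3 : horiz (κ x) ∈ ball (0 : Hor n) r := by
      simpa using (hWmem x hx).2.2.1
    have h4 := cv_zero_of_tendstoUniformlyOn isOpen_ball (hΓy.mono fun y hy => hy.1) hunif h3
    have h5 := Cv.comp (u₀ := fun x => horiz (κ x)) (x₀ := x) h4 h2
    refine (((h1.map contDiff_vert).prodMk h5).map (contDiff_fst.sub contDiff_snd)).congr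
      (Eventually.of_forall fun _ => rfl) (Eventually.of_forall fun _ => by simp [u₀])
  have hzero : ∀ᶠ y in l, ∀ x ∈ W, e.symm x ∈ Γ y ↔ u y x = 0 := by
    filter_upwards [hΓy] with y hy x hx
    rw [← hsym x hx, hy.2 _ (hWmem x hx).2.2]
    exact sub_eq_zero.symm
  have hzero₀ : ∀ x ∈ W, e.symm x ∈ Γ₀ ↔ u₀ x = 0 := by
    intro x hx
    rw [← hsym x hx, hΓ₁ _ (hWmem x hx).2.2]
  have hu₀x₀ : u₀ x₀ = 0 := by simp [u₀, hκ0]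
  obtain ⟨s₁, hs₁, hs₁o, hx₀s₁⟩ := _root_.mem_nhds_iff.1 (inter_mem (inter_mem hs hΓ₀) (hW.mem_nhds hx₀W))
  have hg₀x₀ : vert x₀ = g₀ (horiz x₀) := by
    refine (hs₁ hx₀s₁).1.2.1 ?_
    rw [hx₀s]; exact hpΓ
  -- the vertical derivative does not vanish
  have hd : fderiv ℝ u₀ x₀ (up n) ≠ 0 := by
    intro hd0
    have hdu₀ := ((hu x₀ hx₀W).smooth.right.self_of_nhds.differentiableAt (by simp)).hasFDerivAt
    have hj : join (horiz x₀) (g₀ (horiz x₀)) = x₀ := by rw [← hg₀x₀, join_horiz_vert]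
    have h1 : HasFDerivAt (fun z => u₀ (join z (g₀ z)))
        ((fderiv ℝ u₀ x₀).comp ((joinL n).comp ((ContinuousLinearMap.id ℝ (Hor n)).prod
          (fderiv ℝ g₀ (horiz x₀))))) (horiz x₀) := by
      refine HasFDerivAt.comp (horiz x₀) (g := u₀) (f := fun z => join z (g₀ z)) ?_ ?_
      · rw [hj]; exact hdu₀
      · exact (joinL n).hasFDerivAt.comp (horiz x₀)
          ((hasFDerivAt_id _).prodMk (hg₀.differentiableAt (by simp)).hasFDerivAt)
    have hcont : ContinuousAt (fun z => join z (g₀ z)) (horiz x₀) :=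
      continuous_join.continuousAt.comp (continuousAt_id.prodMk hg₀.continuousAt)
    have h2 : (fun z => u₀ (join z (g₀ z))) =ᶠ[𝓝 (horiz x₀)] fun _ => 0 := by
      have h3 : s₁ ∈ 𝓝 (join (horiz x₀) (g₀ (horiz x₀))) := by
        rw [hj]; exact hs₁o.mem_nhds hx₀s₁
      filter_upwards [hcont.preimage_mem_nhds h3] with z hz
      rw [← hzero₀ _ (hs₁ hz).2]
      exact (hs₁ hz).1.2.2 (by simp)
    have h3 := h1.unique ((hasFDerivAt_const (0 : ℝ) (horiz x₀)).congr_of_eventuallyEq h2)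
    have h4 : fderiv ℝ u₀ x₀ = 0 := by
      ext w
      have h5 := congrArg (fun L => L (horiz w)) h3
      simp only [ContinuousLinearMap.comp_apply, ContinuousLinearMap.prod_apply, joinL_apply,
        ContinuousLinearMap.id_apply, zero_apply] at h5
      rw [join_eq, map_add, map_smul, hd0, smul_zero, add_zero] at h5
      rw [← join_horiz_vert w, join_eq, map_add, map_smul, hd0, h5]
      simp
    have hκ' : ContDiffAt ℝ ∞ (fun z => e (e₁.symm z)) 0 := by
      refine contDiffAt_transition he₁ he (hcyl (by simp [cyl, hr])) ?_
      rw [← hp₁0, e₁.left_inv hp₁]; exact hp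
    have h00 : e (e₁.symm 0) = x₀ := by rw [← hp₁0, e₁.left_inv hp₁]
    have h6 : HasFDerivAt (fun z => u₀ (e (e₁.symm z)))
        ((fderiv ℝ u₀ x₀).comp (fderiv ℝ (fun z => e (e₁.symm z)) 0)) 0 := by
      refine HasFDerivAt.comp (0 : Amb n) (g := u₀) (f := fun z => e (e₁.symm z)) ?_
        (hκ'.differentiableAt (by simp)).hasFDerivAt
      rw [h00]; exact hdu₀
    have h7 : (fun z => u₀ (e (e₁.symm z))) =ᶠ[𝓝 0] vert := by
      have h8 : (e₁.symm.trans e).source ∈ 𝓝 (0 : Amb n) := by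
        refine (e₁.symm.trans e).open_source.mem_nhds ⟨hcyl (by simp [cyl, hr]), ?_⟩
        rw [mem_preimage]
        change e₁.symm 0 ∈ e.source
        rw [← hp₁0, e₁.left_inv hp₁]; exact hp
      filter_upwards [h8] with z hz
      have hz1 : z ∈ e₁.target := hz.1
      have hz2 : e₁.symm z ∈ e.source := hz.2
      simp only [u₀, κ]
      rw [e.left_inv hz2, e₁.right_inv hz1]
    have h8 := h6.unique (((vertL n).hasFDerivAt (x := 0)).congr_of_eventuallyEq h7)
    rw [h4] at h8
    have h9 := congrArg (fun L => L (up n)) h8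
    simp [up] at h9
  set d := fderiv ℝ u₀ x₀ (up n) with hddef
  have hud : ∀ x ∈ s₁, Cv l (fun y x => d * u y x) (fun x => d * u₀ x) x := fun x hx =>
    (hu x (hs₁ hx).2).map (U := fun v => d * v) (contDiff_const.mul contDiff_id)
  have hpos : 0 < fderiv ℝ (fun x => d * u₀ x) x₀ (up n) := by
    rw [fderiv_const_mul ((hu x₀ hx₀W).smooth.right.self_of_nhds.differentiableAt (by simp))]
    simp only [smul_apply, smul_eq_mul, ← hddef]
    exact mul_self_pos.2 hd
  obtain ⟨R, hR, hmain⟩ := exists_graph_of_increasing (g₀ := g₀) (hs₁o.mem_nhds hx₀s₁) hud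
    (by simp [hu₀x₀]) hpos (fun x hx => by
      have hx' : e.symm x ∈ Γ₀ ↔ vert x = g₀ (horiz x) := (hs₁ hx).1.2
      rw [← hx', hzero₀ x (hs₁ hx).2]; simp [hd])
  refine ⟨R, hR, fun ρ hρ hρR => ?_⟩
  obtain ⟨δ₀, hδ₀, hmain⟩ := hmain ρ hρ hρR
  refine ⟨δ₀, hδ₀, fun δ hδ hδδ => ?_⟩
  obtain ⟨hsub, g, h1, h2, h3, h4⟩ := hmain δ hδ hδδ
  refine ⟨fun x hx => ⟨(hs₁ (hsub hx)).1.1, (hWmem _ (hs₁ (hsub hx)).2).1⟩, g, ?_, ?_, h2, h3, h4⟩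
  · filter_upwards [h1, hzero] with y hy hy' x hx
    rw [hy' x (hs₁ (hsub (box_subset_cbox hx))).2, ← hy x hx]
    simp [hd]
  · intro x hx
    exact (hs₁ (hsub (box_subset_cbox hx))).1.2

end ChangeOfChart

section Riemannian

variable {n : ℕ} {M : Type*} [EMetricSpace M] [MeasurableSpace M] [BorelSpace M]
  [ChartedSpace (Amb n) M] [IsManifold (𝓡 (n + 1)) ∞ M]
  [Bundle.RiemannianBundle (fun x : M => TangentSpace (𝓡 (n + 1)) x)]
  [IsContMDiffRiemannianBundle (𝓡 (n + 1)) ∞ (Amb n)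
    (fun x : M => TangentSpace (𝓡 (n + 1)) x)]
  [IsRiemannianManifold (𝓡 (n + 1)) M]

section Metric

/-- The image of `w` under the derivative at `x` of the inverse of a chart. -/
def push (e : Chart n M) (x w : Amb n) : TangentSpace (𝓡 (n + 1)) (e.symm x) :=
  mfderiv 𝓘(ℝ, Amb n) (𝓡 (n + 1)) e.symm x w

theorem push_add (e : Chart n M) (x w w' : Amb n) : push e x (w + w') = push e x w + push e x w' :=
  (mfderiv 𝓘(ℝ, Amb n) (𝓡 (n + 1)) e.symm x).map_add w w'

theorem push_smul (e : Chart n M) (x w : Amb n) (c : ℝ) : push e x (c • w) = c • push e x w :=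
  (mfderiv 𝓘(ℝ, Amb n) (𝓡 (n + 1)) e.symm x).map_smul c w

/-- The Riemannian metric read in a chart. -/
def form (e : Chart n M) (x w w' : Amb n) : ℝ :=
  inner ℝ (push e x w) (push e x w')

theorem contMDiffOn_push {e : Chart n M}
    (he : e ∈ MaxAtlas n M) (w : Amb n) : ContMDiffOn 𝓘(ℝ, Amb n) ((𝓡 (n + 1)).prod 𝓘(ℝ, Amb n)) ∞
      (fun x => (⟨e.symm x, push e x w⟩ : Bundle.TotalSpace (Amb n) (fun x : M => TangentSpace (𝓡 (n + 1)) x))) e.target := by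
  have h1 := contMDiffOn_symm_of_mem_maximalAtlas he
  have h2 := h1.contMDiffOn_tangentMapWithin (m := ∞) (by simp) e.open_target.uniqueMDiffOn
  have h3 : ContMDiffOn 𝓘(ℝ, Amb n) ((𝓡 (n + 1)).prod 𝓘(ℝ, Amb n)) ∞
      (fun x : Amb n => (⟨x, w⟩ : Bundle.TotalSpace (Amb n) (fun x : Amb n => TangentSpace 𝓘(ℝ, Amb n) x))) e.target := by
    exact contMDiffOn_vectorSpace_iff_contDiffOn.2 contDiffOn_const
  have h4 := h2.comp h3 (fun x hx => hx)
  refine h4.congr fun x hx => ?_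
  simp only [Function.comp, tangentMapWithin, push]
  rw [mfderivWithin_of_isOpen e.open_target hx]

theorem contDiffOn_form {e : Chart n M}
    (he : e ∈ MaxAtlas n M) (w w' : Amb n) : ContDiffOn ℝ ∞ (fun x => form e x w w') e.target := by
  rw [← contMDiffOn_iff_contDiffOn]
  exact (contMDiffOn_push he w).inner_bundle (contMDiffOn_push he w')

theorem form_self (e : Chart n M) (x w : Amb n) : form e x w w = ‖push e x w‖ ^ 2 := real_inner_self_eq_norm_sq _

theorem push_injective {e : Chart n M}
    (he : e ∈ MaxAtlas n M) {x : Amb n} (hx : x ∈ e.target)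
    {w : Amb n} (h : push e x w = 0) : w = 0 := by
  have h1 := ((contMDiffOn_of_mem_maximalAtlas he).contMDiffAt
    (e.open_source.mem_nhds (e.map_target hx))).mdifferentiableAt (by simp)
  have h2 := ((contMDiffOn_symm_of_mem_maximalAtlas he).contMDiffAt
    (e.open_target.mem_nhds hx)).mdifferentiableAt (by simp)
  have h3 := mfderiv_comp (I := 𝓘(ℝ, Amb n)) x h1 h2
  have h4 : e ∘ e.symm =ᶠ[𝓝 x] id := mem_of_superset (e.open_target.mem_nhds hx) fun z hz => e.right_inv hz
  rw [h4.mfderiv_eq, mfderiv_id] at h3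
  have h5 := congrArg (fun L => L w) h3
  change w = (mfderiv (𝓡 (n + 1)) 𝓘(ℝ, Amb n) e (e.symm x)) (push e x w) at h5
  rw [h, map_zero] at h5
  exact h5

theorem form_smul_left (e : Chart n M) (x w w' : Amb n) (c : ℝ) : form e x (c • w) w' = c * form e x w w' := by
  simp [form, push_smul, real_inner_smul_left]

theorem form_comm (e : Chart n M) (x w w' : Amb n) : form e x w w' = form e x w' w := real_inner_comm _ _

theorem form_add_left (e : Chart n M) (x w w' v : Amb n) : form e x (w + w') v = form e x w v + form e x w' v := by
  simp [form, push_add, inner_add_left]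

theorem form_sum_left (e : Chart n M) (x v : Amb n) {ι : Type*}
    (s : Finset ι) (c : ι → ℝ) (b : ι → Amb n) :
    form e x (∑ i ∈ s, c i • b i) v = ∑ i ∈ s, c i * form e x (b i) v := by
  classical
  induction s using Finset.induction_on with
  | empty => simpa using form_smul_left e x 0 v 0
  | insert a s ha ih => rw [Finset.sum_insert ha, Finset.sum_insert ha, form_add_left, ih, form_smul_left]

/-- The Riemannian metric in a chart, as a family of continuous bilinear forms. -/
def formL (e : Chart n M) (x : Amb n) : Amb n →L[ℝ] Amb n →L[ℝ] ℝ :=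
  ∑ i, ∑ j, form e x (EuclideanSpace.basisFun _ ℝ i) (EuclideanSpace.basisFun _ ℝ j) •
    (EuclideanSpace.proj i : Amb n →L[ℝ] ℝ).smulRight (EuclideanSpace.proj j : Amb n →L[ℝ] ℝ)

theorem formL_apply (e : Chart n M) (x w w' : Amb n) : formL e x w w' = form e x w w' := by
  have h (v : Amb n) : v = ∑ i, v i • EuclideanSpace.basisFun (Fin (n + 1)) ℝ i :=
    ((EuclideanSpace.basisFun (Fin (n + 1)) ℝ).sum_repr v).symm
  conv_rhs => rw [h w, form_sum_left]
  simp_rw [form_comm e x _ w']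
  conv_rhs => rw [h w']
  simp_rw [form_sum_left, Finset.mul_sum]
  simp only [formL, sum_apply, smul_apply, ContinuousLinearMap.smulRight_apply, smul_eq_mul]
  refine Finset.sum_congr rfl fun i _ => Finset.sum_congr rfl fun j _ => ?_
  rw [form_comm]
  change form e x _ _ * (w i * w' j) = w i * (w' j * form e x _ _)
  ring

set_option synthInstance.maxHeartbeats 400000 in
theorem contDiffOn_formL {e : Chart n M}
    (he : e ∈ MaxAtlas n M) : ContDiffOn ℝ ∞ (formL e) e.target := by
  rw [contDiffOn_clm_apply]
  intro w
  rw [contDiffOn_clm_apply]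
  intro w'
  simp_rw [formL_apply]
  exact contDiffOn_form he w w'

set_option synthInstance.maxHeartbeats 400000 in
set_option maxHeartbeats 1000000 in
theorem exists_form_bounds {e : Chart n M}
    (he : e ∈ MaxAtlas n M) {x₀ : Amb n} (hx₀ : x₀ ∈ e.target) :
    ∃ R > 0, ∃ C ≥ 1, ball x₀ R ⊆ e.target ∧ ∀ x ∈ ball x₀ R,
      (∀ w w', |form e x w w'| ≤ C * ‖w‖ * ‖w'‖) ∧ (∀ w, ‖w‖ ^ 2 ≤ C * form e x w w) ∧
      ∀ y ∈ ball x₀ R, ∀ w, |form e x w w - form e y w w| ≤ C * ‖x - y‖ * ‖w‖ ^ 2 := by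
  have hT := (contDiffOn_formL he).contDiffAt (e.open_target.mem_nhds hx₀)
  obtain ⟨K, t, ht, hK⟩ := (hT.of_le (by simp : (1 : WithTop ℕ∞) ≤ ∞)).exists_lipschitzOnWith
  obtain ⟨w₀, hw₀, hmin⟩ := (isCompact_sphere (0 : Amb n) 1).exists_isMinOn
    ⟨up n, by simp⟩ (f := fun w => formL e x₀ w w)
    (by fun_prop)
  have hw₀1 : ‖w₀‖ = 1 := by simpa using hw₀
  set c := formL e x₀ w₀ w₀ with hc
  have hcpos : 0 < c := by
    rw [hc, formL_apply, form_self]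
    have : push e x₀ w₀ ≠ 0 := fun h => by
      rw [push_injective he hx₀ h] at hw₀1; simp at hw₀1
    positivity
  have hcw : ∀ w, c * ‖w‖ ^ 2 ≤ formL e x₀ w w := by
    intro w
    rcases eq_or_ne w 0 with rfl | hw
    · simp
    · have hn : ‖w‖ ≠ 0 := norm_ne_zero_iff.2 hw
      have h1 : c ≤ formL e x₀ (‖w‖⁻¹ • w) (‖w‖⁻¹ • w) :=
        hmin (by simp [norm_smul, hn])
      simp only [map_smul, smul_apply, smul_eq_mul] at h1
      calc c * ‖w‖ ^ 2 ≤ (‖w‖⁻¹ * (‖w‖⁻¹ * formL e x₀ w w)) * ‖w‖ ^ 2 := by gcongr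
        _ = _ := by field_simp
  obtain ⟨R₁, hR₁, hball⟩ := Metric.mem_nhds_iff.1 (inter_mem ht (e.open_target.mem_nhds hx₀))
  set R := min R₁ (c / (2 * (K + 1))) with hR
  have hRpos : 0 < R := lt_min hR₁ (by positivity)
  have hsub : ball x₀ R ⊆ t ∩ e.target := (ball_subset_ball (min_le_left _ _)).trans hball
  have hx₀R : x₀ ∈ ball x₀ R := mem_ball_self hRpos
  have hdiff : ∀ x ∈ ball x₀ R, ∀ y ∈ ball x₀ R, ‖formL e x - formL e y‖ ≤ K * ‖x - y‖ := fun x hx y hy => by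
      simpa [dist_eq_norm] using hK.dist_le_mul x (hsub hx).1 y (hsub hy).1
  have hap : ∀ (T : Amb n →L[ℝ] Amb n →L[ℝ] ℝ) (w w' : Amb n), |T w w'| ≤ ‖T‖ * ‖w‖ * ‖w'‖ :=
    fun T w w' => T.le_opNorm₂ w w'
  have hnear : ∀ x ∈ ball x₀ R, ‖formL e x - formL e x₀‖ ≤ c / 2 := by
    intro x hx
    refine (hdiff x hx x₀ hx₀R).trans ?_
    have h1 : ‖x - x₀‖ < R := by simpa [dist_eq_norm] using hx
    have h2 : R ≤ c / (2 * (K + 1)) := min_le_right _ _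
    calc (K : ℝ) * ‖x - x₀‖ ≤ (K + 1) * (c / (2 * (K + 1))) := by
          gcongr
          · simp
          · exact h1.le.trans h2
      _ = c / 2 := by field_simp
  refine ⟨R, hRpos, max 1 (max (‖formL e x₀‖ + c / 2) (max (2 / c) K)), le_max_left _ _,
    fun x hx => (hsub hx).2, fun x hx => ⟨fun w w' => ?_, fun w => ?_, fun y hy w => ?_⟩⟩
  · rw [← formL_apply]
    refine (hap _ _ _).trans ?_
    gcongr
    refine le_trans ?_ ((le_max_left _ _).trans (le_max_right _ _))
    have := norm_sub_norm_le (formL e x) (formL e x₀)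
    linarith [hnear x hx]
  · rw [← formL_apply]
    have h1 := hap (formL e x - formL e x₀) w w
    rw [sub_apply, sub_apply] at h1
    have h2 := hnear x hx
    have h3 : c / 2 * ‖w‖ ^ 2 ≤ formL e x w w := by
      have h4 : ‖formL e x - formL e x₀‖ * ‖w‖ * ‖w‖ ≤ c / 2 * ‖w‖ ^ 2 := by
        rw [mul_assoc, ← sq]; gcongr
      have := (abs_le.1 (h1.trans h4)).1
      linarith [hcw w]
    have h5 : 0 ≤ formL e x w w := le_trans (by positivity) h3
    calc ‖w‖ ^ 2 = 2 / c * (c / 2 * ‖w‖ ^ 2) := by field_simp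
      _ ≤ 2 / c * formL e x w w := by gcongr
      _ ≤ _ := by
        gcongr
        exact (le_max_left _ _).trans ((le_max_right _ _).trans (le_max_right _ _))
  · rw [← formL_apply, ← formL_apply]
    have h1 := hap (formL e x - formL e y) w w
    rw [sub_apply, sub_apply] at h1
    refine h1.trans ?_
    rw [mul_assoc, ← sq]
    gcongr
    refine (hdiff x hx y hy).trans ?_
    gcongr
    exact (le_max_right _ _).trans ((le_max_right _ _).trans (le_max_right _ _))

end Metric

section Paths

theorem enorm_mfderiv_symm_comp {e : Chart n M}
    (he : e ∈ MaxAtlas n M) {c : ℝ → Amb n} {t : ℝ}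
    (hc : DifferentiableAt ℝ c t) (ht : c t ∈ e.target) :
    ‖mfderiv 𝓘(ℝ, ℝ) (𝓡 (n + 1)) (e.symm ∘ c) t 1‖ₑ = ‖push e (c t) (deriv c t)‖ₑ := by
  have h2 := ((contMDiffOn_symm_of_mem_maximalAtlas he).contMDiffAt
    (e.open_target.mem_nhds ht)).mdifferentiableAt (by simp)
  have h3 := mfderiv_comp (I := 𝓘(ℝ, ℝ)) t h2 hc.mdifferentiableAt
  rw [h3, mfderiv_eq_fderiv]
  rfl

theorem edist_symm_le {e : Chart n M}
    (he : e ∈ MaxAtlas n M) {c : ℝ → Amb n}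
    (hc : ContDiffOn ℝ 1 c (Icc 0 1)) (hm : MapsTo c (Icc 0 1) e.target) : edist (e.symm (c 0)) (e.symm (c 1)) ≤
      ∫⁻ t in Ioo (0 : ℝ) 1, ‖push e (c t) (deriv c t)‖ₑ := by
  rw [IsRiemannianManifold.out (I := 𝓡 (n + 1))]
  have h1 : ContMDiffOn 𝓘(ℝ, ℝ) (𝓡 (n + 1)) 1 (e.symm ∘ c) (Icc 0 1) :=
    ((contMDiffOn_symm_of_mem_maximalAtlas he).of_le (by simp)).comp
      (contMDiffOn_iff_contDiffOn.2 hc) hm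
  refine (Manifold.riemannianEDist_le_pathELength h1 rfl rfl zero_le_one).trans ?_
  rw [Manifold.pathELength_eq_lintegral_mfderiv_Ioo]
  refine (setLIntegral_congr_fun measurableSet_Ioo fun t ht => ?_).le
  exact enorm_mfderiv_symm_comp he
    ((hc.contDiffAt (Icc_mem_nhds ht.1 ht.2)).differentiableAt (by simp)) (hm ⟨ht.1.le, ht.2.le⟩)

theorem exists_path_in_chart {e : Chart n M}
    (he : e ∈ MaxAtlas n M) {O : Set M} {p₀ : M}
    (hO : O ∈ 𝓝 p₀) (hp : p₀ ∈ e.source) :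
    ∃ V ∈ 𝓝 p₀, V ⊆ e.source ∩ O ∧ ∀ p ∈ V, ∀ q ∈ V, edist p q ≠ ⊤ ∧ ∀ L, edist p q < L → ∃ c : ℝ → Amb n,
      ContDiffOn ℝ 1 c (Icc 0 1) ∧ MapsTo c (Icc 0 1) (e.target ∩ e.symm ⁻¹' O) ∧ c 0 = e p ∧ c 1 = e q ∧
      ∫⁻ t in Ioo (0 : ℝ) 1, ‖push e (c t) (deriv c t)‖ₑ < L := by
  obtain ⟨r, hr, hball⟩ := EMetric.mem_nhds_iff.1 (inter_mem (e.open_source.mem_nhds hp) hO)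
  have hr3 : 0 < r / 3 := ENNReal.div_pos hr.ne' (by simp)
  refine ⟨eball p₀ (r / 3), eball_mem_nhds _ hr3, ?_, ?_⟩
  · refine (eball_subset_eball ?_).trans hball
    exact ENNReal.div_le_of_le_mul (le_mul_of_one_le_right' (by norm_num))
  intro p hp' q hq
  have hpq : edist p q < r / 3 + r / 3 := by
    refine (edist_triangle_right p q p₀).trans_lt (ENNReal.add_lt_add hp' hq)
  refine ⟨hpq.ne_top, fun L hL => ?_⟩
  have hlt : Manifold.riemannianEDist (𝓡 (n + 1)) p q < min L (r / 3 + r / 3) := by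
    rw [← IsRiemannianManifold.out (I := 𝓡 (n + 1))]
    exact lt_min hL hpq
  obtain ⟨γ, h0, h1, hγ, hlen⟩ := Manifold.exists_lt_of_riemannianEDist_lt hlt
  have hmem : ∀ t ∈ Icc (0 : ℝ) 1, γ t ∈ eball p₀ r := by
    intro t ht
    have h2 : edist p (γ t) < r / 3 + r / 3 := by
      rw [IsRiemannianManifold.out (I := 𝓡 (n + 1))]
      refine (Manifold.riemannianEDist_le_pathELength
        (hγ.mono (Icc_subset_Icc_right ht.2)) h0 rfl ht.1).trans_lt ?_
      exact (Manifold.pathELength_mono le_rfl ht.2).trans_lt (hlen.trans_le (min_le_right _ _))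
    rw [mem_eball]
    calc edist (γ t) p₀ ≤ edist p (γ t) + edist p p₀ := by
          rw [edist_comm p (γ t)]; exact edist_triangle _ _ _
      _ < (r / 3 + r / 3) + r / 3 := ENNReal.add_lt_add h2 hp'
      _ = r := ENNReal.add_thirds r
  have hγe : ContMDiffOn 𝓘(ℝ, ℝ) (𝓡 (n + 1)) 1 (e ∘ γ) (Icc 0 1) :=
    ((contMDiffOn_of_mem_maximalAtlas he).of_le (by simp)).comp hγ fun t ht => (hball (hmem t ht)).1
  have hc : ContDiffOn ℝ 1 (e ∘ γ) (Icc 0 1) := contMDiffOn_iff_contDiffOn.1 hγe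
  have hm : MapsTo (e ∘ γ) (Icc 0 1) e.target := fun t ht => e.map_source (hball (hmem t ht)).1
  refine ⟨e ∘ γ, hc, fun t ht => ⟨hm ht, ?_⟩, by simp [h0], by simp [h1], ?_⟩
  · change e.symm (e (γ t)) ∈ O
    rw [e.left_inv (hball (hmem t ht)).1]
    exact (hball (hmem t ht)).2
  · refine lt_of_eq_of_lt ?_ (hlen.trans_le (min_le_left _ _))
    rw [← Manifold.pathELength_congr_Ioo (γ := e.symm ∘ e ∘ γ) (γ' := γ)
      (fun t ht => e.left_inv (hball (hmem t ⟨ht.1.le, ht.2.le⟩)).1), Manifold.pathELength_eq_lintegral_mfderiv_Ioo]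
    refine setLIntegral_congr_fun measurableSet_Ioo fun t ht => ?_
    exact (enorm_mfderiv_symm_comp he
      ((hc.contDiffAt (Icc_mem_nhds ht.1 ht.2)).differentiableAt (by simp))
      (hm ⟨ht.1.le, ht.2.le⟩)).symm

theorem norm_push_le_of_form_le {e : Chart n M} {x w y u : Amb n} {κ : ℝ} (hκ : 0 ≤ κ)
    (h : form e y u u ≤ κ ^ 2 * form e x w w) : ‖push e y u‖ ≤ κ * ‖push e x w‖ := by
  rw [form_self, form_self, ← mul_pow] at h
  exact le_of_sq_le_sq h (by positivity)

theorem enorm_le_ofReal_mul {A B : Type*} [SeminormedAddCommGroup A] [SeminormedAddCommGroup B] {a : A} {b : B} {κ : ℝ} (hκ : 0 ≤ κ)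
    (h : ‖a‖ ≤ κ * ‖b‖) : ‖a‖ₑ ≤ ENNReal.ofReal κ * ‖b‖ₑ := by
  rw [← ofReal_norm, ← ofReal_norm, ← ENNReal.ofReal_mul hκ]
  exact ENNReal.ofReal_le_ofReal h

theorem le_mul_of_forall_lt {a d : ENNReal} {K : NNReal} (hd : d ≠ ⊤)
    (h : ∀ L, d < L → a ≤ K * L) : a ≤ K * d := by
  have hne : (𝓝[>] d).NeBot := nhdsGT_neBot_of_exists_gt ⟨⊤, hd.lt_top⟩
  have ht : Tendsto (fun L : ENNReal => (K : ENNReal) * L) (𝓝[>] d) (𝓝 (K * d)) :=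
    ((ENNReal.continuous_const_mul ENNReal.coe_ne_top).tendsto d).mono_left nhdsWithin_le_nhds
  exact ge_of_tendsto ht (eventually_mem_nhdsWithin.mono h)

theorem exists_lipschitz_conj {e : Chart n M}
    (he : e ∈ MaxAtlas n M) {x₀ : Amb n} (hx₀ : x₀ ∈ e.target) :
    ∃ R > 0, ball x₀ R ⊆ e.target ∧ ∃ Λ ≥ (1 : ℝ), ∀ R', 0 < R' → R' ≤ R → ∃ V ∈ 𝓝 (e.symm x₀),
      V ⊆ e.source ∩ e ⁻¹' ball x₀ R' ∧ ∀ (Φ : Amb n → Amb n) (μ δ : ℝ), 0 < μ → μ ≤ 1 →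
      0 ≤ δ → δ ≤ 1 → ContDiffOn ℝ 1 Φ (ball x₀ R') → MapsTo Φ (ball x₀ R') (ball x₀ R) →
      (∀ x ∈ ball x₀ R', ‖Φ x - x‖ ≤ δ) → (∀ x ∈ ball x₀ R', ∀ w, ‖fderiv ℝ Φ x w - μ • w‖ ≤ μ * δ * ‖w‖) →
      LipschitzOnWith (Real.toNNReal (μ * (1 + Λ * δ))) (fun p => e.symm (Φ (e p))) V := by
  obtain ⟨R, hR, C, hC, hsub, hform⟩ := exists_form_bounds he hx₀
  refine ⟨R, hR, hsub, 4 * C ^ 2, by nlinarith, fun R' hR' hRR' => ?_⟩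
  have hx₀s : e.symm x₀ ∈ e.source := e.map_target hx₀
  have hO : e.source ∩ e ⁻¹' ball x₀ R' ∈ 𝓝 (e.symm x₀) := by
    refine (e.isOpen_inter_preimage isOpen_ball).mem_nhds ⟨hx₀s, ?_⟩
    rw [mem_preimage, e.right_inv hx₀]; exact mem_ball_self hR'
  obtain ⟨V, hV, hVs, hpath⟩ := exists_path_in_chart he hO hx₀s
  refine ⟨V, hV, fun p hp => (hVs hp).2, ?_⟩
  intro Φ μ δ hμ hμ1 hδ hδ1 hΦ hmaps hclose hder p hp q hq
  have hκ : 0 ≤ μ * (1 + 4 * C ^ 2 * δ) := by positivity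
  have hpt : ∀ x ∈ ball x₀ R', ∀ w, ‖push e (Φ x) (fderiv ℝ Φ x w)‖ ≤ μ * (1 + 4 * C ^ 2 * δ) * ‖push e x w‖ := by
    intro x hx w
    refine norm_push_le_of_form_le hκ ?_
    have hxR : x ∈ ball x₀ R := ball_subset_ball hRR' hx
    obtain ⟨h1, h2, h3⟩ := hform _ (hmaps hx)
    set r := μ⁻¹ • (fderiv ℝ Φ x w - μ • w) with hr
    have hu : fderiv ℝ Φ x w = μ • (w + r) := by
      rw [hr, smul_add, smul_smul, mul_inv_cancel₀ hμ.ne', one_smul, add_sub_cancel]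
    have hrn : ‖r‖ ≤ δ * ‖w‖ := by
      rw [hr, norm_smul, norm_inv, Real.norm_of_nonneg hμ.le, inv_mul_le_iff₀ hμ, ← mul_assoc]
      exact hder x hx w
    have hexp : form e (Φ x) (μ • (w + r)) (μ • (w + r)) =
        μ ^ 2 * (form e (Φ x) w w + 2 * form e (Φ x) w r + form e (Φ x) r r) := by
      rw [form_smul_left, form_comm, form_smul_left, form_add_left, form_comm, form_comm e _ r,
        form_add_left, form_add_left, form_comm e _ r w]
      ring
    rw [hu, hexp]
    have hb1 := (abs_le.1 (h3 x hxR w)).2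
    have hb2 := (abs_le.1 (h1 w r)).2
    have hb3 := (abs_le.1 (h1 r r)).2
    have hb4 := ((hform x hxR).2.1 w)
    have hww := norm_nonneg w
    have hrr := norm_nonneg r
    have hF : 0 ≤ form e x w w := by rw [form_self]; positivity
    have e1 : C * ‖Φ x - x‖ * ‖w‖ ^ 2 ≤ C * δ * ‖w‖ ^ 2 := by gcongr; exact hclose x hx
    have e2 : C * ‖w‖ * ‖r‖ ≤ C * δ * ‖w‖ ^ 2 := by
      calc C * ‖w‖ * ‖r‖ ≤ C * ‖w‖ * (δ * ‖w‖) := by gcongr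
        _ = _ := by ring
    have e3 : C * ‖r‖ * ‖r‖ ≤ C * δ * ‖w‖ ^ 2 := by
      calc C * ‖r‖ * ‖r‖ ≤ C * (δ * ‖w‖) * (δ * ‖w‖) := by gcongr
        _ = C * δ * ‖w‖ ^ 2 * δ := by ring
        _ ≤ C * δ * ‖w‖ ^ 2 * 1 := by gcongr
        _ = _ := by ring
    have e4 : C * δ * ‖w‖ ^ 2 ≤ C * δ * (C * form e x w w) := by gcongr
    have e5 : form e (Φ x) w w + 2 * form e (Φ x) w r + form e (Φ x) r r ≤
        (1 + 4 * C ^ 2 * δ) * form e x w w := by nlinarith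
    have e6 : (1 + 4 * C ^ 2 * δ) ≤ (1 + 4 * C ^ 2 * δ) ^ 2 := by
      have : 0 ≤ 4 * C ^ 2 * δ := by positivity
      nlinarith
    calc _ ≤ μ ^ 2 * ((1 + 4 * C ^ 2 * δ) * form e x w w) := by gcongr
      _ ≤ μ ^ 2 * ((1 + 4 * C ^ 2 * δ) ^ 2 * form e x w w) := by gcongr
      _ = _ := by ring
  refine le_mul_of_forall_lt (hpath p hp q hq).1 fun L hL => ?_
  obtain ⟨c, hc, hcm, hc0, hc1, hlen⟩ := (hpath p hp q hq).2 L hL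
  have hcb : MapsTo c (Icc 0 1) (ball x₀ R') := fun t ht => by
    have h1 := (hcm ht).2.2
    rwa [mem_preimage, e.right_inv (hcm ht).1] at h1
  have h := edist_symm_le he (hΦ.comp hc hcb) ((hmaps.mono_right hsub).comp hcb)
  simp only [Function.comp_apply, hc0, hc1] at h
  refine h.trans ?_
  calc _ ≤ ∫⁻ t in Ioo (0 : ℝ) 1, ENNReal.ofReal (μ * (1 + 4 * C ^ 2 * δ)) * ‖push e (c t) (deriv c t)‖ₑ := by
        refine setLIntegral_mono' measurableSet_Ioo fun t ht => ?_
        refine enorm_le_ofReal_mul hκ ?_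
        have ht' : t ∈ Icc (0 : ℝ) 1 := ⟨ht.1.le, ht.2.le⟩
        have hd : deriv (Φ ∘ c) t = fderiv ℝ Φ (c t) (deriv c t) :=
          fderiv_comp_deriv t ((hΦ.contDiffAt (isOpen_ball.mem_nhds (hcb ht'))).differentiableAt
            (by simp)) ((hc.contDiffAt (Icc_mem_nhds ht.1 ht.2)).differentiableAt (by simp))
        rw [hd]
        exact hpt _ (hcb ht') _
    _ = ENNReal.ofReal (μ * (1 + 4 * C ^ 2 * δ)) * ∫⁻ t in Ioo (0 : ℝ) 1, ‖push e (c t) (deriv c t)‖ₑ :=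
      lintegral_const_mul' _ _ ENNReal.ofReal_ne_top
    _ ≤ _ := by gcongr; exact le_rfl

theorem exists_lipschitz_symm {e : Chart n M}
    (he : e ∈ MaxAtlas n M) {x₀ : Amb n} (hx₀ : x₀ ∈ e.target) : ∃ K : NNReal, ∃ R > 0, ball x₀ R ⊆ e.target ∧
      LipschitzOnWith K e.symm (ball x₀ R) := by
  obtain ⟨R, hR, C, hC, hsub, hform⟩ := exists_form_bounds he hx₀
  refine ⟨C.toNNReal, R, hR, hsub, fun x hx y hy => ?_⟩
  let c : ℝ → Amb n := fun t => AffineMap.lineMap x y t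
  have hc : ContDiff ℝ 1 c := (ContinuousAffineMap.lineMap (R := ℝ) x y).contDiff
  have hm : MapsTo c (Icc 0 1) (ball x₀ R) := fun t ht => (convex_ball x₀ R).lineMap_mem hx hy ht
  have h := edist_symm_le he hc.contDiffOn (hm.mono_right hsub)
  have hd : ∀ t, deriv c t = y - x := fun t => by
    simpa [c] using (AffineMap.hasDerivAt_lineMap (a := x) (b := y) (x := t)).deriv
  simp only [c, AffineMap.lineMap_apply_zero, AffineMap.lineMap_apply_one] at h
  refine h.trans ?_
  calc _ ≤ ∫⁻ t in Ioo (0 : ℝ) 1, ENNReal.ofReal C * ‖y - x‖ₑ := by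
        refine setLIntegral_mono' measurableSet_Ioo fun t ht => ?_
        refine enorm_le_ofReal_mul (by positivity) ?_
        have h1 := (hform _ (hm ⟨ht.1.le, ht.2.le⟩)).1 (y - x) (y - x)
        rw [form_self, abs_of_nonneg (by positivity)] at h1
        change ‖push e (c t) (deriv c t)‖ ≤ _
        rw [hd]
        refine le_of_sq_le_sq (h1.trans ?_) (by positivity)
        calc C * ‖y - x‖ * ‖y - x‖ = C * ‖y - x‖ ^ 2 := by ring
          _ ≤ C ^ 2 * ‖y - x‖ ^ 2 := by gcongr; nlinarith
          _ = _ := by ring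
    _ = _ := by
      rw [setLIntegral_const, edist_comm, edist_eq_enorm_sub]; simp; rfl

theorem exists_lipschitz_chart {e : Chart n M}
    (he : e ∈ MaxAtlas n M) {p₀ : M} (hp₀ : p₀ ∈ e.source) :
    ∃ K : NNReal, ∃ V ∈ 𝓝 p₀, V ⊆ e.source ∧ LipschitzOnWith K e V := by
  obtain ⟨R, hR, C, hC, hsub, hform⟩ := exists_form_bounds he (e.map_source hp₀)
  have hO : e.source ∩ e ⁻¹' ball (e p₀) R ∈ 𝓝 p₀ :=
    (e.isOpen_inter_preimage isOpen_ball).mem_nhds ⟨hp₀, mem_ball_self hR⟩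
  obtain ⟨V, hV, hVs, hpath⟩ := exists_path_in_chart he hO hp₀
  refine ⟨C.toNNReal, V, hV, fun p hp => (hVs hp).1, fun p hp q hq => ?_⟩
  refine le_mul_of_forall_lt (hpath p hp q hq).1 fun L hL => ?_
  obtain ⟨c, hc, hcm, hc0, hc1, hlen⟩ := (hpath p hp q hq).2 L hL
  have h := enorm_sub_le_lintegral_derivWithin_Icc_of_contDiffOn_Icc hc zero_le_one
  rw [← hc0, ← hc1, edist_comm, edist_eq_enorm_sub]
  refine h.trans ?_
  rw [← Measure.restrict_congr_set Ioo_ae_eq_Icc]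
  calc _ ≤ ∫⁻ t in Ioo (0 : ℝ) 1, ENNReal.ofReal C * ‖push e (c t) (deriv c t)‖ₑ := by
        refine setLIntegral_mono' measurableSet_Ioo fun t ht => ?_
        refine enorm_le_ofReal_mul (by positivity) ?_
        rw [derivWithin_of_mem_nhds (Icc_mem_nhds ht.1 ht.2)]
        have ht' := hcm ⟨ht.1.le, ht.2.le⟩
        have h1 := ht'.2.2
        rw [mem_preimage, e.right_inv ht'.1] at h1
        have h2 := (hform _ h1).2.1 (deriv c t)
        rw [form_self] at h2
        refine le_of_sq_le_sq (h2.trans ?_) (by positivity)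
        rw [mul_pow]
        gcongr
        nlinarith
    _ = ENNReal.ofReal C * ∫⁻ t in Ioo (0 : ℝ) 1, ‖push e (c t) (deriv c t)‖ₑ :=
      lintegral_const_mul' _ _ ENNReal.ofReal_ne_top
    _ ≤ _ := by gcongr; exact le_rfl

end Paths

section HausdorffFacts

variable {X X' : Type*} [EMetricSpace X] [MeasurableSpace X] [BorelSpace X] [EMetricSpace X']
  [MeasurableSpace X'] [BorelSpace X']

theorem area_image_le {K : NNReal} {f : X → X'} {s : Set X}
    (h : LipschitzOnWith K f s) (d : ℕ) : μHE[d] (f '' s) ≤ (K : ENNReal) ^ d * μHE[d] s := by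
  rw [Measure.euclideanHausdorffMeasure_def, Measure.euclideanHausdorffMeasure_def]
  simp only [Measure.smul_apply, ENNReal.smul_def, smul_eq_mul]
  have := h.hausdorffMeasure_image_le (d := d) (by positivity)
  rw [ENNReal.rpow_natCast] at this
  calc _ ≤ _ * ((K : ENNReal) ^ d * μH[d] s) := by gcongr
    _ = _ := by ring

theorem area_singleton {d : ℕ} (hd : 1 ≤ d) (x : X) : μHE[d] {x} = 0 := by
  rw [Measure.euclideanHausdorffMeasure_def]
  have := Measure.nullSingletonClass_hausdorff X (d := d) (by exact_mod_cast hd)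
  simp

theorem area_finite {d : ℕ} (hd : 1 ≤ d) {s : Set X} (hs : s.Finite) : μHE[d] s = 0 := by
  rw [← biUnion_of_singleton s]
  exact (measure_biUnion_null_iff hs.countable).2 fun x _ => area_singleton hd x

theorem isSeparable_of_hausdorffMeasure_lt_top {d : ℕ} {s : Set X} (hs : μHE[d] s ≠ ⊤) :
    TopologicalSpace.IsSeparable s := by
  have hs' : μH[d] s ≠ ⊤ := by
    rw [Measure.euclideanHausdorffMeasure_def] at hs
    simp only [Measure.smul_apply, ENNReal.smul_def, smul_eq_mul] at hs
    intro h
    rw [h, ENNReal.mul_top] at hs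
    · exact hs rfl
    · simpa using Measure.addHaarScalarFactor_volume_hausdorffMeasure_ne_zero d
  obtain ⟨t, -, ht, hst⟩ := EMetric.subset_countable_closure_of_almost_dense_set s fun ε hε => by
    rw [Measure.hausdorffMeasure_apply] at hs'
    have h1 := ((le_iSup₂ (f := fun (r : ENNReal) (_ : 0 < r) => ⨅ (t : ℕ → Set X) (_ : s ⊆ ⋃ n, t n)
      (_ : ∀ n, ediam (t n) ≤ r), ∑' n, ⨆ _ : (t n).Nonempty, ediam (t n) ^ (d : ℝ))
      ε hε).trans_lt hs'.lt_top)
    simp only [iInf_lt_iff] at h1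
    obtain ⟨t, hst, hd, -⟩ := h1
    classical
    refine ⟨⋃ k, if h : (t k).Nonempty then {h.some} else ∅, countable_iUnion fun k => ?_, ?_⟩
    · split_ifs <;> simp
    · intro x hx
      obtain ⟨k, hk⟩ := mem_iUnion.1 (hst hx)
      have hne : (t k).Nonempty := ⟨x, hk⟩
      refine mem_iUnion₂.2 ⟨hne.some, mem_iUnion.2 ⟨k, by simp [hne]⟩, ?_⟩
      exact (edist_le_ediam_of_mem hk hne.some_mem).trans (hd k)
  exact ⟨t, ht, hst⟩

theorem exists_null_frontier_nhd (ν : Measure X) [IsFiniteMeasure ν] {x : X} {V : Set X}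
    (hV : V ∈ 𝓝 x) : ∃ O ⊆ V, IsOpen O ∧ x ∈ O ∧ ν (frontier O) = 0 := by
  obtain ⟨a, ha, hball⟩ := EMetric.mem_nhds_iff.1 hV
  have hm : Measurable fun y => (edist y x).toReal := by fun_prop
  have hc := Measure.countable_meas_level_set_pos (μ := ν) hm
  set b : ℝ := (min a 1).toReal
  have hmin : min a 1 ≠ ⊤ := ((min_le_right a 1).trans_lt ENNReal.one_lt_top).ne
  have hb : 0 < b := ENNReal.toReal_pos (lt_min ha one_pos).ne' hmin
  obtain ⟨r, hr, hr'⟩ := (hc.dense_compl ℝ).exists_between hb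
  have hr0 : ν {y | (edist y x).toReal = r} = 0 := by simpa using hr
  refine ⟨eball x (ENNReal.ofReal r), (eball_subset_eball ?_).trans hball,
    isOpen_eball, mem_eball_self (by simpa using hr'.1), ?_⟩
  · refine (ENNReal.ofReal_le_ofReal hr'.2.le).trans ?_
    rw [ENNReal.ofReal_toReal hmin]
    exact min_le_left _ _
  · refine measure_mono_null (fun y hy => ?_) hr0
    have h1 : y ∈ {y | edist y x = ENNReal.ofReal r} :=
      frontier_lt_subset_eq (f := fun y => edist y x) (g := fun _ => ENNReal.ofReal r)
        (by fun_prop) continuous_const hy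
    have h2 : edist y x = ENNReal.ofReal r := h1
    simp [h2, hr'.1.le]

end HausdorffFacts

section AreaConv

variable {n : ℕ} {M : Type*} [EMetricSpace M] [MeasurableSpace M] [BorelSpace M] {Y : Type*}

/-- The areas of `Γ y` converge to the area of `Γ₀` in every small set which has negligible
frontier in `Γ₀`. -/
def AreaConv (n : ℕ) (l : Filter Y) (Γ : Y → Set M) (Γ₀ : Set M) (x : M) : Prop :=
  ∃ V ∈ 𝓝 x, μHE[n] (Γ₀ ∩ V) < ⊤ ∧ ∀ B ⊆ V, MeasurableSet B → μHE[n] (Γ₀ ∩ frontier B) = 0 →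
    Tendsto (fun y => μHE[n] (Γ y ∩ B)) l (𝓝 (μHE[n] (Γ₀ ∩ B)))

theorem AreaConv.of_disjoint {l : Filter Y} {Γ : Y → Set M} {Γ₀ : Set M} {x : M} {V : Set M}
    (hV : V ∈ 𝓝 x) (h₀ : Disjoint V Γ₀) (h : ∀ᶠ y in l, Disjoint V (Γ y)) : AreaConv n l Γ Γ₀ x := by
  refine ⟨V, hV, by simp [h₀.symm.inter_eq], fun B hB _ _ => ?_⟩
  rw [(h₀.mono_left hB).symm.inter_eq]
  refine tendsto_const_nhds.congr' ?_
  filter_upwards [h] with y hy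
  rw [(hy.mono_left hB).symm.inter_eq]

theorem null_frontier_inter {ν : Measure M} {A B : Set M} (hA : ν (frontier A) = 0)
    (hB : ν (frontier B) = 0) : ν (frontier (A ∩ B)) = 0 := by
  refine measure_mono_null (frontier_inter_subset A B) (measure_union_null ?_ ?_)
  · exact measure_mono_null inter_subset_left hA
  · exact measure_mono_null inter_subset_right hB

theorem null_frontier_diff {ν : Measure M} {A B : Set M} (hA : ν (frontier A) = 0)
    (hB : ν (frontier B) = 0) : ν (frontier (A \ B)) = 0 := by
  rw [sdiff_eq]
  exact null_frontier_inter hA (by rwa [frontier_compl])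

theorem null_frontier_union {ν : Measure M} {A B : Set M} (hA : ν (frontier A) = 0)
    (hB : ν (frontier B) = 0) : ν (frontier (A ∪ B)) = 0 := by
  refine measure_mono_null (frontier_union_subset A B) (measure_union_null ?_ ?_)
  · exact measure_mono_null inter_subset_left hA
  · exact measure_mono_null inter_subset_right hB

theorem restrict_frontier {Γ₀ B : Set M} :
    (μHE[n] : Measure M).restrict Γ₀ (frontier B) = μHE[n] (Γ₀ ∩ frontier B) := by
  rw [Measure.restrict_apply isClosed_frontier.measurableSet, inter_comm]

theorem measure_split (Γ B O : Set M) (hO : MeasurableSet O) :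
    μHE[n] (Γ ∩ B) = μHE[n] (Γ ∩ (B ∩ O)) + μHE[n] (Γ ∩ (B \ O)) := by
  rw [← measure_inter_add_sdiff (Γ ∩ B) hO, inter_assoc, inter_sdiff_assoc]

/-- Convergence of areas in a set covered by finitely many open sets in which the areas converge. -/
theorem tendsto_area_of_finite_cover {l : Filter Y} {Γ : Y → Set M} {Γ₀ : Set M} {ι : Type*}
    (s : Finset ι) (O : ι → Set M) (hO : ∀ i, IsOpen (O i))
    (hfr : ∀ i, μHE[n] (Γ₀ ∩ frontier (O i)) = 0)
    (hconv : ∀ i, ∀ B ⊆ O i, MeasurableSet B → μHE[n] (Γ₀ ∩ frontier B) = 0 →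
      Tendsto (fun y => μHE[n] (Γ y ∩ B)) l (𝓝 (μHE[n] (Γ₀ ∩ B))))
    {B : Set M} (hB : B ⊆ ⋃ i ∈ s, O i) (hBm : MeasurableSet B)
    (hBf : μHE[n] (Γ₀ ∩ frontier B) = 0) : Tendsto (fun y => μHE[n] (Γ y ∩ B)) l (𝓝 (μHE[n] (Γ₀ ∩ B))) := by
  classical
  induction s using Finset.induction_on generalizing B with
  | empty =>
    have : B = ∅ := by simpa using hB
    simp [this, tendsto_const_nhds]
  | insert a s ha ih =>
    have e1 := fun Γ : Set M => measure_split (n := n) Γ B (O a) (hO a).measurableSet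
    simp_rw [e1]
    rw [← restrict_frontier] at hBf
    refine Tendsto.add ?_ ?_
    · refine hconv a _ inter_subset_right (hBm.inter (hO a).measurableSet) ?_
      rw [← restrict_frontier]
      exact null_frontier_inter hBf (by rw [restrict_frontier]; exact hfr a)
    · refine ih ?_ (hBm.diff (hO a).measurableSet) ?_
      · intro x hx
        have := hB hx.1
        simp only [Finset.mem_insert, iUnion_iUnion_eq_or_left] at this
        exact this.resolve_left hx.2
      · rw [← restrict_frontier]
        exact null_frontier_diff hBf (by rw [restrict_frontier]; exact hfr a)

theorem AreaConv.exists_open {l : Filter Y} {Γ : Y → Set M} {Γ₀ : Set M} {x : M}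
    (h : AreaConv n l Γ Γ₀ x) {V : Set M} (hV : V ∈ 𝓝 x) : ∃ O ⊆ V, IsOpen O ∧ x ∈ O ∧
      μHE[n] (Γ₀ ∩ O) < ⊤ ∧ μHE[n] (Γ₀ ∩ frontier O) = 0 ∧ ∀ B ⊆ O, MeasurableSet B → μHE[n] (Γ₀ ∩ frontier B) = 0 →
        Tendsto (fun y => μHE[n] (Γ y ∩ B)) l (𝓝 (μHE[n] (Γ₀ ∩ B))) := by
  obtain ⟨W, hW, hfin, hconv⟩ := h
  obtain ⟨V', hV', hV'c, hV'W⟩ := exists_mem_nhds_isClosed_subset (inter_mem hV hW)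
  have : IsFiniteMeasure ((μHE[n] : Measure M).restrict (Γ₀ ∩ W)) := ⟨by simpa using hfin⟩
  obtain ⟨O, hOV, hO, hxO, hOf⟩ := exists_null_frontier_nhd ((μHE[n] : Measure M).restrict (Γ₀ ∩ W)) hV'
  rw [restrict_frontier] at hOf
  have hfrW : frontier O ⊆ W := (frontier_subset_closure.trans (hV'c.closure_subset_iff.2 hOV)).trans
    (hV'W.trans inter_subset_right)
  have hOW : O ⊆ W := hOV.trans (hV'W.trans inter_subset_right)
  refine ⟨O, hOV.trans (hV'W.trans inter_subset_left), hO, hxO,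
    (measure_mono (inter_subset_inter_right _ hOW)).trans_lt hfin, ?_, fun B hB => hconv B (hB.trans hOW)⟩
  refine measure_mono_null ?_ hOf
  exact fun y hy => ⟨⟨hy.1, hfrW hy.2⟩, hy.2⟩

/-- Convergence of areas in sets contained in a compact set. -/
theorem tendsto_area_of_isCompact {l : Filter Y} {Γ : Y → Set M} {Γ₀ : Set M} {K : Set M}
    (hK : IsCompact K) (h : ∀ x ∈ K, AreaConv n l Γ Γ₀ x) {B : Set M} (hB : B ⊆ K)
    (hBm : MeasurableSet B) (hBf : μHE[n] (Γ₀ ∩ frontier B) = 0) :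
    Tendsto (fun y => μHE[n] (Γ y ∩ B)) l (𝓝 (μHE[n] (Γ₀ ∩ B))) := by
  have h' : ∀ x : K, ∃ O, IsOpen O ∧ x.1 ∈ O ∧ μHE[n] (Γ₀ ∩ frontier O) = 0 ∧
      ∀ B ⊆ O, MeasurableSet B → μHE[n] (Γ₀ ∩ frontier B) = 0 →
        Tendsto (fun y => μHE[n] (Γ y ∩ B)) l (𝓝 (μHE[n] (Γ₀ ∩ B))) := fun x => by
    obtain ⟨O, -, h1, h2, -, h3⟩ := (h x x.2).exists_open univ_mem
    exact ⟨O, h1, h2, h3⟩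
  choose O hO hxO hOf hconv using h'
  obtain ⟨t, ht⟩ := hK.elim_finite_subcover O hO fun x hx => mem_iUnion.2 ⟨⟨x, hx⟩, hxO ⟨x, hx⟩⟩
  exact tendsto_area_of_finite_cover t O hO hOf hconv (hB.trans ht) hBm hBf

theorem measure_lt_top_of_isCompact {l : Filter Y} {Γ : Y → Set M} {Γ₀ : Set M} {K : Set M}
    (hK : IsCompact K) (h : ∀ x ∈ K, AreaConv n l Γ Γ₀ x) : μHE[n] (Γ₀ ∩ K) < ⊤ := by
  refine hK.induction_on (p := fun s => μHE[n] (Γ₀ ∩ s) < ⊤) (by simp)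
    (fun s t hst ht => (measure_mono (inter_subset_inter_right _ hst)).trans_lt ht)
    (fun s t hs ht => ?_) fun x hx => ?_
  · rw [inter_union_distrib_left]
    exact (measure_union_le _ _).trans_lt (ENNReal.add_lt_top.2 ⟨hs, ht⟩)
  · obtain ⟨V, hV, hfin, -⟩ := h x hx
    exact ⟨V, mem_nhdsWithin_of_mem_nhds hV, hfin⟩

theorem AreaConv.exists_small {l : Filter Y} {Γ : Y → Set M} {Γ₀ : Set M} {x : M} (hn : 1 ≤ n)
    (h : AreaConv n l Γ Γ₀ x) {ε : ENNReal} (hε : 0 < ε) : ∃ V ∈ 𝓝 x, ∀ᶠ y in l, μHE[n] (Γ y ∩ V) ≤ ε := by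
  obtain ⟨O, -, hO, hxO, hfin, hOf, hconv⟩ := h.exists_open univ_mem
  set ν := (μHE[n] : Measure M).restrict (Γ₀ ∩ O) with hν
  have : IsFiniteMeasure ν := ⟨by simpa [hν] using hfin⟩
  have hν0 : ν {x} = 0 := nonpos_iff_eq_zero.1 ((Measure.restrict_apply_le _ _).trans_eq
    (area_singleton hn x))
  obtain ⟨U, hxU, hU, hUε⟩ := Set.exists_isOpen_lt_of_lt {x} ε (by rw [hν0]; exact hε)
  have hxU' := hxU rfl
  obtain ⟨W, hW, hWo, hxW, -, hWf, -⟩ := AreaConv.exists_open (n := n) (l := l) (Γ := Γ) (Γ₀ := Γ₀)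
    ⟨O, hO.mem_nhds hxO, hfin, hconv⟩ (inter_mem (hU.mem_nhds hxU') (hO.mem_nhds hxO))
  refine ⟨W, hWo.mem_nhds hxW, ?_⟩
  have h1 := hconv W (hW.trans inter_subset_right) hWo.measurableSet hWf
  have h2 : μHE[n] (Γ₀ ∩ W) < ε := by
    refine lt_of_le_of_lt ?_ hUε
    rw [hν, Measure.restrict_apply hU.measurableSet]
    refine measure_mono fun y hy => ⟨(hW hy.2).1, hy.1, (hW hy.2).2⟩
  filter_upwards [h1.eventually (gt_mem_nhds h2)] with y hy using hy.le

/-- At an isolated bad point, convergence of areas follows if no area concentrates there. -/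
theorem AreaConv.of_punctured {l : Filter Y} {Γ : Y → Set M} {Γ₀ : Set M} {x : M} {K : Set M}
    (hK : K ∈ 𝓝 x) (hKc : IsCompact K) (hfin : μHE[n] (Γ₀ ∩ K) < ⊤)
    (h : ∀ z ∈ K, z ≠ x → AreaConv n l Γ Γ₀ z)
    (hnc : ∀ ε > 0, ∃ V ∈ 𝓝 x, μHE[n] (Γ₀ ∩ V) ≤ ε ∧ ∀ᶠ y in l, μHE[n] (Γ y ∩ V) ≤ ε) : AreaConv n l Γ Γ₀ x := by
  refine ⟨K, hK, hfin, fun B hB hBm hBf => ?_⟩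
  set ν := (μHE[n] : Measure M).restrict (Γ₀ ∩ K) with hν
  have : IsFiniteMeasure ν := ⟨by simpa [hν] using hfin⟩
  have hfinB : μHE[n] (Γ₀ ∩ B) ≠ ⊤ := ((measure_mono (inter_subset_inter_right _ hB)).trans_lt hfin).ne
  rw [ENNReal.tendsto_nhds hfinB]
  intro ε hε
  obtain ⟨V, hV, hV0, hVy⟩ := hnc (ε / 2) (ENNReal.half_pos hε.ne')
  obtain ⟨K', hK', hK'c, hK'K⟩ := exists_mem_nhds_isClosed_subset (inter_mem hK hV)
  obtain ⟨O, hOK, hO, hxO, hOf⟩ := exists_null_frontier_nhd ν hK'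
  have hOV : O ⊆ V := hOK.trans (hK'K.trans inter_subset_right)
  rw [restrict_frontier] at hOf
  have hOf' : μHE[n] (Γ₀ ∩ frontier O) = 0 := by
    refine measure_mono_null ?_ hOf
    exact fun y hy => ⟨⟨hy.1, (hK'K ((frontier_subset_closure.trans
      (hK'c.closure_subset_iff.2 hOK)) hy.2)).1⟩, hy.2⟩
  have hconv : Tendsto (fun y => μHE[n] (Γ y ∩ (B \ O))) l (𝓝 (μHE[n] (Γ₀ ∩ (B \ O)))) := by
    refine tendsto_area_of_isCompact (hKc.diff hO) (fun z hz => h z hz.1 ?_)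
      (sdiff_subset_sdiff_left hB) (hBm.diff hO.measurableSet) ?_
    · rintro rfl; exact hz.2 hxO
    · rw [← restrict_frontier] at hBf hOf' ⊢
      exact null_frontier_diff hBf hOf'
  have hfin' : μHE[n] (Γ₀ ∩ (B \ O)) ≠ ⊤ :=
    ((measure_mono (inter_subset_inter_right _ sdiff_subset)).trans_lt hfinB.lt_top).ne
  have h2 := (ENNReal.tendsto_nhds hfin').1 hconv (ε / 2) (ENNReal.half_pos hε.ne')
  filter_upwards [h2, hVy] with y hy hyV
  rw [measure_split (Γ y) B O hO.measurableSet, measure_split Γ₀ B O hO.measurableSet]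
  have i0 : μHE[n] (Γ₀ ∩ (B ∩ O)) ≤ ε / 2 :=
    (measure_mono (inter_subset_inter_right _ (inter_subset_right.trans hOV))).trans hV0
  have iy : μHE[n] (Γ y ∩ (B ∩ O)) ≤ ε / 2 :=
    (measure_mono (inter_subset_inter_right _ (inter_subset_right.trans hOV))).trans hyV
  constructor
  · rw [tsub_le_iff_right]
    calc _ ≤ ε / 2 + (μHE[n] (Γ y ∩ (B \ O)) + ε / 2) :=
          add_le_add i0 (tsub_le_iff_right.1 hy.1)
      _ = μHE[n] (Γ y ∩ (B \ O)) + (ε / 2 + ε / 2) := by ring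
      _ = μHE[n] (Γ y ∩ (B \ O)) + ε := by rw [ENNReal.add_halves]
      _ ≤ _ := by gcongr; exact le_add_self
  · calc _ ≤ ε / 2 + (μHE[n] (Γ₀ ∩ (B \ O)) + ε / 2) := add_le_add iy hy.2
      _ = μHE[n] (Γ₀ ∩ (B \ O)) + (ε / 2 + ε / 2) := by ring
      _ = μHE[n] (Γ₀ ∩ (B \ O)) + ε := by rw [ENNReal.add_halves]
      _ ≤ _ := by gcongr; exact le_add_self

/-- If the total area converges, and the areas converge locally away from a negligible set, then the
areas converge in every set with negligible frontier. -/
theorem tendsto_area_of_total {l : Filter Y} {Γ : Y → Set M} {Γ₀ P : Set M} (hΓ₀ : μHE[n] Γ₀ < ⊤)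
    (hP : μHE[n] P = 0) (h : ∀ x ∈ Γ₀ \ P, AreaConv n l Γ Γ₀ x)
    (htot : Tendsto (fun y => μHE[n] (Γ y)) l (𝓝 (μHE[n] Γ₀))) {B : Set M} (hBm : MeasurableSet B)
    (hBf : μHE[n] (Γ₀ ∩ frontier B) = 0) : Tendsto (fun y => μHE[n] (Γ y ∩ B)) l (𝓝 (μHE[n] (Γ₀ ∩ B))) := by
  have lower : ∀ A : Set M, MeasurableSet A → μHE[n] (Γ₀ ∩ frontier A) = 0 →
      ∀ a < μHE[n] (Γ₀ ∩ A), ∀ᶠ y in l, a < μHE[n] (Γ y ∩ A) := by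
    intro A hAm hAf a ha
    have hsep : TopologicalSpace.IsSeparable (Γ₀ \ P) :=
      (isSeparable_of_hausdorffMeasure_lt_top hΓ₀.ne).mono sdiff_subset
    have h' : ∀ x : M, ∃ O, IsOpen O ∧ (x ∈ Γ₀ \ P → x ∈ O) ∧ μHE[n] (Γ₀ ∩ frontier O) = 0 ∧
        ∀ B ⊆ O, MeasurableSet B → μHE[n] (Γ₀ ∩ frontier B) = 0 →
          Tendsto (fun y => μHE[n] (Γ y ∩ B)) l (𝓝 (μHE[n] (Γ₀ ∩ B))) := fun x => by
      by_cases hx : x ∈ Γ₀ \ P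
      · obtain ⟨O, -, h1, h2, -, h3, h4⟩ := (h x hx).exists_open univ_mem
        exact ⟨O, h1, fun _ => h2, h3, h4⟩
      · exact ⟨∅, isOpen_empty, fun h => absurd h hx, by simp, fun B hB _ _ => by
          simp [subset_empty_iff.1 hB, tendsto_const_nhds]⟩
    choose O hO hxO hOf hconv using h'
    have hcov : ∃ t : Set M, t.Countable ∧ Γ₀ \ P ⊆ ⋃ x ∈ t, O x := by
      have := hsep.secondCountableTopology
      obtain ⟨t, ht, htu⟩ := TopologicalSpace.isOpen_iUnion_countable
        (fun x : M => ((↑) : ↥(Γ₀ \ P) → M) ⁻¹' O x) fun x => (hO x).preimage continuous_subtype_val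
      refine ⟨t, ht, fun x hx => ?_⟩
      have : (⟨x, hx⟩ : ↥(Γ₀ \ P)) ∈ ⋃ i ∈ t, ((↑) : ↥(Γ₀ \ P) → M) ⁻¹' O i := by
        rw [htu]; exact mem_iUnion.2 ⟨x, hxO x hx⟩
      simpa using this
    obtain ⟨t, ht, hcov⟩ := hcov
    have hmeas : μHE[n] (Γ₀ ∩ A) ≤ μHE[n] (Γ₀ ∩ A ∩ ⋃ x ∈ t, O x) := by
      calc μHE[n] (Γ₀ ∩ A) ≤ μHE[n] ((Γ₀ ∩ A ∩ ⋃ x ∈ t, O x) ∪ P) := measure_mono fun z hz => by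
            by_cases hzP : z ∈ P
            · exact Or.inr hzP
            · exact Or.inl ⟨hz, hcov ⟨hz.1, hzP⟩⟩
        _ ≤ _ := (measure_union_le _ _).trans_eq (by rw [hP, add_zero])
    have hex : ∃ s : Finset M, a < μHE[n] (Γ₀ ∩ (A ∩ ⋃ x ∈ s, O x)) := by
      rcases t.eq_empty_or_nonempty with rfl | hne
      · simp only [mem_empty_iff_false, iUnion_of_empty, iUnion_empty, inter_empty, measure_empty] at hmeas
        exact absurd (ha.trans_le hmeas) (by simp)
      obtain ⟨f, rfl⟩ := ht.exists_eq_range hne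
      rw [biUnion_range, inter_iUnion, measure_iUnion_eq_iSup_accumulate] at hmeas
      obtain ⟨i, hi⟩ := lt_iSup_iff.1 (ha.trans_le hmeas)
      classical
      refine ⟨(Finset.range (i + 1)).image f, hi.trans_le (measure_mono fun z hz => ?_)⟩
      obtain ⟨j, hj, hz1, hz2⟩ := mem_accumulate.1 hz
      refine ⟨hz1.1, hz1.2, mem_iUnion₂.2 ⟨f j, ?_, hz2⟩⟩
      exact Finset.mem_image_of_mem f (Finset.mem_range.2 (by omega))
    obtain ⟨s, hs⟩ := hex
    have hfr : ∀ s : Finset M, (μHE[n] : Measure M).restrict Γ₀ (frontier (⋃ x ∈ s, O x)) = 0 := by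
      classical
      intro s
      induction s using Finset.induction_on with
      | empty => simp
      | insert b s hb ih =>
        rw [Finset.set_biUnion_insert]
        exact null_frontier_union (by rw [restrict_frontier]; exact hOf b) ih
    have hc := tendsto_area_of_finite_cover s O hO hOf hconv (B := A ∩ ⋃ x ∈ s, O x)
      inter_subset_right (hAm.inter (isOpen_biUnion fun x _ => hO x).measurableSet) (by
        rw [← restrict_frontier] at hAf ⊢
        exact null_frontier_inter hAf (hfr s))
    filter_upwards [hc.eventually (lt_mem_nhds hs)] with y hy
    exact hy.trans_le (measure_mono (inter_subset_inter_right _ inter_subset_left))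
  refine tendsto_order.2 ⟨lower B hBm hBf, fun b hb => ?_⟩
  have hsplit : ∀ G : Set M, μHE[n] G = μHE[n] (G ∩ B) + μHE[n] (G ∩ Bᶜ) := fun G => by
    rw [← sdiff_eq, measure_inter_add_sdiff _ hBm]
  have hBc : μHE[n] (Γ₀ ∩ frontier Bᶜ) = 0 := by rwa [frontier_compl]
  have hfinc : μHE[n] (Γ₀ ∩ Bᶜ) ≠ ⊤ := ((measure_mono inter_subset_left).trans_lt hΓ₀).ne
  have hfinB : μHE[n] (Γ₀ ∩ B) ≠ ⊤ := ((measure_mono inter_subset_left).trans_lt hΓ₀).ne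
  obtain ⟨c, hc, hcb⟩ := exists_between hb
  obtain ⟨ε, hε, hεc⟩ : ∃ ε : ENNReal, 0 < ε ∧ μHE[n] (Γ₀ ∩ B) + (ε + ε) ≤ b := by
    refine ⟨(c - μHE[n] (Γ₀ ∩ B)) / 2, ENNReal.half_pos (tsub_pos_of_lt hc).ne', ?_⟩
    rw [ENNReal.add_halves, add_tsub_cancel_of_le hc.le]
    exact hcb.le
  have hev1 : ∀ᶠ y in l, μHE[n] (Γ₀ ∩ Bᶜ) ≤ μHE[n] (Γ y ∩ Bᶜ) + ε := by
    by_cases hle : μHE[n] (Γ₀ ∩ Bᶜ) ≤ ε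
    · exact Eventually.of_forall fun y => hle.trans le_add_self
    · have hpos : μHE[n] (Γ₀ ∩ Bᶜ) ≠ 0 := fun h0 => hle (by rw [h0]; exact zero_le)
      filter_upwards [lower Bᶜ hBm.compl hBc _ (ENNReal.sub_lt_self hfinc hpos hε.ne')] with y hy
      exact tsub_le_iff_right.1 hy.le
  have hev2 : ∀ᶠ y in l, μHE[n] (Γ y) < μHE[n] Γ₀ + ε :=
    htot.eventually (gt_mem_nhds (ENNReal.lt_add_right hΓ₀.ne hε.ne'))
  filter_upwards [hev1, hev2] with y h1 h2
  have hfy : μHE[n] (Γ y ∩ Bᶜ) ≠ ⊤ := ((measure_mono inter_subset_left).trans_lt (h2.trans_le le_top)).ne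
  refine lt_of_lt_of_le ?_ hεc
  rw [← ENNReal.add_lt_add_iff_right hfy, ← hsplit (Γ y)]
  calc μHE[n] (Γ y) < μHE[n] (Γ₀ ∩ B) + μHE[n] (Γ₀ ∩ Bᶜ) + ε := by rwa [← hsplit]
    _ ≤ μHE[n] (Γ₀ ∩ B) + (μHE[n] (Γ y ∩ Bᶜ) + ε) + ε := by gcongr
    _ = _ := by ring

end AreaConv

section GraphArea
variable {Y : Type*}

theorem lipschitzOnWith_joinGraph {γ : Hor n → ℝ} {L : NNReal} {A : Set (Hor n)}
    (h : LipschitzOnWith L γ A) : LipschitzOnWith (1 + L) (fun z => join z (γ z)) A := by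
  refine LipschitzOnWith.of_dist_le_mul fun z hz z' hz' => ?_
  have h1 := h.dist_le_mul z hz z' hz'
  rw [dist_eq_norm, dist_eq_norm] at *
  refine (norm_le_add _).trans ?_
  simp only [horiz_sub, horiz_join, vert_sub, vert_join]
  rw [Real.norm_eq_abs] at h1
  push_cast
  linarith

theorem area_graph_le {F : Amb n → M} {K : NNReal} {S : Set (Amb n)}
    (hK : LipschitzOnWith K F S) {γ : Hor n → ℝ} {L : NNReal} {A : Set (Hor n)}
    (h : LipschitzOnWith L γ A) (hS : ∀ z ∈ A, join z (γ z) ∈ S) :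
    μHE[n] (F '' ((fun z => join z (γ z)) '' A)) ≤ ((K * (1 + L) : NNReal) : ENNReal) ^ n * volume A := by
  rw [← EuclideanSpace.euclideanHausdorffMeasure_eq_volume, ← image_comp]
  exact area_image_le (hK.comp (lipschitzOnWith_joinGraph h) fun z hz => hS z hz) n

theorem tendsto_of_squeeze_param {f : Y → ENNReal} {l : Filter Y} {Lo Up : ℝ → ENNReal} {m : ENNReal}
    (hLo : Tendsto Lo (𝓝[>] 0) (𝓝 m)) (hUp : Tendsto Up (𝓝[>] 0) (𝓝 m))
    (h : ∀ᶠ δ in 𝓝[>] (0 : ℝ), ∀ᶠ y in l, Lo δ ≤ f y ∧ f y ≤ Up δ) : Tendsto f l (𝓝 m) := by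
  refine tendsto_order.2 ⟨fun a ha => ?_, fun a ha => ?_⟩
  · obtain ⟨δ, h1, h2⟩ := ((hLo.eventually (lt_mem_nhds ha)).and h).exists
    exact h2.mono fun y hy => h1.trans_le hy.1
  · obtain ⟨δ, h1, h2⟩ := ((hUp.eventually (gt_mem_nhds ha)).and h).exists
    exact h2.mono fun y hy => hy.2.trans_lt h1

/-- Graphical convergence implies convergence of areas. -/
theorem GraphConv.areaConv {l : Filter Y} {Γ : Y → Set M} {Γ₀ : Set M} {p : M}
    (h : GraphConv (n := n) l Γ Γ₀ p) : AreaConv n l Γ Γ₀ p := by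
  obtain ⟨e, he, r, hr, g, hp, hp0, hcyl, hΓ₀, hΓ, hunif⟩ := h
  have h0t : (0 : Amb n) ∈ e.target := hp0 ▸ e.map_source hp
  have hs0 : e.symm 0 = p := by rw [← hp0, e.left_inv hp]
  obtain ⟨R, hR, hRt, Λ, hΛ, hconj⟩ := exists_lipschitz_conj he h0t
  obtain ⟨K, R₁, hR₁, hR₁t, hK⟩ := exists_lipschitz_symm he h0t
  set R' := min (min R R₁) r / 2 with hR'
  have hR'pos : 0 < R' := by positivity
  have hle : 2 * R' = min (min R R₁) r := by rw [hR']; ring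
  have hRR : 2 * R' ≤ R := hle.trans_le ((min_le_left _ _).trans (min_le_left _ _))
  have hRR₁ : 2 * R' ≤ R₁ := hle.trans_le ((min_le_left _ _).trans (min_le_right _ _))
  have hRr : 2 * R' ≤ r := hle.trans_le (min_le_right _ _)
  obtain ⟨V, hV, hVs, hlip⟩ := hconj R' hR'pos (by linarith)
  rw [hs0] at hV
  obtain ⟨ρ₂, hρ₂, hball⟩ := EMetric.mem_nhds_iff.1 hV
  set ρ : ENNReal := ρ₂ / 2 with hρdef
  have hρ : 0 < ρ := ENNReal.half_pos hρ₂.ne'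
  have hball' : ∀ x ∈ eball p ρ, ∀ y, edist y x < ρ → y ∈ V := fun x hx y hy => by
    refine hball ?_
    calc edist y p ≤ edist y x + edist x p := edist_triangle _ _ _
      _ < ρ + ρ := ENNReal.add_lt_add hy hx
      _ = ρ₂ := ENNReal.add_halves _
  have hVcyl : ∀ x : Amb n, ‖x‖ < 2 * R' → x ∈ cyl n r := fun x hx =>
    ⟨(norm_horiz_le x).trans_lt (hx.trans_le hRr), (abs_vert_le x).trans_lt (hx.trans_le hRr)⟩
  have hVe : ∀ q ∈ V, q ∈ e.source ∧ ‖e q‖ < R' := fun q hq => ⟨(hVs hq).1, by simpa using (hVs hq).2⟩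
  have hfin : μHE[n] (Γ₀ ∩ V) < ⊤ := by
    have h1 : Γ₀ ∩ V ⊆ e.symm '' ((fun z => join z ((fun _ : Hor n => (0 : ℝ)) z)) '' ball 0 R') := by
      rintro q ⟨hq, hqV⟩
      obtain ⟨hqs, hqn⟩ := hVe q hqV
      have h2 := (hΓ₀ (e q) (hVcyl _ (by linarith))).1 (by rwa [e.left_inv hqs])
      refine ⟨e q, ⟨horiz (e q), ?_, ?_⟩, e.left_inv hqs⟩
      · simpa using (norm_horiz_le _).trans_lt hqn
      · simp only; rw [← h2, join_horiz_vert]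
    refine (measure_mono h1).trans_lt ((area_graph_le hK (L := 0) (LipschitzWith.const (0:ℝ)).lipschitzOnWith ?_).trans_lt ?_)
    · intro z hz
      have hz' : ‖z‖ < R' := by simpa using hz
      rw [mem_ball_zero_iff]
      refine (norm_le_add _).trans_lt ?_
      simp only [horiz_join, vert_join, abs_zero, add_zero]
      linarith
    · exact ENNReal.mul_lt_top (ENNReal.pow_lt_top ENNReal.coe_lt_top) measure_ball_lt_top
  -- comparison maps
  let F : ℝ → Y → M → M := fun σ y q => e.symm (e q + (σ * g y (horiz (e q))) • up n)
  have hsmall : ∀ δ > 0, ∀ᶠ y in l, ContDiffOn ℝ ∞ (g y) (ball 0 r) ∧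
      (∀ x ∈ cyl n r, e.symm x ∈ Γ y ↔ vert x = g y (horiz x)) ∧
      ∀ z ∈ ball (0 : Hor n) r, |g y z| ≤ δ ∧ ‖fderiv ℝ (g y) z‖ ≤ δ := by
    intro δ hδ
    filter_upwards [hΓ, tendstoUniformlyOn_iff.1 (hunif 0) δ hδ,
      tendstoUniformlyOn_iff.1 (hunif 1) δ hδ] with y h1 h2 h3
    refine ⟨h1.1, h1.2, fun z hz => ⟨?_, ?_⟩⟩
    · have := (h2 z hz).le
      rwa [dist_zero_left, norm_iteratedFDeriv_zero] at this
    · have := (h3 z hz).le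
      rwa [dist_zero_left, norm_iteratedFDeriv_one] at this
  have hF : ∀ δ, 0 < δ → δ ≤ 1 → δ < R' → ∀ᶠ y in l, (∀ x ∈ cyl n r, e.symm x ∈ Γ y ↔ vert x = g y (horiz x)) ∧
      (∀ z ∈ ball (0 : Hor n) r, |g y z| ≤ δ) ∧
      ∀ σ : ℝ, |σ| ≤ 1 → LipschitzOnWith (Real.toNNReal (1 + Λ * δ)) (F σ y) V ∧
        ∀ q ∈ V, edist (F σ y q) q ≤ ENNReal.ofReal (K * δ) := by
    intro δ hδ hδ1 hδR
    filter_upwards [hsmall δ hδ] with y hy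
    refine ⟨hy.2.1, fun z hz => (hy.2.2 z hz).1, fun σ hσ => ?_⟩
    have hin : ∀ x ∈ ball (0 : Amb n) R', horiz x ∈ ball (0 : Hor n) r := fun x hx => by
      have : ‖x‖ < R' := by simpa using hx
      rw [mem_ball_zero_iff]
      exact (norm_horiz_le x).trans_lt (by linarith)
    have hgs : ∀ x ∈ ball (0 : Amb n) R', ‖(σ * g y (horiz x)) • up n‖ ≤ δ := fun x hx => by
      rw [norm_smul, norm_up, mul_one, Real.norm_eq_abs, abs_mul]
      calc |σ| * |g y (horiz x)| ≤ 1 * δ := by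
            gcongr; exact (hy.2.2 _ (hin x hx)).1
        _ = δ := one_mul _
    constructor
    · have := hlip (fun x => x + (σ * g y (horiz x)) • up n) 1 δ one_pos le_rfl hδ.le hδ1 ?_ ?_ ?_ ?_
      · simpa using this
      · refine contDiffOn_id.add ((ContinuousLinearMap.toSpanSingleton ℝ (up n)).contDiff.comp_contDiffOn
          (f := fun x => σ * g y (horiz x)) (contDiffOn_const.mul ?_))
        exact (hy.1.of_le (by simp)).comp (contDiff_horiz.of_le (by simp)).contDiffOn hin
      · intro x hx
        have hx' : ‖x‖ < R' := by simpa using hx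
        rw [mem_ball_zero_iff]
        exact (norm_add_le _ _).trans_lt (by linarith [hgs x hx])
      · intro x hx
        simpa using hgs x hx
      · intro x hx w
        have hd : HasFDerivAt (g y) (fderiv ℝ (g y) (horiz x)) (horiz x) :=
          ((hy.1.contDiffAt (isOpen_ball.mem_nhds (hin x hx))).differentiableAt (by simp)).hasFDerivAt
        have hd1 := (hasFDerivAt_id x).add (((hd.comp x (horizL n).hasFDerivAt).const_mul σ).smul_const (up n))
        have hd2 : fderiv ℝ (fun x => x + (σ * g y (horiz x)) • up n) x = _ := hd1.fderiv
        rw [hd2]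
        simp only [add_apply, ContinuousLinearMap.id_apply, ContinuousLinearMap.smulRight_apply,
          smul_apply, ContinuousLinearMap.comp_apply, horizL_apply, one_smul, add_sub_cancel_left, one_mul]
        rw [norm_smul, norm_up, mul_one, smul_eq_mul, norm_mul]
        calc ‖σ‖ * ‖fderiv ℝ (g y) (horiz x) (horiz w)‖ ≤ 1 * (δ * ‖w‖) := by
              gcongr
              · exact hσ
              · refine (ContinuousLinearMap.le_opNorm _ _).trans ?_
                gcongr
                · exact (hy.2.2 _ (hin x hx)).2
                · exact norm_horiz_le w
          _ = _ := one_mul _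
    · intro q hq
      obtain ⟨hqs, hqn⟩ := hVe q hq
      have hq1 : e q ∈ ball (0 : Amb n) R' := by simpa using hqn
      have hin1 : e q + (σ * g y (horiz (e q))) • up n ∈ ball (0 : Amb n) R₁ := by
        rw [mem_ball_zero_iff]
        exact (norm_add_le _ _).trans_lt (by linarith [hgs _ hq1])
      have hin2 : e q ∈ ball (0 : Amb n) R₁ := ball_subset_ball (by linarith) hq1
      have := hK hin1 hin2
      rw [e.left_inv hqs] at this
      refine this.trans ?_
      rw [edist_eq_enorm_sub, add_sub_cancel_left, ENNReal.ofReal_mul (NNReal.coe_nonneg K), ← ofReal_norm]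
      exact mul_le_mul' (by simp) (ENNReal.ofReal_le_ofReal (hgs _ hq1))
  unfold AreaConv
  refine ⟨V ∩ eball p ρ, inter_mem hV (eball_mem_nhds _ hρ),
    (measure_mono (inter_subset_inter_right _ inter_subset_left)).trans_lt hfin, fun B hB hBm hBf => ?_⟩
  set ν := (μHE[n] : Measure M).restrict (Γ₀ ∩ V) with hν
  have hνfin : IsFiniteMeasure ν := ⟨by simpa [hν] using hfin⟩
  have hνB : ν B = μHE[n] (Γ₀ ∩ B) := by
    rw [hν, Measure.restrict_apply hBm, ← inter_assoc, inter_comm B, inter_assoc,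
      inter_eq_self_of_subset_left (hB.trans inter_subset_left)]
  have hνf : ν (frontier B) = 0 := by
    rw [hν, restrict_frontier]
    exact measure_mono_null (inter_subset_inter_left _ inter_subset_left) hBf
  have hνcl : ν (closure B) = ν B := by
    refine le_antisymm ?_ (measure_mono subset_closure)
    rw [closure_eq_self_union_frontier]
    exact (measure_union_le _ _).trans_eq (by rw [hνf, add_zero])
  have hνcl' : ν (closure Bᶜ) = ν Bᶜ := by
    refine le_antisymm ?_ (measure_mono subset_closure)
    rw [closure_eq_self_union_frontier, frontier_compl]
    exact (measure_union_le _ _).trans_eq (by rw [hνf, add_zero])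
  have hKδ : Tendsto (fun δ : ℝ => (K : ℝ) * δ) (𝓝[>] 0) (𝓝 0) := by
    have : Tendsto (fun δ : ℝ => (K : ℝ) * δ) (𝓝 0) (𝓝 (K * 0)) := tendsto_id.const_mul _
    rw [mul_zero] at this
    exact this.mono_left nhdsWithin_le_nhds
  have hT1 : Tendsto (fun δ : ℝ => ν (cthickening (K * δ) B)) (𝓝[>] 0) (𝓝 (ν B)) := by
    rw [← hνcl]
    exact (tendsto_measure_cthickening ⟨1, one_pos, measure_ne_top _ _⟩).comp hKδ
  have hT2 : Tendsto (fun δ : ℝ => ν (cthickening (K * δ) Bᶜ)ᶜ) (𝓝[>] 0) (𝓝 (ν B)) := by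
    have h1 : Tendsto (fun δ : ℝ => ν (cthickening (K * δ) Bᶜ)) (𝓝[>] 0) (𝓝 (ν Bᶜ)) := by
      rw [← hνcl']
      exact (tendsto_measure_cthickening ⟨1, one_pos, measure_ne_top _ _⟩).comp hKδ
    have h2 : ν B = ν univ - ν Bᶜ := by
      rw [← measure_compl hBm.compl (measure_ne_top _ _), compl_compl]
    have h3 : ∀ δ : ℝ, ν (cthickening (K * δ) Bᶜ)ᶜ = ν univ - ν (cthickening (K * δ) Bᶜ) :=
      fun δ => measure_compl isClosed_cthickening.measurableSet (measure_ne_top _ _)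
    simp_rw [h3]
    rw [h2]
    exact ENNReal.Tendsto.sub tendsto_const_nhds h1 (Or.inl (measure_ne_top _ _))
  have hT3 : Tendsto (fun δ : ℝ => ((Real.toNNReal (1 + Λ * δ) : NNReal) : ENNReal) ^ n) (𝓝[>] 0) (𝓝 1) := by
    have h1 : Continuous fun δ : ℝ => ((Real.toNNReal (1 + Λ * δ) : NNReal) : ENNReal) ^ n :=
      (ENNReal.continuous_pow n).comp (ENNReal.continuous_coe.comp
        (continuous_real_toNNReal.comp (by fun_prop)))
    have h2 := h1.tendsto 0
    simp only [mul_zero, add_zero, Real.toNNReal_one, ENNReal.coe_one, one_pow] at h2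
    exact h2.mono_left nhdsWithin_le_nhds
  have hlim1 : Tendsto (fun δ : ℝ => ((Real.toNNReal (1 + Λ * δ) : NNReal) : ENNReal) ^ n *
      ν (cthickening (K * δ) B)) (𝓝[>] 0) (𝓝 (ν B)) := by
    have := ENNReal.Tendsto.mul hT3 (Or.inl one_ne_zero) hT1 (Or.inr ENNReal.one_ne_top)
    rwa [one_mul] at this
  have hlim2 : Tendsto (fun δ : ℝ => (((Real.toNNReal (1 + Λ * δ) : NNReal) : ENNReal) ^ n)⁻¹ *
      ν (cthickening (K * δ) Bᶜ)ᶜ) (𝓝[>] 0) (𝓝 (ν B)) := by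
    have h1 : Tendsto (fun δ : ℝ => (((Real.toNNReal (1 + Λ * δ) : NNReal) : ENNReal) ^ n)⁻¹) (𝓝[>] 0) (𝓝 1) := by
      have := (tendsto_inv_iff.2 hT3)
      rwa [inv_one] at this
    have := ENNReal.Tendsto.mul h1 (Or.inl one_ne_zero) hT2 (Or.inr ENNReal.one_ne_top)
    rwa [one_mul] at this
  rw [← hνB]
  refine tendsto_of_squeeze_param hlim2 hlim1 ?_
  have hρδ : ∀ᶠ δ in 𝓝[>] (0 : ℝ), ENNReal.ofReal (K * δ) < ρ := by
    have h1 := (ENNReal.continuous_ofReal.tendsto 0).comp hKδ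
    rw [ENNReal.ofReal_zero] at h1
    exact h1.eventually (gt_mem_nhds hρ)
  filter_upwards [hρδ, self_mem_nhdsWithin, Ioo_mem_nhdsGT (lt_min one_pos hR'pos)] with δ hδρ hδ0 hδ1
  have hδ0' : (0 : ℝ) < δ := hδ0
  filter_upwards [hF δ hδ0' (hδ1.2.le.trans (min_le_left _ _)) (hδ1.2.trans_le (min_le_right _ _))]
    with y ⟨hy1, hy2, hy3⟩
  obtain ⟨hLp, hdp⟩ := hy3 1 (by simp)
  obtain ⟨hLm, hdm⟩ := hy3 (-1) (by simp)
  have hvadd : ∀ (x : Amb n) (c : ℝ), horiz (x + c • up n) = horiz x ∧ vert (x + c • up n) = vert x + c := by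
    intro x c; simp [up]
  have hshift : ∀ q ∈ V, ∀ σ : ℝ, |σ| ≤ 1 → q ∈ e.source ∧ e q ∈ cyl n r ∧
      e q + (σ * g y (horiz (e q))) • up n ∈ cyl n r := by
    intro q hq σ hσ
    obtain ⟨hqs, hqn⟩ := hVe q hq
    have h1 : e q ∈ cyl n r := hVcyl _ (by linarith)
    refine ⟨hqs, h1, hVcyl _ ((norm_add_le _ _).trans_lt ?_)⟩
    have h2 : ‖(σ * g y (horiz (e q))) • up n‖ ≤ δ := by
      rw [norm_smul, norm_up, mul_one, Real.norm_eq_abs, abs_mul]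
      calc |σ| * |g y (horiz (e q))| ≤ 1 * δ := by
            gcongr; exact hy2 _ (by simpa using h1.1)
        _ = δ := one_mul _
    have := hδ1.2.trans_le (min_le_right _ _)
    linarith
  constructor
  · -- lower bound
    have hsub : Γ₀ ∩ V ∩ (cthickening (K * δ) Bᶜ)ᶜ ⊆ F (-1) y '' (Γ y ∩ B) := by
      rintro q ⟨⟨hq0, hqV⟩, hqc⟩
      obtain ⟨hqs, hqcyl, hqcyl'⟩ := hshift q hqV 1 (by simp)
      have hv0 := (hΓ₀ _ hqcyl).1 (by rwa [e.left_inv hqs])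
      have hqB : F 1 y q ∈ B := by
        by_contra hcon
        refine hqc ?_
        rw [mem_cthickening_iff]
        refine (infEDist_le_edist_of_mem (show F 1 y q ∈ Bᶜ from hcon)).trans ?_
        rw [edist_comm]; exact hdp q hqV
      refine ⟨F 1 y q, ⟨(hy1 _ hqcyl').2 ?_, hqB⟩, ?_⟩
      · rw [(hvadd _ _).1, (hvadd _ _).2, hv0]; ring
      · change e.symm (e (e.symm _) + _ • up n) = q
        rw [e.right_inv (hcyl hqcyl'), (hvadd _ _).1, add_assoc, ← add_smul]
        simp [e.left_inv hqs]
    have h1 : ν (cthickening (K * δ) Bᶜ)ᶜ ≤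
        ((Real.toNNReal (1 + Λ * δ) : NNReal) : ENNReal) ^ n * μHE[n] (Γ y ∩ B) := by
      rw [hν, Measure.restrict_apply isClosed_cthickening.measurableSet.compl, inter_comm]
      refine (measure_mono hsub).trans (area_image_le (hLm.mono ?_) n)
      exact inter_subset_right.trans (hB.trans inter_subset_left)
    have hpos : ((Real.toNNReal (1 + Λ * δ) : NNReal) : ENNReal) ^ n ≠ 0 := by
      refine pow_ne_zero _ ?_
      have : (0 : ℝ) < 1 + Λ * δ := by positivity
      simpa using this
    rw [mul_comm, ← div_eq_mul_inv]
    exact ENNReal.div_le_of_le_mul' h1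
  · have hsub : Γ y ∩ B ⊆ F 1 y '' (Γ₀ ∩ V ∩ cthickening (K * δ) B) := by
      rintro q ⟨hqy, hqB⟩
      have hqV : q ∈ V := (hB hqB).1
      obtain ⟨hqs, hqcyl, hqcyl'⟩ := hshift q hqV (-1) (by simp)
      have hvy := (hy1 _ hqcyl).1 (by rwa [e.left_inv hqs])
      refine ⟨F (-1) y q, ⟨⟨(hΓ₀ _ hqcyl').2 ?_, ?_⟩, ?_⟩, ?_⟩
      · rw [(hvadd _ _).2, hvy]; ring
      · exact hball' q (hB hqB).2 _ ((hdm q hqV).trans_lt hδρ)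
      · rw [mem_cthickening_iff]
        exact (infEDist_le_edist_of_mem hqB).trans (hdm q hqV)
      · change e.symm (e (e.symm _) + _ • up n) = q
        rw [e.right_inv (hcyl hqcyl'), (hvadd _ _).1, add_assoc, ← add_smul]
        simp [e.left_inv hqs]
    refine (measure_mono hsub).trans ((area_image_le
      (hLp.mono (inter_subset_left.trans inter_subset_right)) n).trans ?_)
    refine mul_le_mul' le_rfl ?_
    rw [hν, Measure.restrict_apply isClosed_cthickening.measurableSet, inter_comm]

end GraphArea

section CvSup

variable {Y : Type*} {X F : Type} [NormedAddCommGroup X] [NormedSpace ℝ X] [NormedAddCommGroup F]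
  [NormedSpace ℝ F]

theorem CvK.sup {l l' : Filter Y} {x₀ : X} {k : ℕ} {u : Y → X → F} {u₀ : X → F}
    (h : CvK l x₀ k F u u₀) (h' : CvK l' x₀ k F u u₀) : CvK (l ⊔ l') x₀ k F u u₀ := by
  induction k generalizing F with
  | zero =>
    change Tendsto _ ((l ⊔ l') ×ˢ 𝓝 x₀) _
    rw [sup_prod]
    exact Tendsto.sup h h'
  | succ k ih =>
    refine ⟨?_, ih h.2 h'.2⟩
    rw [sup_prod]
    exact Tendsto.sup h.1 h'.1

theorem Cv.sup {l l' : Filter Y} {x₀ : X} {u : Y → X → F} {u₀ : X → F} (h : Cv l u u₀ x₀)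
    (h' : Cv l' u u₀ x₀) : Cv (l ⊔ l') u u₀ x₀ := by
  refine ⟨⟨?_, h.smooth.right⟩, fun k => (h.conv k).sup (h'.conv k)⟩
  rw [sup_prod]
  exact eventually_sup.2 ⟨h.smooth.left, h'.smooth.left⟩

/-- Bounded multiples of maps which converge smoothly to zero converge smoothly to zero. -/
theorem CvK.bounded_smul {l : Filter Y} {x₀ : X} {k : ℕ} {u : Y → X → F} {c : Y → ℝ} {C : ℝ}
    (hc : ∀ᶠ y in l, |c y| ≤ C) (hs : SmoothNear l u (fun _ => 0) x₀)
    (h : CvK l x₀ k F u (fun _ => 0)) : CvK l x₀ k F (fun y x => c y • u y x) (fun _ => 0) := by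
  have h0 : ∀ {F : Type} [NormedAddCommGroup F] [NormedSpace ℝ F] {u : Y → X → F},
      Tendsto (fun p : Y × X => u p.1 p.2) (l ×ˢ 𝓝 x₀) (𝓝 0) →
      Tendsto (fun p : Y × X => c p.1 • u p.1 p.2) (l ×ˢ 𝓝 x₀) (𝓝 0) := by
    intro F _ _ u hu
    have h1 : Tendsto (fun p : Y × X => C * ‖u p.1 p.2‖) (l ×ˢ 𝓝 x₀) (𝓝 0) := by
      simpa using hu.norm.const_mul C
    refine squeeze_zero_norm' ?_ h1
    filter_upwards [hc.prod_inl (𝓝 x₀)] with p hp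
    rw [norm_smul]
    gcongr
    exact hp
  induction k generalizing F with
  | zero => exact h0 h
  | succ k ih =>
    have hz : fderiv ℝ (fun _ : X => (0 : F)) = fun _ => 0 := by ext; simp
    have h2 := h.2
    rw [hz] at h2
    have hs' := hs.fderiv
    rw [hz] at hs'
    refine ⟨h0 h.1, ?_⟩
    rw [hz]
    refine (ih hs' h2).congr ?_ (Eventually.of_forall fun _ => rfl)
    filter_upwards [hs.left] with p hp
    exact (fderiv_fun_const_smul (hp.differentiableAt (by simp)) _).symm

theorem Cv.bounded_smul {l : Filter Y} {x₀ : X} {u : Y → X → F} {c : Y → ℝ} {C : ℝ}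
    (hc : ∀ᶠ y in l, |c y| ≤ C) (h : Cv l u (fun _ => 0) x₀) : Cv l (fun y x => c y • u y x) (fun _ => 0) x₀ := by
  refine ⟨⟨h.smooth.left.mono fun p hp => hp.const_smul _, h.smooth.right⟩,
    fun k => (h.conv k).bounded_smul hc h.smooth⟩

end CvSup

section LocalConvergence

variable {Y Y' : Type*}

theorem GraphConv.sup {l l' : Filter Y} {Γ : Y → Set M} {Γ₀ : Set M}
    {p : M} (h : GraphConv (n := n) l Γ Γ₀ p) (h' : GraphConv (n := n) l' Γ Γ₀ p) :
    GraphConv (n := n) (l ⊔ l') Γ Γ₀ p := by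
  obtain ⟨e, he, r, hr, g₁, hp, hp0, hcyl, hΓ₀, hΓ, hunif⟩ := h
  have hflat : ∀ᶠ x in 𝓝 (e p), e.symm x ∈ Γ₀ ↔ vert x = (fun _ : Hor n => (0 : ℝ)) (horiz x) := by
    rw [hp0]
    refine mem_of_superset ?_ hΓ₀
    rw [cyl_eq_box]
    exact (isOpen_box _ _ _).mem_nhds (mem_box_self hr hr)
  obtain ⟨R, hR, hmain⟩ := h'.graph he hp (g₀ := fun _ => 0) contDiffAt_const hflat univ_mem
  set ρ := min R r with hρ
  have hρ0 : 0 < ρ := lt_min hR hr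
  obtain ⟨δ₀, hδ₀, hmain⟩ := hmain ρ hρ0 (min_le_left _ _)
  set δ := min δ₀ r with hδ
  have hδ0 : 0 < δ := lt_min hδ₀ hr
  obtain ⟨-, g₂, h1, -, h3, -, h5⟩ := hmain δ hδ0 (min_le_left _ _)
  rw [hp0] at h1 h3 h5
  have hbox : box (0 : Amb n) δ ρ ⊆ cyl n r := by
    rw [cyl_eq_box]; exact box_mono (min_le_right _ _) (min_le_right _ _)
  have hball : ball (0 : Hor n) δ ⊆ ball 0 r := ball_subset_ball (min_le_right _ _)
  have hcv1 : ∀ z ∈ ball (0 : Hor n) δ, Cv l g₁ (fun _ => 0) z := fun z hz =>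
    cv_zero_of_tendstoUniformlyOn isOpen_ball (hΓ.mono fun y hy => hy.1) hunif (hball hz)
  classical
  set E : Y → Prop := fun y => ∀ x ∈ box (0 : Amb n) δ ρ, e.symm x ∈ Γ y ↔ vert x = g₁ y (horiz x)
    with hE
  set g : Y → Hor n → ℝ := fun y => if E y then g₁ y else g₂ y with hg
  have hEl : ∀ᶠ y in l, E y := hΓ.mono fun y hy x hx => hy.2 x (hbox hx)
  have hgl : ∀ᶠ y in l, g y = g₁ y := hEl.mono fun y hy => if_pos hy
  simp only [horiz_zero, vert_zero, sub_zero] at h1 h3 h5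
  have hgl' : ∀ᶠ y in l', ∀ z ∈ ball (0 : Hor n) δ, g y z = g₂ y z := by
    filter_upwards [h1, h3] with y hy1 hy3 z hz
    by_cases hEy : E y
    · have hx : join z (g₂ y z) ∈ box (0 : Amb n) δ ρ := by
        refine ⟨by simpa using hz, by simpa using hy3 z hz⟩
      have := (hEy _ hx).1 ((hy1 _ hx).2 (by simp))
      simp only [vert_join, horiz_join] at this
      simp only [hg, if_pos hEy, this]
    · simp only [hg, if_neg hEy]
  have key := graphConv_of_graph (l := l ⊔ l') (Γ := Γ) (Γ₀ := Γ₀) he (x₀ := 0)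
    (hcyl (by simp [cyl, hr])) hδ0 hρ0 (g := g) (g₀ := fun _ => 0) ?_ ?_ ?_ contDiffOn_const ?_
  · rwa [← hp0, e.left_inv hp] at key
  · refine eventually_sup.2 ⟨?_, ?_⟩
    · filter_upwards [hEl, hgl] with y hy hy'
      rw [hy']; exact hy
    · filter_upwards [h1, hgl'] with y hy hy' x hx
      rw [hy' _ (by simpa using hx.1)]; exact hy x hx
  · exact fun x hx => hΓ₀ x (hbox hx)
  · simp
  · intro z hz
    rw [horiz_zero] at hz
    refine Cv.sup ?_ ?_
    · refine (hcv1 z hz).congr ?_ (Eventually.of_forall fun _ => rfl)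
      filter_upwards [hgl.prod_inl (𝓝 z)] with q hq
      rw [hq]
    · refine (h5 z hz).congr ?_ (Eventually.of_forall fun _ => rfl)
      filter_upwards [hgl'.prod_mk (isOpen_ball.mem_nhds hz)] with q hq
      rw [hq.1 _ hq.2]

/-- Convergence of a family of surfaces `G y`, together with open sets `Θ y`, near the point `x`:
smoothly at the points of the limit surface which do not belong to the exceptional set `Q₀`, and
without concentration of area at the points of `Q₀`. -/
structure LocConv (n : ℕ) [ChartedSpace (Amb n) M] (l : Filter Y)
    (G Θ : Y → Set M) (G₀ Θ₀ Q₀ : Set M) (x : M) : Prop where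
  lower : x ∈ G₀ → ∀ V ∈ 𝓝 x, ∀ᶠ y in l, (G y ∩ V).Nonempty
  off : x ∉ G₀ → ∃ V ∈ 𝓝 x, ∀ᶠ y in l, ∀ z ∈ V, z ∉ G y ∧ (z ∈ Θ y ↔ z ∈ Θ₀)
  smooth : x ∈ G₀ → x ∉ Q₀ → GraphConv (n := n) l G G₀ x
  small : x ∈ G₀ → x ∈ Q₀ → ∀ ε > 0, ∃ V ∈ 𝓝 x, μHE[n] (G₀ ∩ V) ≤ ε ∧ ∀ᶠ y in l, μHE[n] (G y ∩ V) ≤ ε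

variable {l l' : Filter Y} {G Θ G' Θ' : Y → Set M} {G₀ Θ₀ Q₀ G₀' Θ₀' Q₀' : Set M} {x : M}

theorem LocConv.comp_param {l' : Filter Y'} {φ : Y' → Y} (h : LocConv n l G Θ G₀ Θ₀ Q₀ x)
    (hφ : Tendsto φ l' l) : LocConv n l' (fun y => G (φ y)) (fun y => Θ (φ y)) G₀ Θ₀ Q₀ x where
  lower hx V hV := hφ.eventually (h.lower hx V hV)
  off hx := by
    obtain ⟨V, hV, hy⟩ := h.off hx
    exact ⟨V, hV, hφ.eventually hy⟩
  smooth hx hq := (h.smooth hx hq).comp_param hφ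
  small hx hq ε hε := by
    obtain ⟨V, hV, h0, hy⟩ := h.small hx hq ε hε
    exact ⟨V, hV, h0, hφ.eventually hy⟩

theorem LocConv.mono (h : LocConv n l G Θ G₀ Θ₀ Q₀ x) (hl : l' ≤ l) :
    LocConv n l' G Θ G₀ Θ₀ Q₀ x := h.comp_param (φ := id) hl

theorem LocConv.congr (h : LocConv n l G Θ G₀ Θ₀ Q₀ x) {V : Set M} (hV : V ∈ 𝓝 x)
    (h₀ : ∀ z ∈ V, (z ∈ G₀ ↔ z ∈ G₀') ∧ (z ∈ Θ₀ ↔ z ∈ Θ₀')) (hQ : x ∈ Q₀ ↔ x ∈ Q₀')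
    (hy : ∀ᶠ y in l, ∀ z ∈ V, (z ∈ G y ↔ z ∈ G' y) ∧ (z ∈ Θ y ↔ z ∈ Θ' y)) : LocConv n l G' Θ' G₀' Θ₀' Q₀' x where
  lower hx W hW := by
    filter_upwards [h.lower ((h₀ x (mem_of_mem_nhds hV)).1.2 hx) _ (inter_mem hV hW), hy]
      with y ⟨z, hz1, hz2⟩ hy'
    exact ⟨z, (hy' z hz2.1).1.1 hz1, hz2.2⟩
  off hx := by
    obtain ⟨W, hW, h1⟩ := h.off (fun hx' => hx ((h₀ x (mem_of_mem_nhds hV)).1.1 hx'))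
    refine ⟨W ∩ V, inter_mem hW hV, ?_⟩
    filter_upwards [h1, hy] with y h2 h3 z hz
    rw [← (h3 z hz.2).1, ← (h3 z hz.2).2, ← (h₀ z hz.2).2]
    exact h2 z hz.1
  smooth hx hq := (h.smooth ((h₀ x (mem_of_mem_nhds hV)).1.2 hx) (fun h => hq (hQ.1 h))).congr hV
    (fun z hz => (h₀ z hz).1) (hy.mono fun y h z hz => (h z hz).1)
  small hx hq ε hε := by
    obtain ⟨W, hW, h0, h1⟩ := h.small ((h₀ x (mem_of_mem_nhds hV)).1.2 hx) (hQ.2 hq) ε hε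
    refine ⟨W ∩ V, inter_mem hW hV, (measure_mono ?_).trans h0, ?_⟩
    · exact fun z hz => ⟨(h₀ z hz.2.2).1.2 hz.1, hz.2.1⟩
    · filter_upwards [h1, hy] with y h2 h3
      refine (measure_mono ?_).trans h2
      exact fun z hz => ⟨(h3 z hz.2.2).1.2 hz.1, hz.2.1⟩

theorem LocConv.sup (h : LocConv n l G Θ G₀ Θ₀ Q₀ x)
    (h' : LocConv n l' G Θ G₀ Θ₀ Q₀ x) : LocConv n (l ⊔ l') G Θ G₀ Θ₀ Q₀ x where
  lower hx V hV := eventually_sup.2 ⟨h.lower hx V hV, h'.lower hx V hV⟩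
  off hx := by
    obtain ⟨V, hV, h1⟩ := h.off hx
    obtain ⟨V', hV', h2⟩ := h'.off hx
    exact ⟨V ∩ V', inter_mem hV hV', eventually_sup.2 ⟨h1.mono fun y hy z hz => hy z hz.1,
      h2.mono fun y hy z hz => hy z hz.2⟩⟩
  smooth hx hq := (h.smooth hx hq).sup (h'.smooth hx hq)
  small hx hq ε hε := by
    obtain ⟨V, hV, h0, h1⟩ := h.small hx hq ε hε
    obtain ⟨V', hV', -, h2⟩ := h'.small hx hq ε hε
    exact ⟨V ∩ V', inter_mem hV hV', (measure_mono (by gcongr; exact inter_subset_left)).trans h0,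
      eventually_sup.2 ⟨h1.mono fun y hy => (measure_mono (by gcongr; exact inter_subset_left)).trans hy,
      h2.mono fun y hy => (measure_mono (by gcongr; exact inter_subset_right)).trans hy⟩⟩

/-- `G₀` is, near `x` and up to points of `Q₀`, the boundary of the open set `Θ₀`. -/
structure BdAt (G₀ Θ₀ Q₀ : Set M) (x : M) : Prop where
  mem_nhds : x ∈ Θ₀ → Θ₀ ∈ 𝓝 x
  frontier_subset : x ∈ frontier Θ₀ → x ∈ G₀
  subset_frontier : x ∈ G₀ → x ∉ Q₀ → x ∈ frontier Θ₀

theorem mem_frontier_congr {A B V : Set M} (hV : V ∈ 𝓝 x) (h : ∀ z ∈ V, z ∈ A ↔ z ∈ B) :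
    x ∈ frontier A ↔ x ∈ frontier B := by
  have h1 : ∀ᶠ z in 𝓝 x, z ∈ A ↔ z ∈ B := mem_of_superset hV h
  rw [frontier_eq_closure_inter_closure, frontier_eq_closure_inter_closure]
  simp only [mem_inter_iff, mem_closure_iff_frequently, mem_compl_iff]
  rw [frequently_congr h1, frequently_congr (h1.mono fun z hz => not_congr hz)]

theorem BdAt.congr (h : BdAt G₀ Θ₀ Q₀ x) {V : Set M} (hV : V ∈ 𝓝 x)
    (h₀ : ∀ z ∈ V, (z ∈ G₀ ↔ z ∈ G₀') ∧ (z ∈ Θ₀ ↔ z ∈ Θ₀')) (hQ : x ∈ Q₀ → x ∈ Q₀') : BdAt G₀' Θ₀' Q₀' x := by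
  have hx := h₀ x (mem_of_mem_nhds hV)
  have hf := mem_frontier_congr hV fun z hz => (h₀ z hz).2
  refine ⟨fun h1 => ?_, fun h1 => hx.1.1 (h.frontier_subset (hf.2 h1)), fun h1 h2 =>
    hf.1 (h.subset_frontier (hx.1.2 h1) fun h3 => h2 (hQ h3))⟩
  filter_upwards [h.mem_nhds (hx.2.2 h1), hV] with z hz1 hz2
  exact (h₀ z hz2).2.1 hz1

theorem AreaConv.of_locConv (hG₀ : IsClosed G₀) (hQ : Q₀.Finite)
    (h : ∀ᶠ z in 𝓝 x, LocConv n l G Θ G₀ Θ₀ Q₀ z) : AreaConv n l G G₀ x := by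
  have hreg : ∀ z, LocConv n l G Θ G₀ Θ₀ Q₀ z → (z ∈ G₀ → z ∉ Q₀) → AreaConv n l G G₀ z := by
    intro z hz hzQ
    by_cases hzG : z ∈ G₀
    · exact (hz.smooth hzG (hzQ hzG)).areaConv
    · obtain ⟨V, hV, hy⟩ := hz.off hzG
      refine AreaConv.of_disjoint (V := V ∩ G₀ᶜ) (inter_mem hV (hG₀.isOpen_compl.mem_nhds hzG)) ?_ ?_
      · exact disjoint_left.2 fun w hw hw' => hw.2 hw'
      · exact hy.mono fun y h1 => disjoint_left.2 fun w hw hw' => (h1 w hw.1).1 hw'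
  by_cases hx : x ∈ G₀ ∧ x ∈ Q₀
  · obtain ⟨V, hV, hV0, -⟩ := h.self_of_nhds.small hx.1 hx.2 1 one_pos
    have hQx : (Q₀ \ {x})ᶜ ∈ 𝓝 x :=
      (hQ.subset sdiff_subset).isClosed.isOpen_compl.mem_nhds (by simp)
    have := ChartedSpace.locallyCompactSpace (Amb n) M
    obtain ⟨K, hK, hKs, hKc⟩ := local_compact_nhds (inter_mem (inter_mem hV hQx) h)
    refine AreaConv.of_punctured hK hKc (((measure_mono (inter_subset_inter_right _
      fun z hz => (hKs hz).1.1)).trans hV0).trans_lt ENNReal.one_lt_top) ?_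
      (h.self_of_nhds.small hx.1 hx.2)
    intro z hz hzx
    exact hreg z (hKs hz).2 fun _ hzQ => (hKs hz).1.2 ⟨hzQ, hzx⟩
  · exact hreg x h.self_of_nhds fun h1 h2 => hx ⟨h1, h2⟩

end LocalConvergence

section Families

variable {Y Y' : Type*} [TopologicalSpace Y] [TopologicalSpace Y'] {D : Set Y} {G Θ Q : Y → Set M}

/-- A continuous family of surfaces `G y` which are, up to finite sets `Q y`, the boundaries of the
open sets `Θ y`. -/
structure ContFamily (n : ℕ) [ChartedSpace (Amb n) M] (D : Set Y)
    (G Θ Q : Y → Set M) : Prop where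
  finite : ∀ y ∈ D, (Q y).Finite
  bd : ∀ y ∈ D, ∀ x, BdAt (G y) (Θ y) (Q y) x
  conv : ∀ y ∈ D, ∀ x, LocConv n (𝓝[D] y) G Θ (G y) (Θ y) (Q y) x

theorem ContFamily.isClosed (h : ContFamily n D G Θ Q) {y : Y} (hy : y ∈ D) : IsClosed (G y) := by
  rw [← isOpen_compl_iff, isOpen_iff_mem_nhds]
  intro x hx
  obtain ⟨V, hV, h1⟩ := (h.conv y hy x).off hx
  exact mem_of_superset hV fun z hz => (h1.self_of_nhdsWithin hy z hz).1

theorem ContFamily.isOpen (h : ContFamily n D G Θ Q) {y : Y} (hy : y ∈ D) : IsOpen (Θ y) :=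
  isOpen_iff_mem_nhds.2 fun x hx => (h.bd y hy x).mem_nhds hx

theorem ContFamily.comp (h : ContFamily n D G Θ Q) {D' : Set Y'} {φ : Y' → Y}
    (hφ : ContinuousOn φ D') (hD : MapsTo φ D' D) :
    ContFamily n D' (fun y => G (φ y)) (fun y => Θ (φ y)) (fun y => Q (φ y)) where
  finite _ hy := h.finite _ (hD hy)
  bd _ hy := h.bd _ (hD hy)
  conv y hy x := (h.conv _ (hD hy) x).comp_param
    (tendsto_nhdsWithin_iff.2 ⟨hφ y hy, eventually_mem_nhdsWithin.mono fun _ hz => hD hz⟩)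

theorem ContFamily.areaConv (h : ContFamily n D G Θ Q) {y : Y} (hy : y ∈ D) (x : M) : AreaConv n (𝓝[D] y) G (G y) x :=
  AreaConv.of_locConv (h.isClosed hy) (h.finite y hy) (Eventually.of_forall (h.conv y hy))

end Families

section Connected

variable {X : Type*} [TopologicalSpace X]

/-- Each point has arbitrarily small connected neighbourhoods. -/
theorem exists_preconnected_nhd [LocallyConnectedSpace X] {x : X} {V : Set X} (hV : V ∈ 𝓝 x) :
    ∃ W ⊆ V, W ∈ 𝓝 x ∧ IsPreconnected W := by
  obtain ⟨W, ⟨hWo, hxW, hWc⟩, hWV⟩ := (locallyConnectedSpace_iff_hasBasis_isOpen_isConnected.1 ‹_› x).mem_iff.1 hV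
  exact ⟨W, hWV, hWo.mem_nhds hxW, hWc.isPreconnected⟩

theorem subset_or_disjoint_of_isPreconnected {W A : Set X} (hW : IsPreconnected W)
    (h : Disjoint W (frontier A)) : W ⊆ A ∨ Disjoint W A := by
  by_contra hcon
  rw [not_or, not_subset, not_disjoint_iff] at hcon
  obtain ⟨⟨a, ha, haA⟩, b, hb, hbA⟩ := hcon
  have hf : ∀ z ∈ W, z ∉ frontier A := fun z hz => disjoint_left.1 h hz
  have h1 : a ∈ (closure A)ᶜ := fun hc => hf a ha ⟨hc, fun hi => haA (interior_subset hi)⟩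
  have h2 : b ∈ interior A := by
    by_contra hi
    exact hf b hb ⟨subset_closure hbA, hi⟩
  obtain ⟨z, -, hz1, hz2⟩ := hW _ _ isOpen_interior isClosed_closure.isOpen_compl
    (fun z hz => by
      by_cases hz' : z ∈ closure A
      · left
        by_contra hi
        exact hf z hz ⟨hz', hi⟩
      · exact Or.inr hz') ⟨b, hb, h2⟩ ⟨a, ha, h1⟩
  exact hz2 (subset_closure (interior_subset hz1))

end Connected

section Volume

theorem volume_pos_of_mem_nhds {x : M} {V : Set M} (hV : V ∈ 𝓝 x) : 0 < μHE[n + 1] V := by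
  obtain ⟨e, he, hx⟩ : ∃ e ∈ MaxAtlas n M, x ∈ e.source :=
    ⟨chartAt (Amb n) x, IsManifold.chart_mem_maximalAtlas x, mem_chart_source _ x⟩
  obtain ⟨K, W, hW, hWs, hK⟩ := exists_lipschitz_chart he hx
  obtain ⟨U, hU, hUo, hxU⟩ := mem_nhds_iff.1 (inter_mem hV hW)
  have hopen : IsOpen (e '' U) := e.isOpen_image_of_subset_source hUo fun z hz => hWs (hU hz).2
  have h1 : 0 < volume (e '' U) := hopen.measure_pos _ ⟨_, mem_image_of_mem _ hxU⟩
  have h2 := area_image_le (hK.mono fun z hz => (hU hz).2) (n + 1)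
  rw [EuclideanSpace.euclideanHausdorffMeasure_eq_volume] at h2
  refine (pos_iff_ne_zero.2 fun h0 => ?_ : 0 < μHE[n + 1] U).trans_le (measure_mono fun z hz => (hU hz).1)
  rw [h0, mul_zero] at h2
  exact h1.not_ge h2

theorem exists_volume_lt_top (x : M) : ∃ V ∈ 𝓝 x, μHE[n + 1] V < ⊤ := by
  obtain ⟨e, he, hx⟩ : ∃ e ∈ MaxAtlas n M, x ∈ e.source :=
    ⟨chartAt (Amb n) x, IsManifold.chart_mem_maximalAtlas x, mem_chart_source _ x⟩
  obtain ⟨K, R, hR, hRt, hK⟩ := exists_lipschitz_symm he (e.map_source hx)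
  refine ⟨e.symm '' ball (e x) R, ?_, ?_⟩
  · refine mem_of_superset ((e.isOpen_inter_preimage isOpen_ball).mem_nhds
      ⟨hx, mem_ball_self hR⟩) fun z hz => ⟨e z, hz.2, e.left_inv hz.1⟩
  · refine (area_image_le hK (n + 1)).trans_lt ?_
    rw [EuclideanSpace.euclideanHausdorffMeasure_eq_volume]
    exact ENNReal.mul_lt_top (ENNReal.pow_lt_top ENNReal.coe_lt_top) measure_ball_lt_top

theorem volume_lt_top_of_isCompact {K : Set M} (hK : IsCompact K) : μHE[n + 1] K < ⊤ := by
  have : IsLocallyFiniteMeasure (μHE[n + 1] : Measure M) := ⟨fun x => exists_volume_lt_top x⟩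
  exact hK.measure_lt_top

end Volume

section Original

theorem tendsto_measure_of_area {E : Type*} [NormedAddCommGroup E] [NormedSpace ℝ E]
    {T : Set E} {Γ P : E → Set M} (h : IsGeneralizedSmoothFamily n T Γ P) {t₀ : E} (ht₀ : t₀ ∈ T) :
    Tendsto (fun t => μHE[n] (Γ t)) (𝓝[T] t₀) (𝓝 (μHE[n] (Γ t₀))) := by
  have h1 : Tendsto (fun t => area n (Γ t)) (𝓝[T] t₀) (𝓝 (area n (Γ t₀))) := h.area_smooth.continuousOn t₀ ht₀
  have h2 := (ENNReal.continuous_ofReal.tendsto _).comp h1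
  rw [area, ENNReal.ofReal_toReal (h.measure_lt_top t₀ ht₀).ne] at h2
  refine h2.congr' (eventually_mem_nhdsWithin.mono fun t ht => ?_)
  exact ENNReal.ofReal_toReal (h.measure_lt_top t ht).ne

/-- The areas of the surfaces of a generalized smooth family converge in every set with negligible
frontier. -/
theorem tendsto_area_inter {E : Type*} [NormedAddCommGroup E] [NormedSpace ℝ E] (hn : 1 ≤ n)
    {T : Set E} {Γ P : E → Set M} (h : IsGeneralizedSmoothFamily n T Γ P) {t₀ : E} (ht₀ : t₀ ∈ T)
    {B : Set M} (hBm : MeasurableSet B) (hBf : μHE[n] (Γ t₀ ∩ frontier B) = 0) :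
    Tendsto (fun t => μHE[n] (Γ t ∩ B)) (𝓝[T] t₀) (𝓝 (μHE[n] (Γ t₀ ∩ B))) :=
  tendsto_area_of_total (h.measure_lt_top t₀ ht₀)
    (area_finite hn (h.finite_exceptional t₀ ht₀))
    (fun x hx => GraphConv.areaConv (h.converges_on t₀ ht₀ x hx)) (tendsto_measure_of_area h ht₀) hBm hBf

theorem contFamily_of_boundaryFamily (hn : 1 ≤ n) {Γ Ω P : ℝ → Set M}
    (h : IsGeneralizedSmoothFamily n (Icc (0 : ℝ) 1) Γ P)
    (hΩ : ∀ t ∈ Icc (0 : ℝ) 1, IsOpen (Ω t))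
    (hfr : ∀ t ∈ Icc (0 : ℝ) 1, frontier (Ω t) ⊆ Γ t ∧ Γ t \ frontier (Ω t) ⊆ P t)
    (hvol : ∀ s ∈ Icc (0 : ℝ) 1, Tendsto (fun t => μHE[n + 1] (Ω t \ Ω s) + μHE[n + 1] (Ω s \ Ω t))
        (𝓝[Icc (0 : ℝ) 1] s) (𝓝 0)) : ContFamily n (Icc (0 : ℝ) 1) Γ Ω P where
  finite := h.finite_exceptional
  bd t ht x := ⟨fun hx => (hΩ t ht).mem_nhds hx, fun hx => (hfr t ht).1 hx, fun hx hxP => by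
    by_contra hcon
    exact hxP ((hfr t ht).2 ⟨hx, hcon⟩)⟩
  conv t₀ ht₀ x := by
    have hH := h.hausdorff_continuous t₀ ht₀
    refine ⟨fun hx V hV => ?_, fun hx => ?_, fun hx hxP => h.converges_on t₀ ht₀ x ⟨hx, hxP⟩, fun hx hxP ε hε => ?_⟩
    · obtain ⟨r, hr, hball⟩ := EMetric.mem_nhds_iff.1 hV
      filter_upwards [hH.eventually (gt_mem_nhds hr)] with t ht
      obtain ⟨z, hz, hzx⟩ := infEDist_lt_iff.1
        ((infEDist_le_hausdorffEDist_of_mem hx).trans_lt (hausdorffEDist_comm.trans_lt ht))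
      exact ⟨z, hz, hball (by rwa [mem_eball, edist_comm])⟩
    · obtain ⟨r, hr, hball⟩ := EMetric.mem_nhds_iff.1 ((h.isClosed t₀ ht₀).isOpen_compl.mem_nhds hx)
      have hr2 : 0 < r / 2 := ENNReal.half_pos hr.ne'
      have := ChartedSpace.locallyConnectedSpace (Amb n) M
      obtain ⟨W, hWb, hW, hWc⟩ := exists_preconnected_nhd (eball_mem_nhds x hr2)
      have hdisj : ∀ᶠ t in 𝓝[Icc (0 : ℝ) 1] t₀, Disjoint W (Γ t) := by
        filter_upwards [hH.eventually (gt_mem_nhds hr2)] with t ht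
        refine disjoint_left.2 fun z hzW hzt => ?_
        obtain ⟨w, hw, hzw⟩ := infEDist_lt_iff.1
          ((infEDist_le_hausdorffEDist_of_mem hzt).trans_lt ht)
        refine hball (show w ∈ eball x r from ?_) hw
        calc edist w x ≤ edist w z + edist z x := edist_triangle _ _ _
          _ < r / 2 + r / 2 := ENNReal.add_lt_add (by rwa [edist_comm]) (hWb hzW)
          _ = r := ENNReal.add_halves r
      refine ⟨W, hW, ?_⟩
      have hpos := volume_pos_of_mem_nhds (n := n) hW
      filter_upwards [hdisj, (hvol t₀ ht₀).eventually (gt_mem_nhds hpos), eventually_mem_nhdsWithin]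
        with t h1 h2 ht z hz
      refine ⟨disjoint_left.1 h1 hz, ?_⟩
      have h0 := hdisj.self_of_nhdsWithin ht₀
      rcases subset_or_disjoint_of_isPreconnected hWc (h1.mono_right (hfr t ht).1) with ht' | ht' <;>
      rcases subset_or_disjoint_of_isPreconnected hWc (h0.mono_right (hfr t₀ ht₀).1) with ht'' | ht''
      · exact ⟨fun _ => ht'' hz, fun _ => ht' hz⟩
      · exfalso
        refine h2.not_ge (le_trans (measure_mono ?_) le_self_add)
        exact fun w hw => ⟨ht' hw, disjoint_left.1 ht'' hw⟩
      · exfalso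
        refine h2.not_ge (le_trans (measure_mono ?_) le_add_self)
        exact fun w hw => ⟨ht'' hw, disjoint_left.1 ht' hw⟩
      · exact ⟨fun h => absurd h (disjoint_left.1 ht' hz), fun h => absurd h (disjoint_left.1 ht'' hz)⟩
    · set ν := (μHE[n] : Measure M).restrict (Γ t₀) with hν
      have : IsFiniteMeasure ν := ⟨by simpa [hν] using h.measure_lt_top t₀ ht₀⟩
      have hν0 : ν {x} = 0 := nonpos_iff_eq_zero.1 ((Measure.restrict_apply_le _ _).trans_eq
        (area_singleton hn x))
      obtain ⟨U, hxU, hU, hUε⟩ := Set.exists_isOpen_lt_of_lt {x} ε (by rw [hν0]; exact hε)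
      obtain ⟨O, hOU, hO, hxO, hOf⟩ := exists_null_frontier_nhd ν (hU.mem_nhds (hxU rfl))
      rw [restrict_frontier] at hOf
      have h1 := tendsto_area_inter hn h ht₀ hO.measurableSet hOf
      have h2 : μHE[n] (Γ t₀ ∩ O) < ε := by
        refine lt_of_le_of_lt ?_ hUε
        rw [hν, Measure.restrict_apply hU.measurableSet, inter_comm]
        exact measure_mono (inter_subset_inter_left _ hOU)
      exact ⟨O, hO.mem_nhds hxO, h2.le, (h1.eventually (gt_mem_nhds h2)).mono fun t ht => ht.le⟩

theorem IsBoundaryFamily.exists_contFamily (hn : 1 ≤ n) {Γ Ω : ℝ → Set M}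
    (h : IsBoundaryFamily n Γ Ω) : ∃ P, IsGeneralizedSmoothFamily n (Icc (0 : ℝ) 1) Γ P ∧
      ContFamily n (Icc (0 : ℝ) 1) Γ Ω P := by
  obtain ⟨P, h1, h2, h3, h4⟩ := h
  exact ⟨P, h1, contFamily_of_boundaryFamily hn h1 h2 h3 h4⟩

end Original

section DimensionZero

variable {M : Type*} [EMetricSpace M] [MeasurableSpace M] [BorelSpace M]

theorem exists_area_zero_eq (Γ : Set M) : ∃ k : ℕ, area 0 Γ = k := by
  have hfinset : ∀ s : Finset M, μHE[0] (s : Set M) = s.card := by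
    intro s
    rw [Measure.euclideanHausdorffMeasure_zero]
    have : (s : Set M) = ⋃ x ∈ s, {x} := by ext; simp
    rw [this, measure_biUnion_finset (fun x _ y _ hxy => by simpa using hxy)
      fun x _ => measurableSet_singleton x]
    simp
  by_cases hfin : Γ.Finite
  · refine ⟨hfin.toFinset.card, ?_⟩
    have := hfinset hfin.toFinset
    rw [hfin.coe_toFinset] at this
    rw [area, this]; simp
  · refine ⟨0, ?_⟩
    have : μHE[0] Γ = ⊤ := by
      refine ENNReal.eq_top_of_forall_nnreal_le fun r => ?_
      obtain ⟨k, hk⟩ := exists_nat_ge r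
      obtain ⟨s, hs, hcard⟩ := Set.Infinite.exists_subset_card_eq hfin k
      refine le_trans ?_ (measure_mono hs)
      rw [hfinset, hcard]
      exact_mod_cast hk
    rw [area, this]; simp

theorem area_zero_eq_of_continuousOn {S : ℝ → Set M}
    (h : ContinuousOn (fun s => area 0 (S s)) (Icc 0 1)) : area 0 (S 1) = area 0 (S 0) := by
  choose k hk using fun s => exists_area_zero_eq (S s)
  simp_rw [hk] at h ⊢
  have h1 : ContinuousOn k (Icc 0 1) := by
    rw [Nat.isClosedEmbedding_coe_real.isInducing.continuousOn_iff]
    exact h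
  have := isPreconnected_Icc.constant h1 (x := (1 : ℝ)) (y := 0) (by simp) (by simp)
  rw [this]

end DimensionZero

section PiecewiseLinear

/-- The piecewise linear homeomorphism of `ℝ` which is the identity off `[-r, r]` and maps
`a` to `b`. -/
def plShift (r a b v : ℝ) : ℝ := v + (b - a) * max 0 (min ((r - v) / (r - a)) ((r + v) / (r + a)))

variable {r a b v : ℝ}

theorem plShift_of_le_abs (ha : |a| < r) (hv : r ≤ |v|) : plShift r a b v = v := by
  have ha' := abs_lt.1 ha
  have : min ((r - v) / (r - a)) ((r + v) / (r + a)) ≤ 0 := by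
    rcases le_abs.1 hv with h | h
    · exact (min_le_left _ _).trans (div_nonpos_of_nonpos_of_nonneg (by linarith) (by linarith))
    · exact (min_le_right _ _).trans (div_nonpos_of_nonpos_of_nonneg (by linarith) (by linarith))
  simp [plShift, max_eq_left this]

theorem plShift_of_ge (ha : |a| < r) (h1 : a ≤ v) (h2 : v ≤ r) :
    plShift r a b v = r - (r - v) * (r - b) / (r - a) := by
  have ha' := abs_lt.1 ha
  have e1 : 0 < r - a := by linarith
  have e2 : 0 < r + a := by linarith
  have : (r - v) / (r - a) ≤ (r + v) / (r + a) := by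
    rw [div_le_div_iff₀ e1 e2]; nlinarith
  rw [plShift, min_eq_left this, max_eq_right (div_nonneg (by linarith) e1.le)]
  field_simp
  ring

theorem plShift_of_le (ha : |a| < r) (h1 : v ≤ a) (h2 : -r ≤ v) :
    plShift r a b v = -r + (r + v) * (r + b) / (r + a) := by
  have ha' := abs_lt.1 ha
  have e1 : 0 < r - a := by linarith
  have e2 : 0 < r + a := by linarith
  have : (r + v) / (r + a) ≤ (r - v) / (r - a) := by
    rw [div_le_div_iff₀ e2 e1]; nlinarith
  rw [plShift, min_eq_right this, max_eq_right (div_nonneg (by linarith) e2.le)]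
  field_simp
  ring

theorem plShift_plShift (ha : |a| < r) (hb : |b| < r) : plShift r b a (plShift r a b v) = v := by
  have ha' := abs_lt.1 ha
  have hb' := abs_lt.1 hb
  have e1 : 0 < r - a := by linarith
  have e2 : 0 < r + a := by linarith
  have e3 : 0 < r - b := by linarith
  have e4 : 0 < r + b := by linarith
  rcases le_total r |v| with hv | hv
  · rw [plShift_of_le_abs ha hv, plShift_of_le_abs hb hv]
  obtain ⟨hv1, hv2⟩ := abs_le.1 hv
  rcases le_total a v with h | h
  · have h3 : (r - v) * (r - b) / (r - a) ≤ r - b := by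
      rw [div_le_iff₀ e1]; nlinarith
    have h4 : 0 ≤ (r - v) * (r - b) / (r - a) := by
      have : 0 ≤ r - v := by linarith
      positivity
    rw [plShift_of_ge ha h hv2, plShift_of_ge hb (by linarith) (by linarith)]
    field_simp
    ring
  · have h3 : (r + v) * (r + b) / (r + a) ≤ r + b := by
      rw [div_le_iff₀ e2]; nlinarith
    have h4 : 0 ≤ (r + v) * (r + b) / (r + a) := by
      have : 0 ≤ r + v := by linarith
      positivity
    rw [plShift_of_le ha h hv1, plShift_of_le hb (by linarith) (by linarith)]
    field_simp
    ring

theorem plShift_self : plShift r a a v = v := by simp [plShift]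

theorem plShift_apply (ha : |a| < r) : plShift r a b a = b := by
  have ha' := abs_lt.1 ha
  have e1 : r - a ≠ 0 := by linarith
  rw [plShift_of_ge ha le_rfl (by linarith)]
  field_simp
  ring

theorem plShift_eq_iff (ha : |a| < r) (hb : |b| < r) : plShift r b a v = a ↔ v = b := by
  constructor
  · intro h
    rw [← plShift_plShift (v := v) hb ha, h, plShift_apply ha]
  · rintro rfl
    exact plShift_apply hb

theorem abs_plShift_le (ha : |a| < r) (hb : |b| < r) (hv : |v| ≤ r) : |plShift r a b v| ≤ r := by
  by_contra h
  push Not at h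
  have h1 := plShift_plShift (v := v) ha hb
  rw [plShift_of_le_abs hb h.le] at h1
  rw [h1] at h
  exact h.not_ge hv

theorem tendsto_plShift {Z : Type*} {l : Filter Z} {A B V : Z → ℝ} (ha : |a| < r)
    (hA : Tendsto A l (𝓝 a)) (hB : Tendsto B l (𝓝 b)) (hV : Tendsto V l (𝓝 v)) :
    Tendsto (fun z => plShift r (A z) (B z) (V z)) l (𝓝 (plShift r a b v)) := by
  have ha' := abs_lt.1 ha
  have e1 : r - a ≠ 0 := by linarith
  have e2 : r + a ≠ 0 := by linarith
  exact hV.add ((hB.sub hA).mul (tendsto_const_nhds.max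
    (((tendsto_const_nhds.sub hV).div (tendsto_const_nhds.sub hA) e1).min
      ((tendsto_const_nhds.add hV).div (tendsto_const_nhds.add hA) e2))))

end PiecewiseLinear

section FiberMap

variable {Y : Type*}

open Classical in
/-- The map of `M` which, in the chart `e`, moves the height `α` to the height `β` in
vertical direction. -/
def fiberMap (e : Chart n M) (r : ℝ) (α β : Hor n → ℝ) (q : M) : M :=
  if q ∈ e.source then
    e.symm (join (horiz (e q)) (plShift r (α (horiz (e q))) (β (horiz (e q))) (vert (e q))))
  else q

/-- The heights `α` and `β` are bounded by `r` and agree off the ball of radius `ρ`. -/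
structure HeightPair (r ρ : ℝ) (α β : Hor n → ℝ) : Prop where
  left : ∀ z, |α z| < r
  right : ∀ z, |β z| < r
  agree : ∀ z, ρ < ‖z‖ → α z = β z

theorem HeightPair.symm {r ρ : ℝ} {α β : Hor n → ℝ} (h : HeightPair r ρ α β) :
    HeightPair r ρ β α := ⟨h.right, h.left, fun z hz => (h.agree z hz).symm⟩

variable {e : Chart n M} {r ρ : ℝ} {α β : Hor n → ℝ}

theorem horiz_shift_eq (x : Amb n) (hx : plShift r (α (horiz x)) (β (horiz x)) (vert x) = vert x) :
    join (horiz x) (plShift r (α (horiz x)) (β (horiz x)) (vert x)) = x := by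
  rw [hx, join_horiz_vert]

theorem HeightPair.shift_eq (h : HeightPair r ρ α β) {x : Amb n} (hx : x ∉ cbox 0 ρ r) :
    plShift r (α (horiz x)) (β (horiz x)) (vert x) = vert x := by
  simp only [cbox, horiz_zero, sub_zero, vert_zero, mem_ofPred_eq, not_and_or, not_le] at hx
  rcases hx with hx | hx
  · rw [h.agree _ hx, plShift_self]
  · exact plShift_of_le_abs (h.left _) hx.le

theorem HeightPair.fiberMap_of_notMem (h : HeightPair r ρ α β) {q : M}
    (hq : q ∉ e.source ∩ e ⁻¹' cbox 0 ρ r) : fiberMap e r α β q = q := by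
  rw [fiberMap]
  split_ifs with hs
  · rw [horiz_shift_eq _ (h.shift_eq fun hc => hq ⟨hs, hc⟩), e.left_inv hs]
  · rfl

theorem HeightPair.shift_mem (h : HeightPair r ρ α β) {x : Amb n} (hx : x ∈ cbox 0 ρ r) :
    join (horiz x) (plShift r (α (horiz x)) (β (horiz x)) (vert x)) ∈ cbox (0 : Amb n) ρ r := by
  simp only [cbox, horiz_zero, sub_zero, vert_zero, mem_ofPred_eq, horiz_join, vert_join] at hx ⊢
  exact ⟨hx.1, abs_plShift_le (h.left _) (h.right _) hx.2⟩

theorem fiberMap_of_mem {q : M} (hq : q ∈ e.source) : fiberMap e r α β q =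
    e.symm (join (horiz (e q)) (plShift r (α (horiz (e q))) (β (horiz (e q))) (vert (e q)))) :=
  if_pos hq

theorem HeightPair.fiberMap_fiberMap (h : HeightPair r ρ α β) (hb : cbox 0 ρ r ⊆ e.target) (q : M) :
    fiberMap e r β α (fiberMap e r α β q) = q := by
  by_cases hq : q ∈ e.source ∩ e ⁻¹' cbox 0 ρ r
  · have h1 := hb (h.shift_mem hq.2)
    rw [fiberMap_of_mem hq.1, fiberMap_of_mem (e.map_target h1), e.right_inv h1]
    simp only [horiz_join, vert_join]
    rw [plShift_plShift (h.left _) (h.right _), join_horiz_vert, e.left_inv hq.1]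
  · rw [h.fiberMap_of_notMem hq, h.symm.fiberMap_of_notMem hq]

theorem isClosed_cbox_preimage (hb : cbox 0 ρ r ⊆ e.target) : IsClosed (e.source ∩ e ⁻¹' cbox 0 ρ r) := by
  have : e.source ∩ e ⁻¹' cbox 0 ρ r = e.symm '' cbox 0 ρ r := by
    rw [e.symm_image_eq_source_inter_preimage hb]
  rw [this]
  exact ((isCompact_cbox _ _ _).image_of_continuousOn (e.continuousOn_symm.mono hb)).isClosed

theorem tendsto_fiberMap {l : Filter Y} {α β : Y → Hor n → ℝ} {α₀ β₀ : Hor n → ℝ} {r₁ : ℝ}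
    (hρ : ρ < r₁) (hb : cbox 0 ρ r ⊆ e.target) (h : ∀ᶠ y in l, HeightPair r ρ (α y) (β y))
    (h₀ : HeightPair r ρ α₀ β₀)
    (hα : ∀ z ∈ ball 0 r₁, Tendsto (fun p : Y × Hor n => α p.1 p.2) (l ×ˢ 𝓝 z) (𝓝 (α₀ z)))
    (hβ : ∀ z ∈ ball 0 r₁, Tendsto (fun p : Y × Hor n => β p.1 p.2) (l ×ˢ 𝓝 z) (𝓝 (β₀ z)))
    (q : M) : Tendsto (fun p : Y × M => fiberMap e r (α p.1) (β p.1) p.2) (l ×ˢ 𝓝 q)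
      (𝓝 (fiberMap e r α₀ β₀ q)) := by
  by_cases hq : q ∈ e.source ∩ e ⁻¹' cbox 0 ρ r
  · have hz : horiz (e q) ∈ ball (0 : Hor n) r₁ := by
      have := hq.2.1
      simp only [horiz_zero, sub_zero] at this
      rw [mem_ball_zero_iff]
      exact this.trans_lt hρ
    have he : Tendsto (fun p : Y × M => e p.2) (l ×ˢ 𝓝 q) (𝓝 (e q)) := (e.continuousAt hq.1).tendsto.comp tendsto_snd
    have hh : Tendsto (fun p : Y × M => horiz (e p.2)) (l ×ˢ 𝓝 q) (𝓝 (horiz (e q))) :=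
      (continuous_horiz.tendsto _).comp he
    have hv : Tendsto (fun p : Y × M => vert (e p.2)) (l ×ˢ 𝓝 q) (𝓝 (vert (e q))) :=
      (continuous_vert.tendsto _).comp he
    have hp : Tendsto (fun p : Y × M => (p.1, horiz (e p.2))) (l ×ˢ 𝓝 q) (l ×ˢ 𝓝 (horiz (e q))) :=
      tendsto_fst.prodMk hh
    have key := tendsto_plShift (h₀.left (horiz (e q))) ((hα _ hz).comp hp) ((hβ _ hz).comp hp) hv
    have hj := (continuous_join.tendsto (horiz (e q), plShift r (α₀ (horiz (e q)))
      (β₀ (horiz (e q))) (vert (e q)))).comp (hh.prodMk_nhds key)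
    have hs := (e.continuousAt_symm (hb (h₀.shift_mem hq.2))).tendsto.comp hj
    rw [fiberMap_of_mem hq.1]
    refine hs.congr' ?_
    filter_upwards [tendsto_snd.eventually (e.open_source.mem_nhds hq.1)] with p hp
    exact (fiberMap_of_mem hp).symm
  · rw [h₀.fiberMap_of_notMem hq]
    have ho := (isClosed_cbox_preimage hb).isOpen_compl.mem_nhds hq
    refine (tendsto_snd (f := l) (g := 𝓝 q)).congr' ?_
    filter_upwards [h.prod_mk ho] with p hp
    exact (hp.1.fiberMap_of_notMem hp.2).symm

end FiberMap

section BoxGraph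

variable {Y : Type*} {l : Filter Y} {G Θ : Y → Set M} {G₀ Θ₀ Q₀ : Set M}
  {e : Chart n M}

theorem mem_cbox_zero {r₁ r v : ℝ} {z : Hor n} : join z v ∈ cbox (0 : Amb n) r₁ r ↔ ‖z‖ ≤ r₁ ∧ |v| ≤ r := by
  simp [cbox]

/-- `G` is the graph of `γ` in a closed box. -/
def IsBoxGraph (e : Chart n M) (r₁ r : ℝ) (G : Set M) (γ : Hor n → ℝ) : Prop :=
  ∀ x ∈ cbox (0 : Amb n) r₁ r, e.symm x ∈ G ↔ vert x = γ (horiz x)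

/-- Nearby heights are close, for surfaces that are graphs in a box. -/
theorem IsBoxGraph.tendsto {r₁ r : ℝ} (hb : cbox (0 : Amb n) r₁ r ⊆ e.target)
    {α : Y → Hor n → ℝ} {α₀ : Hor n → ℝ} (h : ∀ᶠ y in l, IsBoxGraph e r₁ r (G y) (α y))
    (h₀ : IsBoxGraph e r₁ r G₀ α₀) (hα : ∀ᶠ y in l, ∀ z, |α y z| < r)
    (hc : ∀ x ∈ cbox (0 : Amb n) r₁ r, LocConv n l G Θ G₀ Θ₀ Q₀ (e.symm x)) {z₀ : Hor n}
    (hz₀ : z₀ ∈ ball 0 r₁) : Tendsto (fun p : Y × Hor n => α p.1 p.2) (l ×ˢ 𝓝 z₀) (𝓝 (α₀ z₀)) := by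
  rw [Metric.tendsto_nhds]
  intro ε hε
  have hK : IsCompact (Icc (-r) r ∩ {v | ε ≤ dist v (α₀ z₀)}) :=
    isCompact_Icc.inter_right (isClosed_le continuous_const (continuous_id.dist continuous_const))
  have hz₀' := mem_ball_zero_iff.1 hz₀
  have key : ∀ᶠ p in l ×ˢ 𝓝 z₀, ∀ v ∈ Icc (-r) r ∩ {v | ε ≤ dist v (α₀ z₀)}, e.symm (join p.2 v) ∉ G p.1 := by
    refine hK.eventually_forall_filter (Q := fun (p : Y × Hor n) v => e.symm (join p.2 v) ∉ G p.1) ?_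
    rintro v ⟨hv, hvε⟩
    have hmem : join z₀ v ∈ cbox (0 : Amb n) r₁ r := mem_cbox_zero.2 ⟨hz₀'.le, abs_le.2 hv⟩
    have hnot : e.symm (join z₀ v) ∉ G₀ := by
      intro hG
      have := (h₀ _ hmem).1 hG
      simp only [vert_join, horiz_join] at this
      rw [mem_ofPred_eq, this, dist_self] at hvε
      linarith
    obtain ⟨V, hV, h1⟩ := (hc _ hmem).off hnot
    have hcont : Tendsto (fun q : (Y × Hor n) × ℝ => e.symm (join q.1.2 q.2)) ((l ×ˢ 𝓝 z₀) ×ˢ 𝓝 v)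
        (𝓝 (e.symm (join z₀ v))) :=
      (e.continuousAt_symm (hb hmem)).tendsto.comp ((continuous_join.tendsto (z₀, v)).comp
        ((tendsto_snd.comp tendsto_fst).prodMk_nhds tendsto_snd))
    filter_upwards [hcont hV, (tendsto_fst.comp tendsto_fst).eventually h1] with q hq1 hq2
    exact (hq2 _ hq1).1
  have hz : ∀ᶠ z in 𝓝 z₀, ‖z‖ < r₁ := (continuous_norm.tendsto z₀).eventually (isOpen_Iio.mem_nhds hz₀')
  filter_upwards [key, (h.and hα).prod_mk hz] with p hp hq
  by_contra hcon
  refine hp _ ⟨abs_le.1 (hq.1.2 p.2).le, not_lt.1 hcon⟩ ?_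
  rw [hq.1.1 _ (mem_cbox_zero.2 ⟨hq.2.le, (hq.1.2 p.2).le⟩)]
  simp

theorem IsBoxGraph.cv {r₁ r : ℝ} (he : e ∈ MaxAtlas n M)
    (hb : cbox (0 : Amb n) r₁ r ⊆ e.target)
    {α : Y → Hor n → ℝ} {α₀ : Hor n → ℝ} (h : ∀ᶠ y in l, IsBoxGraph e r₁ r (G y) (α y))
    (h₀ : IsBoxGraph e r₁ r G₀ α₀) {z₀ : Hor n} (hz₀ : z₀ ∈ ball 0 r₁) (hα : |α₀ z₀| < r)
    (hs : ContDiffAt ℝ ∞ α₀ z₀) (hc : GraphConv (n := n) l G G₀ (e.symm (join z₀ (α₀ z₀)))) : Cv l α α₀ z₀ := by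
  have hmem : join z₀ (α₀ z₀) ∈ e.target := hb (mem_cbox_zero.2 ⟨(mem_ball_zero_iff.1 hz₀).le, hα.le⟩)
  have hbox : cbox (0 : Amb n) r₁ r ∈ 𝓝 (e (e.symm (join z₀ (α₀ z₀)))) := by
    rw [e.right_inv hmem]
    exact mem_of_superset ((isOpen_box 0 r₁ r).mem_nhds
      (by simpa [box] using ⟨mem_ball_zero_iff.1 hz₀, hα⟩)) box_subset_cbox
  obtain ⟨R, hR, hmain⟩ := hc.graph he (e.map_target hmem) (g₀ := α₀) (s := cbox (0 : Amb n) r₁ r)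
    (by rw [e.right_inv hmem]; simpa using hs)
    (mem_of_superset hbox fun x hx => h₀ x hx) hbox
  obtain ⟨δ, hδ, hmain⟩ := hmain R hR le_rfl
  obtain ⟨h1, g, h2, -, h3, -, h5⟩ := hmain δ hδ le_rfl
  rw [e.right_inv hmem] at h1 h2 h3 h5
  simp only [horiz_join, vert_join] at h1 h2 h3 h5
  refine (h5 z₀ (mem_ball_self hδ)).congr ?_ (Eventually.of_forall fun _ => rfl)
  filter_upwards [((h.and h2).and h3).prod_mk (isOpen_ball.mem_nhds (mem_ball_self hδ))]
    with p hp
  have hx : join p.2 (g p.1 p.2) ∈ box (join z₀ (α₀ z₀)) δ R := by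
    refine ⟨?_, ?_⟩
    · simpa [dist_eq_norm] using hp.2
    · simpa using hp.1.2 _ hp.2
  have := (hp.1.1.1 _ (h1 (box_subset_cbox hx)).1).1 ((hp.1.1.2 _ hx).2 (by simp))
  simpa using this

open Classical in
/-- The height of a surface in a box, provided that it is a graph there. -/
def boxHeight (e : Chart n M) (r : ℝ) (G : Set M) (z : Hor n) : ℝ :=
  if h : ∃ v, |v| < r ∧ e.symm (join z v) ∈ G then h.choose else 0

theorem abs_boxHeight_lt {r : ℝ} (hr : 0 < r) (G : Set M) (z : Hor n) : |boxHeight e r G z| < r := by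
  rw [boxHeight]
  split_ifs with h
  · exact h.choose_spec.1
  · simpa using hr

theorem boxHeight_eq {r v : ℝ} {G : Set M} {z : Hor n} (hv : |v| < r)
    (h : ∀ w, |w| < r → (e.symm (join z w) ∈ G ↔ w = v)) : boxHeight e r G z = v := by
  have hex : ∃ v, |v| < r ∧ e.symm (join z v) ∈ G := ⟨v, hv, (h v hv).2 rfl⟩
  rw [boxHeight, dif_pos hex]
  exact (h _ hex.choose_spec.1).1 hex.choose_spec.2

/-- Surfaces which converge to a slice in a box are graphs. -/
theorem eventually_isBoxGraph {r₁ r R : ℝ} (he : e ∈ MaxAtlas n M)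
    (hr : 0 < r) (hr₁R : r₁ < R) (hrR : r < R) (hcyl : cyl n R ⊆ e.target)
    (hflat : ∀ x ∈ cyl n R, e.symm x ∈ G₀ ↔ vert x = 0)
    (hc : ∀ x ∈ cbox (0 : Amb n) r₁ r, LocConv n l G Θ G₀ Θ₀ Q₀ (e.symm x))
    (hQ : ∀ x ∈ cbox (0 : Amb n) r₁ r, vert x = 0 → e.symm x ∉ Q₀) :
    (∀ᶠ y in l, IsBoxGraph e r₁ r (G y) (boxHeight e r (G y))) ∧
      ∀ z ∈ closedBall (0 : Hor n) r₁, Cv l (fun y => boxHeight e r (G y)) (fun _ => 0) z := by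
  have hsub : cbox (0 : Amb n) r₁ r ⊆ cyl n R := fun x hx => by
    simp only [cbox, horiz_zero, sub_zero, vert_zero, mem_ofPred_eq] at hx
    exact ⟨hx.1.trans_lt hr₁R, hx.2.trans_lt hrR⟩
  have hcylo : IsOpen (cyl n R) := by rw [cyl_eq_box]; exact isOpen_box _ _ _
  have key : ∀ z₀ ∈ closedBall (0 : Hor n) r₁, ∃ g : Y → Hor n → ℝ, Cv l g (fun _ => 0) z₀ ∧ ∀ᶠ p in l ×ˢ 𝓝 z₀,
        |g p.1 p.2| < r ∧ ∀ v ∈ Icc (-r) r, e.symm (join p.2 v) ∈ G p.1 ↔ v = g p.1 p.2 := by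
    intro z₀ hz₀
    rw [mem_closedBall_zero_iff] at hz₀
    have hmem : ∀ v ∈ Icc (-r) r, join z₀ v ∈ cbox (0 : Amb n) r₁ r := fun v hv => mem_cbox_zero.2 ⟨hz₀, abs_le.2 hv⟩
    have h0 := hmem 0 ⟨by linarith, hr.le⟩
    have h0G : e.symm (join z₀ 0) ∈ G₀ := (hflat _ (hsub h0)).2 (by simp)
    have hgc := (hc _ h0).smooth h0G (hQ _ h0 (by simp))
    have hcylN : cyl n R ∈ 𝓝 (e (e.symm (join z₀ 0))) := by
      rw [e.right_inv (hcyl (hsub h0))]; exact hcylo.mem_nhds (hsub h0)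
    obtain ⟨ρ, hρ, hmain⟩ := hgc.graph he (e.map_target (hcyl (hsub h0))) (g₀ := fun _ => 0)
      contDiffAt_const (mem_of_superset hcylN fun x hx => hflat x hx) hcylN
    obtain ⟨δ, hδ, hmain⟩ := hmain ρ hρ le_rfl
    obtain ⟨-, g, h2, -, h3, -, h5⟩ := hmain δ hδ le_rfl
    rw [e.right_inv (hcyl (hsub h0))] at h2 h3 h5
    simp only [horiz_join, vert_join, sub_zero] at h2 h3 h5
    have hcv := h5 z₀ (mem_ball_self hδ)
    have hball : ∀ᶠ z in 𝓝 z₀, z ∈ ball z₀ δ := isOpen_ball.mem_nhds (mem_ball_self hδ)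
    have hgt : Tendsto (fun p : Y × Hor n => |g p.1 p.2|) (l ×ˢ 𝓝 z₀) (𝓝 0) := by
      simpa using hcv.tendsto.abs
    refine ⟨g, hcv, (hgt.eventually (isOpen_Iio.mem_nhds (show (0 : ℝ) ∈ Iio r from hr))).and ?_⟩
    refine isCompact_Icc.eventually_forall_filter
      (Q := fun (p : Y × Hor n) v => e.symm (join p.2 v) ∈ G p.1 ↔ v = g p.1 p.2) ?_
    intro v hv
    by_cases hv0 : v = 0
    · subst hv0
      have hvρ : ∀ᶠ w : ℝ in 𝓝 0, |w| < ρ :=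
        (continuous_abs.tendsto' 0 0 (by simp)).eventually (isOpen_Iio.mem_nhds hρ)
      filter_upwards [(h2.prod_mk hball).prod_mk hvρ] with q hq
      have hx : join q.1.2 q.2 ∈ box (join z₀ 0) δ ρ := by
        refine ⟨?_, by simpa using hq.2⟩
        simpa [dist_eq_norm] using hq.1.2
      simpa using hq.1.1 _ hx
    · obtain ⟨V, hV, h1⟩ := (hc _ (hmem v hv)).off fun hG => hv0 (by
        simpa using (hflat _ (hsub (hmem v hv))).1 hG)
      have hcont : Tendsto (fun q : (Y × Hor n) × ℝ => e.symm (join q.1.2 q.2)) ((l ×ˢ 𝓝 z₀) ×ˢ 𝓝 v)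
          (𝓝 (e.symm (join z₀ v))) :=
        (e.continuousAt_symm (hcyl (hsub (hmem v hv)))).tendsto.comp
          ((continuous_join.tendsto (z₀, v)).comp
            ((tendsto_snd.comp tendsto_fst).prodMk_nhds tendsto_snd))
      have hne : ∀ᶠ q : (Y × Hor n) × ℝ in (l ×ˢ 𝓝 z₀) ×ˢ 𝓝 v, q.2 - g q.1.1 q.1.2 ≠ 0 := by
        have : Tendsto (fun q : (Y × Hor n) × ℝ => q.2 - g q.1.1 q.1.2) ((l ×ˢ 𝓝 z₀) ×ˢ 𝓝 v)
            (𝓝 (v - 0)) := tendsto_snd.sub (hcv.tendsto.comp tendsto_fst)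
        exact this.eventually_ne (by simpa using hv0)
      filter_upwards [hcont hV, (tendsto_fst.comp tendsto_fst).eventually h1, hne] with q hq1 hq2 hq3
      exact iff_of_false (hq2 _ hq1).1 fun h => hq3 (by rw [h, sub_self])
  have heq : ∀ z₀ ∈ closedBall (0 : Hor n) r₁, ∃ g : Y → Hor n → ℝ, Cv l g (fun _ => 0) z₀ ∧ ∀ᶠ p in l ×ˢ 𝓝 z₀,
        boxHeight e r (G p.1) p.2 = g p.1 p.2 ∧ ∀ v ∈ Icc (-r) r, e.symm (join p.2 v) ∈ G p.1 ↔ v = g p.1 p.2 := by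
    intro z₀ hz₀
    obtain ⟨g, hcv, hg⟩ := key z₀ hz₀
    refine ⟨g, hcv, hg.mono fun p hp => ⟨boxHeight_eq hp.1 fun w hw => hp.2 w (abs_le.1 hw.le), hp.2⟩⟩
  constructor
  · have := (isCompact_closedBall (0 : Hor n) r₁).eventually_forall_filter (l := l)
      (Q := fun y z => ∀ v ∈ Icc (-r) r, e.symm (join z v) ∈ G y ↔ v = boxHeight e r (G y) z) ?_
    · filter_upwards [this] with y hy x hx
      simp only [cbox, horiz_zero, sub_zero, vert_zero, mem_ofPred_eq] at hx
      simpa using hy (horiz x) (by simpa using hx.1) (vert x) (abs_le.1 hx.2)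
    · intro z₀ hz₀
      obtain ⟨g, -, hg⟩ := heq z₀ hz₀
      filter_upwards [hg] with p hp
      rw [hp.1]
      exact hp.2
  · intro z₀ hz₀
    obtain ⟨g, hcv, hg⟩ := heq z₀ hz₀
    exact hcv.congr (hg.mono fun p hp => hp.1.symm) (Eventually.of_forall fun _ => rfl)

end BoxGraph

section Flatten

variable {Y : Type*} {l : Filter Y} {G Θ : Y → Set M} {G₀ Θ₀ Q₀ : Set M}
  {e : Chart n M} {r ρ r₁ : ℝ}

theorem HeightPair.mono {α β : Hor n → ℝ} (h : HeightPair r ρ α β) (hρ : ρ ≤ r₁) :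
    HeightPair r r₁ α β := ⟨h.left, h.right, fun z hz => h.agree z (hρ.trans_lt hz)⟩

theorem cbox_zero_mono (h : ρ ≤ r₁) : cbox (0 : Amb n) ρ r ⊆ cbox 0 r₁ r := fun _ hx => ⟨hx.1.trans h, hx.2⟩

theorem IsBoxGraph.flatten {α β : Hor n → ℝ} {G : Set M} (hb : cbox (0 : Amb n) r₁ r ⊆ e.target)
    (h : IsBoxGraph e r₁ r G α) (hp : HeightPair r r₁ α β) : IsBoxGraph e r₁ r (fiberMap e r β α ⁻¹' G) β := by
  intro x hx
  have hx' := hp.symm.shift_mem hx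
  rw [mem_preimage, fiberMap_of_mem (e.map_target (hb hx)), e.right_inv (hb hx), h _ hx']
  simp only [vert_join, horiz_join]
  exact plShift_eq_iff (hp.left _) (hp.right _)

/-- The homeomorphism of `M` given by a pair of heights in a box. -/
def fiberHomeo (e : Chart n M) (hρ : ρ < r₁)
    (hb : cbox (0 : Amb n) r₁ r ⊆ e.target) (α β : Hor n → ℝ) (hp : HeightPair r ρ α β)
    (hα : ∀ z ∈ ball 0 r₁, ContinuousAt α z)
    (hβ : ∀ z ∈ ball 0 r₁, ContinuousAt β z) : M ≃ₜ M where
  toFun := fiberMap e r β α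
  invFun := fiberMap e r α β
  left_inv q := hp.symm.fiberMap_fiberMap ((cbox_zero_mono hρ.le).trans hb) q
  right_inv q := hp.fiberMap_fiberMap ((cbox_zero_mono hρ.le).trans hb) q
  continuous_toFun := by
    refine continuous_iff_continuousAt.2 fun q => ?_
    have := tendsto_fiberMap (l := (pure () : Filter Unit)) (α := fun _ => β) (β := fun _ => α) hρ
      ((cbox_zero_mono hρ.le).trans hb) (Eventually.of_forall fun _ => hp.symm) hp.symm
      (fun z hz => (hβ z hz).tendsto.comp tendsto_snd)
      (fun z hz => (hα z hz).tendsto.comp tendsto_snd) q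
    exact this.comp ((tendsto_const_pure : Tendsto (fun _ : M => ()) (𝓝 q) (pure ())).prodMk tendsto_id)
  continuous_invFun := by
    refine continuous_iff_continuousAt.2 fun q => ?_
    have := tendsto_fiberMap (l := (pure () : Filter Unit)) (α := fun _ => α) (β := fun _ => β) hρ
      ((cbox_zero_mono hρ.le).trans hb) (Eventually.of_forall fun _ => hp) hp
      (fun z hz => (hα z hz).tendsto.comp tendsto_snd)
      (fun z hz => (hβ z hz).tendsto.comp tendsto_snd) q
    exact this.comp ((tendsto_const_pure : Tendsto (fun _ : M => ()) (𝓝 q) (pure ())).prodMk tendsto_id)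

theorem BdAt.preimage (ψ : M ≃ₜ M) {x : M} (h : BdAt G₀ Θ₀ Q₀ (ψ x)) : BdAt (ψ ⁻¹' G₀) (ψ ⁻¹' Θ₀) (ψ ⁻¹' Q₀) x where
  mem_nhds hx := ψ.continuous.continuousAt.preimage_mem_nhds (h.mem_nhds hx)
  frontier_subset hx := by
    rw [← ψ.preimage_frontier] at hx
    exact h.frontier_subset hx
  subset_frontier h1 h2 := by
    rw [← ψ.preimage_frontier]
    exact h.subset_frontier h1 h2

theorem BdAt.locally_const {x : M} (h : BdAt G₀ Θ₀ Q₀ x) (hx : x ∉ G₀) : ∀ᶠ z in 𝓝 x, z ∈ Θ₀ ↔ x ∈ Θ₀ := by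
  by_cases hxΘ : x ∈ Θ₀
  · exact mem_of_superset (h.mem_nhds hxΘ) fun z hz => iff_of_true hz hxΘ
  · have h1 : x ∉ frontier Θ₀ := fun h1 => hx (h.frontier_subset h1)
    have h2 : x ∉ closure Θ₀ := fun h2 => h1 ⟨h2, fun h3 => hxΘ (interior_subset h3)⟩
    exact mem_of_superset (isClosed_closure.isOpen_compl.mem_nhds h2)
      fun z hz => iff_of_false (fun h3 => hz (subset_closure h3)) hxΘ

/-- Lipschitz graphs have small area in small sets. -/
theorem exists_nhd_area_graph_le (hn : 1 ≤ n) (he : e ∈ MaxAtlas n M)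
    {x₀ : Amb n} (hx₀ : x₀ ∈ e.target) {s : Set (Amb n)} (hs : s ∈ 𝓝 x₀) (L : NNReal)
    {A : Set (Hor n)} {ε : ENNReal} (hε : 0 < ε) :
    ∃ V ∈ 𝓝 (e.symm x₀), ∀ (G : Set M) (γ : Hor n → ℝ), LipschitzOnWith L γ A →
      (∀ x ∈ s, e.symm x ∈ G → horiz x ∈ A ∧ vert x = γ (horiz x)) → μHE[n] (G ∩ V) ≤ ε := by
  obtain ⟨K, R, hR, hRt, hK⟩ := exists_lipschitz_symm he hx₀
  set C : ENNReal := ((K * (1 + L) : NNReal) : ENNReal) ^ n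
  have hCtop : C ≠ ⊤ := ENNReal.pow_ne_top ENNReal.coe_ne_top
  have : Nonempty (Fin n) := ⟨⟨0, hn⟩⟩
  have hvol : Tendsto (fun δ : ℝ => C * volume (closedBall (horiz x₀) δ)) (𝓝[>] 0) (𝓝 0) := by
    have h1 : Tendsto (fun δ : ℝ => volume (closedBall (horiz x₀) δ)) (𝓝[>] 0)
        (𝓝 (volume ({horiz x₀} : Set (Hor n)))) :=
      tendsto_measure_cthickening_of_isClosed (μ := volume) (s := {horiz x₀})
        ⟨1, one_pos, by rw [cthickening_singleton _ zero_le_one]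
                        exact measure_closedBall_lt_top.ne⟩ isClosed_singleton
        |>.mono_left nhdsWithin_le_nhds |>.congr' (by
          filter_upwards [self_mem_nhdsWithin] with δ hδ
          rw [cthickening_singleton _ (le_of_lt hδ)])
    have h2 := ENNReal.Tendsto.const_mul (a := C) h1 (Or.inr hCtop)
    simpa using h2
  obtain ⟨δ, hδε, hδ⟩ := ((hvol.eventually (gt_mem_nhds hε)).and self_mem_nhdsWithin).exists
  have hδ0 : 0 < δ := hδ
  have hO : s ∩ ball x₀ R ∩ ball x₀ δ ∈ 𝓝 x₀ := inter_mem (inter_mem hs (ball_mem_nhds _ hR)) (ball_mem_nhds _ hδ0)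
  refine ⟨e.source ∩ e ⁻¹' (s ∩ ball x₀ R ∩ ball x₀ δ), ?_, ?_⟩
  · refine inter_mem (e.open_source.mem_nhds (e.map_target hx₀))
      ((e.continuousAt (e.map_target hx₀)).preimage_mem_nhds ?_)
    rwa [e.right_inv hx₀]
  · intro G γ hγ hG
    set A' : Set (Hor n) := {z ∈ A | join z (γ z) ∈ ball x₀ R ∩ ball x₀ δ} with hA'
    refine (measure_mono ?_).trans ((area_graph_le hK (hγ.mono (s := A') fun z hz => hz.1)
      fun z hz => hz.2.1).trans ?_)
    · rintro q ⟨hqG, hq, hq2⟩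
      have h1 := hG (e q) hq2.1.1 (by rwa [e.left_inv hq])
      have h2 : join (horiz (e q)) (γ (horiz (e q))) = e q := by rw [← h1.2, join_horiz_vert]
      refine ⟨join (horiz (e q)) (γ (horiz (e q))), ⟨horiz (e q), ⟨h1.1, ?_⟩, rfl⟩, ?_⟩
      · rw [h2]; exact ⟨hq2.1.2, hq2.2⟩
      · rw [h2, e.left_inv hq]
    · refine le_trans ?_ hδε.le
      refine mul_le_mul_right (measure_mono ?_) C
      intro z hz
      have h3 := mem_ball.1 hz.2.2
      rw [dist_eq_norm] at h3
      rw [mem_closedBall, dist_eq_norm]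
      have := norm_horiz_le (join z (γ z) - x₀)
      rw [horiz_sub, horiz_join] at this
      linarith

/-- Changing the heights of graphs in a box preserves convergence. -/
theorem LocConv.flatten (hn : 1 ≤ n) (he : e ∈ MaxAtlas n M)
    (hρ : ρ < r₁) (hb : cbox (0 : Amb n) r₁ r ⊆ e.target)
    {α β : Y → Hor n → ℝ} {α₀ β₀ : Hor n → ℝ}
    (hG : ∀ᶠ y in l, IsBoxGraph e r₁ r (G y) (α y)) (hG₀ : IsBoxGraph e r₁ r G₀ α₀)
    (hp : ∀ᶠ y in l, HeightPair r ρ (α y) (β y)) (hp₀ : HeightPair r ρ α₀ β₀)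
    (hc : ∀ x, LocConv n l G Θ G₀ Θ₀ Q₀ x) (hbd : ∀ x, BdAt G₀ Θ₀ Q₀ x) (hQ : Q₀.Finite)
    (hβ : ∀ z ∈ ball 0 r₁, Tendsto (fun p : Y × Hor n => β p.1 p.2) (l ×ˢ 𝓝 z) (𝓝 (β₀ z)))
    (hαs : ∀ z ∈ ball 0 r₁, ContDiffAt ℝ ∞ α₀ z)
    (hβs : ∀ z ∈ ball 0 r₁, ContDiffAt ℝ ∞ β₀ z)
    (hcv : ∀ z ∈ ball 0 r₁, Cv l α α₀ z → Cv l β β₀ z) {L : NNReal}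
    (hL : ∀ᶠ y in l, LipschitzOnWith L (β y) (ball 0 r₁))
    (hL₀ : LipschitzOnWith L β₀ (ball 0 r₁)) (x : M) : LocConv n l (fun y => fiberMap e r (β y) (α y) ⁻¹' G y)
      (fun y => fiberMap e r (β y) (α y) ⁻¹' Θ y) (fiberMap e r β₀ α₀ ⁻¹' G₀)
      (fiberMap e r β₀ α₀ ⁻¹' Θ₀) (fiberMap e r β₀ α₀ ⁻¹' Q₀) x := by
  have hbρ : cbox (0 : Amb n) ρ r ⊆ e.target := (cbox_zero_mono hρ.le).trans hb
  have hα : ∀ z ∈ ball 0 r₁, Tendsto (fun p : Y × Hor n => α p.1 p.2) (l ×ˢ 𝓝 z) (𝓝 (α₀ z)) := fun z hz =>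
    IsBoxGraph.tendsto hb hG hG₀ (hp.mono fun y h => h.left) (fun x _ => hc _) hz
  have hψ := tendsto_fiberMap hρ hbρ (hp.mono fun y h => h.symm) hp₀.symm hβ hα
  have hφ := tendsto_fiberMap hρ hbρ hp hp₀ hα hβ
  by_cases hx : x ∈ e.source ∩ e ⁻¹' cbox 0 ρ r
  swap
  · refine (hc x).congr ((isClosed_cbox_preimage hbρ).isOpen_compl.mem_nhds hx) ?_ ?_ ?_
    · intro z hz
      simp only [mem_preimage, hp₀.symm.fiberMap_of_notMem hz, and_self]
    · simp only [mem_preimage, hp₀.symm.fiberMap_of_notMem hx]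
    · filter_upwards [hp] with y hy z hz
      simp only [mem_preimage, hy.symm.fiberMap_of_notMem hz, and_self]
  have hxt : e x ∈ e.target := e.map_source hx.1
  have hz₀ : horiz (e x) ∈ ball (0 : Hor n) r₁ := by
    have := hx.2.1
    simp only [horiz_zero, sub_zero] at this
    exact mem_ball_zero_iff.2 (this.trans_lt hρ)
  have hbg₀ := hG₀.flatten hb (hp₀.mono hρ.le)
  have hvert : x ∈ fiberMap e r β₀ α₀ ⁻¹' G₀ → vert (e x) = β₀ (horiz (e x)) := fun h =>
    (hbg₀ _ (cbox_zero_mono hρ.le hx.2)).1 (by rwa [e.left_inv hx.1])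
  have hnbox : vert (e x) = β₀ (horiz (e x)) → box (0 : Amb n) r₁ r ∈ 𝓝 (e x) := fun h =>
    (isOpen_box _ _ _).mem_nhds ⟨by simpa using hz₀, by
      rw [vert_zero, sub_zero, h]; exact hp₀.right _⟩
  refine ⟨?_, ?_, ?_, ?_⟩
  · intro hxG V hV
    have h1 := hφ (fiberMap e r β₀ α₀ x)
    rw [hp₀.symm.fiberMap_fiberMap hbρ] at h1
    obtain ⟨E, hE, W, hW, hEW⟩ := mem_prod_iff.1 (h1 hV)
    filter_upwards [(hc _).lower hxG W hW, hE, hp] with y ⟨w, hw1, hw2⟩ hyE hy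
    refine ⟨fiberMap e r (α y) (β y) w, ?_, hEW (mk_mem_prod hyE hw2)⟩
    rw [mem_preimage, hy.fiberMap_fiberMap hbρ]
    exact hw1
  · intro hxG
    obtain ⟨V, hV, h1⟩ := (hc _).off hxG
    have h2 := hψ x (inter_mem hV ((hbd _).locally_const hxG))
    obtain ⟨E, hE, W, hW, hEW⟩ := mem_prod_iff.1 h2
    have h3 : ∀ᶠ z in 𝓝 x, fiberMap e r β₀ α₀ z ∈ Θ₀ ↔ fiberMap e r β₀ α₀ x ∈ Θ₀ := by
      have hcont : ContinuousAt (fiberMap e r β₀ α₀) x :=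
        (fiberHomeo e hρ hb α₀ β₀ hp₀ (fun z hz => (hαs z hz).continuousAt)
          (fun z hz => (hβs z hz).continuousAt)).continuous.continuousAt
      exact hcont.eventually ((hbd _).locally_const hxG)
    refine ⟨W ∩ _, inter_mem hW h3, ?_⟩
    filter_upwards [h1, hE] with y hy hyE z hz
    have h4 := hEW (mk_mem_prod hyE hz.1)
    refine ⟨(hy _ h4.1).1, ?_⟩
    exact ((hy _ h4.1).2.trans h4.2).trans (Iff.symm hz.2)
  · intro hxG hxQ
    have hv := hvert hxG
    have hbg : ∀ᶠ y in l, IsBoxGraph e r₁ r (fiberMap e r (β y) (α y) ⁻¹' G y) (β y) := by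
      filter_upwards [hG, hp] with y h1 h2 using h1.flatten hb (h2.mono hρ.le)
    have hmemt : ∀ z ∈ ball (0 : Hor n) r₁, join z (α₀ z) ∈ cbox (0 : Amb n) r₁ r :=
      fun z hz => mem_cbox_zero.2 ⟨(mem_ball_zero_iff.1 hz).le, (hp₀.left z).le⟩
    have hψx : fiberMap e r β₀ α₀ x = e.symm (join (horiz (e x)) (α₀ (horiz (e x)))) := by
      rw [fiberMap_of_mem hx.1, hv, plShift_apply (hp₀.right _)]
    have hnear : ∀ᶠ z in 𝓝 (horiz (e x)), z ∈ ball (0 : Hor n) r₁ ∧ e.symm (join z (α₀ z)) ∉ Q₀ := by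
      refine Eventually.and (isOpen_ball.mem_nhds hz₀) ?_
      have hcont : Tendsto (fun z => e.symm (join z (α₀ z))) (𝓝 (horiz (e x)))
          (𝓝 (e.symm (join (horiz (e x)) (α₀ (horiz (e x)))))) :=
        (e.continuousAt_symm (hb (hmemt _ hz₀))).tendsto.comp
          ((continuous_join.tendsto (horiz (e x), α₀ (horiz (e x)))).comp
            (tendsto_id.prodMk_nhds (hαs _ hz₀).continuousAt.tendsto))
      refine hcont.eventually (hQ.isClosed.isOpen_compl.mem_nhds ?_)
      rw [mem_compl_iff, ← hψx]
      exact hxQ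
    obtain ⟨δ₁, hδ₁, hball⟩ := Metric.mem_nhds_iff.1 hnear
    obtain ⟨R, hR, hbox⟩ := exists_cbox_subset (hnbox hv)
    have hbox' : box (e x) (min δ₁ R) R ⊆ cbox (0 : Amb n) r₁ r :=
      box_subset_cbox.trans ((hbox _ (min_le_right _ _) _ le_rfl).trans box_subset_cbox)
    have hball' : ∀ z ∈ ball (horiz (e x)) (min δ₁ R), z ∈ ball (0 : Hor n) r₁ ∧
        e.symm (join z (α₀ z)) ∉ Q₀ := fun z hz => hball (ball_subset_ball (min_le_left _ _) hz)
    have key := graphConv_of_graph (l := l) (Γ := fun y => fiberMap e r (β y) (α y) ⁻¹' G y)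
      (Γ₀ := fiberMap e r β₀ α₀ ⁻¹' G₀) he hxt (lt_min hδ₁ hR) hR (g := β) (g₀ := β₀) ?_ ?_ hv ?_ ?_
    · rwa [e.left_inv hx.1] at key
    · exact hbg.mono fun y hy x hx => hy x (hbox' hx)
    · exact fun x hx => hbg₀ x (hbox' hx)
    · exact fun z hz => (hβs z (hball' z hz).1).contDiffWithinAt
    · intro z hz
      have hz' := hball' z hz
      refine hcv z hz'.1 (IsBoxGraph.cv he hb hG hG₀ hz'.1 (hp₀.left z) (hαs z hz'.1) ?_)
      refine (hc _).smooth ?_ hz'.2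
      rw [hG₀ _ (hmemt z hz'.1)]
      simp
  · intro hxG hxQ ε hε
    obtain ⟨V, hV, hmain⟩ := exists_nhd_area_graph_le hn he hxt (hnbox (hvert hxG)) L
      (A := ball 0 r₁) hε
    rw [e.left_inv hx.1] at hV
    refine ⟨V, hV, hmain _ β₀ hL₀ fun w hw h1 => ⟨by simpa using hw.1, (hbg₀ w (box_subset_cbox hw)).1 h1⟩, ?_⟩
    filter_upwards [hG, hp, hL] with y h1 h2 h3
    exact hmain _ (β y) h3 fun w hw h4 => ⟨by simpa using hw.1,
      (h1.flatten hb (h2.mono hρ.le) w (box_subset_cbox hw)).1 h4⟩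

end Flatten

section Freeze

/-- The parameters `(t, f)` with `t ∈ [0, 1]` close to `t₀` and `f ∈ [0, 1]`. -/
def strip (t₀ η : ℝ) : Set (ℝ × ℝ) := (Icc 0 1 ∩ closedBall t₀ η) ×ˢ Icc 0 1

theorem strip_mono (t₀ : ℝ) {η η' : ℝ} (h : η ≤ η') : strip t₀ η ⊆ strip t₀ η' :=
  prod_mono (inter_subset_inter_right _ (closedBall_subset_closedBall h)) subset_rfl

/-- The filter `t → t₀`, uniformly in `f ∈ [0, 1]`. -/
def stripFilter (t₀ η : ℝ) : Filter (ℝ × ℝ) := comap Prod.fst (𝓝 t₀) ⊓ 𝓟 (strip t₀ η)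

theorem stripFilter_mono (t₀ : ℝ) {η η' : ℝ} (h : η ≤ η') : stripFilter t₀ η ≤ stripFilter t₀ η' :=
  inf_le_inf_left _ (principal_mono.2 (strip_mono t₀ h))

theorem exists_strip_of_eventually {t₀ η : ℝ} (hη : 0 < η) {p : ℝ × ℝ → Prop}
    (h : ∀ᶠ y in stripFilter t₀ η, p y) : ∃ η' > 0, η' ≤ η ∧ ∀ y ∈ strip t₀ η', p y := by
  rw [stripFilter, eventually_inf_principal] at h
  obtain ⟨s, hs, h1⟩ := mem_comap.1 h
  obtain ⟨δ, hδ, h2⟩ := nhds_basis_closedBall.mem_iff.1 hs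
  exact ⟨min δ η, lt_min hδ hη, min_le_right _ _, fun y hy =>
    h1 (h2 (strip_mono t₀ (min_le_left _ _) hy).1.2) (strip_mono t₀ (min_le_right _ _) hy)⟩

theorem tendsto_stripFilter {t₀ η : ℝ} (hη : 0 < η) {f : ℝ} (hf : f ∈ Icc (0 : ℝ) 1) :
    Tendsto (fun t => (t, f)) (𝓝[Icc 0 1] t₀) (stripFilter t₀ η) := by
  refine tendsto_inf.2 ⟨tendsto_comap_iff.2 (tendsto_id.mono_left nhdsWithin_le_nhds), ?_⟩
  refine tendsto_principal.2 ?_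
  filter_upwards [self_mem_nhdsWithin, nhdsWithin_le_nhds (closedBall_mem_nhds t₀ hη)]
    with t h1 h2 using ⟨⟨h1, h2⟩, hf⟩

/-- Modifications `G (t, f)`, with `t` close to `t₀`, of the family `Γ t`, in a compact
subset `C` of `O`. -/
structure FreezeFamily (n : ℕ) [ChartedSpace (Amb n) M]
    (Γ Ξ P : ℝ → Set M) (t₀ : ℝ) (O : Set M) where
  G : ℝ × ℝ → Set M
  Θ : ℝ × ℝ → Set M
  Q : ℝ × ℝ → Set M
  η : ℝ
  C : Set M
  η_pos : 0 < η
  fam : ContFamily n (strip t₀ η) G Θ Q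
  conv : ∀ x, LocConv n (stripFilter t₀ η) G Θ (Γ t₀) (Ξ t₀) (P t₀) x
  start : ∀ t, G (t, 0) = Γ t ∧ Θ (t, 0) = Ξ t
  base : ∀ f ∈ Icc (0 : ℝ) 1, G (t₀, f) = Γ t₀ ∧ Θ (t₀, f) = Ξ t₀
  off : ∀ y ∈ strip t₀ η, ∀ x ∉ C, (x ∈ G y ↔ x ∈ Γ y.1) ∧ (x ∈ Θ y ↔ x ∈ Ξ y.1)
  isCompact : IsCompact C
  subset : C ⊆ O

variable {Γ Ξ P : ℝ → Set M} {t₀ : ℝ} {O : Set M}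

/-- At the end of the modification, the surfaces agree with `Γ t₀` near the point `x`. -/
def FreezeFamily.Agrees (F : FreezeFamily n Γ Ξ P t₀ O) (x : M) : Prop :=
  ∃ V ∈ 𝓝 x, ∀ᶠ t in 𝓝[Icc 0 1] t₀, ∀ z ∈ V, (z ∈ F.G (t, 1) ↔ z ∈ Γ t₀) ∧ (z ∈ F.Θ (t, 1) ↔ z ∈ Ξ t₀)

theorem FreezeFamily.agrees_of_notMem (F : FreezeFamily n Γ Ξ P t₀ O) (hΓ : IsClosed (Γ t₀)) {x : M}
    (hx : x ∉ Γ t₀) : F.Agrees x := by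
  obtain ⟨V, hV, h⟩ := (F.conv x).off hx
  refine ⟨V ∩ (Γ t₀)ᶜ, inter_mem hV (hΓ.isOpen_compl.mem_nhds hx), ?_⟩
  filter_upwards [(tendsto_stripFilter F.η_pos ⟨zero_le_one, le_rfl⟩).eventually h] with t ht z hz
  exact ⟨iff_of_false (ht z hz.1).1 hz.2, (ht z hz.1).2⟩

/-- The unmodified family. -/
def FreezeFamily.trivial (h : ContFamily n (Icc 0 1) Γ Ξ P) (ht₀ : t₀ ∈ Icc (0 : ℝ) 1) (O : Set M) :
    FreezeFamily n Γ Ξ P t₀ O where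
  G y := Γ y.1
  Θ y := Ξ y.1
  Q y := P y.1
  η := 1
  C := ∅
  η_pos := one_pos
  fam := h.comp continuous_fst.continuousOn fun _ hy => hy.1.1
  conv x := (h.conv t₀ ht₀ x).comp_param (tendsto_nhdsWithin_iff.2
    ⟨tendsto_comap.mono_left inf_le_left, eventually_inf_principal.2
      (Eventually.of_forall fun _ hy => hy.1.1)⟩)
  start _ := ⟨rfl, rfl⟩
  base _ _ := ⟨rfl, rfl⟩
  off _ _ _ _ := ⟨Iff.rfl, Iff.rfl⟩
  isCompact := isCompact_empty
  subset := empty_subset _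

theorem fiberMap_self {e : Chart n M} {r : ℝ} {α β : Hor n → ℝ} {q : M}
    (h : q ∈ e.source → α (horiz (e q)) = β (horiz (e q))) : fiberMap e r α β q = q := by
  rw [fiberMap]
  split_ifs with hs
  · rw [h hs, plShift_self, join_horiz_vert, e.left_inv hs]
  · rfl

theorem fiberMap_self_preimage {e : Chart n M} {r : ℝ} {α β : Hor n → ℝ}
    (h : ∀ z, α z = β z) (A : Set M) : fiberMap e r α β ⁻¹' A = A := by
  ext q
  rw [mem_preimage, fiberMap_self fun _ => h _]

/-- Open sets with the same boundary in a flat chart, which agree at a point on either side of it. -/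
theorem agree_of_flat_boundary {e : Chart n M} (hn : 1 ≤ n) {δ r : ℝ}
    (hb : box (0 : Amb n) δ r ⊆ e.target)
    {G₁ Θ₁ Q₁ G₂ Θ₂ Q₂ : Set M} (hQ₁ : Q₁.Finite) (hQ₂ : Q₂.Finite)
    (h₁ : ∀ x, BdAt G₁ Θ₁ Q₁ x) (h₂ : ∀ x, BdAt G₂ Θ₂ Q₂ x)
    (hG₁ : ∀ x ∈ box (0 : Amb n) δ r, e.symm x ∈ G₁ ↔ vert x = 0)
    (hG₂ : ∀ x ∈ box (0 : Amb n) δ r, e.symm x ∈ G₂ ↔ vert x = 0) {v w : ℝ}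
    (hv : 0 < v ∧ v < r) (hw : -r < w ∧ w < 0)
    (h : e.symm (join 0 v) ∈ Θ₁ ↔ e.symm (join 0 v) ∈ Θ₂)
    (h' : e.symm (join 0 w) ∈ Θ₁ ↔ e.symm (join 0 w) ∈ Θ₂) {x : Amb n} (hx : x ∈ box 0 δ r) :
    e.symm x ∈ Θ₁ ↔ e.symm x ∈ Θ₂ := by
  have hslice : ∀ {G Θ Q : Set M}, Q.Finite → (∀ x, BdAt G Θ Q x) →
      (∀ x ∈ box (0 : Amb n) δ r, e.symm x ∈ G ↔ vert x = 0) → vert x = 0 → e.symm x ∉ Θ := by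
    intro G Θ Q hQ h hG hx0 hxΘ
    have : Nonempty (Fin n) := ⟨⟨0, hn⟩⟩
    have hN : {z : Hor n | join z 0 ∈ box (0 : Amb n) δ r ∩ (e.target ∩ e.symm ⁻¹' interior Θ)} ∈ 𝓝 (horiz x) := by
      have hop : IsOpen (box (0 : Amb n) δ r ∩ (e.target ∩ e.symm ⁻¹' interior Θ)) :=
        (isOpen_box _ _ _).inter (e.isOpen_inter_preimage_symm isOpen_interior)
      have hc : Continuous fun z : Hor n => join z 0 := continuous_join.comp (continuous_id.prodMk continuous_const)
      refine (hop.preimage hc).mem_nhds ?_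
      have : join (horiz x) 0 = x := by rw [← hx0, join_horiz_vert]
      rw [mem_preimage, this]
      exact ⟨hx, hb hx, mem_interior_iff_mem_nhds.2 ((h _).mem_nhds hxΘ)⟩
    have hinj : InjOn (fun z : Hor n => e.symm (join z 0))
        {z : Hor n | join z 0 ∈ box (0 : Amb n) δ r ∩ (e.target ∩ e.symm ⁻¹' interior Θ)} := by
      intro z₁ hz₁ z₂ hz₂ h12
      have := e.symm.injOn hz₁.2.1 hz₂.2.1 h12
      simpa using congrArg horiz this
    refine (infinite_of_mem_nhds _ hN) (Set.Finite.of_finite_image (hQ.subset ?_) hinj)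
    rintro _ ⟨z, hz, rfl⟩
    by_contra hzQ
    exact ((h _).subset_frontier ((hG _ hz.1).2 (by simp)) hzQ).2 hz.2.2
  have hside : ∀ A ⊆ box (0 : Amb n) δ r, Convex ℝ A → (∀ z ∈ A, vert z ≠ 0) →
      ∀ a ∈ A, ∀ b ∈ A, (e.symm a ∈ Θ₁ ↔ e.symm a ∈ Θ₂) → (e.symm b ∈ Θ₁ ↔ e.symm b ∈ Θ₂) := by
    intro A hA hconv hA0 a ha b hb' hab
    have hpre : IsPreconnected (e.symm '' A) := hconv.isPreconnected.image _ (e.continuousOn_symm.mono (hA.trans hb))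
    have aux : ∀ {G Θ Q : Set M}, (∀ x, BdAt G Θ Q x) →
        (∀ x ∈ box (0 : Amb n) δ r, e.symm x ∈ G ↔ vert x = 0) → (e.symm a ∈ Θ ↔ e.symm b ∈ Θ) := by
      intro G Θ Q h hG
      have hd : Disjoint (e.symm '' A) (frontier Θ) := by
        refine disjoint_left.2 ?_
        rintro _ ⟨z, hz, rfl⟩ hzf
        exact hA0 z hz ((hG z (hA hz)).1 ((h _).frontier_subset hzf))
      rcases subset_or_disjoint_of_isPreconnected hpre hd with h1 | h1
      · exact iff_of_true (h1 (mem_image_of_mem _ ha)) (h1 (mem_image_of_mem _ hb'))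
      · exact iff_of_false (disjoint_left.1 h1 (mem_image_of_mem _ ha))
          (disjoint_left.1 h1 (mem_image_of_mem _ hb'))
    rw [← aux h₁ hG₁, ← aux h₂ hG₂, hab]
  have hδ : 0 < δ := (norm_nonneg _).trans_lt hx.1
  have hboxc : Convex ℝ (box (0 : Amb n) δ r) := by
    have : box (0 : Amb n) δ r = horizL n ⁻¹' ball 0 δ ∩ vertL n ⁻¹' ball 0 r := by
      ext z; simp [box]
    rw [this]
    exact ((convex_ball _ _).linear_preimage (horizL n).toLinearMap).inter
      ((convex_ball _ _).linear_preimage (vertL n).toLinearMap)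
  rcases lt_trichotomy (vert x) 0 with hx0 | hx0 | hx0
  · refine hside (box 0 δ r ∩ vertL n ⁻¹' Iio 0) inter_subset_left
      (hboxc.inter ((convex_Iio 0).linear_preimage (vertL n).toLinearMap)) (fun z hz => ?_)
      (join 0 w) ⟨⟨by simpa using hδ, ?_⟩, ?_⟩ x ⟨hx, by simpa using hx0⟩ h'
    · have := hz.2
      simp only [mem_preimage, vertL_apply, mem_Iio] at this
      exact this.ne
    · simpa using abs_lt.2 ⟨hw.1, by linarith [hw.1, hw.2]⟩
    · simpa using hw.2
  · exact iff_of_false (hslice hQ₁ h₁ hG₁ hx0) (hslice hQ₂ h₂ hG₂ hx0)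
  · refine hside (box 0 δ r ∩ vertL n ⁻¹' Ioi 0) inter_subset_left
      (hboxc.inter ((convex_Ioi 0).linear_preimage (vertL n).toLinearMap)) (fun z hz => ?_)
      (join 0 v) ⟨⟨by simpa using hδ, ?_⟩, ?_⟩ x ⟨hx, by simpa using hx0⟩ h
    · have := hz.2
      simp only [mem_preimage, vertL_apply, mem_Ioi] at this
      exact this.ne'
    · simpa using abs_lt.2 ⟨by linarith [hv.1, hv.2], hv.2⟩
    · simpa using hv.1

end Freeze

section FreezeStep

/-- A box in `O`, free of exceptional points, in which `Γ₀` is a slice. -/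
structure FlatBox (n : ℕ) [ChartedSpace (Amb n) M] (Γ₀ P₀ O : Set M) where
  e : Chart n M
  he : e ∈ MaxAtlas n M
  R : ℝ
  R_pos : 0 < R
  target : cyl n R ⊆ e.target
  flat : ∀ x ∈ cyl n R, e.symm x ∈ Γ₀ ↔ vert x = 0
  mem : ∀ x ∈ cyl n R, e.symm x ∈ O ∧ e.symm x ∉ P₀

variable {Γ₀ P₀ O : Set M}

theorem GraphConv.exists_flatBox {Y : Type*} {l : Filter Y} {Γ : Y → Set M} {p : M}
    (h : GraphConv (n := n) l Γ Γ₀ p) (hO : O ∈ 𝓝 p) (hP : P₀.Finite) (hp : p ∉ P₀) :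
    ∃ B : FlatBox n Γ₀ P₀ O, p ∈ B.e.source ∧ B.e p = 0 := by
  obtain ⟨e, he, r, hr, g, hps, hp0, hcyl, hflat, -⟩ := h
  have := symm_preimage_mem_nhds hps (inter_mem hO (hP.isClosed.isOpen_compl.mem_nhds hp))
  rw [hp0] at this
  obtain ⟨R, hR, h1⟩ := exists_cyl_subset this
  exact ⟨⟨e, he, min R r, lt_min hR hr, (cyl_mono (min_le_right _ _)).trans hcyl,
    fun x hx => hflat x (cyl_mono (min_le_right _ _) hx), fun x hx => h1 _ (min_le_left _ _) hx⟩, hps, hp0⟩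

namespace FlatBox

variable (B : FlatBox n Γ₀ P₀ O)

def r : ℝ := B.R / 2

theorem r_pos : 0 < B.r := half_pos B.R_pos

theorem r_lt : B.r < B.R := half_lt_self B.R_pos

def bump : ContDiffBump (0 : Hor n) where
  rIn := B.R / 8
  rOut := B.R / 4
  rIn_pos := by linarith [B.R_pos]
  rIn_lt_rOut := by linarith [B.R_pos]

theorem cbox_subset : cbox 0 B.r B.r ⊆ cyl n B.R := fun x hx => by
  simp only [cbox, horiz_zero, sub_zero, vert_zero, mem_ofPred_eq] at hx
  exact ⟨hx.1.trans_lt B.r_lt, hx.2.trans_lt B.r_lt⟩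

theorem cbox_target : cbox 0 B.r B.r ⊆ B.e.target := B.cbox_subset.trans B.target

/-- The height `α`, multiplied by `1 - f` in the middle of the box. -/
def damp (f : ℝ) (α : Hor n → ℝ) (z : Hor n) : ℝ := (1 - f * B.bump z) * α z

theorem damp_zero (α : Hor n → ℝ) (z : Hor n) : B.damp 0 α z = α z := by simp [damp]

theorem heightPair {f : ℝ} (hf : f ∈ Icc (0 : ℝ) 1) {α : Hor n → ℝ} (hα : ∀ z, |α z| < B.r) :
    HeightPair B.r (B.R / 4) α (B.damp f α) where
  left := hα
  right z := by
    refine lt_of_le_of_lt ?_ (hα z)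
    rw [damp, abs_mul]
    refine mul_le_of_le_one_left (abs_nonneg _) (abs_le.2 ⟨?_, ?_⟩)
    · nlinarith [hf.1, hf.2, B.bump.nonneg (x := z), B.bump.le_one (x := z)]
    · nlinarith [hf.1, hf.2, B.bump.nonneg (x := z), B.bump.le_one (x := z)]
  agree z hz := by
    rw [damp, B.bump.zero_of_le_dist (by simpa [bump] using hz.le)]
    simp

theorem damp_one {α : Hor n → ℝ} {z : Hor n} (hz : ‖z‖ ≤ B.R / 8) : B.damp 1 α z = 0 := by
  rw [damp, B.bump.one_of_mem_closedBall (by simpa [bump] using hz)]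
  simp

theorem contDiffAt_damp {f : ℝ} {α : Hor n → ℝ} {z : Hor n} (h : ContDiffAt ℝ ∞ α z) :
    ContDiffAt ℝ ∞ (B.damp f α) z :=
  (contDiffAt_const.sub (contDiffAt_const.mul B.bump.contDiffAt)).mul h

theorem cv_damp {Y : Type*} {l : Filter Y} {f : Y → ℝ} {f₀ : ℝ} (hf : Tendsto f l (𝓝 f₀))
    {α : Y → Hor n → ℝ} {α₀ : Hor n → ℝ} {z : Hor n} (h : Cv l α α₀ z) :
    Cv l (fun y => B.damp (f y) (α y)) (B.damp f₀ α₀) z := by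
  have hφ : Cv l (fun _ => (B.bump : Hor n → ℝ)) B.bump z := Cv.of_contDiff B.bump.contDiff
  exact ((Cv.of_tendsto hf).prodMk (hφ.prodMk h)).map (U := fun q : ℝ × ℝ × ℝ => (1 - q.1 * q.2.1) * q.2.2)
    (by fun_prop)

theorem cv_damp_zero {Y : Type*} {l : Filter Y} {f : Y → ℝ} (hf : ∀ᶠ y in l, |f y| ≤ 1)
    {α : Y → Hor n → ℝ} {z : Hor n} (h : Cv l α (fun _ => 0) z) :
    Cv l (fun y => B.damp (f y) (α y)) (fun _ => 0) z := by
  have hφ : Cv l (fun _ => (B.bump : Hor n → ℝ)) B.bump z := Cv.of_contDiff B.bump.contDiff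
  have h1 : Cv l (fun y z => B.bump z * α y z) (fun _ => 0) z := by
    simpa using (hφ.prodMk h).map (U := fun q : ℝ × ℝ => q.1 * q.2) (by fun_prop)
  have h2 := (h.prodMk (h1.bounded_smul hf)).map (U := fun q : ℝ × ℝ => q.1 - q.2) (by fun_prop)
  simp only [smul_eq_mul, sub_zero] at h2
  refine h2.congr (Eventually.of_forall fun p => ?_) (Eventually.of_forall fun _ => rfl)
  simp only [damp]
  ring

theorem tendsto_damp {Y : Type*} {l : Filter Y} {f : Y → ℝ} {f₀ : ℝ} (hf : Tendsto f l (𝓝 f₀))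
    {α : Y → Hor n → ℝ} {α₀ : Hor n → ℝ} {z : Hor n}
    (h : Tendsto (fun p : Y × Hor n => α p.1 p.2) (l ×ˢ 𝓝 z) (𝓝 (α₀ z))) :
    Tendsto (fun p : Y × Hor n => B.damp (f p.1) (α p.1) p.2) (l ×ˢ 𝓝 z) (𝓝 (B.damp f₀ α₀ z)) :=
  (tendsto_const_nhds.sub ((hf.comp tendsto_fst).mul
    ((B.bump.continuous.tendsto z).comp tendsto_snd))).mul h

end FlatBox

theorem eventually_lipschitz_of_cv {Y : Type*} {l : Filter Y} {β : Y → Hor n → ℝ} {r : ℝ}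
    (h : ∀ z ∈ closedBall (0 : Hor n) r, Cv l β (fun _ => 0) z) {κ : NNReal} (hκ : 0 < κ) :
    ∀ᶠ y in l, (∀ z ∈ closedBall (0 : Hor n) r, ContDiffAt ℝ ∞ (β y) z) ∧ LipschitzOnWith κ (β y) (ball 0 r) := by
  have h1 := eventually_contDiffOn_of_smoothNear (isCompact_closedBall (0 : Hor n) r)
    fun z hz => (h z hz).smooth
  have h2 := (isCompact_closedBall (0 : Hor n) r).eventually_forall_filter (l := l)
    (Q := fun y z => ‖fderiv ℝ (β y) z‖₊ ≤ κ) fun z hz => by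
      have h3 := (h z hz).fderivs.tendsto
      have h4 : Tendsto (fun p : Y × Hor n => ‖fderiv ℝ (β p.1) p.2‖₊) (l ×ˢ 𝓝 z) (𝓝 0) := by
        simpa using h3.nnnorm
      exact (h4.eventually (gt_mem_nhds hκ)).mono fun _ h => h.le
  filter_upwards [h1, h2] with y hy1 hy2
  refine ⟨hy1, (convex_ball (0 : Hor n) r).lipschitzOnWith_of_nnnorm_fderiv_le
    (fun z hz => (hy1 z (ball_subset_closedBall hz)).differentiableAt (by simp))
    fun z hz => hy2 z (ball_subset_closedBall hz)⟩

variable {Γ Ξ P : ℝ → Set M} {t₀ : ℝ}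

theorem FlatBox.isBoxGraph (B : FlatBox n Γ₀ P₀ O) : IsBoxGraph B.e B.r B.r Γ₀ (fun _ => 0) :=
  fun x hx => B.flat x (B.cbox_subset hx)

/-- In a flat box, the surfaces near `t₀` are graphs. -/
theorem FreezeFamily.exists_good (F : FreezeFamily n Γ Ξ P t₀ O) (B : FlatBox n (Γ t₀) (P t₀) O) :
    (∀ z ∈ closedBall (0 : Hor n) B.r, Cv (stripFilter t₀ F.η)
      (fun y => boxHeight B.e B.r (F.G y)) (fun _ => 0) z) ∧ ∃ η' > 0, η' ≤ F.η ∧ ∀ y ∈ strip t₀ η',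
      IsBoxGraph B.e B.r B.r (F.G y) (boxHeight B.e B.r (F.G y)) ∧
      (∀ z ∈ closedBall (0 : Hor n) B.r, ContDiffAt ℝ ∞ (boxHeight B.e B.r (F.G y)) z) ∧
      LipschitzOnWith 1 (B.damp y.2 (boxHeight B.e B.r (F.G y))) (ball 0 B.r) := by
  obtain ⟨h1, h2⟩ := eventually_isBoxGraph B.he B.r_pos B.r_lt B.r_lt B.target B.flat
    (fun x _ => F.conv _) (fun x hx _ => (B.mem x (B.cbox_subset hx)).2)
  refine ⟨h2, ?_⟩
  have hf : ∀ᶠ y in stripFilter t₀ F.η, |y.2| ≤ 1 := by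
    rw [stripFilter, eventually_inf_principal]
    exact Eventually.of_forall fun y hy => abs_le.2 ⟨by linarith [hy.2.1], hy.2.2⟩
  have h3 := eventually_lipschitz_of_cv (fun z hz => B.cv_damp_zero hf (h2 z hz)) one_pos
  exact exists_strip_of_eventually F.η_pos (h1.and
    ((eventually_lipschitz_of_cv h2 one_pos).and h3) |>.mono fun y hy => ⟨hy.1, hy.2.1.1, hy.2.2.2⟩)

/-- Flattening the surfaces in the middle of a box. -/
theorem FreezeFamily.exists_flatten (hn : 1 ≤ n) (F : FreezeFamily n Γ Ξ P t₀ O) (ht₀ : t₀ ∈ Icc (0 : ℝ) 1)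
    (hbd : ∀ x, BdAt (Γ t₀) (Ξ t₀) (P t₀) x) (hP : (P t₀).Finite)
    (B : FlatBox n (Γ t₀) (P t₀) O) : ∃ F' : FreezeFamily n Γ Ξ P t₀ O,
      (∀ y, F'.G y = fiberMap B.e B.r (B.damp y.2 (boxHeight B.e B.r (F.G y)))
        (boxHeight B.e B.r (F.G y)) ⁻¹' F.G y) ∧
      (∀ y, F'.Θ y = fiberMap B.e B.r (B.damp y.2 (boxHeight B.e B.r (F.G y)))
        (boxHeight B.e B.r (F.G y)) ⁻¹' F.Θ y) ∧ F'.η ≤ F.η ∧ ∀ y ∈ strip t₀ F'.η,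
      IsBoxGraph B.e B.r B.r (F.G y) (boxHeight B.e B.r (F.G y)) := by
  obtain ⟨hcv0, η', hη', hηle, hgood⟩ := F.exists_good B
  set α : ℝ × ℝ → Hor n → ℝ := fun y => boxHeight B.e B.r (F.G y) with hα
  set β : ℝ × ℝ → Hor n → ℝ := fun y => B.damp y.2 (α y) with hβ
  have hlt : ∀ y z, |α y z| < B.r := fun y z => abs_boxHeight_lt B.r_pos _ _
  have hρ : B.R / 4 < B.r := by have := B.R_pos; rw [FlatBox.r]; linarith
  have hpair : ∀ y ∈ strip t₀ η', HeightPair B.r (B.R / 4) (α y) (β y) := fun y hy => B.heightPair hy.2 (hlt y)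
  have hstrip : strip t₀ η' ⊆ strip t₀ F.η := strip_mono t₀ hηle
  have hbρ : cbox (0 : Amb n) (B.R / 4) B.r ⊆ B.e.target := (cbox_zero_mono hρ.le).trans B.cbox_target
  have hψ : ∀ y ∈ strip t₀ η', ∃ ψ : M ≃ₜ M, ∀ q, ψ q = fiberMap B.e B.r (β y) (α y) q := fun y hy =>
    ⟨fiberHomeo B.e hρ B.cbox_target (α y) (β y) (hpair y hy)
      (fun z hz => ((hgood y hy).2.1 z (ball_subset_closedBall hz)).continuousAt)
      (fun z hz => (B.contDiffAt_damp ((hgood y hy).2.1 z (ball_subset_closedBall hz))).continuousAt), fun q => rfl⟩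
  have hpre : ∀ y ∈ strip t₀ η', ∃ ψ : M ≃ₜ M, ∀ A, ψ ⁻¹' A = fiberMap B.e B.r (β y) (α y) ⁻¹' A := by
    intro y hy
    obtain ⟨ψ, h⟩ := hψ y hy
    exact ⟨ψ, fun A => by ext q; rw [mem_preimage, h, mem_preimage]⟩
  refine ⟨{
    G := fun y => fiberMap B.e B.r (β y) (α y) ⁻¹' F.G y
    Θ := fun y => fiberMap B.e B.r (β y) (α y) ⁻¹' F.Θ y
    Q := fun y => fiberMap B.e B.r (β y) (α y) ⁻¹' F.Q y
    η := η'
    C := F.C ∪ B.e.symm '' cbox 0 (B.R / 4) B.r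
    η_pos := hη'
    fam := ⟨?_, ?_, ?_⟩
    conv := ?_
    start := ?_
    base := ?_
    off := ?_
    isCompact := F.isCompact.union ((isCompact_cbox _ _ _).image_of_continuousOn
      (B.e.continuousOn_symm.mono hbρ))
    subset := union_subset F.subset ?_ }, fun y => rfl, fun y => rfl, hηle, fun y hy => (hgood y hy).1⟩
  · intro y hy
    obtain ⟨ψ, h⟩ := hpre y hy
    rw [← h]
    exact (F.fam.finite y (hstrip hy)).preimage ψ.injective.injOn
  · intro y hy x
    obtain ⟨ψ, h⟩ := hpre y hy
    rw [← h, ← h, ← h]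
    exact (F.fam.bd y (hstrip hy) _).preimage ψ
  · intro y hy x
    have hev : ∀ᶠ w in 𝓝[strip t₀ η'] y, w ∈ strip t₀ η' := self_mem_nhdsWithin
    have hc : ∀ x, LocConv n (𝓝[strip t₀ η'] y) F.G F.Θ (F.G y) (F.Θ y) (F.Q y) x := fun x =>
      (F.fam.conv y (hstrip hy) x).mono (nhdsWithin_mono _ hstrip)
    have hf : Tendsto Prod.snd (𝓝[strip t₀ η'] y) (𝓝 y.2) :=
      continuous_snd.continuousAt.tendsto.mono_left nhdsWithin_le_nhds
    have hbg : ∀ᶠ w in 𝓝[strip t₀ η'] y, IsBoxGraph B.e B.r B.r (F.G w) (α w) := hev.mono fun w hw => (hgood w hw).1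
    exact LocConv.flatten (L := 1) hn B.he hρ B.cbox_target hbg (hgood y hy).1
      (hev.mono fun w hw => hpair w hw) (hpair y hy) hc (F.fam.bd y (hstrip hy))
      (F.fam.finite y (hstrip hy))
      (fun z hz => B.tendsto_damp hf (IsBoxGraph.tendsto B.cbox_target hbg (hgood y hy).1
        (Eventually.of_forall hlt) (fun x _ => hc _) hz))
      (fun z hz => (hgood y hy).2.1 z (ball_subset_closedBall hz))
      (fun z hz => B.contDiffAt_damp ((hgood y hy).2.1 z (ball_subset_closedBall hz)))
      (fun z hz h => B.cv_damp hf h) (hev.mono fun w hw => (hgood w hw).2.2) (hgood y hy).2.2 x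
  · intro x
    have hev : ∀ᶠ w in stripFilter t₀ η', w ∈ strip t₀ η' :=
      eventually_inf_principal.2 (Eventually.of_forall fun _ h => h)
    have hfb : ∀ᶠ w in stripFilter t₀ η', |w.2| ≤ 1 :=
      hev.mono fun y hy => abs_le.2 ⟨by linarith [hy.2.1], hy.2.2⟩
    have hcvα : ∀ z ∈ ball (0 : Hor n) B.r, Cv (stripFilter t₀ η') α (fun _ => 0) z := fun z hz =>
      (hcv0 z (ball_subset_closedBall hz)).mono (stripFilter_mono t₀ hηle)
    have key := LocConv.flatten (L := 1) (α := α) (β := β) (α₀ := fun _ => 0) (β₀ := fun _ => 0) hn B.he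
      hρ B.cbox_target (hev.mono fun w hw => (hgood w hw).1) B.isBoxGraph
      (hev.mono fun w hw => hpair w hw) ⟨by simp [B.r_pos], by simp [B.r_pos], fun _ _ => rfl⟩
      (fun x => (F.conv x).mono (stripFilter_mono t₀ hηle)) hbd hP
      (fun z hz => (B.cv_damp_zero hfb (hcvα z hz)).tendsto)
      (fun z hz => contDiffAt_const) (fun z hz => contDiffAt_const)
      (fun z hz h => B.cv_damp_zero hfb h) (hev.mono fun w hw => (hgood w hw).2.2)
      (LipschitzOnWith.of_dist_le_mul fun x _ y _ => by simp) x
    rwa [fiberMap_self_preimage fun _ => rfl, fiberMap_self_preimage fun _ => rfl,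
      fiberMap_self_preimage fun _ => rfl] at key
  · intro t
    have : ∀ z, β (t, 0) z = α (t, 0) z := fun z => B.damp_zero _ z
    rw [fiberMap_self_preimage this, fiberMap_self_preimage this]
    exact F.start t
  · intro f hf
    have hmem : (t₀, f) ∈ strip t₀ η' := ⟨⟨ht₀, mem_closedBall_self hη'.le⟩, hf⟩
    have h0 : ∀ z, ‖z‖ ≤ B.r → α (t₀, f) z = 0 := by
      intro z hz
      have h1 : join z 0 ∈ cbox (0 : Amb n) B.r B.r := mem_cbox_zero.2 ⟨hz, by simpa using B.r_pos.le⟩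
      have h2 := ((hgood _ hmem).1 _ h1)
      rw [(F.base f hf).1, B.isBoxGraph _ h1] at h2
      change boxHeight B.e B.r (F.G (t₀, f)) z = 0
      rw [(F.base f hf).1]
      simpa using (h2.1 (by simp)).symm
    have : ∀ z, β (t₀, f) z = α (t₀, f) z := by
      intro z
      rcases le_or_gt ‖z‖ B.r with hz | hz
      · simp only [hβ, FlatBox.damp, h0 z hz, mul_zero]
      · exact ((hpair _ hmem).agree z (hρ.trans hz)).symm
    rw [fiberMap_self_preimage this, fiberMap_self_preimage this]
    exact F.base f hf
  · intro y hy x hx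
    have h1 : x ∉ B.e.source ∩ B.e ⁻¹' cbox 0 (B.R / 4) B.r := fun h => hx (Or.inr ⟨B.e x, h.2, B.e.left_inv h.1⟩)
    rw [mem_preimage, mem_preimage, (hpair y hy).symm.fiberMap_of_notMem h1]
    exact F.off y (hstrip hy) x fun h => hx (Or.inl h)
  · rintro _ ⟨x, hx, rfl⟩
    exact (B.mem x (B.cbox_subset (cbox_zero_mono hρ.le hx))).1

end FreezeStep

section FreezeAgree

variable {Γ Ξ P : ℝ → Set M} {t₀ : ℝ} {O : Set M}

theorem FreezeFamily.eventually_mem_strip (F : FreezeFamily n Γ Ξ P t₀ O) :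
    ∀ᶠ t in 𝓝[Icc 0 1] t₀, (t, (1 : ℝ)) ∈ strip t₀ F.η :=
  (tendsto_stripFilter F.η_pos ⟨zero_le_one, le_rfl⟩).eventually
    (eventually_inf_principal.2 (Eventually.of_forall fun _ h => h))

/-- Flattening makes the surfaces agree in the middle of the box, and preserves agreement. -/
theorem FreezeFamily.exists_agrees (hn : 1 ≤ n) (F : FreezeFamily n Γ Ξ P t₀ O)
    (ht₀ : t₀ ∈ Icc (0 : ℝ) 1) (hΓ : IsClosed (Γ t₀))
    (hbd : ∀ x, BdAt (Γ t₀) (Ξ t₀) (P t₀) x) (hP : (P t₀).Finite)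
    (B : FlatBox n (Γ t₀) (P t₀) O) : ∃ F' : FreezeFamily n Γ Ξ P t₀ O,
      (∀ x ∈ B.e.symm '' box 0 (B.R / 8) B.r, F'.Agrees x) ∧ ∀ x, F.Agrees x → F'.Agrees x := by
  obtain ⟨F', hG, hΘ, hη, hgood⟩ := F.exists_flatten hn ht₀ hbd hP B
  have hR := B.R_pos
  have hr : B.r = B.R / 2 := rfl
  have hbox : box 0 (B.R / 8) B.r ⊆ cbox (0 : Amb n) B.r B.r := fun x hx => by
    have h1 := hx.1
    exact box_subset_cbox ⟨by linarith, hx.2⟩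
  have hboxt := hbox.trans B.cbox_target
  refine ⟨F', ?_, ?_⟩
  · rintro _ ⟨x, hx, rfl⟩
    refine ⟨B.e.symm '' box 0 (B.R / 8) B.r, ?_, ?_⟩
    · refine IsOpen.mem_nhds ?_ (mem_image_of_mem _ hx)
      exact B.e.symm.isOpen_image_of_subset_source (isOpen_box _ _ _) hboxt
    · have hpt : ∀ v : ℝ, v ≠ 0 → |v| < B.r → ∀ᶠ t in 𝓝[Icc 0 1] t₀,
          (B.e.symm (join 0 v) ∈ F'.Θ (t, 1) ↔ B.e.symm (join 0 v) ∈ Ξ t₀) := by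
        intro v hv hvr
        have hm : join 0 v ∈ cyl n B.R := B.cbox_subset (mem_cbox_zero.2 ⟨by simpa using B.r_pos.le, hvr.le⟩)
        obtain ⟨V, hV, h1⟩ := (F'.conv (B.e.symm (join 0 v))).off fun h =>
          hv (by simpa using (B.flat _ hm).1 h)
        filter_upwards [(tendsto_stripFilter F'.η_pos ⟨zero_le_one, le_rfl⟩).eventually h1] with t ht
        exact (ht _ (mem_of_mem_nhds hV)).2
      have hr2 : |B.r / 2| < B.r := by rw [abs_of_pos (half_pos B.r_pos)]; linarith [B.r_pos]
      filter_upwards [F'.eventually_mem_strip, hpt (B.r / 2) (half_pos B.r_pos).ne' hr2,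
        hpt (-(B.r / 2)) (neg_ne_zero.2 (half_pos B.r_pos).ne') (by rwa [abs_neg])] with t ht h1 h2
      have hbg := (hgood _ ht).flatten B.cbox_target ((B.heightPair (f := 1) ⟨zero_le_one, le_rfl⟩
        fun z => abs_boxHeight_lt B.r_pos _ _).mono (r₁ := B.r) (by linarith))
      have hflat : ∀ x ∈ box (0 : Amb n) (B.R / 8) B.r, B.e.symm x ∈ F'.G (t, 1) ↔ vert x = 0 := by
        intro x hx
        rw [hG, hbg x (hbox hx), B.damp_one (by simpa using hx.1.le)]
      have hflat0 : ∀ x ∈ box (0 : Amb n) (B.R / 8) B.r, B.e.symm x ∈ Γ t₀ ↔ vert x = 0 :=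
        fun x hx => B.flat x (B.cbox_subset (hbox hx))
      rintro _ ⟨x, hx, rfl⟩
      refine ⟨(hflat x hx).trans (hflat0 x hx).symm, ?_⟩
      exact agree_of_flat_boundary hn hboxt (F'.fam.finite _ ht) hP (F'.fam.bd _ ht) hbd hflat hflat0
        (v := B.r / 2) (w := -(B.r / 2)) ⟨half_pos B.r_pos, by linarith [B.r_pos]⟩
        ⟨by linarith [B.r_pos], by linarith [B.r_pos]⟩ h1 h2 hx
  · intro x hx
    by_cases hxΓ : x ∈ Γ t₀
    swap
    · exact F'.agrees_of_notMem hΓ hxΓ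
    obtain ⟨V, hV, hev⟩ := hx
    have hbρ : cbox (0 : Amb n) (B.R / 4) B.r ⊆ B.e.target :=
      (cbox_zero_mono (by linarith)).trans B.cbox_target
    suffices h : ∃ W ∈ 𝓝 x, ∀ᶠ t in 𝓝[Icc 0 1] t₀, ∀ z ∈ W,
        fiberMap B.e B.r (B.damp 1 (boxHeight B.e B.r (F.G (t, 1)))) (boxHeight B.e B.r (F.G (t, 1))) z = z by
      obtain ⟨W, hW, h⟩ := h
      refine ⟨V ∩ W, inter_mem hV hW, ?_⟩
      filter_upwards [hev, h] with t h1 h2 z hz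
      rw [hG, hΘ, mem_preimage, mem_preimage, h2 z hz.2]
      exact h1 z hz.1
    by_cases hxb : x ∈ B.e.source ∩ B.e ⁻¹' cbox 0 (B.R / 4) B.r
    swap
    · refine ⟨_, (isClosed_cbox_preimage hbρ).isOpen_compl.mem_nhds hxb, Eventually.of_forall ?_⟩
      intro t z hz
      exact (B.heightPair (f := 1) ⟨zero_le_one, le_rfl⟩
        fun z => abs_boxHeight_lt B.r_pos _ _).symm.fiberMap_of_notMem hz
    have hxr : B.e x ∈ cbox (0 : Amb n) B.r B.r := cbox_zero_mono (by linarith) hxb.2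
    have hv0 : vert (B.e x) = 0 := (B.flat _ (B.cbox_subset hxr)).1 (by rwa [B.e.left_inv hxb.1])
    have hN : {z : Hor n | ‖z‖ < B.r ∧ B.e.symm (join z 0) ∈ V} ∈ 𝓝 (horiz (B.e x)) := by
      have h1 : ‖horiz (B.e x)‖ < B.r := by
        have := hxb.2.1
        simp only [horiz_zero, sub_zero] at this
        linarith
      refine inter_mem ((isOpen_lt continuous_norm continuous_const).mem_nhds h1) ?_
      have h2 : join (horiz (B.e x)) 0 = B.e x := by rw [← hv0, join_horiz_vert]
      have hc : ContinuousAt (fun z : Hor n => B.e.symm (join z 0)) (horiz (B.e x)) := by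
        refine ContinuousAt.comp (f := fun z : Hor n => join z 0) ?_
          (continuous_join.comp (continuous_id.prodMk continuous_const)).continuousAt
        rw [h2]
        exact B.e.continuousAt_symm (B.cbox_target hxr)
      refine hc.preimage_mem_nhds ?_
      rwa [h2, B.e.left_inv hxb.1]
    refine ⟨B.e.source ∩ B.e ⁻¹' (horiz ⁻¹' {z : Hor n | ‖z‖ < B.r ∧ B.e.symm (join z 0) ∈ V}),
      inter_mem (B.e.open_source.mem_nhds hxb.1) ((B.e.continuousAt hxb.1).preimage_mem_nhds
        (continuous_horiz.continuousAt.preimage_mem_nhds hN)), ?_⟩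
    filter_upwards [hev, F'.eventually_mem_strip] with t h1 h2 z hz
    refine fiberMap_self fun _ => ?_
    obtain ⟨h3, h4⟩ := hz.2
    have hm : join (horiz (B.e z)) 0 ∈ cbox (0 : Amb n) B.r B.r :=
      mem_cbox_zero.2 ⟨h3.le, by simpa using B.r_pos.le⟩
    have h5 := (hgood _ h2 _ hm).1 ((h1 _ h4).1.2 ((B.flat _ (B.cbox_subset hm)).2 (by simp)))
    simp only [vert_join, horiz_join] at h5
    rw [FlatBox.damp, ← h5, mul_zero]

/-- The family can be modified so that, in the end, it is constant near a compact set. -/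
theorem exists_freeze (hn : 1 ≤ n) (h : ContFamily n (Icc 0 1) Γ Ξ P) (ht₀ : t₀ ∈ Icc (0 : ℝ) 1)
    (hO : IsOpen O) {K : Set M} (hK : IsCompact K) (hKO : K ⊆ O) (hKP : Disjoint K (P t₀)) :
    ∃ F : FreezeFamily n Γ Ξ P t₀ O, ∃ η > 0, η ≤ F.η ∧ ∃ V, IsOpen V ∧ K ⊆ V ∧
      ∀ t ∈ Icc (0 : ℝ) 1 ∩ closedBall t₀ η, ∀ z ∈ V, (z ∈ F.G (t, 1) ↔ z ∈ Γ t₀) ∧ (z ∈ F.Θ (t, 1) ↔ z ∈ Ξ t₀) := by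
  have hΓ := h.isClosed ht₀
  have hP := h.finite t₀ ht₀
  have hbd := h.bd t₀ ht₀
  have key : ∀ F : FreezeFamily n Γ Ξ P t₀ O, ∃ F' : FreezeFamily n Γ Ξ P t₀ O,
      (∀ x ∈ K, F'.Agrees x) ∧ ∀ x, F.Agrees x → F'.Agrees x := by
    refine hK.induction_on (p := fun K => ∀ F : FreezeFamily n Γ Ξ P t₀ O,
      ∃ F' : FreezeFamily n Γ Ξ P t₀ O, (∀ x ∈ K, F'.Agrees x) ∧ ∀ x, F.Agrees x → F'.Agrees x)
      ?_ ?_ ?_ ?_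
    · exact fun F => ⟨F, by simp, fun _ => id⟩
    · intro s t hst ht F
      obtain ⟨F', h1, h2⟩ := ht F
      exact ⟨F', fun x hx => h1 x (hst hx), h2⟩
    · intro s t hs ht F
      obtain ⟨F', h1, h2⟩ := hs F
      obtain ⟨F'', h3, h4⟩ := ht F'
      exact ⟨F'', fun x hx => hx.elim (fun h => h4 x (h1 x h)) (h3 x), fun x hx => h4 x (h2 x hx)⟩
    · intro p hp
      by_cases hpΓ : p ∈ Γ t₀
      · obtain ⟨B, hB, hB0⟩ := ((h.conv t₀ ht₀ p).smooth hpΓ (disjoint_left.1 hKP hp)).exists_flatBox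
          (hO.mem_nhds (hKO hp)) hP (disjoint_left.1 hKP hp)
        refine ⟨B.e.symm '' box 0 (B.R / 8) B.r, mem_nhdsWithin_of_mem_nhds ?_,
          fun F => F.exists_agrees hn ht₀ hΓ hbd hP B⟩
        have hR := B.R_pos
        have hr : B.r = B.R / 2 := rfl
        refine IsOpen.mem_nhds (B.e.symm.isOpen_image_of_subset_source (isOpen_box _ _ _) ?_) ?_
        · refine fun x hx => B.cbox_target ?_
          have h1 := hx.1
          exact box_subset_cbox ⟨by linarith, hx.2⟩
        · exact ⟨0, mem_box_self (by linarith) B.r_pos, by rw [← hB0, B.e.left_inv hB]⟩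
      · exact ⟨(Γ t₀)ᶜ, mem_nhdsWithin_of_mem_nhds (hΓ.isOpen_compl.mem_nhds hpΓ),
          fun F => ⟨F, fun x hx => F.agrees_of_notMem hΓ hx, fun _ => id⟩⟩
  obtain ⟨F, hF, -⟩ := key (FreezeFamily.trivial h ht₀ O)
  obtain ⟨V, hV, hKV, h1⟩ : ∃ V, IsOpen V ∧ K ⊆ V ∧ ∀ᶠ t in 𝓝[Icc 0 1] t₀, ∀ z ∈ V,
      (z ∈ F.G (t, 1) ↔ z ∈ Γ t₀) ∧ (z ∈ F.Θ (t, 1) ↔ z ∈ Ξ t₀) := by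
    refine hK.induction_on (p := fun s => ∃ V, IsOpen V ∧ s ⊆ V ∧ ∀ᶠ t in 𝓝[Icc 0 1] t₀, ∀ z ∈ V,
      (z ∈ F.G (t, 1) ↔ z ∈ Γ t₀) ∧ (z ∈ F.Θ (t, 1) ↔ z ∈ Ξ t₀)) ?_ ?_ ?_ ?_
    · exact ⟨∅, isOpen_empty, subset_rfl, Eventually.of_forall fun _ _ h => h.elim⟩
    · exact fun s t hst ⟨V, hV, h1, h2⟩ => ⟨V, hV, hst.trans h1, h2⟩
    · rintro s t ⟨V, hV, h1, h2⟩ ⟨V', hV', h1', h2'⟩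
      exact ⟨V ∪ V', hV.union hV', union_subset_union h1 h1', (h2.and h2').mono fun t ht z hz =>
        hz.elim (ht.1 z) (ht.2 z)⟩
    · intro x hx
      obtain ⟨V, hV, hev⟩ := hF x hx
      exact ⟨interior V, mem_nhdsWithin_of_mem_nhds (interior_mem_nhds.2 hV), interior V, isOpen_interior,
        subset_rfl, hev.mono fun t ht z hz => ht z (interior_subset hz)⟩
  obtain ⟨δ, hδ, hsub⟩ := nhds_basis_closedBall.mem_iff.1 (eventually_nhdsWithin_iff.1 h1)
  exact ⟨F, min δ F.η, lt_min hδ F.η_pos, min_le_right _ _, V, hV, hKV, fun t ht =>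
    hsub (closedBall_subset_closedBall (min_le_left _ _) ht.2) ht.1⟩

end FreezeAgree

section Glue

variable {Y : Type*} [TopologicalSpace Y] {D D₁ D₂ : Set Y} {G Θ Q G' Θ' Q' : Y → Set M}

theorem ContFamily.congr (h : ContFamily n D G Θ Q) (hG : ∀ y ∈ D, G y = G' y)
    (hΘ : ∀ y ∈ D, Θ y = Θ' y) (hQ : ∀ y ∈ D, Q y = Q' y) : ContFamily n D G' Θ' Q' where
  finite y hy := hQ y hy ▸ h.finite y hy
  bd y hy x := hG y hy ▸ hΘ y hy ▸ hQ y hy ▸ h.bd y hy x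
  conv y hy x := by
    refine (h.conv y hy x).congr univ_mem (fun z _ => ?_) (by rw [hQ y hy]) ?_
    · rw [hG y hy, hΘ y hy]; exact ⟨Iff.rfl, Iff.rfl⟩
    · filter_upwards [self_mem_nhdsWithin] with w hw z _
      rw [hG w hw, hΘ w hw]; exact ⟨Iff.rfl, Iff.rfl⟩

theorem ContFamily.mono (h : ContFamily n D G Θ Q) (hD : D₁ ⊆ D) : ContFamily n D₁ G Θ Q :=
  h.comp (φ := id) continuousOn_id hD

theorem ContFamily.union (h₁ : ContFamily n D₁ G Θ Q) (h₂ : ContFamily n D₂ G Θ Q)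
    (hD₁ : IsClosed D₁) (hD₂ : IsClosed D₂) : ContFamily n (D₁ ∪ D₂) G Θ Q where
  finite y hy := hy.elim (h₁.finite y) (h₂.finite y)
  bd y hy := hy.elim (h₁.bd y) (h₂.bd y)
  conv y hy x := by
    have hbot : ∀ {D : Set Y}, IsClosed D → y ∉ D → 𝓝[D] y = ⊥ := fun hD hy => by
      exact not_neBot.1 fun h => hy (hD.closure_eq ▸ mem_closure_iff_nhdsWithin_neBot.2 h)
    rw [nhdsWithin_union]
    by_cases hy1 : y ∈ D₁
    · by_cases hy2 : y ∈ D₂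
      · exact (h₁.conv y hy1 x).sup (h₂.conv y hy2 x)
      · rw [hbot hD₂ hy2, sup_bot_eq]
        exact h₁.conv y hy1 x
    · rw [hbot hD₁ hy1, bot_sup_eq]
      exact h₂.conv y (hy.resolve_left hy1) x

theorem GraphConv.small_nhdsWithin (hn : 1 ≤ n) {y : Y} (hy : y ∈ D) {x : M}
    (h : GraphConv (n := n) (𝓝[D] y) G (G y) x) {ε : ENNReal} (hε : 0 < ε) :
    ∃ V ∈ 𝓝 x, μHE[n] (G y ∩ V) ≤ ε ∧ ∀ᶠ z in 𝓝[D] y, μHE[n] (G z ∩ V) ≤ ε := by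
  obtain ⟨V, hV, h1⟩ := h.areaConv.exists_small hn hε
  exact ⟨V, hV, h1.self_of_nhdsWithin hy, h1⟩

theorem ContFamily.mono_exc (hn : 1 ≤ n) (h : ContFamily n D G Θ Q) (hQ : ∀ y ∈ D, Q y ⊆ Q' y)
    (hfin : ∀ y ∈ D, (Q' y).Finite) : ContFamily n D G Θ Q' where
  finite := hfin
  bd y hy x := ⟨(h.bd y hy x).mem_nhds, (h.bd y hy x).frontier_subset,
    fun h1 h2 => (h.bd y hy x).subset_frontier h1 fun h3 => h2 (hQ y hy h3)⟩
  conv y hy x := ⟨(h.conv y hy x).lower, (h.conv y hy x).off,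
    fun h1 h2 => (h.conv y hy x).smooth h1 fun h3 => h2 (hQ y hy h3), fun h1 _ ε hε => by
      by_cases hx : x ∈ Q y
      · exact (h.conv y hy x).small h1 hx ε hε
      · exact ((h.conv y hy x).smooth h1 hx).small_nhdsWithin hn hy hε⟩

/-- The set which is `A` outside `W` and `B` inside `W`. -/
def glue (W A B : Set M) : Set M := A \ W ∪ B ∩ W

theorem mem_glue_of_mem {W A B : Set M} {x : M} (hx : x ∈ W) : x ∈ glue W A B ↔ x ∈ B := by
  simp [glue, hx]

theorem mem_glue_of_notMem {W A B : Set M} {x : M} (hx : x ∉ W) : x ∈ glue W A B ↔ x ∈ A := by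
  simp [glue, hx]

theorem glue_self (W A : Set M) : glue W A A = A := by
  simp [glue, union_comm]

/-- Two families which agree near the frontier of `W` can be glued. -/
theorem ContFamily.glue (hn : 1 ≤ n) (h : ContFamily n D G Θ Q) (h' : ContFamily n D G' Θ' Q')
    {W V : Set M} (hW : IsOpen W) (hV : IsOpen V) (hWV : frontier W ⊆ V)
    (hagree : ∀ y ∈ D, ∀ z ∈ V, (z ∈ G y ↔ z ∈ G' y) ∧ (z ∈ Θ y ↔ z ∈ Θ' y)) :
    ContFamily n D (fun y => glue W (G y) (G' y)) (fun y => glue W (Θ y) (Θ' y))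
      (fun y => Q y ∪ Q' y) := by
  have hfin : ∀ y ∈ D, (Q y ∪ Q' y).Finite := fun y hy => (h.finite y hy).union (h'.finite y hy)
  have k := h.mono_exc hn (fun y _ => subset_union_left) hfin
  have k' := h'.mono_exc hn (fun y _ => subset_union_right) hfin
  have key : ∀ x : M, ∃ N ∈ 𝓝 x, (∀ y ∈ D, ∀ z ∈ N, (z ∈ G y ↔ z ∈ MinMax.glue W (G y) (G' y)) ∧
      (z ∈ Θ y ↔ z ∈ MinMax.glue W (Θ y) (Θ' y))) ∨ (∀ y ∈ D, ∀ z ∈ N, (z ∈ G' y ↔ z ∈ MinMax.glue W (G y) (G' y)) ∧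
      (z ∈ Θ' y ↔ z ∈ MinMax.glue W (Θ y) (Θ' y))) := by
    intro x
    by_cases hx : x ∈ W
    · exact ⟨W, hW.mem_nhds hx, Or.inr fun y _ z hz => ⟨(mem_glue_of_mem hz).symm, (mem_glue_of_mem hz).symm⟩⟩
    by_cases hx' : x ∈ closure W
    · refine ⟨V, hV.mem_nhds (hWV ⟨hx', by rwa [hW.interior_eq]⟩), Or.inl fun y hy z hz => ?_⟩
      by_cases hzW : z ∈ W
      · rw [mem_glue_of_mem hzW, mem_glue_of_mem hzW]; exact hagree y hy z hz
      · rw [mem_glue_of_notMem hzW, mem_glue_of_notMem hzW]; exact ⟨Iff.rfl, Iff.rfl⟩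
    · exact ⟨(closure W)ᶜ, isClosed_closure.isOpen_compl.mem_nhds hx', Or.inl fun y _ z hz =>
        ⟨(mem_glue_of_notMem fun h => hz (subset_closure h)).symm,
          (mem_glue_of_notMem fun h => hz (subset_closure h)).symm⟩⟩
  refine ⟨hfin, fun y hy x => ?_, fun y hy x => ?_⟩
  · obtain ⟨N, hN, h1 | h1⟩ := key x
    · exact (k.bd y hy x).congr hN (h1 y hy) id
    · exact (k'.bd y hy x).congr hN (h1 y hy) id
  · obtain ⟨N, hN, h1 | h1⟩ := key x
    · exact (k.conv y hy x).congr hN (h1 y hy) Iff.rfl (eventually_mem_nhdsWithin.mono h1)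
    · exact (k'.conv y hy x).congr hN (h1 y hy) Iff.rfl (eventually_mem_nhdsWithin.mono h1)

theorem exists_open_between {X : Type*} [TopologicalSpace X] [T2Space X] [LocallyCompactSpace X]
    [MeasurableSpace X] [BorelSpace X] (ν : Measure X) [IsFiniteMeasure ν]
    {C O : Set X} (hC : IsCompact C) (hO : IsOpen O) (hCO : C ⊆ O) :
    ∃ B, IsOpen B ∧ C ⊆ B ∧ closure B ⊆ O ∧ IsCompact (closure B) ∧ ν (frontier B) = 0 := by
  obtain ⟨f, hf1, hf0, hfc, -⟩ := exists_continuous_one_zero_of_isCompact hC hO.isClosed_compl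
    (disjoint_compl_right_iff_subset.2 hCO)
  have hc := Measure.countable_meas_level_set_pos (μ := ν) f.continuous.measurable
  obtain ⟨c, hc, hc0, hc1⟩ := (hc.dense_compl ℝ).exists_between (zero_lt_one (α := ℝ))
  have hcl : closure {x | c < f x} ⊆ {x | c ≤ f x} := closure_lt_subset_le continuous_const f.continuous
  refine ⟨{x | c < f x}, isOpen_lt continuous_const f.continuous, ?_, ?_, ?_, ?_⟩
  · intro x hx
    rw [mem_ofPred_eq, hf1 hx]
    exact hc1
  · intro x hx
    by_contra hxO
    have := hcl hx
    rw [mem_ofPred_eq, hf0 hxO] at this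
    exact this.not_gt hc0
  · refine hfc.isCompact.of_isClosed_subset isClosed_closure (hcl.trans fun x hx => ?_)
    exact subset_tsupport f (by rw [Function.mem_support]; exact (hc0.trans_le hx).ne')
  · refine measure_mono_null (fun x hx => ?_) (by simpa using hc : ν {x | f x = c} = 0)
    exact (frontier_lt_subset_eq continuous_const f.continuous hx).symm

/-- The area of a family which agrees with `Γ` off a compact set is continuous. -/
theorem ContFamily.continuousOn_area (hn : 1 ≤ n) {Γ P : ℝ → Set M}
    (hΓ : IsGeneralizedSmoothFamily n (Icc (0 : ℝ) 1) Γ P) (h : ContFamily n D G Θ Q) {T : Y → ℝ}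
    (hT : ContinuousOn T D) (hTI : MapsTo T D (Icc 0 1)) {C : Set M} (hC : IsCompact C)
    (hoff : ∀ y ∈ D, ∀ x ∉ C, x ∈ G y ↔ x ∈ Γ (T y)) :
    (∀ y ∈ D, μHE[n] (G y) < ⊤) ∧ ContinuousOn (fun y => area n (G y)) D := by
  have := ChartedSpace.locallyCompactSpace (Amb n) M
  obtain ⟨K, hK, hCK⟩ := exists_compact_superset hC
  have hfin : ∀ y ∈ D, μHE[n] (G y) < ⊤ := by
    intro y hy
    have h1 := measure_lt_top_of_isCompact hK fun x _ => h.areaConv hy x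
    refine (measure_mono (t := G y ∩ K ∪ Γ (T y)) ?_).trans_lt ((measure_union_le _ _).trans_lt
      (ENNReal.add_lt_top.2 ⟨h1, hΓ.measure_lt_top _ (hTI hy)⟩))
    intro x hx
    by_cases hxK : x ∈ K
    · exact Or.inl ⟨hx, hxK⟩
    · exact Or.inr ((hoff y hy x fun hxC => hxK (interior_subset (hCK hxC))).1 hx)
  refine ⟨hfin, fun y hy => ?_⟩
  have f1 : IsFiniteMeasure ((μHE[n] : Measure M).restrict (Γ (T y))) :=
    ⟨by rw [Measure.restrict_apply_univ]; exact hΓ.measure_lt_top _ (hTI hy)⟩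
  have f2 : IsFiniteMeasure ((μHE[n] : Measure M).restrict (G y)) :=
    ⟨by rw [Measure.restrict_apply_univ]; exact hfin y hy⟩
  obtain ⟨B, hB, hCB, hBK, -, hBf⟩ := exists_open_between
    ((μHE[n] : Measure M).restrict (Γ (T y)) + (μHE[n] : Measure M).restrict (G y)) hC isOpen_interior hCK
  rw [Measure.add_apply, add_eq_zero, restrict_frontier, restrict_frontier] at hBf
  have t1 : Tendsto (fun z => μHE[n] (G z ∩ B)) (𝓝[D] y) (𝓝 (μHE[n] (G y ∩ B))) :=
    tendsto_area_of_isCompact hK (fun x _ => h.areaConv hy x)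
      (subset_closure.trans (hBK.trans interior_subset)) hB.measurableSet hBf.2
  have t2 : Tendsto (fun z => μHE[n] (Γ (T z) ∩ Bᶜ)) (𝓝[D] y) (𝓝 (μHE[n] (Γ (T y) ∩ Bᶜ))) :=
    (tendsto_area_inter hn hΓ (hTI hy) hB.measurableSet.compl (by rw [frontier_compl]; exact hBf.1)).comp
      (tendsto_nhdsWithin_iff.2 ⟨hT y hy, eventually_mem_nhdsWithin.mono hTI⟩)
  have hsplit : ∀ z ∈ D, μHE[n] (G z) = μHE[n] (G z ∩ B) + μHE[n] (Γ (T z) ∩ Bᶜ) := by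
    intro z hz
    rw [← measure_inter_add_sdiff (G z) hB.measurableSet, sdiff_eq]
    congr 2
    ext x
    exact and_congr_left fun hx => hoff z hz x fun hxC => hx (hCB hxC)
  have t3 : Tendsto (fun z => μHE[n] (G z)) (𝓝[D] y) (𝓝 (μHE[n] (G y))) := by
    rw [hsplit y hy]
    refine (t1.add t2).congr' ?_
    filter_upwards [self_mem_nhdsWithin] with z hz using (hsplit z hz).symm
  exact (ENNReal.tendsto_toReal (hfin y hy).ne).comp t3

end Glue

/-- The nearest point of `[0, 1]`. -/
def clamp (x : ℝ) : ℝ := max 0 (min x 1)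

@[fun_prop] theorem continuous_clamp : Continuous clamp := by unfold clamp; fun_prop

theorem clamp_mem (x : ℝ) : clamp x ∈ Icc (0 : ℝ) 1 := ⟨le_max_left _ _, max_le zero_le_one (min_le_right _ _)⟩

theorem clamp_of_le {x : ℝ} (h : x ≤ 0) : clamp x = 0 := max_eq_left ((min_le_left _ _).trans h)

theorem clamp_of_ge {x : ℝ} (h : 1 ≤ x) : clamp x = 1 := by
  rw [clamp, min_eq_right h, max_eq_right zero_le_one]

theorem clamp_of_mem {x : ℝ} (h : x ∈ Icc (0 : ℝ) 1) : clamp x = x := by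
  rw [clamp, min_eq_left h.2, max_eq_right h.1]

section Composite

/-- The times in `[0, 1]` close to `t₀`. -/
def near (t₀ η : ℝ) : Set ℝ := Icc 0 1 ∩ closedBall t₀ η

/-- The data needed to replace, for `t` close to `t₀`, the surface `Γ t` by the surfaces `S s`
inside `W`: the family is first frozen near the frontier of `W`. -/
structure Composite (n : ℕ) [ChartedSpace (Amb n) M]
    (Γ Ξ P : ℝ → Set M) (t₀ : ℝ) (O : Set M) where
  F : FreezeFamily n Γ Ξ P t₀ O
  η : ℝ
  η_pos : 0 < η
  η_le : η ≤ F.η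
  W : Set M
  V : Set M
  isOpen_W : IsOpen W
  isCompact_W : IsCompact (closure W)
  isOpen_V : IsOpen V
  frontier_W : frontier W ⊆ V
  freeze : ∀ t ∈ near t₀ η, ∀ z ∈ V, (z ∈ F.G (t, 1) ↔ z ∈ Γ t₀) ∧ (z ∈ F.Θ (t, 1) ↔ z ∈ Ξ t₀)
  S : ℝ → Set M
  Ω : ℝ → Set M
  PS : ℝ → Set M
  fam : ContFamily n (Icc 0 1) S Ω PS
  start : S 0 = Γ t₀ ∧ Ω 0 = Ξ t₀
  agree : ∀ s ∈ Icc (0 : ℝ) 1, ∀ z, z ∈ V ∨ z ∉ W → (z ∈ S s ↔ z ∈ Γ t₀) ∧ (z ∈ Ω s ↔ z ∈ Ξ t₀)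
  sch : ℝ → ℝ
  sch_continuous : Continuous sch
  sch_mem : ∀ m, sch m ∈ Icc (0 : ℝ) 1
  sch_of_le : ∀ m ≤ 2, sch m = 0

namespace Composite

variable {Γ Ξ P : ℝ → Set M} {t₀ : ℝ} {O : Set M} (K : Composite n Γ Ξ P t₀ O)

/-- The time at which the family is frozen inside `W`. -/
def tau (t₀ : ℝ) (y : ℝ × ℝ) : ℝ := y.1 + clamp (y.2 - 1) * (t₀ - y.1)

theorem continuous_tau : Continuous (tau t₀) := by unfold tau; fun_prop

theorem tau_mem {η : ℝ} (hη : 0 < η) (ht₀ : t₀ ∈ Icc (0 : ℝ) 1) {y : ℝ × ℝ} (hy : y.1 ∈ near t₀ η) :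
    tau t₀ y ∈ near t₀ η := by
  have hc : Convex ℝ (near t₀ η) := (convex_Icc 0 1).inter (convex_closedBall t₀ η)
  have h0 : t₀ ∈ near t₀ η := ⟨ht₀, mem_closedBall_self hη.le⟩
  have h1 := clamp_mem (y.2 - 1)
  have := hc hy h0 (sub_nonneg.2 h1.2) h1.1 (by ring)
  convert this using 1
  simp only [tau, smul_eq_mul]
  ring

/-- The part inside `W` of the composite surface. -/
def inner (t₀ : ℝ) (sch : ℝ → ℝ) (A : ℝ × ℝ → Set M) (S : ℝ → Set M) (y : ℝ × ℝ) : Set M :=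
  if y.2 ≤ 2 then A (tau t₀ y, clamp y.2) else S (sch y.2)

/-- The composite surface at the parameter `(t, m)`. -/
def G (y : ℝ × ℝ) : Set M := glue K.W (K.F.G (y.1, clamp y.2)) (inner t₀ K.sch K.F.G K.S y)

def Θ (y : ℝ × ℝ) : Set M := glue K.W (K.F.Θ (y.1, clamp y.2)) (inner t₀ K.sch K.F.Θ K.Ω y)

def Q (y : ℝ × ℝ) : Set M :=
  K.F.Q (y.1, clamp y.2) ∪ (K.F.Q (tau t₀ y, clamp y.2) ∪ K.PS (K.sch y.2))

variable {K}

theorem near_subset {t : ℝ} (ht : t ∈ near t₀ K.η) (m : ℝ) : (t, clamp m) ∈ strip t₀ K.F.η :=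
  strip_mono t₀ K.η_le ⟨ht, clamp_mem m⟩

theorem inner_of_ge {y : ℝ × ℝ} (hy : 2 ≤ y.2) :
    inner t₀ K.sch K.F.G K.S y = K.S (K.sch y.2) ∧ inner t₀ K.sch K.F.Θ K.Ω y = K.Ω (K.sch y.2) := by
  rcases hy.eq_or_lt with h | h
  · have h1 : tau t₀ y = t₀ := by rw [tau, clamp_of_ge (by linarith)]; ring
    have hb := K.F.base 1 ⟨zero_le_one, le_rfl⟩
    rw [inner, if_pos h.ge, inner, if_pos h.ge, h1, clamp_of_ge (by linarith), K.sch_of_le _ h.ge, hb.1,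
      hb.2, K.start.1, K.start.2]
    exact ⟨rfl, rfl⟩
  · rw [inner, if_neg h.not_ge, inner, if_neg h.not_ge]
    exact ⟨rfl, rfl⟩

theorem tau_of_le {y : ℝ × ℝ} (hy : y.2 ≤ 1) : tau t₀ y = y.1 := by
  rw [tau, clamp_of_le (by linarith)]; ring

/-- Without any replacement, the composite surface is `Γ t`. -/
theorem eq_of_nonpos {y : ℝ × ℝ} (hy : y.2 ≤ 0) : K.G y = Γ y.1 ∧ K.Θ y = Ξ y.1 := by
  have h1 : y.2 ≤ 2 := by linarith
  rw [G, Θ, inner, if_pos h1, inner, if_pos h1, tau_of_le (by linarith), clamp_of_le hy, glue_self, glue_self]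
  exact K.F.start y.1

theorem eq_base (m : ℝ) : K.G (t₀, m) = K.S (K.sch m) := by
  have hg : ∀ s ∈ Icc (0 : ℝ) 1, glue K.W (Γ t₀) (K.S s) = K.S s := by
    intro s hs
    ext z
    by_cases hz : z ∈ K.W
    · rw [mem_glue_of_mem hz]
    · rw [mem_glue_of_notMem hz, (K.agree s hs z (Or.inr hz)).1]
  have hb := fun f hf => (K.F.base f hf).1
  have h2 : tau t₀ (t₀, m) = t₀ := by simp [tau]
  rw [G, inner, h2, hb _ (clamp_mem m)]
  split_ifs with h
  · rw [K.sch_of_le m h, glue_self, K.start.1]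
  · exact hg _ (K.sch_mem m)

theorem mem_iff_of_notMem {y : ℝ × ℝ} (hy : y.1 ∈ near t₀ K.η) {x : M}
    (hx : x ∉ K.F.C ∪ closure K.W) : (x ∈ K.G y ↔ x ∈ Γ y.1) ∧ (x ∈ K.Θ y ↔ x ∈ Ξ y.1) := by
  have hxW : x ∉ K.W := fun h => hx (Or.inr (subset_closure h))
  rw [G, Θ, mem_glue_of_notMem hxW, mem_glue_of_notMem hxW]
  exact K.F.off _ (near_subset hy _) x fun h => hx (Or.inl h)

theorem contFamily (hn : 1 ≤ n) (ht₀ : t₀ ∈ Icc (0 : ℝ) 1) : ContFamily n (near t₀ K.η ×ˢ univ) K.G K.Θ K.Q := by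
  have hcl : IsClosed (near t₀ K.η) := isClosed_Icc.inter isClosed_closedBall
  have hfin : ∀ y ∈ near t₀ K.η ×ˢ univ, (K.Q y).Finite := fun y hy =>
    (K.F.fam.finite _ (near_subset hy.1 _)).union ((K.F.fam.finite _
      (near_subset (tau_mem K.η_pos ht₀ hy.1) _)).union (K.fam.finite _ (K.sch_mem _)))
  have fA := K.F.fam.comp (φ := fun y : ℝ × ℝ => (y.1, clamp y.2)) (D' := near t₀ K.η ×ˢ univ)
    (by fun_prop) fun y hy => near_subset hy.1 _
  have fB := K.F.fam.comp (φ := fun y : ℝ × ℝ => (tau t₀ y, clamp y.2)) (D' := near t₀ K.η ×ˢ univ)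
    (continuous_tau.prodMk (by fun_prop)).continuousOn
    fun y hy => near_subset (tau_mem K.η_pos ht₀ hy.1) _
  have fS := K.fam.comp (φ := fun y : ℝ × ℝ => K.sch y.2) (D' := near t₀ K.η ×ˢ univ)
    (K.sch_continuous.comp continuous_snd).continuousOn fun y _ => K.sch_mem _
  have sub1 : near t₀ K.η ×ˢ Iic (1 : ℝ) ⊆ near t₀ K.η ×ˢ univ := prod_mono_right (subset_univ _)
  have sub2 : near t₀ K.η ×ˢ Icc (1 : ℝ) 2 ⊆ near t₀ K.η ×ˢ univ := prod_mono_right (subset_univ _)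
  have sub3 : near t₀ K.η ×ˢ Ici (2 : ℝ) ⊆ near t₀ K.η ×ˢ univ := prod_mono_right (subset_univ _)
  have d1 : ContFamily n (near t₀ K.η ×ˢ Iic (1 : ℝ)) K.G K.Θ K.Q := by
    refine (((fA.mono sub1).congr (fun y hy => ?_) (fun y hy => ?_) (fun _ _ => rfl)).mono_exc hn
      (fun y hy => subset_union_left) fun y hy => hfin y (sub1 hy))
    · have : y.2 ≤ 1 := hy.2
      rw [G, inner, if_pos (by linarith), tau_of_le this, glue_self]
    · have : y.2 ≤ 1 := hy.2
      rw [Θ, inner, if_pos (by linarith), tau_of_le this, glue_self]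
  have d2 : ContFamily n (near t₀ K.η ×ˢ Icc (1 : ℝ) 2) K.G K.Θ K.Q := by
    refine (((fA.mono sub2).glue hn (fB.mono sub2) K.isOpen_W K.isOpen_V K.frontier_W ?_).congr
      (fun y hy => ?_) (fun y hy => ?_) (fun _ _ => rfl)).mono_exc hn (fun y hy => ?_)
      fun y hy => hfin y (sub2 hy)
    · intro y hy z hz
      have h1 := K.freeze _ hy.1 z hz
      have h2 := K.freeze _ (tau_mem K.η_pos ht₀ hy.1) z hz
      rw [clamp_of_ge hy.2.1, h1.1, h1.2, h2.1, h2.2]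
      exact ⟨Iff.rfl, Iff.rfl⟩
    · rw [G, inner, if_pos hy.2.2]
    · rw [Θ, inner, if_pos hy.2.2]
    · exact union_subset_union_right _ subset_union_left
  have d3 : ContFamily n (near t₀ K.η ×ˢ Ici (2 : ℝ)) K.G K.Θ K.Q := by
    refine (((fA.mono sub3).glue hn (fS.mono sub3) K.isOpen_W K.isOpen_V K.frontier_W ?_).congr
      (fun y hy => ?_) (fun y hy => ?_) (fun _ _ => rfl)).mono_exc hn (fun y hy => ?_)
      fun y hy => hfin y (sub3 hy)
    · intro y hy z hz
      have h0 : (2 : ℝ) ≤ y.2 := hy.2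
      have h1 := K.freeze _ hy.1 z hz
      have h2 := K.agree _ (K.sch_mem y.2) z (Or.inl hz)
      rw [clamp_of_ge (by linarith), h1.1, h1.2, h2.1, h2.2]
      exact ⟨Iff.rfl, Iff.rfl⟩
    · rw [G, (inner_of_ge hy.2).1]
    · rw [Θ, (inner_of_ge hy.2).2]
    · exact union_subset_union_right _ subset_union_right
  refine ((d1.union d2 (hcl.prod isClosed_Iic) (hcl.prod isClosed_Icc)).union d3
    ((hcl.prod isClosed_Iic).union (hcl.prod isClosed_Icc)) (hcl.prod isClosed_Ici)).mono ?_
  rintro ⟨t, m⟩ ⟨ht, -⟩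
  rcases le_total m 1 with h | h
  · exact Or.inl (Or.inl ⟨ht, h⟩)
  rcases le_total m 2 with h' | h'
  · exact Or.inl (Or.inr ⟨ht, h, h'⟩)
  · exact Or.inr ⟨ht, h'⟩

end Composite

end Composite

section SphereGraph

variable {Y : Type*} {l : Filter Y}

theorem cv_sphere {c : Y → Amb n} {c₀ : Amb n} {ρ : Y → ℝ} {ρ₀ : ℝ} (hc : Tendsto c l (𝓝 c₀))
    (hρ : Tendsto ρ l (𝓝 ρ₀)) {z : Hor n} (hz : ‖z - horiz c₀‖ < ρ₀) :
    Cv l (fun y z => vert (c y) + √(ρ y ^ 2 - ‖z - horiz (c y)‖ ^ 2))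
      (fun z => vert c₀ + √(ρ₀ ^ 2 - ‖z - horiz c₀‖ ^ 2)) z := by
  have hp : Cv l (fun y z => (z, c y, ρ y)) (fun z => (z, c₀, ρ₀)) z :=
    (Cv.of_contDiff contDiff_id).prodMk ((Cv.of_tendsto hc).prodMk (Cv.of_tendsto hρ))
  have hcont : Continuous fun q : Hor n × Amb n × ℝ => q.2.2 ^ 2 - ‖q.1 - horiz q.2.1‖ ^ 2 := by
    fun_prop
  have hU : ∀ᶠ q in 𝓝 (z, c₀, ρ₀), ContDiffAt ℝ ∞
      (fun q : Hor n × Amb n × ℝ => vert q.2.1 + √(q.2.2 ^ 2 - ‖q.1 - horiz q.2.1‖ ^ 2)) q := by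
    have hpos : (0 : ℝ) < ρ₀ ^ 2 - ‖z - horiz c₀‖ ^ 2 := by
      have := norm_nonneg (z - horiz c₀)
      nlinarith
    filter_upwards [(isOpen_lt continuous_const hcont).mem_nhds hpos] with q hq
    have h1 : ContDiff ℝ ∞ fun q : Hor n × Amb n × ℝ => q.2.2 ^ 2 - ‖q.1 - horiz q.2.1‖ ^ 2 :=
      (contDiff_snd.comp contDiff_snd).pow 2 |>.sub
        ((contDiff_fst.sub (contDiff_horiz.comp (contDiff_fst.comp contDiff_snd))).norm_sq ℝ)
    exact (contDiff_vert.comp (contDiff_fst.comp contDiff_snd)).contDiffAt.add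
      (h1.contDiffAt.sqrt (ne_of_gt hq))
  exact Cv.comp (u := fun y z => (z, c y, ρ y)) (u₀ := fun z => (z, c₀, ρ₀))
    (U := fun _ => fun q : Hor n × Amb n × ℝ => vert q.2.1 + √(q.2.2 ^ 2 - ‖q.1 - horiz q.2.1‖ ^ 2))
    (U₀ := fun q : Hor n × Amb n × ℝ => vert q.2.1 + √(q.2.2 ^ 2 - ‖q.1 - horiz q.2.1‖ ^ 2))
    (Cv.const hU) hp

theorem mem_sphere_iff_graph {c w : Amb n} {ρ : ℝ} (hρ : 0 < ρ) (hv : vert c < vert w)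
    (hh : ‖horiz w - horiz c‖ ≤ ρ) : w ∈ sphere c ρ ↔ vert w = vert c + √(ρ ^ 2 - ‖horiz w - horiz c‖ ^ 2) := by
  have h1 := norm_sq_eq (w - c)
  rw [horiz_sub, vert_sub] at h1
  have h2 : 0 ≤ ρ ^ 2 - ‖horiz w - horiz c‖ ^ 2 := by
    have := norm_nonneg (horiz w - horiz c)
    nlinarith
  rw [mem_sphere_iff_norm, ← sq_eq_sq₀ (norm_nonneg _) hρ.le, h1, ← sub_eq_iff_eq_add',
    eq_comm (b := √_), Real.sqrt_eq_iff_eq_sq h2 (by linarith)]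
  constructor <;> intro h <;> linarith

/-- Spheres in a chart converge smoothly. -/
theorem graphConv_sphere {e : Chart n M}
    (he : e ∈ MaxAtlas n M) {c : Y → Amb n} {c₀ : Amb n} {ρ : Y → ℝ}
    {ρ₀ : ℝ} (hc : Tendsto c l (𝓝 c₀)) (hρ : Tendsto ρ l (𝓝 ρ₀)) (hρ₀ : 0 < ρ₀)
    (hs : ∀ᶠ y in l, sphere (c y) (ρ y) ⊆ e.target) (hs₀ : sphere c₀ ρ₀ ⊆ e.target)
    {x : Amb n} (hx : x ∈ sphere c₀ ρ₀) : GraphConv (n := n) l (fun y => e.symm '' sphere (c y) (ρ y))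
      (e.symm '' sphere c₀ ρ₀) (e.symm x) := by
  set A : Amb n ≃ₗᵢ[ℝ] Amb n := Submodule.reflection (ℝ ∙ ((x - c₀) - ρ₀ • up n))ᗮ with hA
  have hAx : A (x - c₀) = ρ₀ • up n := by
    refine Submodule.reflection_sub ?_
    rw [mem_sphere_iff_norm.1 hx, norm_smul, norm_up, mul_one, Real.norm_of_nonneg hρ₀.le]
  have hAx' : A x = A c₀ + ρ₀ • up n := by rw [← hAx, map_sub]; abel
  set φ : OpenPartialHomeomorph (Amb n) (Amb n) := A.toHomeomorph.toOpenPartialHomeomorph with hφ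
  have he' : e.trans φ ∈ MaxAtlas n M := trans_mem_maximalAtlas he A.contDiff.contDiffOn A.symm.contDiff.contDiffOn
  have hsymm : ∀ w, (e.trans φ).symm w = e.symm (A.symm w) := fun w => rfl
  have hxt : x ∈ e.target := hs₀ hx
  have hopen : IsOpen (A.symm ⁻¹' e.target) := e.open_target.preimage A.symm.continuous
  obtain ⟨R, hR, hcb⟩ := exists_cbox_subset (hopen.mem_nhds (show A x ∈ A.symm ⁻¹' e.target by
    rw [mem_preimage, A.symm_apply_apply]; exact hxt))
  have hmem : ∀ {c : Amb n} {ρ : ℝ}, sphere c ρ ⊆ e.target → ∀ w ∈ A.symm ⁻¹' e.target,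
      (e.symm (A.symm w) ∈ e.symm '' sphere c ρ ↔ w ∈ sphere (A c) ρ) := by
    intro c ρ hcρ w hw
    rw [e.symm.injOn.mem_image_iff hcρ hw, mem_sphere_iff_norm, mem_sphere_iff_norm,
      ← A.norm_map (A.symm w - c), map_sub, A.apply_symm_apply]
  have hAc : Tendsto (fun y => A (c y)) l (𝓝 (A c₀)) := (A.continuous.tendsto c₀).comp hc
  have hvx : vert (A x) = vert (A c₀) + ρ₀ := by
    rw [hAx', vert_add, vert_smul]; simp [up]
  have hhx : horiz (A x) = horiz (A c₀) := by
    rw [hAx', horiz_add, horiz_smul]; simp [up]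
  set δ := min R (ρ₀ / 2)
  have hδ : 0 < δ := lt_min hR (half_pos hρ₀)
  have hδR : δ ≤ R := min_le_left _ _
  have hδρ : δ ≤ ρ₀ / 2 := min_le_right _ _
  have hbt : box (A x) δ δ ⊆ A.symm ⁻¹' e.target := box_subset_cbox.trans (hcb δ hδR δ hδR)
  have key := graphConv_of_graph (l := l) (Γ := fun y => e.symm '' sphere (c y) (ρ y))
    (Γ₀ := e.symm '' sphere c₀ ρ₀) he' (x₀ := A x) ?_ hδ hδ
    (g := fun y z => vert (A (c y)) + √(ρ y ^ 2 - ‖z - horiz (A (c y))‖ ^ 2))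
    (g₀ := fun z => vert (A c₀) + √(ρ₀ ^ 2 - ‖z - horiz (A c₀)‖ ^ 2)) ?_ ?_ ?_ ?_ ?_
  · rwa [hsymm, A.symm_apply_apply] at key
  · refine ⟨by simp [hφ], ?_⟩
    change A.symm (A x) ∈ e.target
    rwa [A.symm_apply_apply]
  · have h1 : ∀ᶠ y in l, vert (A (c y)) < vert (A c₀) + ρ₀ / 2 :=
      ((continuous_vert.tendsto _).comp hAc).eventually (gt_mem_nhds (by linarith))
    have h2 : ∀ᶠ y in l, ‖horiz (A c₀) - horiz (A (c y))‖ + ρ₀ / 2 < ρ y := by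
      have t1 : Tendsto (fun y => ‖horiz (A c₀) - horiz (A (c y))‖ + ρ₀ / 2) l (𝓝 (0 + ρ₀ / 2)) := by
        have := (tendsto_const_nhds (x := horiz (A c₀))).sub ((continuous_horiz.tendsto _).comp hAc)
        simpa using this.norm.add_const (ρ₀ / 2)
      exact t1.eventually_lt hρ (by linarith)
    filter_upwards [h1, h2, hs] with y hy1 hy2 hys w hw
    rw [hsymm, hmem hys w (hbt hw)]
    have hw1 := hw.1
    have hw2 := abs_lt.1 hw.2
    rw [hhx] at hw1
    have h3 : ‖horiz w - horiz (A (c y))‖ ≤ ‖horiz w - horiz (A c₀)‖ + ‖horiz (A c₀) - horiz (A (c y))‖ :=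
      norm_sub_le_norm_sub_add_norm_sub _ _ _
    have h4 := norm_nonneg (horiz (A c₀) - horiz (A (c y)))
    exact mem_sphere_iff_graph (by linarith) (by linarith) (by linarith)
  · intro w hw
    rw [hsymm, hmem hs₀ w (hbt hw)]
    have hw1 := hw.1
    have hw2 := abs_lt.1 hw.2
    rw [hhx] at hw1
    exact mem_sphere_iff_graph hρ₀ (by linarith) (by linarith)
  · rw [hvx, hhx]
    simp [Real.sqrt_sq hρ₀.le]
  · intro z hz
    rw [hhx, mem_ball, dist_eq_norm] at hz
    exact (cv_sphere hAc hρ (by linarith)).smooth.right.self_of_nhds.contDiffWithinAt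
  · intro z hz
    rw [hhx, mem_ball, dist_eq_norm] at hz
    exact cv_sphere hAc hρ (by linarith)

end SphereGraph

section SphereArea

variable {e : Chart n M}

theorem sphere_area_lt_top (he : e ∈ MaxAtlas n M) {c : Amb n} {ρ : ℝ}
    (hρ : 0 < ρ) (hs : sphere c ρ ⊆ e.target) : μHE[n] (e.symm '' sphere c ρ) < ⊤ := by
  have hK : IsCompact (e.symm '' sphere c ρ) :=
    (isCompact_sphere c ρ).image_of_continuousOn (e.continuousOn_symm.mono hs)
  have := measure_lt_top_of_isCompact (n := n) (l := (pure () : Filter Unit))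
    (Γ := fun _ => e.symm '' sphere c ρ) (Γ₀ := e.symm '' sphere c ρ) hK ?_
  · rwa [inter_self] at this
  · rintro _ ⟨x, hx, rfl⟩
    exact (graphConv_sphere he tendsto_const_nhds tendsto_const_nhds hρ (Eventually.of_forall fun _ => hs)
      hs hx).areaConv

theorem sphere_area_pos {V : Set M} {K : NNReal} (hV : LipschitzOnWith K e V) {c : Amb n} {ρ : ℝ}
    (hρ : 0 < ρ) (hs : sphere c ρ ⊆ e.target) (hsV : e.symm '' sphere c ρ ⊆ V) :
    0 < μHE[n] (e.symm '' sphere c ρ) := by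
  have h1 : LipschitzOnWith (1 * K) (fun p => horiz (e p)) (e.symm '' sphere c ρ) := by
    refine LipschitzWith.comp_lipschitzOnWith (f := (horiz : Amb n → Hor n)) ?_ (hV.mono hsV)
    refine LipschitzWith.of_dist_le_mul fun x y => ?_
    rw [dist_eq_norm, dist_eq_norm, ← horiz_sub]
    simpa using norm_horiz_le (x - y)
  have h2 := area_image_le h1 n
  have h3 : ball (horiz c) ρ ⊆ (fun p => horiz (e p)) '' (e.symm '' sphere c ρ) := by
    intro z hz
    rw [mem_ball, dist_eq_norm] at hz
    have hw : join z (vert c + √(ρ ^ 2 - ‖z - horiz c‖ ^ 2)) ∈ sphere c ρ := by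
      have hpos : 0 < ρ ^ 2 - ‖z - horiz c‖ ^ 2 := by nlinarith [norm_nonneg (z - horiz c)]
      rw [mem_sphere_iff_graph hρ] <;> simp [hz.le, Real.sqrt_pos.2 hpos]
    refine ⟨_, mem_image_of_mem _ hw, ?_⟩
    simp only [e.right_inv (hs hw), horiz_join]
  have h4 : 0 < μHE[n] (ball (horiz c) ρ) := by
    rw [EuclideanSpace.euclideanHausdorffMeasure_eq_volume]
    exact measure_ball_pos volume _ hρ
  have h5 := h4.trans_le ((measure_mono h3).trans h2)
  exact (ENNReal.mul_pos_iff.1 h5).2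

/-- Comparison of the areas of two spheres in a chart. -/
theorem exists_sphere_area_le (he : e ∈ MaxAtlas n M) {s : Set (Amb n)}
    (hs : s ∈ 𝓝 0) (h0 : (0 : Amb n) ∈ e.target) :
    ∃ Λ ≥ (1 : ℝ), ∃ R' > 0, 4 * R' ≤ 1 ∧ 2 * R' * Λ ≤ 1 ∧ ∃ κ > 0, κ ≤ R' ∧ ball 0 κ ⊆ s ∩ e.target ∧
      (∀ c ρ, 0 < ρ → sphere c ρ ⊆ ball 0 κ → 0 < μHE[n] (e.symm '' sphere c ρ) ∧ μHE[n] (e.symm '' sphere c ρ) < ⊤) ∧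
      ∀ (c c' : Amb n) (ρ q μ δ : ℝ), 0 < ρ → 0 < q → q ≤ 2 → 0 < μ → μ ≤ 1 → 0 ≤ δ → δ ≤ 1 →
        |q - μ| ≤ μ * δ → c ∈ ball 0 κ → c' ∈ ball 0 κ → sphere c ρ ⊆ ball 0 κ →
        (∀ x ∈ ball (0 : Amb n) R', ‖c' + q • (x - c) - x‖ ≤ δ) → μHE[n] (e.symm '' sphere c' (q * ρ)) ≤
          ENNReal.ofReal (μ * (1 + Λ * δ)) ^ n * μHE[n] (e.symm '' sphere c ρ) := by
  obtain ⟨R, hR, hRt, Λ, hΛ, hmain⟩ := exists_lipschitz_conj he h0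
  obtain ⟨L, V₂, hV₂, hV₂s, hL⟩ := exists_lipschitz_chart he (e.map_target h0)
  set R' := min (R / 6) (1 / (4 * Λ)) with hR'
  have hR'0 : 0 < R' := lt_min (by positivity) (by positivity)
  have hR'R : 6 * R' ≤ R := by have := min_le_left (R / 6) (1 / (4 * Λ)); linarith
  have hR'Λ : 4 * (R' * Λ) ≤ 1 := by
    have h1 := min_le_right (R / 6) (1 / (4 * Λ))
    rw [← hR', le_div_iff₀ (by positivity)] at h1
    linarith
  have hRle : R' ≤ R' * Λ := by nlinarith
  obtain ⟨V, hV, hVs, hLip⟩ := hmain R' hR'0 (by linarith)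
  have hn1 : s ∩ (e.target ∩ (e.symm ⁻¹' V ∩ e.symm ⁻¹' V₂)) ∈ 𝓝 (0 : Amb n) :=
    inter_mem hs (inter_mem (e.open_target.mem_nhds h0) (inter_mem
      ((e.continuousAt_symm h0).preimage_mem_nhds hV) ((e.continuousAt_symm h0).preimage_mem_nhds hV₂)))
  obtain ⟨κ, hκ, hκs⟩ := Metric.mem_nhds_iff.1 hn1
  have hb : ball (0 : Amb n) (min κ R') ⊆ ball 0 κ := ball_subset_ball (min_le_left _ _)
  refine ⟨Λ, hΛ, R', hR'0, by linarith, by linarith, min κ R', lt_min hκ hR'0, min_le_right _ _,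
    fun x hx => ⟨(hκs (hb hx)).1, (hκs (hb hx)).2.1⟩, ?_, ?_⟩
  · intro c ρ hρ hc
    have ht : sphere c ρ ⊆ e.target := fun x hx => (hκs (hb (hc hx))).2.1
    refine ⟨sphere_area_pos hL hρ ht ?_, sphere_area_lt_top he hρ ht⟩
    rintro _ ⟨x, hx, rfl⟩
    exact (hκs (hb (hc hx))).2.2.2
  · intro c c' ρ q μ δ hρ hq hq2 hμ hμ1 hδ hδ1 hqμ hc hc' hcs hdisp
    have hcR := (mem_ball_zero_iff.1 hc).trans_le (min_le_right κ R')
    have hcR' := (mem_ball_zero_iff.1 hc').trans_le (min_le_right κ R')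
    have hΦ : LipschitzOnWith (Real.toNNReal (μ * (1 + Λ * δ)))
        (fun p => e.symm (c' + q • (e p - c))) V := by
      refine hLip (fun x => c' + q • (x - c)) μ δ hμ hμ1 hδ hδ1 (by fun_prop) ?_ hdisp ?_
      · intro x hx
        rw [mem_ball_zero_iff] at hx ⊢
        have h1 : ‖c' + q • (x - c)‖ ≤ ‖c'‖ + q * (‖x‖ + ‖c‖) := by
          refine (norm_add_le _ _).trans ?_
          rw [norm_smul, Real.norm_of_nonneg hq.le]
          gcongr
          exact norm_sub_le _ _
        nlinarith [norm_nonneg x, norm_nonneg c]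
      · intro x _ w
        have h1 : HasFDerivAt (fun x : Amb n => c' + q • (x - c)) (q • ContinuousLinearMap.id ℝ (Amb n)) x :=
          (((hasFDerivAt_id x).sub_const c).const_smul q).const_add c'
        rw [h1.fderiv]
        change ‖q • w - μ • w‖ ≤ _
        rw [← sub_smul, norm_smul, Real.norm_eq_abs]
        gcongr
    have himg : e.symm '' sphere c' (q * ρ) = (fun p => e.symm (c' + q • (e p - c))) '' (e.symm '' sphere c ρ) := by
      rw [image_image]
      have h1 : sphere c' (q * ρ) = (fun x => c' + q • (x - c)) '' sphere c ρ := by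
        ext w
        constructor
        · intro hw
          refine ⟨c + q⁻¹ • (w - c'), ?_, ?_⟩
          · rw [mem_sphere_iff_norm] at hw ⊢
            rw [add_sub_cancel_left, norm_smul, hw, Real.norm_of_nonneg (by positivity)]
            field_simp
          · simp [smul_smul, hq.ne']
        · rintro ⟨x, hx, rfl⟩
          rw [mem_sphere_iff_norm] at hx ⊢
          rw [add_sub_cancel_left, norm_smul, hx, Real.norm_of_nonneg hq.le]
      rw [h1, image_image]
      refine image_congr fun x hx => ?_
      rw [e.right_inv (hκs (hb (hcs hx))).2.1]
    rw [himg]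
    refine area_image_le (hΦ.mono ?_) n
    rintro _ ⟨x, hx, rfl⟩
    exact (hκs (hb (hcs hx))).2.2.1

end SphereArea

/-- The inverse of a family of strictly increasing functions is continuous. -/
theorem exists_continuous_inverse {X : Type*} [TopologicalSpace X] {V : Set X} (hV : IsCompact V)
    {ρ₁ : ℝ} (hρ₁ : 0 < ρ₁) {A : X → ℝ → ℝ}
    (hA : ContinuousOn (fun p : X × ℝ => A p.1 p.2) (V ×ˢ Icc 0 ρ₁)) (h0 : ∀ v ∈ V, A v 0 = 0)
    (hmono : ∀ v ∈ V, StrictMonoOn (A v) (Icc 0 ρ₁)) :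
    ∃ H > 0, ∃ Rad : X → ℝ → ℝ, ContinuousOn (fun p : X × ℝ => Rad p.1 p.2) (V ×ˢ Icc 0 H) ∧
      ∀ v ∈ V, Rad v 0 = 0 ∧ ∀ h ∈ Icc 0 H, Rad v h ∈ Icc 0 ρ₁ ∧ A v (Rad v h) = h := by
  have m0 : (0 : ℝ) ∈ Icc 0 ρ₁ := ⟨le_rfl, hρ₁.le⟩
  have m1 : ρ₁ ∈ Icc 0 ρ₁ := ⟨hρ₁.le, le_rfl⟩
  obtain ⟨H, hH, hHA⟩ : ∃ H > 0, ∀ v ∈ V, H ≤ A v ρ₁ := by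
    rcases V.eq_empty_or_nonempty with rfl | hne
    · exact ⟨1, one_pos, by simp⟩
    · obtain ⟨v, hv, hmin⟩ := hV.exists_isMinOn hne (f := fun v => A v ρ₁)
        (hA.comp (f := fun v => (v, ρ₁)) (by fun_prop) fun v hv => ⟨hv, m1⟩)
      exact ⟨A v ρ₁, by rw [← h0 v hv]; exact hmono v hv m0 m1 hρ₁, fun w hw => hmin hw⟩
  have hex : ∀ v ∈ V, ∀ h ∈ Icc 0 H, ∃ ρ ∈ Icc 0 ρ₁, A v ρ = h := by
    intro v hv h hh
    have hc : ContinuousOn (A v) (Icc 0 ρ₁) :=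
      hA.comp (f := fun ρ => (v, ρ)) (by fun_prop) fun ρ hρ => ⟨hv, hρ⟩
    exact intermediate_value_Icc hρ₁.le hc ⟨by rw [h0 v hv]; exact hh.1, hh.2.trans (hHA v hv)⟩
  classical
  set Rad : X → ℝ → ℝ := fun v h => if hx : ∃ ρ ∈ Icc 0 ρ₁, A v ρ = h then hx.choose else 0
  have hRad : ∀ v ∈ V, ∀ h ∈ Icc 0 H, Rad v h ∈ Icc 0 ρ₁ ∧ A v (Rad v h) = h := by
    intro v hv h hh
    have hx := hex v hv h hh
    simp only [Rad, dif_pos hx]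
    exact hx.choose_spec
  refine ⟨H, hH, Rad, ?_, fun v hv => ⟨?_, hRad v hv⟩⟩
  · rintro ⟨v, h⟩ ⟨hv, hh⟩
    refine Metric.tendsto_nhds.2 fun ε hε => ?_
    have hK : IsCompact (Icc 0 ρ₁ ∩ {ρ | ε ≤ dist ρ (Rad v h)}) :=
      isCompact_Icc.inter_right (isClosed_le continuous_const (continuous_id.dist continuous_const))
    have key := hK.eventually_forall_filter (l := 𝓝[V ×ˢ Icc 0 H] (v, h))
      (Q := fun p ρ => ρ ∈ Icc 0 ρ₁ → A p.1 ρ ≠ p.2) (by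
        rintro ρ ⟨hρ, hρε⟩
        have hne : A v ρ - h ≠ 0 := by
          intro h1
          have h2 := (hmono v hv).injOn hρ (hRad v hv h hh).1
            ((sub_eq_zero.1 h1).trans (hRad v hv h hh).2.symm)
          rw [mem_ofPred_eq, h2, dist_self] at hρε
          linarith
        have t1 : Tendsto (fun q : (X × ℝ) × ℝ => A q.1.1 q.2 - q.1.2)
            ((𝓝[V ×ˢ Icc 0 H] (v, h)) ×ˢ 𝓝[Icc 0 ρ₁] ρ) (𝓝 (A v ρ - h)) := by
          have t0 : Tendsto (fun q : (X × ℝ) × ℝ => (q.1.1, q.2))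
              ((𝓝[V ×ˢ Icc 0 H] (v, h)) ×ˢ 𝓝[Icc 0 ρ₁] ρ) (𝓝[V ×ˢ Icc 0 ρ₁] (v, ρ)) := by
            refine tendsto_nhdsWithin_iff.2 ⟨((continuous_fst.tendsto (v, h)).comp (tendsto_fst.mono_right
              nhdsWithin_le_nhds)).prodMk_nhds (tendsto_snd.mono_right nhdsWithin_le_nhds), ?_⟩
            filter_upwards [prod_mem_prod self_mem_nhdsWithin self_mem_nhdsWithin] with q hq
            exact ⟨hq.1.1, hq.2⟩
          exact ((hA (v, ρ) ⟨hv, hρ⟩).tendsto.comp t0).sub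
            ((continuous_snd.tendsto (v, h)).comp (tendsto_fst.mono_right nhdsWithin_le_nhds))
        obtain ⟨s, hs, t, ht, hst⟩ := mem_prod_iff.1 (t1.eventually_ne hne)
        filter_upwards [Eventually.prod_mk hs (eventually_nhdsWithin_iff.1 ht)] with q hq hqI heq
        exact hst (mk_mem_prod hq.1 (hq.2 hqI)) (sub_eq_zero.2 heq))
    filter_upwards [key, self_mem_nhdsWithin] with p hp hpm
    by_contra hcon
    exact hp _ ⟨(hRad _ hpm.1 _ hpm.2).1, not_lt.1 hcon⟩ (hRad _ hpm.1 _ hpm.2).1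
      (hRad _ hpm.1 _ hpm.2).2
  · have h1 := hRad v hv 0 ⟨le_rfl, hH.le⟩
    exact (hmono v hv).injOn h1.1 m0 (h1.2.trans (h0 v hv).symm)

section SphereRadius

variable {e : Chart n M}

/-- The center of the sphere of radius `ρ` placed over the point at height `v`. -/
def ctr (n : ℕ) (v ρ : ℝ) : Amb n := (v + 2 * ρ) • up n

@[fun_prop] theorem continuous_ctr : Continuous fun p : ℝ × ℝ => ctr n p.1 p.2 := by
  unfold ctr; fun_prop

theorem norm_ctr (v ρ : ℝ) : ‖ctr n v ρ‖ = |v + 2 * ρ| := by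
  rw [ctr, norm_smul, norm_up, mul_one, Real.norm_eq_abs]

theorem closedBall_ctr_subset {κ v ρ : ℝ} (hκ : 0 < κ) (hv : |v| ≤ κ / 8) (hρ : 0 ≤ ρ) (hρκ : ρ ≤ κ / 8) :
    closedBall (ctr n v ρ) ρ ⊆ ball 0 κ := by
  intro x hx
  rw [mem_closedBall_iff_norm] at hx
  rw [mem_ball_zero_iff]
  have h1 := norm_le_norm_sub_add x (ctr n v ρ)
  rw [norm_ctr] at h1
  have h2 := abs_add_le v (2 * ρ)
  rw [abs_of_nonneg (show (0 : ℝ) ≤ 2 * ρ by linarith)] at h2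
  linarith

theorem toReal_le_mul_of_le {a b : ENNReal} {q : ℝ} (hq : 0 ≤ q) (hb : b < ⊤)
    (h : a ≤ ENNReal.ofReal q ^ n * b) : a.toReal ≤ q ^ n * b.toReal := by
  rw [← ENNReal.ofReal_pow hq] at h
  have := ENNReal.toReal_mono (ENNReal.mul_ne_top ENNReal.ofReal_ne_top hb.ne) h
  rwa [ENNReal.toReal_mul, ENNReal.toReal_ofReal (by positivity)] at this

/-- Small spheres in a chart, sitting over a point of height `v`, are determined by their area. -/
theorem exists_sphere_radius (hn : 1 ≤ n) (he : e ∈ MaxAtlas n M)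
    {s : Set (Amb n)} (hs : s ∈ 𝓝 0) (h0 : (0 : Amb n) ∈ e.target) :
    ∃ κ > 0, ball 0 κ ⊆ s ∩ e.target ∧ ∀ ρ₁, 0 < ρ₁ → ρ₁ ≤ κ / 8 → ∃ H > 0, ∃ Rad : ℝ → ℝ → ℝ,
      ContinuousOn (fun p : ℝ × ℝ => Rad p.1 p.2) (Icc (-(κ / 8)) (κ / 8) ×ˢ Icc 0 H) ∧
      ∀ v ∈ Icc (-(κ / 8)) (κ / 8), Rad v 0 = 0 ∧ ∀ h ∈ Icc 0 H, Rad v h ∈ Icc 0 ρ₁ ∧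
        area n (e.symm '' sphere (ctr n v (Rad v h)) (Rad v h)) = h := by
  obtain ⟨Λ, hΛ, R', hR', hR'1, hR'Λ, κ, hκ, hκR', hball, hfin, hcomp⟩ := exists_sphere_area_le he hs h0
  set A : ℝ → ℝ → ℝ := fun v ρ => area n (e.symm '' sphere (ctr n v ρ) ρ) with hA
  have hsub : ∀ {v ρ : ℝ}, v ∈ Icc (-(κ / 8)) (κ / 8) → 0 ≤ ρ → ρ ≤ κ / 8 →
      sphere (ctr n v ρ) ρ ⊆ ball 0 κ := fun hv h1 h2 =>
    sphere_subset_closedBall.trans (closedBall_ctr_subset hκ (abs_le.2 hv) h1 h2)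
  have hctr : ∀ {v ρ : ℝ}, v ∈ Icc (-(κ / 8)) (κ / 8) → 0 ≤ ρ → ρ ≤ κ / 8 → ctr n v ρ ∈ ball 0 κ :=
    fun hv h1 h2 => closedBall_ctr_subset hκ (abs_le.2 hv) h1 h2 (mem_closedBall_self h1)
  have hA0 : ∀ v, A v 0 = 0 := by
    intro v
    simp only [hA, sphere_zero, image_singleton, area]
    rw [area_singleton hn, ENNReal.toReal_zero]
  have hApos : ∀ {v ρ : ℝ}, v ∈ Icc (-(κ / 8)) (κ / 8) → 0 < ρ → ρ ≤ κ / 8 → 0 < A v ρ := fun hv h1 h2 =>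
    ENNReal.toReal_pos (hfin _ _ h1 (hsub hv h1.le h2)).1.ne' (hfin _ _ h1 (hsub hv h1.le h2)).2.ne
  have hcmp : ∀ {v v' ρ q μ δ : ℝ}, v ∈ Icc (-(κ / 8)) (κ / 8) → v' ∈ Icc (-(κ / 8)) (κ / 8) →
      0 < ρ → ρ ≤ κ / 8 → 0 < q → q ≤ 2 → q * ρ ≤ κ / 8 → 0 < μ → μ ≤ 1 → 0 ≤ δ → δ ≤ 1 → |q - μ| ≤ μ * δ →
      (∀ x ∈ ball (0 : Amb n) R', ‖ctr n v' (q * ρ) + q • (x - ctr n v ρ) - x‖ ≤ δ) →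
      A v' (q * ρ) ≤ (μ * (1 + Λ * δ)) ^ n * A v ρ := by
    intro v v' ρ q μ δ hv hv' hρ hρκ hq hq2 hqκ hμ hμ1 hδ hδ1 hqμ hd
    exact toReal_le_mul_of_le (by positivity) (hfin _ _ hρ (hsub hv hρ.le hρκ)).2
      (hcomp _ _ ρ q μ δ hρ hq hq2 hμ hμ1 hδ hδ1 hqμ (hctr hv hρ.le hρκ)
        (hctr hv' (by positivity) hqκ) (hsub hv hρ.le hρκ) hd)
  have hmono : ∀ v ∈ Icc (-(κ / 8)) (κ / 8), StrictMonoOn (A v) (Icc 0 (κ / 8)) := by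
    intro v hv ρ hρ ρ' hρ' hlt
    rcases hρ.1.eq_or_lt with h | h
    · rw [← h, hA0]
      exact hApos hv (h.trans_lt hlt) hρ'.2
    have hρ'0 : 0 < ρ' := h.trans hlt
    set q := ρ / ρ' with hq
    have hq0 : 0 < q := by positivity
    have hq1 : q < 1 := (div_lt_one hρ'0).2 hlt
    have hqρ : q * ρ' = ρ := by rw [hq]; field_simp
    have key := hcmp (v := v) (v' := v) (ρ := ρ') (q := q) (μ := q) (δ := (1 - q) * (2 * R')) hv hv hρ'0
      hρ'.2 hq0 (by linarith) (by rw [hqρ]; exact hρ.2) hq0 hq1.le (by nlinarith) (by nlinarith)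
      (by rw [sub_self, abs_zero]; have : 0 ≤ 1 - q := by linarith
          positivity) ?_
    · rw [hqρ] at key
      refine key.trans_lt ?_
      have hb0 : 0 ≤ q * (1 + Λ * ((1 - q) * (2 * R'))) := by
        have : 0 ≤ 1 - q := by linarith
        positivity
      have hb1 : q * (1 + Λ * ((1 - q) * (2 * R'))) < 1 := by
        have h3 : Λ * ((1 - q) * (2 * R')) ≤ 1 - q := by
          have : 0 ≤ 1 - q := by linarith
          calc Λ * ((1 - q) * (2 * R')) = (1 - q) * (2 * R' * Λ) := by ring
            _ ≤ (1 - q) * 1 := by gcongr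
            _ = 1 - q := mul_one _
        nlinarith
      have h4 := pow_lt_one₀ hb0 hb1 (by omega : n ≠ 0)
      have h5 := hApos hv hρ'0 hρ'.2
      nlinarith
    · intro x hx
      rw [mem_ball_zero_iff] at hx
      have h1 : ctr n v (q * ρ') + q • (x - ctr n v ρ') - x = (1 - q) • (v • up n - x) := by
        simp only [ctr]; module
      rw [h1, norm_smul, Real.norm_of_nonneg (by linarith)]
      have h2 : ‖v • up n - x‖ ≤ 2 * R' := by
        refine (norm_sub_le _ _).trans ?_
        rw [norm_smul, norm_up, mul_one, Real.norm_eq_abs]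
        have := abs_le.2 hv
        linarith
      have : 0 ≤ 1 - q := by linarith
      gcongr
  have hzero : ∃ C : ℝ, ∀ v ∈ Icc (-(κ / 8)) (κ / 8), ∀ ρ ∈ Icc 0 (κ / 8), A v ρ ≤ C * ρ := by
    set ρ₂ := κ / 8 with hρ₂
    have hρ₂0 : 0 < ρ₂ := by positivity
    have hm0 : (0 : ℝ) ∈ Icc (-ρ₂) ρ₂ := ⟨by linarith, hρ₂0.le⟩
    refine ⟨(1 + Λ) ^ n / ρ₂ * A 0 ρ₂, fun v hv ρ hρ => ?_⟩
    rcases hρ.1.eq_or_lt with h | h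
    · rw [← h, hA0, mul_zero]
    have hq0 : 0 < ρ / ρ₂ := by positivity
    have hq1 : ρ / ρ₂ ≤ 1 := (div_le_one hρ₂0).2 hρ.2
    have hqρ : ρ / ρ₂ * ρ₂ = ρ := by field_simp
    have key := hcmp (v := 0) (v' := v) (ρ := ρ₂) (q := ρ / ρ₂) (μ := ρ / ρ₂) (δ := 1) hm0 hv hρ₂0 le_rfl
      hq0 (by linarith) (by rw [hqρ]; exact hρ.2) hq0 hq1 zero_le_one le_rfl (by simp [hq0.le]) ?_
    · rw [hqρ] at key
      refine key.trans ?_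
      rw [mul_one, mul_pow]
      have h1 : (ρ / ρ₂) ^ n ≤ ρ / ρ₂ := pow_le_of_le_one hq0.le hq1 (by omega)
      have h2 := (hApos hm0 hρ₂0 le_rfl).le
      calc (ρ / ρ₂) ^ n * (1 + Λ) ^ n * A 0 ρ₂ ≤ (ρ / ρ₂) * (1 + Λ) ^ n * A 0 ρ₂ := by gcongr
        _ = (1 + Λ) ^ n / ρ₂ * A 0 ρ₂ * ρ := by ring
    · intro x hx
      rw [mem_ball_zero_iff] at hx
      have h1 := mem_ball_zero_iff.1 (hctr hv hρ.1 hρ.2)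
      have h2 := mem_ball_zero_iff.1 (hctr hm0 hρ₂0.le le_rfl)
      rw [hqρ]
      have h3 : ‖ctr n v ρ + (ρ / ρ₂) • (x - ctr n 0 ρ₂) - x‖ ≤ ‖ctr n v ρ‖ + 1 * (‖x‖ + ‖ctr n 0 ρ₂‖) + ‖x‖ := by
        refine (norm_sub_le _ _).trans (add_le_add_left ((norm_add_le _ _).trans
          (add_le_add_right ?_ _)) _)
        rw [norm_smul, Real.norm_of_nonneg hq0.le]
        gcongr
        exact norm_sub_le _ _
      linarith
  have hcont : ContinuousOn (fun p : ℝ × ℝ => A p.1 p.2) (Icc (-(κ / 8)) (κ / 8) ×ˢ Icc 0 (κ / 8)) := by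
    rintro ⟨v, ρ⟩ ⟨hv, hρ⟩
    have hl : 𝓝[Icc (-(κ / 8)) (κ / 8) ×ˢ Icc 0 (κ / 8)] (v, ρ) ≤ 𝓝 (v, ρ) := nhdsWithin_le_nhds
    have hmem : ∀ᶠ p : ℝ × ℝ in 𝓝[Icc (-(κ / 8)) (κ / 8) ×ˢ Icc 0 (κ / 8)] (v, ρ),
        p ∈ Icc (-(κ / 8)) (κ / 8) ×ˢ Icc 0 (κ / 8) := self_mem_nhdsWithin
    rcases hρ.1.eq_or_lt with h | h
    · obtain ⟨C, hC⟩ := hzero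
      subst h
      have t1 : Tendsto (fun p : ℝ × ℝ => C * p.2) (𝓝[Icc (-(κ / 8)) (κ / 8) ×ˢ Icc 0 (κ / 8)] (v, 0)) (𝓝 0) :=
        (Continuous.tendsto' (by fun_prop) _ _ (by simp)).mono_left hl
      change Tendsto _ _ (𝓝 (A v 0))
      rw [hA0]
      exact squeeze_zero' (hmem.mono fun p hp => ENNReal.toReal_nonneg)
        (hmem.mono fun p hp => hC _ hp.1 _ hp.2) t1
    · set d : ℝ × ℝ → ℝ := fun p => |p.2 / ρ - 1| + |ρ / p.2 - 1| + ‖ctr n p.1 p.2 - ctr n v ρ‖ with hd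
      have td : Tendsto d (𝓝 (v, ρ)) (𝓝 0) := by
        have h1 : ContinuousAt d (v, ρ) := by
          refine ContinuousAt.add (ContinuousAt.add ?_ ?_) ?_
          · exact ((continuousAt_snd.div_const _).sub continuousAt_const).abs
          · exact ((continuousAt_const.div continuousAt_snd h.ne').sub continuousAt_const).abs
          · exact (continuous_ctr.continuousAt.sub continuousAt_const).norm
        have h2 : d (v, ρ) = 0 := by simp [hd, h.ne']
        rw [← h2]
        exact h1.tendsto
      have hdle : ∀ᶠ p in 𝓝 (v, ρ), d p < 1 ∧ 0 < p.2 := (td.eventually (gt_mem_nhds one_pos)).and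
          ((continuous_snd.tendsto (v, ρ)).eventually (lt_mem_nhds h))
      have hdisp : ∀ {c c' x : Amb n} {q δ : ℝ}, x ∈ ball (0 : Amb n) R' → c ∈ ball (0 : Amb n) κ →
          |q - 1| + ‖c' - c‖ ≤ δ → ‖c' + q • (x - c) - x‖ ≤ δ := by
        intro c c' x q δ hx hc hq
        rw [mem_ball_zero_iff] at hx hc
        have h1 : c' + q • (x - c) - x = (c' - c) + (q - 1) • (x - c) := by module
        rw [h1]
        refine (norm_add_le _ _).trans ?_
        rw [norm_smul, Real.norm_eq_abs]
        have h2 : ‖x - c‖ ≤ 1 := (norm_sub_le _ _).trans (by linarith)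
        nlinarith [abs_nonneg (q - 1)]
      have hub : ∀ᶠ p in 𝓝[Icc (-(κ / 8)) (κ / 8) ×ˢ Icc 0 (κ / 8)] (v, ρ),
          A p.1 p.2 ≤ (1 + Λ * d p) ^ n * A v ρ ∧ A v ρ ≤ (1 + Λ * d p) ^ n * A p.1 p.2 := by
        filter_upwards [hmem, hl hdle] with p hp ⟨hd1, hp0⟩
        have n1 := abs_nonneg (p.2 / ρ - 1)
        have n2 := abs_nonneg (ρ / p.2 - 1)
        have n3 := norm_nonneg (ctr n p.1 p.2 - ctr n v ρ)
        have hd0 : 0 ≤ d p := by positivity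
        have e1 : p.2 / ρ * ρ = p.2 := by field_simp
        have e2 : ρ / p.2 * p.2 = ρ := by field_simp
        constructor
        · have key := hcmp (v := v) (v' := p.1) (ρ := ρ) (q := p.2 / ρ) (μ := 1) (δ := d p) hv hp.1 h hρ.2
            (by positivity) (by linarith [le_abs_self (p.2 / ρ - 1)]) (by rw [e1]; exact hp.2.2) one_pos le_rfl hd0 hd1.le
            (by rw [one_mul]; linarith) ?_
          · rwa [e1, one_mul] at key
          · intro x hx
            rw [e1]
            exact hdisp hx (hctr hv h.le hρ.2) (by linarith)
        · have key := hcmp (v := p.1) (v' := v) (ρ := p.2) (q := ρ / p.2) (μ := 1) (δ := d p) hp.1 hv hp0 hp.2.2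
            (by positivity) (by linarith [le_abs_self (ρ / p.2 - 1)]) (by rw [e2]; exact hρ.2) one_pos le_rfl hd0 hd1.le
            (by rw [one_mul]; linarith) ?_
          · rwa [e2, one_mul] at key
          · intro x hx
            rw [e2]
            exact hdisp hx (hctr hp.1 hp0.le hp.2.2) (by rw [norm_sub_rev]; linarith)
      have tU : Tendsto (fun p => (1 + Λ * d p) ^ n * A v ρ) (𝓝 (v, ρ)) (𝓝 (A v ρ)) := by
        simpa using (((td.const_mul Λ).const_add 1).pow n).mul_const (A v ρ)
      have tL : Tendsto (fun p => A v ρ / (1 + Λ * d p) ^ n) (𝓝 (v, ρ)) (𝓝 (A v ρ)) := by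
        have tp : Tendsto (fun p => (1 + Λ * d p) ^ n) (𝓝 (v, ρ)) (𝓝 1) := by
          simpa using ((td.const_mul Λ).const_add 1).pow n
        have := (tendsto_const_nhds (x := A v ρ)).div tp one_ne_zero
        rwa [div_one] at this
      refine tendsto_of_tendsto_of_tendsto_of_le_of_le' (tL.mono_left hl) (tU.mono_left hl) ?_
        (hub.mono fun p hp => hp.1)
      filter_upwards [hub] with p hp
      have hd0 : 0 ≤ d p := by positivity
      rw [div_le_iff₀ (by positivity), mul_comm]
      exact hp.2
  refine ⟨κ, hκ, hball, fun ρ₁ hρ₁ hρ₁κ => ?_⟩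
  have hI : Icc 0 ρ₁ ⊆ Icc 0 (κ / 8) := Icc_subset_Icc_right hρ₁κ
  exact exists_continuous_inverse isCompact_Icc hρ₁ (hcont.mono (prod_mono_right hI)) (fun v _ => hA0 v)
    fun v hv => (hmono v hv).mono hI

end SphereRadius

section AddSphere

variable {Y : Type*} [TopologicalSpace Y]

/-- Spheres in a chart, disjoint from the surfaces `G y`, which may shrink to points of `G y`. -/
structure SphereSite (n : ℕ) [ChartedSpace (Amb n) M] (D : Set Y)
    (G : Y → Set M) where
  e : Chart n M
  he : e ∈ MaxAtlas n M
  c : Y → Amb n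
  ρ : Y → ℝ
  Z : Set Y
  isClosed_Z : IsClosed Z
  c_cont : ContinuousOn c (D ∩ Z)
  ρ_cont : ContinuousOn ρ D
  ρ_nonneg : ∀ y ∈ D, 0 ≤ ρ y
  mem_Z : ∀ y ∈ D, 0 < ρ y → y ∈ Z
  target : ∀ y ∈ D ∩ Z, closedBall (c y) (ρ y) ⊆ e.target
  base : ∀ y ∈ D ∩ Z, ρ y = 0 → e.symm (c y) ∈ G y
  disj : ∀ y ∈ D, 0 < ρ y → Disjoint (e.symm '' closedBall (c y) (ρ y)) (G y)
  small : ∀ y ∈ D, ρ y = 0 → ∀ ε > 0, ∀ᶠ z in 𝓝[D] y, 0 < ρ z → μHE[n] (e.symm '' sphere (c z) (ρ z)) ≤ ε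

namespace SphereSite

variable {D : Set Y} {G Θ Q : Y → Set M} (σ : SphereSite n D G)

/-- The closed ball bounded by the sphere. -/
def cball (y : Y) : Set M := σ.e.symm '' closedBall (σ.c y) (σ.ρ y)

/-- The open ball bounded by the sphere. -/
def oball (y : Y) : Set M := σ.e.symm '' ball (σ.c y) (σ.ρ y)

/-- The sphere. -/
def sph (y : Y) : Set M := σ.e.symm '' sphere (σ.c y) (σ.ρ y)

open Classical in
/-- The surface together with the sphere. -/
def addG (y : Y) : Set M := if 0 < σ.ρ y then G y ∪ σ.sph y else G y

open Classical in
/-- The open set bounded by the surface and the sphere. -/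
def addΘ (Θ : Y → Set M) (y : Y) : Set M :=
  if 0 < σ.ρ y then Θ y \ σ.cball y ∪ σ.oball y \ Θ y else Θ y

def addQ (Q : Y → Set M) (y : Y) : Set M := Q y ∪ {p | p = σ.e.symm (σ.c y)}

variable {σ} {y : Y}

theorem addG_of_pos (hρ : 0 < σ.ρ y) : σ.addG y = G y ∪ σ.sph y := if_pos hρ

theorem addΘ_of_pos (hρ : 0 < σ.ρ y) : σ.addΘ Θ y = Θ y \ σ.cball y ∪ σ.oball y \ Θ y := if_pos hρ

theorem add_of_not_pos (hρ : ¬0 < σ.ρ y) : σ.addG y = G y ∧ σ.addΘ Θ y = Θ y := ⟨if_neg hρ, if_neg hρ⟩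

theorem sph_subset_cball : σ.sph y ⊆ σ.cball y := image_mono sphere_subset_closedBall

theorem oball_subset_cball : σ.oball y ⊆ σ.cball y := image_mono ball_subset_closedBall

theorem target_of_pos (hy : y ∈ D) (hρ : 0 < σ.ρ y) : closedBall (σ.c y) (σ.ρ y) ⊆ σ.e.target :=
  σ.target y ⟨hy, σ.mem_Z y hy hρ⟩

theorem disjoint_sph_oball (hy : y ∈ D) (hρ : 0 < σ.ρ y) : Disjoint (σ.sph y) (σ.oball y) := by
  have ht := target_of_pos hy hρ
  refine disjoint_left.2 ?_
  rintro _ ⟨u, hu, rfl⟩ ⟨w, hw, h⟩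
  rw [σ.e.symm.injOn (ht (ball_subset_closedBall hw)) (ht (sphere_subset_closedBall hu)) h] at hw
  exact (mem_ball.1 hw).ne hu

theorem isOpen_oball (hy : y ∈ D) (hρ : 0 < σ.ρ y) : IsOpen (σ.oball y) :=
  σ.e.symm.isOpen_image_of_subset_source isOpen_ball
    (ball_subset_closedBall.trans (target_of_pos hy hρ))

theorem isClosed_cball (hy : y ∈ D ∩ σ.Z) : IsClosed (σ.cball y) := ((isCompact_closedBall _ _).image_of_continuousOn
    (σ.e.continuousOn_symm.mono (σ.target y hy))).isClosed

theorem sph_or_oball {x : M} (hx : x ∈ σ.cball y) : x ∈ σ.sph y ∨ x ∈ σ.oball y := by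
  obtain ⟨u, hu, rfl⟩ := hx
  rcases (mem_closedBall.1 hu).eq_or_lt with h | h
  · exact Or.inl ⟨u, h, rfl⟩
  · exact Or.inr ⟨u, h, rfl⟩

/-- Away from the ball, nothing changes. -/
theorem addG_iff {z : M} (hz : 0 < σ.ρ y → z ∉ σ.cball y) :
    (z ∈ G y ↔ z ∈ σ.addG y) ∧ (z ∈ Θ y ↔ z ∈ σ.addΘ Θ y) := by
  by_cases hρ : 0 < σ.ρ y
  · rw [addG_of_pos hρ, addΘ_of_pos hρ]
    have h1 : z ∉ σ.sph y := fun h => hz hρ (sph_subset_cball h)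
    have h2 : z ∉ σ.oball y := fun h => hz hρ (oball_subset_cball h)
    simp [h1, h2, hz hρ]
  · rw [(add_of_not_pos (Θ := Θ) hρ).1, (add_of_not_pos (Θ := Θ) hρ).2]
    exact ⟨Iff.rfl, Iff.rfl⟩

/-- Inside the ball, the surface is empty and the open set is replaced by its complement. -/
theorem addG_iff_of_mem_oball (hy : y ∈ D) (hρ : 0 < σ.ρ y) {z : M} (hz : z ∈ σ.oball y) :
    z ∉ σ.addG y ∧ (z ∈ σ.addΘ Θ y ↔ z ∉ Θ y) := by
  rw [addG_of_pos hρ, addΘ_of_pos hρ]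
  have h1 : z ∉ σ.sph y := fun h => disjoint_left.1 (disjoint_sph_oball hy hρ) h hz
  have h2 : z ∉ G y := disjoint_left.1 (σ.disj y hy hρ) (oball_subset_cball hz)
  simp [h1, h2, hz, oball_subset_cball hz]

theorem exists_nhd_disjoint (hy : y ∈ D) {x : M} (hx : y ∈ σ.Z → x ∉ σ.cball y) :
    ∃ V ∈ 𝓝 x, ∀ᶠ z in 𝓝[D] y, ∀ w ∈ V, 0 < σ.ρ z → w ∉ σ.cball z := by
  by_cases hyZ : y ∈ σ.Z
  swap
  · refine ⟨univ, univ_mem, ?_⟩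
    filter_upwards [self_mem_nhdsWithin, nhdsWithin_le_nhds (σ.isClosed_Z.isOpen_compl.mem_nhds hyZ)]
      with z hz hz' w _ hρ
    exact absurd (σ.mem_Z z hz hρ) hz'
  have hO : IsOpen (σ.e.target ∩ σ.e.symm ⁻¹' {x}ᶜ) := σ.e.isOpen_inter_preimage_symm isOpen_compl_singleton
  obtain ⟨δ, hδ, hsub⟩ := (isCompact_closedBall (σ.c y) (σ.ρ y)).exists_cthickening_subset_open hO
    fun u hu => ⟨σ.target y ⟨hy, hyZ⟩ hu, fun h => hx hyZ ⟨u, hu, h⟩⟩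
  rw [cthickening_closedBall hδ.le (σ.ρ_nonneg y hy)] at hsub
  have hK : IsCompact (σ.e.symm '' closedBall (σ.c y) (δ + σ.ρ y)) := (isCompact_closedBall _ _).image_of_continuousOn
      (σ.e.continuousOn_symm.mono fun u hu => (hsub hu).1)
  refine ⟨(σ.e.symm '' closedBall (σ.c y) (δ + σ.ρ y))ᶜ, hK.isClosed.isOpen_compl.mem_nhds ?_, ?_⟩
  · rintro ⟨u, hu, rfl⟩
    exact (hsub hu).2 rfl
  · have h1 : ∀ᶠ z in 𝓝[D ∩ σ.Z] y, dist (σ.c z) (σ.c y) < δ / 2 :=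
      (σ.c_cont y ⟨hy, hyZ⟩).eventually (ball_mem_nhds _ (half_pos hδ))
    have h2 : ∀ᶠ z in 𝓝[D] y, σ.ρ z < σ.ρ y + δ / 2 :=
      (σ.ρ_cont y hy).eventually (gt_mem_nhds (by linarith))
    rw [eventually_nhdsWithin_iff] at h1
    filter_upwards [nhdsWithin_le_nhds h1, h2, self_mem_nhdsWithin] with z hz1 hz2 hzD w hw hρ hwz
    refine hw (image_mono (closedBall_subset_closedBall' ?_) hwz)
    linarith [hz1 ⟨hzD, σ.mem_Z z hzD hρ⟩]

theorem measure_addG (hy : y ∈ D) (hρ : 0 < σ.ρ y) : μHE[n] (σ.addG y) = μHE[n] (G y) + μHE[n] (σ.sph y) := by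
  rw [addG_of_pos hρ, measure_union]
  · exact ((σ.disj y hy hρ).mono_left sph_subset_cball).symm
  · exact ((isCompact_sphere _ _).image_of_continuousOn (σ.e.continuousOn_symm.mono
      (sphere_subset_closedBall.trans (target_of_pos hy hρ)))).measurableSet

theorem bdAt_add (hy : y ∈ D) (h : ∀ x, BdAt (G y) (Θ y) (Q y) x) (x : M) : BdAt (σ.addG y) (σ.addΘ Θ y) (Q y) x := by
  by_cases hρ : 0 < σ.ρ y
  swap
  · rw [(add_of_not_pos (Θ := Θ) hρ).1, (add_of_not_pos (Θ := Θ) hρ).2]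
    exact h x
  by_cases hx : x ∈ σ.cball y
  swap
  · exact (h x).congr ((isClosed_cball ⟨hy, σ.mem_Z y hy hρ⟩).isOpen_compl.mem_nhds hx)
      (fun z hz => addG_iff fun _ => hz) id
  have hxG : x ∉ G y := disjoint_left.1 (σ.disj y hy hρ) hx
  have hloc := (h x).locally_const hxG
  rcases sph_or_oball hx with hxs | hxo
  · have hxo : x ∉ σ.oball y := disjoint_left.1 (disjoint_sph_oball hy hρ) hxs
    have hnot : x ∉ σ.addΘ Θ y := by
      rw [addΘ_of_pos hρ]
      simp [hx, hxo]
    refine ⟨fun h => absurd h hnot, fun _ => by rw [addG_of_pos hρ]; exact Or.inr hxs, fun _ _ => ?_⟩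
    refine ⟨?_, fun h => hnot (interior_subset h)⟩
    obtain ⟨u, hu, rfl⟩ := hxs
    have hut := target_of_pos hy hρ (sphere_subset_closedBall hu)
    rw [mem_closure_iff_frequently]
    have hcont := σ.e.continuousAt_symm hut
    by_cases hxΘ : σ.e.symm u ∈ Θ y
    · have h1 : ∃ᶠ w in 𝓝 u, w ∈ (closedBall (σ.c y) (σ.ρ y))ᶜ := by
        rw [← mem_closure_iff_frequently, closure_compl, interior_closedBall _ hρ.ne']
        intro h2
        exact (mem_ball.1 h2).ne hu
      refine hcont.tendsto.frequently ((h1.and_eventually ((hcont.eventually hloc).and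
        (σ.e.open_target.mem_nhds hut))).mono ?_)
      rintro w ⟨hw1, hw2, hw3⟩
      rw [addΘ_of_pos hρ]
      refine Or.inl ⟨hw2.2 hxΘ, ?_⟩
      rintro ⟨w', hw', hww'⟩
      rw [σ.e.symm.injOn (target_of_pos hy hρ hw') hw3 hww'] at hw'
      exact hw1 hw'
    · have h1 : ∃ᶠ w in 𝓝 u, w ∈ ball (σ.c y) (σ.ρ y) := by
        rw [← mem_closure_iff_frequently, closure_ball _ hρ.ne']
        exact sphere_subset_closedBall hu
      refine hcont.tendsto.frequently ((h1.and_eventually (hcont.eventually hloc)).mono ?_)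
      rintro w ⟨hw1, hw2⟩
      rw [addΘ_of_pos hρ]
      exact Or.inr ⟨⟨w, hw1, rfl⟩, fun h => hxΘ (hw2.1 h)⟩
  · have hN : σ.oball y ∩ {z | z ∈ Θ y ↔ x ∈ Θ y} ∈ 𝓝 x :=
      inter_mem ((isOpen_oball hy hρ).mem_nhds hxo) hloc
    have hiff : ∀ z ∈ σ.oball y ∩ {z | z ∈ Θ y ↔ x ∈ Θ y}, z ∈ σ.addΘ Θ y ↔ x ∈ σ.addΘ Θ y := by
      intro z hz
      rw [(addG_iff_of_mem_oball hy hρ hz.1).2, (addG_iff_of_mem_oball hy hρ hxo).2]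
      exact not_congr hz.2
    refine ⟨fun hx => mem_of_superset hN fun z hz => (hiff z hz).2 hx, fun hf => ?_,
      fun h => absurd h (addG_iff_of_mem_oball (Θ := Θ) hy hρ hxo).1⟩
    exfalso
    by_cases hx' : x ∈ σ.addΘ Θ y
    · exact hf.2 (mem_interior_iff_mem_nhds.2 (mem_of_superset hN fun z hz => (hiff z hz).2 hx'))
    · have := (mem_closure_iff_frequently.1 hf.1).and_eventually hN
      obtain ⟨z, hz1, hz2⟩ := this.exists
      exact hx' ((hiff z hz2).1 hz1)

theorem exists_nhd_oball {l : Filter Y} (hy : y ∈ D) (hρ : 0 < σ.ρ y) (htc : Tendsto σ.c l (𝓝 (σ.c y)))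
    (htρ : Tendsto σ.ρ l (𝓝 (σ.ρ y))) {x : M} (hx : x ∈ σ.oball y) :
    ∃ N ∈ 𝓝 x, ∀ᶠ z in l, ∀ w ∈ N, w ∈ σ.oball z := by
  obtain ⟨u, hu, rfl⟩ := hx
  have hut := target_of_pos hy hρ (ball_subset_closedBall hu)
  have hxt : σ.e.symm u ∈ σ.e.source := σ.e.map_target hut
  have t0 : Tendsto σ.e (𝓝 (σ.e.symm u)) (𝓝 u) := by
    have := (σ.e.continuousAt hxt).tendsto
    rwa [σ.e.right_inv hut] at this
  have t1 : Tendsto (fun q : Y × M => dist (σ.e q.2) (σ.c q.1) - σ.ρ q.1) (l ×ˢ 𝓝 (σ.e.symm u))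
      (𝓝 (dist u (σ.c y) - σ.ρ y)) :=
    ((t0.comp tendsto_snd).dist (htc.comp tendsto_fst)).sub (htρ.comp tendsto_fst)
  have h1 : ∀ᶠ q : Y × M in l ×ˢ 𝓝 (σ.e.symm u), dist (σ.e q.2) (σ.c q.1) - σ.ρ q.1 < 0 :=
    t1.eventually (gt_mem_nhds (sub_neg.2 (mem_ball.1 hu)))
  obtain ⟨E, hE, N, hN, hEN⟩ := mem_prod_iff.1 h1
  refine ⟨N ∩ σ.e.source, inter_mem hN (σ.e.open_source.mem_nhds hxt), ?_⟩
  filter_upwards [hE] with z hz w hw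
  have h2 : dist (σ.e w) (σ.c z) - σ.ρ z < 0 := @hEN (z, w) ⟨hz, hw.1⟩
  exact ⟨σ.e w, mem_ball.2 (sub_neg.1 h2), σ.e.left_inv hw.2⟩

theorem contFamily_add (hn : 1 ≤ n) (h : ContFamily n D G Θ Q) : ContFamily n D σ.addG (σ.addΘ Θ) (σ.addQ Q) := by
  have hfin : ∀ y ∈ D, (σ.addQ Q y).Finite := fun y hy => (h.finite y hy).union (Set.finite_singleton _)
  have k : ContFamily n D G Θ (σ.addQ Q) := h.mono_exc hn (fun y _ => subset_union_left) hfin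
  refine ⟨hfin, fun y hy x => bdAt_add hy (k.bd y hy) x, fun y hy x => ?_⟩
  by_cases hx : y ∈ σ.Z → x ∉ σ.cball y
  · obtain ⟨V, hV, hev⟩ := exists_nhd_disjoint hy hx
    refine (k.conv y hy x).congr hV (fun z hz => addG_iff (hev.self_of_nhdsWithin hy z hz)) Iff.rfl ?_
    exact hev.mono fun z hz w hw => addG_iff (hz w hw)
  push Not at hx
  obtain ⟨hyZ, hx⟩ := hx
  rcases (σ.ρ_nonneg y hy).eq_or_lt with hρ | hρ
  · have hxc : x = σ.e.symm (σ.c y) := by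
      obtain ⟨u, hu, rfl⟩ := hx
      rw [← hρ, closedBall_zero, mem_singleton_iff] at hu
      rw [hu]
    have hxG : x ∈ G y := hxc ▸ σ.base y ⟨hy, hyZ⟩ hρ.symm
    have hyG : σ.addG y = G y := (add_of_not_pos (Θ := Θ) hρ.not_lt).1
    have hsub : ∀ z, G z ⊆ σ.addG z := fun z => by
      rw [addG]
      split_ifs
      exacts [subset_union_left, subset_rfl]
    have hxQ : x ∈ σ.addQ Q y := Or.inr hxc
    refine ⟨fun _ V hV => ((k.conv y hy x).lower hxG V hV).mono fun z hz =>
      hz.mono (inter_subset_inter_left _ (hsub z)), fun h => absurd (hsub y hxG) h,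
      fun _ h => absurd hxQ h, fun _ _ ε hε => ?_⟩
    obtain ⟨V, hV, h1, h2⟩ := (k.conv y hy x).small hxG hxQ (ε / 2) (ENNReal.half_pos hε.ne')
    refine ⟨V, hV, by rw [hyG]; exact h1.trans ENNReal.half_le_self, ?_⟩
    filter_upwards [h2, σ.small y hy hρ.symm (ε / 2) (ENNReal.half_pos hε.ne')] with z hz1 hz2
    by_cases hz : 0 < σ.ρ z
    · rw [addG_of_pos hz, union_inter_distrib_right, ← ENNReal.add_halves ε]
      exact (measure_union_le _ _).trans (add_le_add hz1 ((measure_mono inter_subset_left).trans (hz2 hz)))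
    · rw [(add_of_not_pos (Θ := Θ) hz).1]
      exact hz1.trans ENNReal.half_le_self
  · have hxG : x ∉ G y := disjoint_left.1 (σ.disj y hy hρ) hx
    have hev : ∀ᶠ z in 𝓝[D] y, z ∈ D ∧ 0 < σ.ρ z :=
      Eventually.and self_mem_nhdsWithin ((σ.ρ_cont y hy).eventually (lt_mem_nhds hρ))
    have htρ : Tendsto σ.ρ (𝓝[D] y) (𝓝 (σ.ρ y)) := σ.ρ_cont y hy
    have htc : Tendsto σ.c (𝓝[D] y) (𝓝 (σ.c y)) := by
      refine (σ.c_cont y ⟨hy, hyZ⟩).tendsto.comp (f := id) (tendsto_nhdsWithin_iff.2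
        ⟨tendsto_id.mono_left nhdsWithin_le_nhds, hev.mono fun z hz => ⟨hz.1, σ.mem_Z z hz.1 hz.2⟩⟩)
    obtain ⟨V, hV, hoff⟩ := (k.conv y hy x).off hxG
    have hxt : x ∈ σ.e.source := by
      obtain ⟨u, hu, rfl⟩ := hx
      exact σ.e.map_target (target_of_pos hy hρ hu)
    rcases sph_or_oball hx with hxs | hxo
    · have hxG' : x ∈ σ.addG y := by rw [addG_of_pos hρ]; exact Or.inr hxs
      have hgc : GraphConv (n := n) (𝓝[D] y) σ.addG (σ.addG y) x := by
        obtain ⟨u, hu, rfl⟩ := hxs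
        refine (graphConv_sphere σ.he htc htρ hρ (hev.mono fun z hz => sphere_subset_closedBall.trans
          (target_of_pos hz.1 hz.2)) (sphere_subset_closedBall.trans (target_of_pos hy hρ)) hu).congr
          hV (fun w hw => ?_) ?_
        · rw [addG_of_pos hρ]
          exact ⟨Or.inr, fun h => h.resolve_left (hoff.self_of_nhdsWithin hy w hw).1⟩
        · filter_upwards [hev, hoff] with z hz1 hz2 w hw
          rw [addG_of_pos hz1.2]
          exact ⟨Or.inr, fun h => h.resolve_left (hz2 w hw).1⟩
      refine ⟨fun _ N hN => ?_, fun h => absurd hxG' h, fun _ _ => hgc, fun _ _ ε hε => hgc.small_nhdsWithin hn hy hε⟩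
      obtain ⟨u, hu, rfl⟩ := hxs
      have hut := target_of_pos hy hρ (sphere_subset_closedBall hu)
      have t1 : Tendsto (fun z => σ.c z + (σ.ρ z / σ.ρ y) • (u - σ.c y)) (𝓝[D] y) (𝓝 u) := by
        have := htc.add ((htρ.div_const (σ.ρ y)).smul_const (u - σ.c y))
        rwa [div_self hρ.ne', one_smul, add_sub_cancel] at this
      filter_upwards [hev, t1.eventually ((σ.e.continuousAt_symm hut).preimage_mem_nhds hN)] with z hz1 hz2
      refine ⟨_, ?_, hz2⟩
      rw [addG_of_pos hz1.2]
      refine Or.inr ⟨_, ?_, rfl⟩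
      rw [mem_sphere_iff_norm] at hu ⊢
      rw [add_sub_cancel_left, norm_smul, hu, Real.norm_of_nonneg (div_nonneg hz1.2.le hρ.le),
        div_mul_cancel₀ _ hρ.ne']
    · obtain ⟨N, hN, hNev⟩ := exists_nhd_oball hy hρ htc htρ hxo
      have hoff' : ∃ V ∈ 𝓝 x, ∀ᶠ z in 𝓝[D] y, ∀ w ∈ V, w ∉ σ.addG z ∧ (w ∈ σ.addΘ Θ z ↔ w ∈ σ.addΘ Θ y) := by
        refine ⟨V ∩ N, inter_mem hV hN, ?_⟩
        filter_upwards [hev, hoff, hNev] with z hz1 hz2 hz3 w hw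
        have a1 := addG_iff_of_mem_oball (Θ := Θ) hz1.1 hz1.2 (hz3 w hw.2)
        have a2 := addG_iff_of_mem_oball (Θ := Θ) hy hρ (hNev.self_of_nhdsWithin hy w hw.2)
        refine ⟨a1.1, ?_⟩
        rw [a1.2, a2.2]
        exact not_congr (hz2 w hw.1).2
      have hxG' := (addG_iff_of_mem_oball (Θ := Θ) hy hρ hxo).1
      exact ⟨fun h => absurd h hxG', fun _ => hoff', fun h => absurd h hxG', fun h => absurd h hxG'⟩

end SphereSite

end AddSphere

section AddSpheres

variable {Y : Type*} [TopologicalSpace Y]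

open Classical in
/-- The area of the added sphere. -/
def SphereSite.mass {D : Set Y} {G : Y → Set M} (σ : SphereSite n D G) (y : Y) : ENNReal :=
  if 0 < σ.ρ y then μHE[n] (σ.sph y) else 0

/-- Adding finitely many disjoint spheres. -/
theorem exists_add_spheres (hn : 1 ≤ n) {D : Set Y} {G Θ Q : Y → Set M} (h : ContFamily n D G Θ Q)
    (σ : ℕ → SphereSite n D G) (N : ℕ)
    (hdisj : ∀ y ∈ D, ∀ k < N, ∀ j < k, 0 < (σ j).ρ y → 0 < (σ k).ρ y → Disjoint ((σ j).cball y) ((σ k).cball y)) :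
    ∃ G' Θ' Q' : Y → Set M, ContFamily n D G' Θ' Q' ∧ ∀ y ∈ D, (∀ z, (∀ k < N, 0 < (σ k).ρ y → z ∉ (σ k).cball y) →
        (z ∈ G' y ↔ z ∈ G y) ∧ (z ∈ Θ' y ↔ z ∈ Θ y)) ∧ G y ⊆ G' y ∧
      μHE[n] (G' y) = μHE[n] (G y) + ∑ k ∈ Finset.range N, (σ k).mass y := by
  induction N with
  | zero => exact ⟨G, Θ, Q, h, fun y hy => ⟨fun z _ => ⟨Iff.rfl, Iff.rfl⟩, subset_rfl, by simp⟩⟩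
  | succ N ih =>
    obtain ⟨G', Θ', Q', h', hG'⟩ := ih fun y hy k hk => hdisj y hy k (hk.trans N.lt_succ_self)
    let τ : SphereSite n D G' :=
      { (σ N) with
        base := fun y hy hρ => (hG' y hy.1).2.1 ((σ N).base y hy hρ)
        disj := fun y hy hρ => by
          refine disjoint_left.2 fun z hz hzG => ?_
          have h1 := ((hG' y hy).1 z fun k hk hρk hzk =>
            disjoint_left.1 (hdisj y hy N N.lt_succ_self k hk hρk hρ) hzk hz).1
          exact disjoint_left.1 ((σ N).disj y hy hρ) hz (h1.1 hzG) }
    refine ⟨τ.addG, τ.addΘ Θ', τ.addQ Q', SphereSite.contFamily_add hn h', fun y hy => ⟨fun z hz => ?_, ?_, ?_⟩⟩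
    · have h1 := (hG' y hy).1 z fun k hk => hz k (hk.trans N.lt_succ_self)
      have h2 := SphereSite.addG_iff (σ := τ) (Θ := Θ') (y := y) (z := z) (hz N N.lt_succ_self)
      exact ⟨h2.1.symm.trans h1.1, h2.2.symm.trans h1.2⟩
    · by_cases hρ : 0 < τ.ρ y
      · rw [SphereSite.addG_of_pos hρ]
        exact (hG' y hy).2.1.trans subset_union_left
      · rw [(SphereSite.add_of_not_pos (Θ := Θ') hρ).1]
        exact (hG' y hy).2.1
    · rw [Finset.sum_range_succ, ← add_assoc, ← (hG' y hy).2.2, SphereSite.mass]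
      by_cases hρ : 0 < τ.ρ y
      · rw [SphereSite.measure_addG hy hρ, if_pos (show 0 < (σ N).ρ y from hρ)]
        rfl
      · rw [(SphereSite.add_of_not_pos (Θ := Θ') hρ).1, if_neg (show ¬0 < (σ N).ρ y from hρ), add_zero]

/-- A chart in `O` in which spheres of prescribed area can be placed above a surface. -/
structure Site (n : ℕ) [ChartedSpace (Amb n) M] (O : Set M) where
  e : Chart n M
  he : e ∈ MaxAtlas n M
  r : ℝ
  r_pos : 0 < r
  sub : ∀ x ∈ cbox (0 : Amb n) r r, x ∈ e.target ∧ e.symm x ∈ O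
  κ : ℝ
  κ_pos : 0 < κ
  ball_sub : ball 0 κ ⊆ box (0 : Amb n) r r
  rad : ∀ ρ₁, 0 < ρ₁ → ρ₁ ≤ κ / 8 → ∃ H > 0, ∃ Rad : ℝ → ℝ → ℝ,
      ContinuousOn (fun p : ℝ × ℝ => Rad p.1 p.2) (Icc (-(κ / 8)) (κ / 8) ×ˢ Icc 0 H) ∧
      ∀ v ∈ Icc (-(κ / 8)) (κ / 8), Rad v 0 = 0 ∧ ∀ h ∈ Icc 0 H, Rad v h ∈ Icc 0 ρ₁ ∧
        area n (e.symm '' sphere (ctr n v (Rad v h)) (Rad v h)) = h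

namespace Site

variable {O : Set M} (T : Site n O) {X X' : Set M}

def height (X : Set M) : ℝ := boxHeight T.e T.r X 0

/-- The surface is a flat graph in the chart. -/
structure Good (X : Set M) : Prop where
  graph : IsBoxGraph T.e T.r T.r X (boxHeight T.e T.r X)
  lip : LipschitzOnWith (1 / 2) (boxHeight T.e T.r X) (ball 0 T.r)
  height : |T.height X| ≤ T.κ / 8

def foot (X : Set M) : M := T.e.symm (join 0 (T.height X))

/-- The closed ball of radius `ρ` above the surface. -/
def cb (X : Set M) (ρ : ℝ) : Set M := T.e.symm '' closedBall (ctr n (T.height X) ρ) ρ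

variable {T}

theorem boxHeight_congr (h : ∀ z ∈ O, z ∈ X ↔ z ∈ X') {z : Hor n} (hz : ‖z‖ ≤ T.r) :
    boxHeight T.e T.r X z = boxHeight T.e T.r X' z := by
  have : (fun v => |v| < T.r ∧ T.e.symm (join z v) ∈ X) = fun v => |v| < T.r ∧ T.e.symm (join z v) ∈ X' := by
    funext v
    refine propext (and_congr_right fun hv => h _ (T.sub _ (mem_cbox_zero.2 ⟨hz, hv.le⟩)).2)
  unfold boxHeight
  classical
  have key : ∀ p q : ℝ → Prop, p = q → (if h : ∃ v, p v then h.choose else 0) =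
      (if h : ∃ v, q v then h.choose else 0) := by
    rintro p _ rfl
    rfl
  convert key _ _ this

theorem height_congr (h : ∀ z ∈ O, z ∈ X ↔ z ∈ X') : T.height X = T.height X' :=
  boxHeight_congr h (by simpa using T.r_pos.le)

theorem Good.congr (hX : T.Good X) (h : ∀ z ∈ O, z ∈ X ↔ z ∈ X') : T.Good X' where
  graph x hx := by
    rw [← h _ (T.sub x hx).2, hX.graph x hx, boxHeight_congr h (by simpa using hx.1)]
  lip x hx z hz := by
    have h1 := hX.lip hx hz
    rwa [boxHeight_congr h (mem_ball_zero_iff.1 hx).le, boxHeight_congr h (mem_ball_zero_iff.1 hz).le] at h1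
  height := by rw [← height_congr h]; exact hX.height

theorem join_eq_smul (v : ℝ) : join (0 : Hor n) v = v • up n := by
  rw [join_eq, show join (0 : Hor n) 0 = 0 from amb_ext (by simp) (by simp), zero_add]

theorem join_height_mem : join 0 (T.height X) ∈ cbox (0 : Amb n) T.r T.r :=
  mem_cbox_zero.2 ⟨by simpa using T.r_pos.le, (abs_boxHeight_lt T.r_pos X 0).le⟩

theorem Good.foot_mem (hX : T.Good X) : T.foot X ∈ X :=
  (hX.graph _ join_height_mem).2 (by rw [vert_join, horiz_join]; rfl)

theorem foot_mem_sub : T.foot X ∈ O := (T.sub _ join_height_mem).2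

theorem cball_subset (hv : |T.height X| ≤ T.κ / 8) {ρ : ℝ} (hρ : 0 ≤ ρ) (hρκ : ρ ≤ T.κ / 8) :
    closedBall (ctr n (T.height X) ρ) ρ ⊆ box (0 : Amb n) T.r T.r :=
  (closedBall_ctr_subset T.κ_pos hv hρ hρκ).trans T.ball_sub

theorem cball_target (hv : |T.height X| ≤ T.κ / 8) {ρ : ℝ} (hρ : 0 ≤ ρ) (hρκ : ρ ≤ T.κ / 8) :
    closedBall (ctr n (T.height X) ρ) ρ ⊆ T.e.target := fun x hx =>
  (T.sub x (box_subset_cbox (cball_subset hv hρ hρκ hx))).1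

theorem cb_subset (hv : |T.height X| ≤ T.κ / 8) {ρ : ℝ} (hρ : 0 ≤ ρ) (hρκ : ρ ≤ T.κ / 8) : T.cb X ρ ⊆ O := by
  rintro _ ⟨x, hx, rfl⟩
  exact (T.sub x (box_subset_cbox (cball_subset hv hρ hρκ hx))).2

@[simp] theorem vert_up : vert (up n) = 1 := by simp [up]

@[simp] theorem horiz_up : horiz (up n) = 0 := by simp [up]

theorem Good.disjoint (hX : T.Good X) {ρ : ℝ} (hρ : 0 < ρ) (hρκ : ρ ≤ T.κ / 8) : Disjoint (T.cb X ρ) X := by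
  refine disjoint_left.2 ?_
  rintro _ ⟨x, hx, rfl⟩ hxX
  have hb := cball_subset hX.height hρ.le hρκ hx
  have h1 := (hX.graph x (box_subset_cbox hb)).1 hxX
  have h2 : ‖horiz x‖ < T.r := by simpa using hb.1
  rw [mem_closedBall_iff_norm] at hx
  have h3 : ‖horiz x‖ ≤ ρ := by
    have := (norm_horiz_le (x - ctr n (T.height X) ρ)).trans hx
    simpa [ctr] using this
  have h4 : |vert x - (T.height X + 2 * ρ)| ≤ ρ := by
    have := (abs_vert_le (x - ctr n (T.height X) ρ)).trans hx
    simpa [ctr] using this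
  have h5 := hX.lip.dist_le_mul (horiz x) (mem_ball_zero_iff.2 h2) 0 (mem_ball_self T.r_pos)
  rw [← h1, dist_zero_right, Real.dist_eq] at h5
  have h6 : |vert x - T.height X| ≤ 2⁻¹ * ‖horiz x‖ := by simpa [Site.height] using h5
  have h7 := (abs_le.1 h4).1
  have h8 := (abs_le.1 h6).2
  linarith

/-- Small balls with different feet are disjoint. -/
theorem exists_disjoint {T' : Site n O} (h : T.foot X ≠ T'.foot X) :
    ∃ ρ₀ > 0, ∀ ρ ρ', 0 ≤ ρ → 0 ≤ ρ' → ρ ≤ ρ₀ → ρ' ≤ ρ₀ → Disjoint (T.cb X ρ) (T'.cb X ρ') := by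
  obtain ⟨A, B, hA, hB, hxA, hxB, hAB⟩ := t2_separation h
  have key : ∀ {T : Site n O} {A : Set M}, IsOpen A → T.foot X ∈ A →
      ∃ ρ₀ > 0, ∀ ρ, 0 ≤ ρ → ρ ≤ ρ₀ → T.cb X ρ ⊆ A := by
    intro T A hA hx
    have h1 := (T.e.continuousAt_symm (T.sub _ (join_height_mem (X := X))).1).preimage_mem_nhds (hA.mem_nhds hx)
    obtain ⟨δ, hδ, h2⟩ := Metric.mem_nhds_iff.1 h1
    refine ⟨δ / 4, by positivity, fun ρ h0 hρ => ?_⟩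
    rintro _ ⟨x, hx, rfl⟩
    refine h2 (mem_ball.2 (lt_of_le_of_lt (dist_triangle _ (ctr n (T.height X) ρ) _) ?_))
    have h3 : dist (ctr n (T.height X) ρ) (join 0 (T.height X)) = 2 * ρ := by
      rw [dist_eq_norm, join_eq_smul, ctr, ← sub_smul, norm_smul, norm_up, Real.norm_of_nonneg (by linarith)]
      ring
    have h4 := mem_closedBall.1 hx
    linarith
  obtain ⟨a, ha, h1⟩ := key hA hxA
  obtain ⟨b, hb, h2⟩ := key hB hxB
  exact ⟨min a b, lt_min ha hb, fun ρ ρ' h0 h0' hρ hρ' =>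
    hAB.mono (h1 ρ h0 (hρ.trans (min_le_left _ _))) (h2 ρ' h0' (hρ'.trans (min_le_right _ _)))⟩

theorem continuousOn_height {D Z : Set Y} {G Θ Q : Y → Set M} (h : ContFamily n D G Θ Q)
    (hgood : ∀ y ∈ D ∩ Z, T.Good (G y)) : ContinuousOn (fun y => T.height (G y)) (D ∩ Z) := by
  intro y hy
  have h1 := IsBoxGraph.tendsto (l := 𝓝[D ∩ Z] y) (G := G) (Θ := Θ) (G₀ := G y) (Θ₀ := Θ y) (Q₀ := Q y)
    (fun x hx => (T.sub x hx).1)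
    (eventually_nhdsWithin_of_forall fun z hz => (hgood z hz).graph) (hgood y hy).graph
    (Eventually.of_forall fun z w => abs_boxHeight_lt T.r_pos (G z) w)
    (fun x _ => (h.conv y hy.1 (T.e.symm x)).comp_param (φ := id)
      (tendsto_id.mono_left (nhdsWithin_mono y inter_subset_left)))
    (mem_ball_self T.r_pos)
  exact h1.comp (tendsto_id.prodMk tendsto_const_nhds)

theorem exists_sphereSite (hn : 1 ≤ n) {D Z : Set Y} {G Θ Q : Y → Set M} (h : ContFamily n D G Θ Q) (hZ : IsClosed Z)
    (hgood : ∀ y ∈ D ∩ Z, T.Good (G y)) {ρ₁ : ℝ} (hρ₁ : 0 < ρ₁) (hρ₁κ : ρ₁ ≤ T.κ / 8) :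
    ∃ H > 0, ∀ f : Y → ℝ, ContinuousOn f D → (∀ y ∈ D, f y ∈ Icc 0 H) → (∀ y ∈ D, 0 < f y → y ∈ Z) →
      ∃ σ : SphereSite n D G, ∀ y ∈ D, σ.mass y = ENNReal.ofReal (f y) ∧
        (0 < σ.ρ y → y ∈ Z ∧ 0 < f y ∧ ∃ ρ, 0 ≤ ρ ∧ ρ ≤ ρ₁ ∧ σ.cball y = T.cb (G y) ρ) := by
  classical
  obtain ⟨H, hH, Rad, hc, hRad⟩ := T.rad ρ₁ hρ₁ hρ₁κ
  refine ⟨H, hH, fun f hf hfH hfZ => ?_⟩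
  set v : Y → ℝ := fun y => T.height (G y) with hv
  have hvm : ∀ y ∈ D ∩ Z, v y ∈ Icc (-(T.κ / 8)) (T.κ / 8) := fun y hy => abs_le.1 (hgood y hy).height
  have hvc : ContinuousOn v (D ∩ Z) := continuousOn_height h hgood
  set ρ : Y → ℝ := fun y => if y ∈ Z then Rad (v y) (f y) else 0 with hρ
  have hρZ : ∀ y ∈ Z, ρ y = Rad (v y) (f y) := fun y hy => if_pos hy
  have hρm : ∀ y ∈ D, 0 ≤ ρ y ∧ ρ y ≤ ρ₁ := by
    intro y hy
    by_cases hyZ : y ∈ Z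
    · rw [hρZ y hyZ]
      exact ((hRad _ (hvm y ⟨hy, hyZ⟩)).2 _ (hfH y hy)).1
    · rw [hρ]
      simp only [if_neg hyZ]
      exact ⟨le_rfl, hρ₁.le⟩
  have hρc : ContinuousOn ρ (D ∩ Z) := by
    refine ContinuousOn.congr (hc.comp (hvc.prodMk (hf.mono inter_subset_left))
      fun y hy => ⟨hvm y hy, hfH y hy.1⟩) fun y hy => hρZ y hy.2
  have harea : ∀ y ∈ D ∩ Z, area n (T.e.symm '' sphere (ctr n (v y) (ρ y)) (ρ y)) = f y := by
    intro y hy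
    rw [hρZ y hy.2]
    exact ((hRad _ (hvm y hy)).2 _ (hfH y hy.1)).2
  have hf0 : ∀ y ∈ D, ρ y = 0 → f y = 0 := by
    intro y hy h0
    by_cases hyZ : y ∈ Z
    · rw [← harea y ⟨hy, hyZ⟩, h0, sphere_zero, image_singleton, area,
        area_finite hn (Set.finite_singleton _), ENNReal.toReal_zero]
    · exact le_antisymm (not_lt.1 fun h => hyZ (hfZ y hy h)) (hfH y hy).1
  have hsub : ∀ y ∈ D ∩ Z, closedBall (ctr n (v y) (ρ y)) (ρ y) ⊆ T.e.target := fun y hy =>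
    cball_target (hgood y hy).height (hρm y hy.1).1 ((hρm y hy.1).2.trans hρ₁κ)
  have hmeas : ∀ y ∈ D ∩ Z, 0 < ρ y →
      μHE[n] (T.e.symm '' sphere (ctr n (v y) (ρ y)) (ρ y)) = ENNReal.ofReal (f y) := by
    intro y hy hpos
    rw [← harea y hy, area, ENNReal.ofReal_toReal
      (sphere_area_lt_top T.he hpos (sphere_subset_closedBall.trans (hsub y hy))).ne]
  have hmemZ : ∀ y ∈ D, 0 < ρ y → y ∈ Z := fun y hy hpos => by
    by_contra hyZ
    rw [hρ] at hpos
    simp only [if_neg hyZ, lt_irrefl] at hpos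
  have hfpos : ∀ y ∈ D, 0 < ρ y → 0 < f y := fun y hy hpos => by
    refine lt_of_le_of_ne (hfH y hy).1 fun h0 => ?_
    have hyZ := hmemZ y hy hpos
    rw [hρZ y hyZ, ← h0, (hRad _ (hvm y ⟨hy, hyZ⟩)).1] at hpos
    exact lt_irrefl _ hpos
  let σ : SphereSite n D G :=
    { e := T.e
      he := T.he
      c := fun y => ctr n (v y) (ρ y)
      ρ := ρ
      Z := Z
      isClosed_Z := hZ
      c_cont := continuous_ctr.comp_continuousOn (hvc.prodMk hρc)
      ρ_cont := fun y hy => by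
        by_cases hyZ : y ∈ Z
        swap
        · refine ContinuousWithinAt.congr_of_eventuallyEq (continuousWithinAt_const (b := (0 : ℝ))) ?_ (if_neg hyZ)
          filter_upwards [nhdsWithin_le_nhds (hZ.isOpen_compl.mem_nhds hyZ)] with z hz
          exact if_neg hz
        rcases (hfH y hy).1.eq_or_lt with h0 | hpos
        · have hy0 : ρ y = 0 := by rw [hρZ y hyZ, ← h0, (hRad _ (hvm y ⟨hy, hyZ⟩)).1]
          rw [ContinuousWithinAt, hy0, Metric.tendsto_nhds]
          intro ε hε
          have h1 := (hρc y ⟨hy, hyZ⟩).eventually (ball_mem_nhds _ hε)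
          rw [hy0, eventually_nhdsWithin_iff] at h1
          filter_upwards [nhdsWithin_le_nhds h1, self_mem_nhdsWithin] with z hz hzD
          by_cases hzZ : z ∈ Z
          · exact hz ⟨hzD, hzZ⟩
          · rw [hρ]
            simpa only [if_neg hzZ, dist_self] using hε
        · refine (hρc y ⟨hy, hyZ⟩).mono_of_mem_nhdsWithin ?_
          filter_upwards [self_mem_nhdsWithin, (hf y hy).eventually (lt_mem_nhds hpos)] with z hz hz'
          exact ⟨hz, hfZ z hz hz'⟩
      ρ_nonneg := fun y hy => (hρm y hy).1
      mem_Z := hmemZ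
      target := hsub
      base := fun y hy h0 => by
        have h1 := (hgood y hy).foot_mem
        rw [foot, join_eq_smul] at h1
        rw [h0, ctr]
        simpa using h1
      disj := fun y hy hpos => (hgood y ⟨hy, hmemZ y hy hpos⟩).disjoint hpos ((hρm y hy).2.trans hρ₁κ)
      small := fun y hy h0 ε hε => by
        have h1 : Tendsto (fun z => ENNReal.ofReal (f z)) (𝓝[D] y) (𝓝 0) := by
          have := (ENNReal.continuous_ofReal.tendsto (f y)).comp (hf y hy)
          rwa [hf0 y hy h0, ENNReal.ofReal_zero] at this
        filter_upwards [h1.eventually (ge_mem_nhds hε), self_mem_nhdsWithin] with z hz hzD hpos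
        rw [hmeas z ⟨hzD, hmemZ z hzD hpos⟩ hpos]
        exact hz }
  refine ⟨σ, fun y hy => ⟨?_, fun hpos => ⟨hmemZ y hy hpos, hfpos y hy hpos, ρ y, (hρm y hy).1, (hρm y hy).2, rfl⟩⟩⟩
  rw [SphereSite.mass]
  split_ifs with hpos
  · exact hmeas y ⟨hy, hmemZ y hy hpos⟩ hpos
  · rw [hf0 y hy (le_antisymm (not_lt.1 hpos) (hρm y hy).1), ENNReal.ofReal_zero]

end Site

theorem FlatBox.exists_site {Γ₀ P₀ O : Set M} (hn : 1 ≤ n) (B : FlatBox n Γ₀ P₀ O) : ∃ T : Site n O,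
    ∀ {Y : Type} {l : Filter Y} {G Θ : Y → Set M} {Θ₀ Q : Set M}, Q ⊆ P₀ →
      (∀ x, LocConv n l G Θ Γ₀ Θ₀ Q x) → ∀ᶠ y in l, T.Good (G y) := by
  have hbox : box (0 : Amb n) B.r B.r ∈ 𝓝 0 := (isOpen_box _ _ _).mem_nhds (mem_box_self B.r_pos B.r_pos)
  have h0 : (0 : Amb n) ∈ B.e.target := B.cbox_target (box_subset_cbox (mem_box_self B.r_pos B.r_pos))
  obtain ⟨κ, hκ, hball, hrad⟩ := exists_sphere_radius hn B.he hbox h0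
  refine ⟨⟨B.e, B.he, B.r, B.r_pos, fun x hx => ⟨B.cbox_target hx, (B.mem x (B.cbox_subset hx)).1⟩, κ, hκ,
    fun x hx => (hball hx).1, hrad⟩, fun {Y l G Θ Θ₀ Q} hQ hc => ?_⟩
  obtain ⟨h1, h2⟩ := eventually_isBoxGraph B.he B.r_pos B.r_lt B.r_lt B.target B.flat (fun x _ => hc (B.e.symm x))
    fun x hx _ h => (B.mem x (B.cbox_subset hx)).2 (hQ h)
  have h3 := eventually_lipschitz_of_cv h2 (κ := 1 / 2) (by norm_num)
  have h4 : Tendsto (fun y => |boxHeight B.e B.r (G y) 0|) l (𝓝 0) := by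
    have h5 := (h2 0 (mem_closedBall_self B.r_pos.le)).tendsto
    have := (h5.comp (tendsto_id.prodMk tendsto_const_nhds)).abs
    simpa using this
  filter_upwards [h1, h3, h4.eventually (ge_mem_nhds (show 0 < κ / 8 by positivity))] with y a1 a2 a3
  exact ⟨a1, a2.2, a3⟩

end AddSpheres

section Sites

def Site.mono {O O' : Set M} (T : Site n O) (h : O ⊆ O') : Site n O' :=
  { T with sub := fun x hx => ⟨(T.sub x hx).1, h (T.sub x hx).2⟩ }

/-- Every surface converging to `Γ₀`, with exceptional points in `P₀`, is eventually flat at the site. -/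
def Site.Catches {O : Set M} (T : Site n O) (Γ₀ P₀ : Set M) : Prop :=
  ∀ {Y : Type} {l : Filter Y} {G Θ : Y → Set M} {Θ₀ Q : Set M}, Q ⊆ P₀ →
      (∀ x, LocConv n l G Θ Γ₀ Θ₀ Q x) → ∀ᶠ y in l, T.Good (G y)

theorem exists_two_sites (hn : 1 ≤ n) {S Ω PS : ℝ → Set M} (h : ContFamily n (Icc 0 1) S Ω PS)
    {P₀ O C : Set M} (hP₀ : P₀.Finite) (hO : IsOpen O) (hCO : C ⊆ O) {s : ℝ} (hs : s ∈ Icc (0 : ℝ) 1)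
    (hinf : (S s ∩ C).Infinite) : ∃ T T' : Site n O, (∀ X X', T.foot X ≠ T'.foot X') ∧ T.Catches (S s) (PS s ∪ P₀) ∧
      T'.Catches (S s) (PS s ∪ P₀) := by
  have hfin : (PS s ∪ P₀).Finite := (h.finite s hs).union hP₀
  obtain ⟨p, ⟨⟨hpS, hpC⟩, hpP⟩, q, ⟨⟨hqS, hqC⟩, hqP⟩, hpq⟩ := (hinf.sdiff hfin).nontrivial
  obtain ⟨A, B, hA, hB, hpA, hqB, hAB⟩ := t2_separation hpq
  obtain ⟨F, -⟩ := ((h.conv s hs p).smooth hpS fun h => hpP (Or.inl h)).exists_flatBox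
    ((hO.inter hA).mem_nhds ⟨hCO hpC, hpA⟩) hfin hpP
  obtain ⟨F', -⟩ := ((h.conv s hs q).smooth hqS fun h => hqP (Or.inl h)).exists_flatBox
    ((hO.inter hB).mem_nhds ⟨hCO hqC, hqB⟩) hfin hqP
  obtain ⟨T, hT⟩ := F.exists_site hn
  obtain ⟨T', hT'⟩ := F'.exists_site hn
  refine ⟨T.mono inter_subset_left, T'.mono inter_subset_left, fun X X' hXX => ?_,
    fun {Y l G Θ Θ₀ Q} hQ hc => ?_, fun {Y l G Θ Θ₀ Q} hQ hc => ?_⟩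
  · have h1 : T.foot X ∈ A := (Site.foot_mem_sub (T := T)).2
    have h2 : T'.foot X' ∈ B := (Site.foot_mem_sub (T := T')).2
    have h3 : T.foot X = T'.foot X' := hXX
    exact disjoint_left.1 hAB h1 (h3 ▸ h2)
  · exact (hT hQ hc).mono fun y hy => ⟨hy.graph, hy.lip, hy.height⟩
  · exact (hT' hQ hc).mono fun y hy => ⟨hy.graph, hy.lip, hy.height⟩

/-- Finitely many sites serve a one-parameter family. -/
theorem exists_sites (hn : 1 ≤ n) {S Ω PS : ℝ → Set M} (h : ContFamily n (Icc 0 1) S Ω PS)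
    {P₀ O C : Set M} (hP₀ : P₀.Finite) (hO : IsOpen O) (hCO : C ⊆ O)
    (hinf : ∀ s ∈ Icc (0 : ℝ) 1, (S s ∩ C).Infinite) : ∃ N : ℕ, 0 < N ∧ ∃ T : ℕ → Site n O, (T 0).Catches (S 0) P₀ ∧
      (∀ k < N, ∀ s ∈ Icc ((k : ℝ) / N) (((k + 1 : ℕ) : ℝ) / N), (T k).Good (S s)) ∧
      ∀ k, k + 1 < N → (T k).foot (S (((k + 1 : ℕ) : ℝ) / N)) ≠ (T (k + 1)).foot (S (((k + 1 : ℕ) : ℝ) / N)) := by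
  classical
  have h2 : ∀ s : ℝ, ∃ T T' : Site n O, s ∈ Icc (0 : ℝ) 1 → (∀ X X', T.foot X ≠ T'.foot X') ∧
      T.Catches (S s) (PS s ∪ P₀) ∧ T'.Catches (S s) (PS s ∪ P₀) := by
    obtain ⟨T₀, T₀', -⟩ := exists_two_sites hn h hP₀ hO hCO (s := 0) ⟨le_rfl, zero_le_one⟩
      (hinf 0 ⟨le_rfl, zero_le_one⟩)
    intro s
    by_cases hs : s ∈ Icc (0 : ℝ) 1
    · obtain ⟨T, T', h⟩ := exists_two_sites hn h hP₀ hO hCO hs (hinf s hs)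
      exact ⟨T, T', fun _ => h⟩
    · exact ⟨T₀, T₀', fun h => absurd h hs⟩
  choose T₁ T₂ hT using h2
  have h3 : ∀ s : ℝ, ∃ δ > 0, s ∈ Icc (0 : ℝ) 1 → ∀ s' ∈ Icc (0 : ℝ) 1, s' ∈ ball s δ →
      (T₁ s).Good (S s') ∧ (T₂ s).Good (S s') := by
    intro s
    by_cases hs : s ∈ Icc (0 : ℝ) 1
    · have h4 := (((hT s hs).2.1 subset_union_left (h.conv s hs)).and
        ((hT s hs).2.2 subset_union_left (h.conv s hs)))
      obtain ⟨δ, hδ, h5⟩ := mem_nhdsWithin_iff.1 h4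
      exact ⟨δ, hδ, fun _ s' hs' hb => h5 ⟨hb, hs'⟩⟩
    · exact ⟨1, one_pos, fun h => absurd h hs⟩
  choose δ hδ hgood using h3
  obtain ⟨δ₁, hδ₁, hleb⟩ := lebesgue_number_lemma_of_metric (s := Icc (0 : ℝ) 1) (ι := Icc (0 : ℝ) 1)
    (c := fun i => ball i (δ i)) isCompact_Icc (fun _ => isOpen_ball)
    fun x hx => mem_iUnion.2 ⟨⟨x, hx⟩, mem_ball_self (hδ x)⟩
  obtain ⟨N, hN⟩ := exists_nat_gt (1 / min δ₁ (δ 0))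
  have hm : 0 < min δ₁ (δ 0) := lt_min hδ₁ (hδ 0)
  have hNpos : (0 : ℝ) < N := lt_trans (by positivity) hN
  have hN1 : 1 / (N : ℝ) < min δ₁ (δ 0) := by
    rw [div_lt_iff₀ hNpos]
    rwa [div_lt_iff₀ hm, mul_comm] at hN
  have hx : ∀ k : ℕ, k < N → (k : ℝ) / N ∈ Icc (0 : ℝ) 1 := fun k hk =>
    ⟨by positivity, (div_le_one hNpos).2 (by exact_mod_cast hk.le)⟩
  have hwin : ∀ k : ℕ, k < N → ∀ s ∈ Icc ((k : ℝ) / N) (((k + 1 : ℕ) : ℝ) / N),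
      s ∈ Icc (0 : ℝ) 1 ∧ s ∈ ball ((k : ℝ) / N) (min δ₁ (δ 0)) := by
    intro k hk s hs
    have h5 : (((k + 1 : ℕ) : ℝ) / N) ≤ 1 := (div_le_one hNpos).2 (by exact_mod_cast hk)
    have h6 : (((k + 1 : ℕ) : ℝ) / N) = (k : ℝ) / N + 1 / N := by push_cast; ring
    refine ⟨⟨(hx k hk).1.trans hs.1, hs.2.trans h5⟩, ?_⟩
    rw [mem_ball, Real.dist_eq, abs_of_nonneg (by linarith [hs.1])]
    linarith [hs.2]
  have h4 : ∀ k : ℕ, ∃ c : ℝ, (k = 0 → c = 0) ∧ (k < N → c ∈ Icc (0 : ℝ) 1 ∧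
      ∀ s ∈ Icc ((k : ℝ) / N) (((k + 1 : ℕ) : ℝ) / N), (T₁ c).Good (S s) ∧ (T₂ c).Good (S s)) := by
    intro k
    rcases Nat.eq_zero_or_pos k with rfl | hk0
    · refine ⟨0, fun _ => rfl, fun hk => ⟨⟨le_rfl, zero_le_one⟩, fun s hs => ?_⟩⟩
      obtain ⟨h5, h6⟩ := hwin 0 hk s hs
      refine hgood 0 ⟨le_rfl, zero_le_one⟩ s h5 (ball_subset_ball (min_le_right δ₁ _) ?_)
      simpa using h6
    · by_cases hk : k < N
      · obtain ⟨i, hi⟩ := hleb _ (hx k hk)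
        refine ⟨i, fun h => absurd h hk0.ne', fun _ => ⟨i.2, fun s hs => ?_⟩⟩
        obtain ⟨h5, h6⟩ := hwin k hk s hs
        exact hgood i i.2 s h5 (hi (ball_subset_ball (min_le_left _ _) h6))
      · exact ⟨0, fun _ => rfl, fun h => absurd h hk⟩
  choose c hc0 hc using h4
  let T : ℕ → Site n O := fun k => Nat.rec (T₁ (c 0)) (fun k T =>
    if T.foot (S (((k + 1 : ℕ) : ℝ) / N)) ≠ (T₁ (c (k + 1))).foot (S (((k + 1 : ℕ) : ℝ) / N)) then T₁ (c (k + 1))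
    else T₂ (c (k + 1))) k
  have hTs : ∀ k, T (k + 1) = if (T k).foot (S (((k + 1 : ℕ) : ℝ) / N)) ≠
      (T₁ (c (k + 1))).foot (S (((k + 1 : ℕ) : ℝ) / N)) then T₁ (c (k + 1)) else T₂ (c (k + 1)) := fun k => rfl
  have hTor : ∀ k, T k = T₁ (c k) ∨ T k = T₂ (c k) := by
    intro k
    cases k with
    | zero => exact Or.inl rfl
    | succ k =>
      rw [hTs]
      split_ifs
      exacts [Or.inl rfl, Or.inr rfl]
  refine ⟨N, by exact_mod_cast hNpos, T, ?_, fun k hk s hs => ?_, fun k hk => ?_⟩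
  · have h5 : T 0 = T₁ 0 := by
      have : T 0 = T₁ (c 0) := rfl
      rw [this, hc0 0 rfl]
    rw [h5]
    intro Y l G Θ Θ₀ Q hQ hl
    exact (hT 0 ⟨le_rfl, zero_le_one⟩).2.1 (hQ.trans subset_union_right) hl
  · rcases hTor k with h5 | h5 <;> rw [h5]
    exacts [((hc k hk).2 s hs).1, ((hc k hk).2 s hs).2]
  · rw [hTs]
    split_ifs with h5
    · exact h5
    · push Not at h5
      rw [h5]
      exact (hT _ (hc (k + 1) hk).1).1 _ _

end Sites

section Stair

/-- A monotone function climbing from `k / N` to `(k + 1) / N` on `[2 * k, 2 * k + 1]`. -/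
def stair (N : ℕ) (u : ℝ) : ℝ := (∑ k ∈ Finset.range N, clamp (u - 2 * k)) / N

@[fun_prop] theorem continuous_stair (N : ℕ) : Continuous (stair N) := by unfold stair; fun_prop

theorem stair_mem (N : ℕ) (u : ℝ) : stair N u ∈ Icc (0 : ℝ) 1 := by
  refine ⟨div_nonneg (Finset.sum_nonneg fun k _ => (clamp_mem _).1) (Nat.cast_nonneg _),
    div_le_one_of_le₀ ?_ (Nat.cast_nonneg _)⟩
  have := Finset.sum_le_card_nsmul (Finset.range N) (fun k : ℕ => clamp (u - 2 * k)) 1 fun k _ => (clamp_mem _).2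
  simpa using this

theorem stair_of_nonpos (N : ℕ) {u : ℝ} (hu : u ≤ 0) : stair N u = 0 := by
  rw [stair, Finset.sum_eq_zero, zero_div]
  intro k _
  exact clamp_of_le (by have : (0 : ℝ) ≤ k := k.cast_nonneg; linarith)

theorem stair_eq {N k : ℕ} (hk : k < N) {u : ℝ} (h : k = 0 ∨ 2 * (k : ℝ) - 1 ≤ u) (h' : u ≤ 2 * k + 2) :
    stair N u = (k + clamp (u - 2 * k)) / N := by
  have h1 : ∀ j ∈ Finset.range k, clamp (u - 2 * (j : ℝ)) = 1 := by
    intro j hj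
    have hjk := Finset.mem_range.1 hj
    rcases h with h | h
    · omega
    · have : (j : ℝ) + 1 ≤ k := by exact_mod_cast hjk
      exact clamp_of_ge (by linarith)
  have h2 : ∀ j ∈ Finset.range N, j ∉ Finset.range (k + 1) → clamp (u - 2 * (j : ℝ)) = 0 := by
    intro j _ hj
    rw [Finset.mem_range, not_lt] at hj
    have : (k : ℝ) + 1 ≤ j := by exact_mod_cast hj
    exact clamp_of_le (by linarith)
  rw [stair, ← Finset.sum_subset (Finset.range_subset_range.2 hk) h2, Finset.sum_range_succ, Finset.sum_congr rfl h1]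
  simp

theorem stair_mem_window {N k : ℕ} (hk : k < N) {u : ℝ} (h : k = 0 ∨ 2 * (k : ℝ) - 1 ≤ u)
    (h' : u ≤ 2 * k + 2) : stair N u ∈ Icc ((k : ℝ) / N) (((k + 1 : ℕ) : ℝ) / N) := by
  rw [stair_eq hk h h']
  have h1 := clamp_mem (u - 2 * k)
  push_cast
  exact ⟨div_le_div_of_nonneg_right (by linarith [h1.1]) N.cast_nonneg,
    div_le_div_of_nonneg_right (by linarith [h1.2]) N.cast_nonneg⟩

theorem stair_eq_between {N k : ℕ} (hk : k < N) {u : ℝ} (h : 2 * (k : ℝ) + 1 ≤ u)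
    (h' : u ≤ 2 * k + 2) : stair N u = ((k + 1 : ℕ) : ℝ) / N := by
  rw [stair_eq hk (Or.inr (by linarith)) h', clamp_of_ge (by linarith)]
  push_cast
  rfl

theorem stair_end {N : ℕ} (hN : 0 < N) {u : ℝ} (h : u = 2 * N - 1) : stair N u = 1 := by
  obtain ⟨k, rfl⟩ : ∃ k, N = k + 1 := ⟨N - 1, by omega⟩
  push_cast at h
  rw [stair_eq_between (k := k) k.lt_succ_self (by linarith) (by linarith)]
  exact div_self (by positivity)

def stairCut (k : ℕ) (u : ℝ) : ℝ := if k = 0 then 1 else clamp (u - (2 * k - 1))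

/-- A partition of unity subordinate to the steps of `stair`. -/
def stairWeight (k : ℕ) (u : ℝ) : ℝ := stairCut k u - stairCut (k + 1) u

@[fun_prop] theorem continuous_stairCut (k : ℕ) : Continuous (stairCut k) := by
  unfold stairCut
  split_ifs <;> fun_prop

@[fun_prop] theorem continuous_stairWeight (k : ℕ) : Continuous (stairWeight k) := by
  unfold stairWeight
  fun_prop

theorem clamp_mono {x y : ℝ} (h : x ≤ y) : clamp x ≤ clamp y := by
  unfold clamp
  gcongr

theorem stairWeight_mem (k : ℕ) (u : ℝ) : stairWeight k u ∈ Icc (0 : ℝ) 1 := by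
  have h1 : stairCut (k + 1) u ∈ Icc (0 : ℝ) 1 := by
    rw [stairCut, if_neg k.succ_ne_zero]
    exact clamp_mem _
  have h2 : stairCut (k + 1) u ≤ stairCut k u ∧ stairCut k u ≤ 1 := by
    by_cases hk : k = 0
    · have : stairCut k u = 1 := if_pos hk
      rw [this]
      exact ⟨h1.2, le_rfl⟩
    · rw [stairCut, stairCut, if_neg hk, if_neg k.succ_ne_zero]
      refine ⟨clamp_mono ?_, (clamp_mem _).2⟩
      push_cast
      linarith
  exact ⟨by rw [stairWeight]; linarith [h2.1], by rw [stairWeight]; linarith [h2.2, h1.1]⟩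

theorem sum_stairWeight {N : ℕ} (hN : 0 < N) {u : ℝ} (hu : u ≤ 2 * N - 1) :
    ∑ k ∈ Finset.range N, stairWeight k u = 1 := by
  simp only [stairWeight]
  rw [Finset.sum_range_sub' (fun k => stairCut k u), stairCut, stairCut, if_pos rfl, if_neg hN.ne',
    clamp_of_le (by linarith), sub_zero]

theorem stairWeight_pos {k : ℕ} {u : ℝ} (h : 0 < stairWeight k u) :
    (k = 0 ∨ 2 * (k : ℝ) - 1 < u) ∧ u < 2 * k + 2 := by
  have h1 : stairCut k u ≤ 1 := by
    unfold stairCut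
    split_ifs
    exacts [le_rfl, (clamp_mem _).2]
  have h2 : 0 ≤ stairCut (k + 1) u := by
    rw [stairCut, if_neg k.succ_ne_zero]
    exact (clamp_mem _).1
  rw [stairWeight] at h
  constructor
  · by_contra! hcon
    have : stairCut k u = 0 := by
      rw [stairCut, if_neg hcon.1, clamp_of_le (by linarith [hcon.2])]
    linarith
  · by_contra! hcon
    have : stairCut (k + 1) u = 1 := by
      rw [stairCut, if_neg k.succ_ne_zero, clamp_of_ge]
      push_cast
      linarith
    linarith

end Stair

section Bubbles

variable {Y : Type*} [TopologicalSpace Y]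

/-- Adding area `f` to a family by spheres distributed over several sites. -/
theorem exists_bubbles (hn : 1 ≤ n) {D : Set Y} {G Θ Q : Y → Set M} (h : ContFamily n D G Θ Q) {O : Set M}
    {N : ℕ} (hN : 0 < N) (T : ℕ → Site n O) (Z : ℕ → Set Y) (hZ : ∀ k, IsClosed (Z k))
    (hgood : ∀ k < N, ∀ y ∈ D ∩ Z k, (T k).Good (G y)) (w : ℕ → Y → ℝ) (hw : ∀ k, ContinuousOn (w k) D)
    (hw01 : ∀ k, ∀ y ∈ D, w k y ∈ Icc (0 : ℝ) 1)
    (hsep : ∃ ρ₀ > 0, ∀ k < N, ∀ j < k, ∀ y ∈ D, y ∈ Z j → y ∈ Z k → 0 < w j y → 0 < w k y →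
      ∀ ρ ρ', 0 ≤ ρ → 0 ≤ ρ' → ρ ≤ ρ₀ → ρ' ≤ ρ₀ → Disjoint ((T j).cb (G y) ρ) ((T k).cb (G y) ρ')) :
    ∃ H > 0, ∀ f : Y → ℝ, ContinuousOn f D → (∀ y ∈ D, f y ∈ Icc 0 H) →
      (∀ y ∈ D, 0 < f y → ∑ k ∈ Finset.range N, w k y = 1 ∧ ∀ k < N, 0 < w k y → y ∈ Z k) →
      ∃ G' Θ' Q' : Y → Set M, ContFamily n D G' Θ' Q' ∧ ∀ y ∈ D,
        (∀ z ∉ O, (z ∈ G' y ↔ z ∈ G y) ∧ (z ∈ Θ' y ↔ z ∈ Θ y)) ∧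
        (f y = 0 → G' y = G y ∧ Θ' y = Θ y) ∧ μHE[n] (G' y) = μHE[n] (G y) + ENNReal.ofReal (f y) := by
  obtain ⟨ρ₀, hρ₀, hsep⟩ := hsep
  have h1 : ∀ᶠ ρ : ℝ in 𝓝[>] 0, 0 < ρ ∧ ρ ≤ ρ₀ ∧ ∀ k ∈ Finset.range N, ρ ≤ (T k).κ / 8 := by
    refine Eventually.and self_mem_nhdsWithin (Eventually.and
      (nhdsWithin_le_nhds (ge_mem_nhds hρ₀)) ((Finset.eventually_all _).2 fun k _ => nhdsWithin_le_nhds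
        (ge_mem_nhds (by have := (T k).κ_pos; positivity))))
  obtain ⟨ρ₁, hρ₁, hρ₁₀, hρ₁κ⟩ := h1.exists
  have h2 : ∀ k : ℕ, ∃ H > 0, k < N → ∀ f : Y → ℝ, ContinuousOn f D → (∀ y ∈ D, f y ∈ Icc 0 H) →
      (∀ y ∈ D, 0 < f y → y ∈ Z k) → ∃ σ : SphereSite n D G, ∀ y ∈ D, σ.mass y = ENNReal.ofReal (f y) ∧
        (0 < σ.ρ y → y ∈ Z k ∧ 0 < f y ∧ ∃ ρ, 0 ≤ ρ ∧ ρ ≤ ρ₁ ∧ σ.cball y = (T k).cb (G y) ρ) := by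
    intro k
    by_cases hk : k < N
    · obtain ⟨H, hH, h3⟩ := Site.exists_sphereSite hn h (hZ k) (hgood k hk) hρ₁ (hρ₁κ k (Finset.mem_range.2 hk))
      exact ⟨H, hH, fun _ => h3⟩
    · exact ⟨1, one_pos, fun h => absurd h hk⟩
  choose Hk hHk hσ using h2
  have h3 : ∀ᶠ H : ℝ in 𝓝[>] 0, 0 < H ∧ ∀ k ∈ Finset.range N, H ≤ Hk k :=
    Eventually.and self_mem_nhdsWithin ((Finset.eventually_all _).2 fun k _ => nhdsWithin_le_nhds
        (ge_mem_nhds (hHk k)))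
  obtain ⟨H, hH, hHle⟩ := h3.exists
  refine ⟨H, hH, fun f hf hfH hfw => ?_⟩
  have h4 : ∀ k : ℕ, ∃ σ : SphereSite n D G, k < N → ∀ y ∈ D, σ.mass y = ENNReal.ofReal (w k y * f y) ∧
        (0 < σ.ρ y → y ∈ Z k ∧ 0 < w k y * f y ∧ ∃ ρ, 0 ≤ ρ ∧ ρ ≤ ρ₁ ∧ σ.cball y = (T k).cb (G y) ρ) := by
    have h5 : ∀ k < N, ∃ σ : SphereSite n D G, ∀ y ∈ D, σ.mass y = ENNReal.ofReal (w k y * f y) ∧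
        (0 < σ.ρ y → y ∈ Z k ∧ 0 < w k y * f y ∧ ∃ ρ, 0 ≤ ρ ∧ ρ ≤ ρ₁ ∧ σ.cball y = (T k).cb (G y) ρ) := by
      intro k hk
      refine hσ k hk (fun y => w k y * f y) ((hw k).mul hf) (fun y hy => ?_) fun y hy hpos => ?_
      · have a1 := hw01 k y hy
        have a2 := hfH y hy
        refine ⟨mul_nonneg a1.1 a2.1, ?_⟩
        exact (mul_le_of_le_one_left a2.1 a1.2).trans (a2.2.trans (hHle k (Finset.mem_range.2 hk)))
      · exact (hfw y hy (pos_of_mul_pos_right hpos (hw01 k y hy).1)).2 k hk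
          (pos_of_mul_pos_left hpos (hfH y hy).1)
    obtain ⟨σ₀, -⟩ := h5 0 hN
    intro k
    by_cases hk : k < N
    · obtain ⟨σ, hσ⟩ := h5 k hk
      exact ⟨σ, fun _ => hσ⟩
    · exact ⟨σ₀, fun h => absurd h hk⟩
  choose σ hσ' using h4
  obtain ⟨G', Θ', Q', h', hG'⟩ := exists_add_spheres hn h σ N fun y hy k hk j hj hρj hρk => by
    obtain ⟨a1, a2, ρ, a3, a4, a5⟩ := (hσ' j (hj.trans hk) y hy).2 hρj
    obtain ⟨b1, b2, ρ', b3, b4, b5⟩ := (hσ' k hk y hy).2 hρk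
    rw [a5, b5]
    have hf0 := (hfH y hy).1
    exact hsep k hk j hj y hy a1 b1 (pos_of_mul_pos_left a2 hf0) (pos_of_mul_pos_left b2 hf0) ρ ρ' a3 b3
      (a4.trans hρ₁₀) (b4.trans hρ₁₀)
  refine ⟨G', Θ', Q', h', fun y hy => ⟨fun z hz => (hG' y hy).1 z fun k hk hρ hzk => ?_, fun h0 => ?_, ?_⟩⟩
  · obtain ⟨a1, a2, ρ, a3, a4, a5⟩ := (hσ' k hk y hy).2 hρ
    rw [a5] at hzk
    exact hz (Site.cb_subset (hgood k hk y ⟨hy, a1⟩).height a3 (a4.trans (hρ₁κ k (Finset.mem_range.2 hk))) hzk)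
  · have h5 : ∀ z, ∀ k < N, 0 < (σ k).ρ y → z ∉ (σ k).cball y := fun z k hk hρ => by
      have := ((hσ' k hk y hy).2 hρ).2.1
      rw [h0, mul_zero] at this
      exact absurd this (lt_irrefl _)
    exact ⟨Set.ext fun z => ((hG' y hy).1 z (h5 z)).1, Set.ext fun z => ((hG' y hy).1 z (h5 z)).2⟩
  · rw [(hG' y hy).2.2]
    congr 1
    rw [Finset.sum_congr rfl fun k hk => (hσ' k (Finset.mem_range.1 hk) y hy).1,
      ← ENNReal.ofReal_sum_of_nonneg fun k _ => mul_nonneg (hw01 k y hy).1 (hfH y hy).1, ← Finset.sum_mul]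
    rcases (hfH y hy).1.eq_or_lt with h0 | hpos
    · rw [← h0, mul_zero]
    · rw [(hfw y hy hpos).1, one_mul]

end Bubbles

section Global

theorem exists_edist_lt_mem {C K : Set M} (hC : IsCompact C) (hCK : C ⊆ interior K) :
    ∃ δ > (0 : ENNReal), ∀ x ∉ K, ∀ y, edist x y < δ → y ∉ C := by
  obtain ⟨δ, hδ, h⟩ := hC.exists_cthickening_subset_open isOpen_interior hCK
  refine ⟨ENNReal.ofReal δ, ENNReal.ofReal_pos.2 hδ, fun x hx y hy hyC => hx (interior_subset (h ?_))⟩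
  exact mem_cthickening_of_edist_le x y δ C hyC hy.le

/-- A family which is continuous locally, and given by a smooth family off a compact set, is
continuous in the Hausdorff sense. -/
theorem ContFamily.tendsto_hausdorffEDist {E : Type*} [NormedAddCommGroup E] [NormedSpace ℝ E] {T : Set E}
    {Γ P : ℝ → Set M} (hΓ : IsGeneralizedSmoothFamily n (Icc (0 : ℝ) 1) Γ P) {G Θ Q : E → Set M}
    (h : ContFamily n T G Θ Q) {τ : E → ℝ} (hτ : ContinuousOn τ T) (hτI : MapsTo τ T (Icc 0 1)) {C : Set M}
    (hC : IsCompact C) (hoff : ∀ y ∈ T, ∀ x ∉ C, x ∈ G y ↔ x ∈ Γ (τ y)) {y : E} (hy : y ∈ T) :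
    Tendsto (fun z => hausdorffEDist (G z) (G y)) (𝓝[T] y) (𝓝 0) := by
  have := ChartedSpace.locallyCompactSpace (Amb n) M
  obtain ⟨K, hK, hCK⟩ := exists_compact_superset hC
  obtain ⟨δ, hδ, hδC⟩ := exists_edist_lt_mem hC hCK
  rw [ENNReal.tendsto_nhds_zero]
  intro ε hε
  have h1 : Tendsto (fun z => hausdorffEDist (Γ (τ z)) (Γ (τ y))) (𝓝[T] y) (𝓝 0) :=
    (hΓ.hausdorff_continuous (τ y) (hτI hy)).comp
      (tendsto_nhdsWithin_iff.2 ⟨hτ y hy, eventually_nhdsWithin_of_forall hτI⟩)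
  have h2 : ∀ᶠ z in 𝓝[T] y, ∀ x ∈ K, x ∈ G z → ∃ w ∈ G y, edist x w ≤ ε := by
    refine hK.eventually_forall_filter (Q := fun z x => x ∈ G z → ∃ w ∈ G y, edist x w ≤ ε) fun x₀ _ => ?_
    by_cases hx₀ : x₀ ∈ G y
    · have h3 : ∀ᶠ x in 𝓝 x₀, edist x x₀ < ε := eball_mem_nhds x₀ hε
      filter_upwards [tendsto_snd.eventually h3] with p hp _
      exact ⟨x₀, hx₀, hp.le⟩
    · obtain ⟨V, hV, h3⟩ := (h.conv y hy x₀).off hx₀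
      filter_upwards [h3.prod_mk hV] with p hp hpG
      exact absurd hpG (hp.1 _ hp.2).1
  have h3 : ∀ᶠ z in 𝓝[T] y, ∀ x ∈ K ∩ G y, ∃ w ∈ G z, edist x w ≤ ε := by
    refine (hK.inter_right (h.isClosed hy)).eventually_forall_filter
      (Q := fun z x => ∃ w ∈ G z, edist x w ≤ ε) fun x₀ hx₀ => ?_
    have hb : eball x₀ (ε / 2) ∈ 𝓝 x₀ := eball_mem_nhds x₀ (ENNReal.half_pos hε.ne')
    have h4 : ∀ᶠ x in 𝓝 x₀, x ∈ eball x₀ (ε / 2) := hb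
    filter_upwards [((h.conv y hy x₀).lower hx₀.2 _ hb).prod_mk h4] with p hp
    obtain ⟨w, hw, hwb⟩ := hp.1
    refine ⟨w, hw, (edist_triangle _ x₀ _).trans ?_⟩
    rw [← ENNReal.add_halves ε]
    exact add_le_add (mem_eball.1 hp.2).le (by rw [edist_comm]; exact (mem_eball.1 hwb).le)
  filter_upwards [self_mem_nhdsWithin, h2, h3, h1.eventually (gt_mem_nhds (lt_min hε hδ))] with z hz h2 h3 h4
  refine hausdorffEDist_le_of_mem_edist (fun x hx => ?_) fun x hx => ?_
  · by_cases hxK : x ∈ K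
    · exact h2 x hxK hx
    · have hxC : x ∉ C := fun h => hxK (interior_subset (hCK h))
      obtain ⟨w, hw, hxw⟩ := exists_edist_lt_of_hausdorffEDist_lt ((hoff z hz x hxC).1 hx) h4
      exact ⟨w, (hoff y hy w (hδC x hxK w (hxw.trans_le (min_le_right _ _)))).2 hw,
        (hxw.trans_le (min_le_left _ _)).le⟩
  · by_cases hxK : x ∈ K
    · exact h3 x ⟨hxK, hx⟩
    · have hxC : x ∉ C := fun h => hxK (interior_subset (hCK h))
      rw [hausdorffEDist_comm] at h4
      obtain ⟨w, hw, hxw⟩ := exists_edist_lt_of_hausdorffEDist_lt ((hoff y hy x hxC).1 hx) h4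
      exact ⟨w, (hoff z hz w (hδC x hxK w (hxw.trans_le (min_le_right _ _)))).2 hw,
        (hxw.trans_le (min_le_left _ _)).le⟩

theorem ContFamily.isGeneralizedSmoothFamily (hn : 1 ≤ n) {E : Type*} [NormedAddCommGroup E] [NormedSpace ℝ E]
    {T : Set E} {Γ P : ℝ → Set M} (hΓ : IsGeneralizedSmoothFamily n (Icc (0 : ℝ) 1) Γ P) {G Θ Q : E → Set M}
    (h : ContFamily n T G Θ Q) {τ : E → ℝ} (hτ : ContinuousOn τ T) (hτI : MapsTo τ T (Icc 0 1)) {C : Set M}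
    (hC : IsCompact C) (hoff : ∀ y ∈ T, ∀ x ∉ C, x ∈ G y ↔ x ∈ Γ (τ y))
    (harea : ContDiffOn ℝ ∞ (fun y => area n (G y)) T) : IsGeneralizedSmoothFamily n T G Q where
  isClosed y hy := h.isClosed hy
  measure_lt_top := (h.continuousOn_area hn hΓ hτ hτI hC hoff).1
  finite_exceptional := h.finite
  smooth_off y hy p hp := ((h.conv y hy p).smooth hp.1 hp.2).isSmooth
  area_smooth := harea
  hausdorff_continuous y hy := h.tendsto_hausdorffEDist hΓ hτ hτI hC hoff hy
  converges_on y hy p hp := (h.conv y hy p).smooth hp.1 hp.2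
  converges_off y hy p hp _ := by
    obtain ⟨V, hV, h1⟩ := (h.conv y hy p).off hp
    exact ⟨V, hV, h1.mono fun z hz => disjoint_left.2 fun x hx => (hz x hx).1⟩

/-- The volume varies continuously. -/
theorem ContFamily.tendsto_volume {Y : Type*} [TopologicalSpace Y] {D : Set Y} {G Θ Q : Y → Set M}
    (h : ContFamily n D G Θ Q) {y : Y} (hy : y ∈ D) (hfin : μHE[n] (G y) < ⊤) {Ξ : Y → Set M}
    (hΞ : Tendsto (fun z => μHE[n + 1] (Ξ z \ Ξ y) + μHE[n + 1] (Ξ y \ Ξ z)) (𝓝[D] y) (𝓝 0)) {C : Set M}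
    (hC : IsCompact C) (hoff : ∀ z ∈ D, ∀ x ∉ C, x ∈ Θ z ↔ x ∈ Ξ z) :
    Tendsto (fun z => μHE[n + 1] (Θ z \ Θ y) + μHE[n + 1] (Θ y \ Θ z)) (𝓝[D] y) (𝓝 0) := by
  have := ChartedSpace.locallyCompactSpace (Amb n) M
  obtain ⟨K, hK, hCK⟩ := exists_compact_superset hC
  have hnull : μHE[n + 1] (G y ∩ C) = 0 := by
    rcases Measure.euclideanHausdorffMeasure_zero_or_top n.lt_succ_self (G y) with h0 | h0
    · exact measure_mono_null inter_subset_left h0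
    · exact absurd h0 hfin.ne
  obtain ⟨R, hR, hRK⟩ := (hC.inter_left (h.isClosed hy)).exists_cthickening_subset_open isOpen_interior
    (inter_subset_right.trans hCK)
  have ht := tendsto_measure_cthickening_of_isClosed (μ := (μHE[n + 1] : Measure M)) (s := G y ∩ C)
    ⟨R, hR, ((measure_mono (hRK.trans interior_subset)).trans_lt (volume_lt_top_of_isCompact hK)).ne⟩
    ((h.isClosed hy).inter hC.isClosed)
  rw [hnull] at ht
  rw [ENNReal.tendsto_nhds_zero] at hΞ ⊢
  intro ε hε
  have h3 : 0 < ε / 3 := ENNReal.div_pos hε.ne' (by simp)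
  have h4 : ∀ᶠ r : ℝ in 𝓝[>] 0, 0 < r ∧ μHE[n + 1] (cthickening r (G y ∩ C)) ≤ ε / 3 :=
    Eventually.and self_mem_nhdsWithin (nhdsWithin_le_nhds (ht.eventually (ge_mem_nhds h3)))
  obtain ⟨r, hr, hrε⟩ := h4.exists
  have h5 : ∀ᶠ z in 𝓝[D] y, ∀ x ∈ C \ thickening r (G y ∩ C), x ∈ Θ z ↔ x ∈ Θ y := by
    refine (hC.diff isOpen_thickening).eventually_forall_filter
      (Q := fun z x => x ∈ Θ z ↔ x ∈ Θ y) fun x hx => ?_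
    have hxG : x ∉ G y := fun hG => hx.2 (self_subset_thickening hr _ ⟨hG, hx.1⟩)
    obtain ⟨V, hV, h6⟩ := (h.conv y hy x).off hxG
    filter_upwards [h6.prod_mk hV] with p hp
    exact (hp.1 _ hp.2).2
  filter_upwards [h5, hΞ _ h3, self_mem_nhdsWithin] with z h5 h6 hz
  have key : ∀ A B A' B' : Set M, (∀ x ∉ C, x ∈ A ↔ x ∈ A') → (∀ x ∉ C, x ∈ B ↔ x ∈ B') →
      (∀ x ∈ C \ thickening r (G y ∩ C), x ∈ A ↔ x ∈ B) → μHE[n + 1] (A \ B) ≤ ε / 3 + μHE[n + 1] (A' \ B') := by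
    intro A B A' B' hA hB hAB
    have hsub : A \ B ⊆ cthickening r (G y ∩ C) ∪ A' \ B' := by
      intro x hx
      by_cases hxC : x ∈ C
      · left
        by_contra hcon
        have h7 := hAB x ⟨hxC, fun h => hcon (thickening_subset_cthickening _ _ h)⟩
        exact hx.2 (h7.1 hx.1)
      · exact Or.inr ⟨(hA x hxC).1 hx.1, fun h => hx.2 ((hB x hxC).2 h)⟩
    exact (measure_mono hsub).trans ((measure_union_le _ _).trans (add_le_add hrε le_rfl))
  have k1 := key (Θ z) (Θ y) (Ξ z) (Ξ y) (hoff z hz) (hoff y hy) h5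
  have k2 := key (Θ y) (Θ z) (Ξ y) (Ξ z) (hoff y hy) (hoff z hz) fun x hx => (h5 x hx).symm
  calc _ ≤ (ε / 3 + μHE[n + 1] (Ξ z \ Ξ y)) + (ε / 3 + μHE[n + 1] (Ξ y \ Ξ z)) := add_le_add k1 k2
    _ = ε / 3 + ε / 3 + (μHE[n + 1] (Ξ z \ Ξ y) + μHE[n + 1] (Ξ y \ Ξ z)) := by ring
    _ ≤ ε / 3 + ε / 3 + ε / 3 := by gcongr
    _ = ε := ENNReal.add_thirds ε

end Global

section Reparametrize

variable {U : Set M} {ε : ℝ} {Γ₀ Ω₀ : Set M}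

/-- A deformation supported in the closure of `U`, each of whose surfaces has infinitely many points
there. -/
structure NonemptyDeformation (n : ℕ) [ChartedSpace (Amb n) M] (U : Set M)
    (ε : ℝ) (Γ₀ Ω₀ : Set M) (S Ω PS : ℝ → Set M) : Prop where
  fam : ContFamily n (Icc 0 1) S Ω PS
  start : S 0 = Γ₀ ∧ Ω 0 = Ω₀
  off : ∀ s ∈ Icc (0 : ℝ) 1, S s \ closure U = Γ₀ \ closure U ∧ Ω s \ U = Ω₀ \ U
  area_le : ∀ s ∈ Icc (0 : ℝ) 1, area n (S s) ≤ area n Γ₀ + ε / 8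
  area_end : area n (S 1) ≤ area n Γ₀ - 3 * ε / 4
  infinite : ∀ s ∈ Icc (0 : ℝ) 1, (S s ∩ closure U).Infinite

/-- Stop a lowering deformation when the area has decreased by `3ε/4`. -/
theorem IsLoweringDeformation.exists_nonempty (hn : 1 ≤ n) (hε : 0 < ε) {S Ω : ℝ → Set M}
    (h : IsLoweringDeformation n U ε Γ₀ Ω₀ S Ω) :
    ∃ S' Ω' PS' : ℝ → Set M, NonemptyDeformation n U ε Γ₀ Ω₀ S' Ω' PS' := by
  obtain ⟨PS, hS, hfam⟩ := h.isBoundaryFamily.exists_contFamily hn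
  have h0I : (0 : ℝ) ∈ Icc (0 : ℝ) 1 := ⟨le_rfl, zero_le_one⟩
  have h1I : (1 : ℝ) ∈ Icc (0 : ℝ) 1 := ⟨zero_le_one, le_rfl⟩
  have hc : ContinuousOn (fun s => area n (S s)) (Icc 0 1) := hS.area_smooth.continuousOn
  set c := area n Γ₀ - 3 * ε / 4 with hcdef
  have hA : IsCompact (Icc 0 1 ∩ (fun s => area n (S s)) ⁻¹' Iic c) :=
    isCompact_Icc.of_isClosed_subset (hc.preimage_isClosed_of_isClosed isClosed_Icc isClosed_Iic)
      inter_subset_left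
  obtain ⟨s₁, ⟨hs₁, hs₁c⟩, hleast⟩ := hA.exists_isLeast
    ⟨1, h1I, by have := h.area_end; simp only [mem_preimage, mem_Iic]; linarith⟩
  have hsub : Icc 0 s₁ ⊆ Icc (0 : ℝ) 1 := Icc_subset_Icc_right hs₁.2
  have hge : ∀ s ∈ Icc 0 s₁, c ≤ area n (S s) := by
    have h0 : c ∈ Icc (area n (S s₁)) (area n (S 0)) := ⟨hs₁c, by rw [h.start_surface]; linarith⟩
    obtain ⟨s₂, hs₂, hs₂c⟩ := intermediate_value_Icc' hs₁.1 (hc.mono hsub) h0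
    have h2 : s₂ = s₁ := le_antisymm hs₂.2 (hleast ⟨hsub hs₂, hs₂c.le⟩)
    intro s hs
    rcases hs.2.eq_or_lt with h3 | h3
    · rw [h3, ← h2]
      exact hs₂c.ge
    · by_contra! hcon
      exact absurd (hleast ⟨hsub hs, hcon.le⟩) (not_le.2 h3)
  have hmaps : MapsTo (fun s => s₁ * s) (Icc 0 1) (Icc 0 s₁) := fun s hs =>
    ⟨mul_nonneg hs₁.1 hs.1, mul_le_of_le_one_right hs₁.1 hs.2⟩
  have hmaps' : MapsTo (fun s => s₁ * s) (Icc 0 1) (Icc 0 1) := fun s hs => hsub (hmaps hs)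
  refine ⟨fun s => S (s₁ * s), fun s => Ω (s₁ * s), fun s => PS (s₁ * s), hfam.comp (by fun_prop) hmaps',
    by simp [h.start_surface, h.start_set], fun s hs => ⟨h.surface_off _ (hmaps' hs), h.set_off _ (hmaps' hs)⟩,
    fun s hs => h.area_le _ (hmaps' hs), by simpa using hs₁c, fun s hs hfin => ?_⟩
  have e1 : μHE[n] (S (s₁ * s)) ≤ μHE[n] (S 1) := by
    calc μHE[n] (S (s₁ * s)) ≤ μHE[n] (S (s₁ * s) ∩ closure U) + μHE[n] (S (s₁ * s) \ closure U) :=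
          measure_le_inter_add_sdiff _ _ _
      _ = μHE[n] (S 1 \ closure U) := by
          rw [area_finite hn hfin, zero_add, h.surface_off _ (hmaps' hs), h.surface_off 1 h1I]
      _ ≤ _ := measure_mono sdiff_subset
  have e2 : area n (S (s₁ * s)) ≤ area n (S 1) := ENNReal.toReal_mono (hS.measure_lt_top 1 h1I).ne e1
  have := hge _ (hmaps hs)
  linarith [h.area_end]

/-- The composite family, together with sites for spheres. -/
theorem exists_composite (hn : 1 ≤ n) {Γ Ξ P : ℝ → Set M} {t₀ : ℝ} (h : ContFamily n (Icc 0 1) Γ Ξ P)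
    (ht₀ : t₀ ∈ Icc (0 : ℝ) 1) {U' : Set M} (hU' : IsOpen U') (hUc : IsCompact (closure U))
    (hUU' : closure U ⊆ U') {S Ω PS : ℝ → Set M} (hS : NonemptyDeformation n U ε (Γ t₀) (Ξ t₀) S Ω PS) :
    ∃ N : ℕ, 0 < N ∧ ∃ K : Composite n Γ Ξ P t₀ U', K.S = S ∧ K.sch = (fun m => stair N (m - 2)) ∧
      closure K.W ⊆ U' ∧ ∃ T : ℕ → Site n K.W,
      (∀ k < N, ∀ t ∈ near t₀ K.η, ∀ m, (k = 0 ∨ 2 * (k : ℝ) - 1 ≤ m - 2) → m - 2 ≤ 2 * k + 2 →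
        (T k).Good (K.G (t, m))) ∧
      ∃ ρ₀ > 0, ∀ k, k + 1 < N → ∀ t ∈ near t₀ K.η, ∀ m, 2 * (k : ℝ) + 1 ≤ m - 2 → m - 2 ≤ 2 * k + 2 →
        ∀ ρ ρ', 0 ≤ ρ → 0 ≤ ρ' → ρ ≤ ρ₀ → ρ' ≤ ρ₀ →
        Disjoint ((T k).cb (K.G (t, m)) ρ) ((T (k + 1)).cb (K.G (t, m)) ρ') := by
  have := ChartedSpace.locallyCompactSpace (Amb n) M
  have hP := h.finite t₀ ht₀
  have : IsFiniteMeasure ((Measure.count : Measure M).restrict (P t₀)) :=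
    ⟨by rw [Measure.restrict_apply_univ]; exact Measure.count_apply_lt_top.2 hP⟩
  obtain ⟨W, hW, hUW, hWU', hWc, hWfr⟩ := exists_open_between ((Measure.count : Measure M).restrict (P t₀))
    hUc hU' hUU'
  have hfrP : Disjoint (frontier W) (P t₀) := by
    rw [Measure.restrict_apply isClosed_frontier.measurableSet, Measure.count_eq_zero_iff] at hWfr
    exact disjoint_iff_inter_eq_empty.2 hWfr
  have hfrc : IsCompact (frontier W) := hWc.of_isClosed_subset isClosed_frontier frontier_subset_closure
  have hfrU : ∀ z ∈ frontier W, z ∉ closure U := fun z hz hzU => by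
    rw [hW.frontier_eq] at hz
    exact hz.2 (hUW hzU)
  obtain ⟨F, η₁, hη₁, hη₁F, V, hV, hfrV, hfreeze⟩ := exists_freeze hn h ht₀ (O := U')
    hU' hfrc (frontier_subset_closure.trans hWU') hfrP
  obtain ⟨N, hN, T, hT0, hTgood, hTsep⟩ := exists_sites hn hS.fam hP hW hUW hS.infinite
  rw [hS.start.1] at hT0
  obtain ⟨η₂, hη₂, hη₂F, hstrip⟩ := exists_strip_of_eventually F.η_pos (hT0 subset_rfl F.conv)
  let K : Composite n Γ Ξ P t₀ U' :=
    { F := F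
      η := min η₁ η₂
      η_pos := lt_min hη₁ hη₂
      η_le := (min_le_left _ _).trans hη₁F
      W := W
      V := V \ closure U
      isOpen_W := hW
      isCompact_W := hWc
      isOpen_V := hV.sdiff isClosed_closure
      frontier_W := fun z hz => ⟨hfrV hz, hfrU z hz⟩
      freeze := fun t ht z hz => hfreeze t ⟨ht.1, closedBall_subset_closedBall (min_le_left _ _) ht.2⟩ z hz.1
      S := S
      Ω := Ω
      PS := PS
      fam := hS.fam
      start := hS.start
      agree := fun s hs z hz => by
        have hzU : z ∉ closure U := hz.elim (fun h => h.2) fun h h' => h (hUW h')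
        have h1 := Set.ext_iff.1 (hS.off s hs).1 z
        have h2 := Set.ext_iff.1 (hS.off s hs).2 z
        have hzU' : z ∉ U := fun h => hzU (subset_closure h)
        simpa [hzU, hzU'] using And.intro h1 h2
      sch := fun m => stair N (m - 2)
      sch_continuous := by fun_prop
      sch_mem := fun m => stair_mem N _
      sch_of_le := fun m hm => stair_of_nonpos N (by linarith) }
  have hinner : ∀ y : ℝ × ℝ, ∀ z ∈ W, z ∈ Composite.inner t₀ K.sch K.F.G K.S y ↔ z ∈ K.G y := fun y z hz =>
    (mem_glue_of_mem (show z ∈ K.W from hz)).symm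
  have hinS : ∀ t m, 2 ≤ m → ∀ z ∈ W, z ∈ S (stair N (m - 2)) ↔ z ∈ K.G (t, m) := fun t m hm z hz => by
    rw [← hinner (t, m) z hz, (Composite.inner_of_ge (K := K) (y := (t, m)) hm).1]
  refine ⟨N, hN, K, rfl, rfl, hWU', T, fun k hk t ht m hm hm' => ?_, ?_⟩
  · by_cases h2 : 2 ≤ m
    · exact (hTgood k hk _ (stair_mem_window hk hm hm')).congr (hinS t m h2)
    · push Not at h2
      have hk0 : k = 0 := by
        by_contra h0
        have h3 : (1 : ℝ) ≤ k := by exact_mod_cast Nat.one_le_iff_ne_zero.2 h0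
        rcases hm with hm | hm
        · exact h0 hm
        · linarith
      subst hk0
      refine (hstrip (Composite.tau t₀ (t, m), clamp m) ⟨?_, clamp_mem m⟩).congr fun z hz => ?_
      · have h3 := Composite.tau_mem (y := (t, m)) K.η_pos ht₀ ht
        exact ⟨h3.1, closedBall_subset_closedBall (min_le_right _ _) h3.2⟩
      · rw [← hinner (t, m) z hz, Composite.inner, if_pos (show (t, m).2 ≤ 2 from h2.le)]
  · have h1 : ∀ k : ℕ, ∃ ρ₀ > 0, k + 1 < N → ∀ ρ ρ', 0 ≤ ρ → 0 ≤ ρ' → ρ ≤ ρ₀ → ρ' ≤ ρ₀ →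
        Disjoint ((T k).cb (S (((k + 1 : ℕ) : ℝ) / N)) ρ) ((T (k + 1)).cb (S (((k + 1 : ℕ) : ℝ) / N)) ρ') := by
      intro k
      by_cases hk : k + 1 < N
      · obtain ⟨ρ₀, hρ₀, h2⟩ := Site.exists_disjoint (hTsep k hk)
        exact ⟨ρ₀, hρ₀, fun _ => h2⟩
      · exact ⟨1, one_pos, fun h => absurd h hk⟩
    choose r hr hdisj using h1
    have h3 : ∀ᶠ ρ : ℝ in 𝓝[>] 0, 0 < ρ ∧ ∀ k ∈ Finset.range N, ρ ≤ r k :=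
      Eventually.and self_mem_nhdsWithin ((Finset.eventually_all _).2 fun k _ => nhdsWithin_le_nhds
        (ge_mem_nhds (hr k)))
    obtain ⟨ρ₀, hρ₀, hle⟩ := h3.exists
    refine ⟨ρ₀, hρ₀, fun k hk t ht m hm hm' ρ ρ' h0 h0' hρ hρ' => ?_⟩
    have hkN : k ∈ Finset.range N := Finset.mem_range.2 (by omega)
    have hk0 : (0 : ℝ) ≤ k := k.cast_nonneg
    have h4 := hdisj k hk ρ ρ' h0 h0' (hρ.trans (hle k hkN)) (hρ'.trans (hle k hkN))
    have h5 := hinS t m (by linarith)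
    rw [stair_eq_between (by omega : k < N) hm hm'] at h5
    rwa [Site.cb, Site.cb, Site.height_congr h5, Site.height_congr h5] at h4

end Reparametrize

section SmoothMajorant

def unitSquare : Set (ℝ × ℝ) := Icc 0 1 ×ˢ Icc 0 1

theorem exists_contDiff_near {d : ℝ × ℝ → ℝ} (hd : ContinuousOn d unitSquare) {δ : ℝ} (hδ : 0 < δ) :
    ∃ E : ℝ × ℝ → ℝ, ContDiff ℝ ∞ E ∧ ∀ y ∈ unitSquare, |E y - d y| < δ := by
  have hc : UniformContinuousOn d unitSquare :=
    (isCompact_Icc.prod isCompact_Icc).uniformContinuousOn_of_continuous hd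
  have hcl : LipschitzWith 1 clamp := by
    have : clamp = fun x => max 0 (min x 1) := rfl
    rw [this]
    exact (LipschitzWith.id.min_const 1).const_max 0
  have hcl2 : UniformContinuous fun y : ℝ × ℝ => (clamp y.1, clamp y.2) :=
    (hcl.uniformContinuous.comp uniformContinuous_fst).prodMk (hcl.uniformContinuous.comp uniformContinuous_snd)
  have hmem : ∀ y : ℝ × ℝ, (clamp y.1, clamp y.2) ∈ unitSquare := fun y => ⟨clamp_mem _, clamp_mem _⟩
  have hu : UniformContinuous fun y : ℝ × ℝ => d (clamp y.1, clamp y.2) := by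
    have := uniformContinuousOn_univ.2 hcl2
    exact uniformContinuousOn_univ.1 (hc.comp this fun y _ => hmem y)
  obtain ⟨E, hE, hdist⟩ := hu.exists_contDiff_dist_le hδ
  refine ⟨E, hE, fun y hy => ?_⟩
  have := hdist y
  rwa [Real.dist_eq, clamp_of_mem hy.1, clamp_of_mem hy.2] at this

/-- A function vanishing outside a region has a close smooth majorant vanishing outside a slightly
larger region. -/
theorem exists_contDiff_majorant {d : ℝ × ℝ → ℝ} (hd : ContinuousOn d unitSquare) {δ a a₁ b₁ b : ℝ}
    (hδ : 0 < δ) (ha : a < a₁) (hb : b₁ < b)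
    (hd0 : ∀ y ∈ unitSquare, y.1 ≤ 1 / 2 ∨ y.2 ≤ a₁ ∨ b₁ ≤ y.2 → d y = 0) :
    ∃ E : ℝ × ℝ → ℝ, ContDiff ℝ ∞ E ∧ ∀ y ∈ unitSquare, E y - d y ∈ Icc 0 δ ∧
      (y.1 = 0 ∨ y.2 ≤ a ∨ b ≤ y.2 → E y = 0) := by
  obtain ⟨E, hE, hEd⟩ := exists_contDiff_near hd (half_pos hδ)
  have ha' : 0 < a₁ - a := sub_pos.2 ha
  have hb' : 0 < b - b₁ := sub_pos.2 hb
  set χ : ℝ × ℝ → ℝ := fun y => Real.smoothTransition (4 * y.1 - 1) *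
    (Real.smoothTransition ((y.2 - a) / (a₁ - a)) * Real.smoothTransition ((b - y.2) / (b - b₁))) with hχ
  have hχs : ContDiff ℝ ∞ χ :=
    (Real.smoothTransition.contDiff.comp (by fun_prop)).mul
      ((Real.smoothTransition.contDiff.comp (by fun_prop)).mul (Real.smoothTransition.contDiff.comp (by fun_prop)))
  have hχ0 : ∀ y, 0 ≤ χ y := fun y => mul_nonneg (Real.smoothTransition.nonneg _)
    (mul_nonneg (Real.smoothTransition.nonneg _) (Real.smoothTransition.nonneg _))
  have hχ1 : ∀ y, χ y ≤ 1 := fun y => mul_le_one₀ (Real.smoothTransition.le_one _)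
    (mul_nonneg (Real.smoothTransition.nonneg _) (Real.smoothTransition.nonneg _))
    (mul_le_one₀ (Real.smoothTransition.le_one _) (Real.smoothTransition.nonneg _) (Real.smoothTransition.le_one _))
  refine ⟨fun y => χ y * (E y + δ / 2), hχs.mul (hE.add contDiff_const), fun y hy => ⟨?_, ?_⟩⟩
  · have h1 := abs_lt.1 (hEd y hy)
    by_cases hout : y.1 ≤ 1 / 2 ∨ y.2 ≤ a₁ ∨ b₁ ≤ y.2
    · rw [hd0 y hy hout, sub_zero] at h1
      rw [hd0 y hy hout, sub_zero]
      have h2 : 0 ≤ E y + δ / 2 := by linarith [h1.1]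
      refine ⟨mul_nonneg (hχ0 y) h2, (mul_le_of_le_one_left h2 (hχ1 y)).trans (by linarith [h1.2])⟩
    · push Not at hout
      have h2 : χ y = 1 := by
        simp only [hχ]
        rw [Real.smoothTransition.one_of_one_le (by linarith),
          Real.smoothTransition.one_of_one_le ((one_le_div ha').2 (by linarith)),
          Real.smoothTransition.one_of_one_le ((one_le_div hb').2 (by linarith))]
        norm_num
      show χ y * (E y + δ / 2) - d y ∈ Icc 0 δ
      rw [h2, one_mul]
      exact ⟨by linarith [h1.1], by linarith [h1.2]⟩
  · intro h
    have h2 : χ y = 0 := by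
      simp only [hχ]
      rcases h with h | h | h
      · rw [Real.smoothTransition.zero_of_nonpos (by rw [h]; norm_num), zero_mul]
      · rw [Real.smoothTransition.zero_of_nonpos (div_nonpos_of_nonpos_of_nonneg (by linarith) ha'.le), zero_mul,
          mul_zero]
      · rw [Real.smoothTransition.zero_of_nonpos (div_nonpos_of_nonpos_of_nonneg
          (by linarith : b - y.2 ≤ 0) hb'.le), mul_zero, mul_zero]
    simp only [h2, zero_mul]

end SmoothMajorant

section Schedule

/-- A cutoff with support in `[a₁, b₁]`, equal to one on `[a', b']`. -/
def cutoff (a₁ a' b' b₁ t : ℝ) : ℝ := clamp ((t - a₁) / (a' - a₁)) * clamp ((b₁ - t) / (b₁ - b'))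

@[fun_prop] theorem continuous_cutoff (a₁ a' b' b₁ : ℝ) : Continuous (cutoff a₁ a' b' b₁) := by
  unfold cutoff; fun_prop

theorem cutoff_mem (a₁ a' b' b₁ t : ℝ) : cutoff a₁ a' b' b₁ t ∈ Icc (0 : ℝ) 1 :=
  ⟨mul_nonneg (clamp_mem _).1 (clamp_mem _).1, mul_le_one₀ (clamp_mem _).2 (clamp_mem _).1 (clamp_mem _).2⟩

theorem cutoff_eq_zero {a₁ a' b' b₁ t : ℝ} (ha : a₁ < a') (hb : b' < b₁) (h : t ≤ a₁ ∨ b₁ ≤ t) :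
    cutoff a₁ a' b' b₁ t = 0 := by
  rcases h with h | h
  · rw [cutoff, clamp_of_le (div_nonpos_of_nonpos_of_nonneg (by linarith) (by linarith)), zero_mul]
  · rw [cutoff, clamp_of_le (x := (b₁ - t) / (b₁ - b'))
      (div_nonpos_of_nonpos_of_nonneg (by linarith) (by linarith)), mul_zero]

theorem cutoff_eq_one {a₁ a' b' b₁ t : ℝ} (ha : a₁ < a') (hb : b' < b₁) (h : t ∈ Icc a' b') :
    cutoff a₁ a' b' b₁ t = 1 := by
  rw [cutoff, clamp_of_ge ((one_le_div (by linarith)).2 (by linarith [h.1])),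
    clamp_of_ge ((one_le_div (by linarith)).2 (by linarith [h.2])), one_mul]

/-- The progress of the replacement at the parameter `(σ, t)`. -/
def progress (L a₁ a' b' b₁ : ℝ) (y : ℝ × ℝ) : ℝ := L * (cutoff a₁ a' b' b₁ y.2 * clamp (2 * y.1 - 1))

@[fun_prop] theorem continuous_progress (L a₁ a' b' b₁ : ℝ) : Continuous (progress L a₁ a' b' b₁) := by
  unfold progress; fun_prop

variable {L a₁ a' b' b₁ : ℝ} {y : ℝ × ℝ}

theorem progress_mem (hL : 0 ≤ L) : progress L a₁ a' b' b₁ y ∈ Icc 0 L := by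
  have h1 := cutoff_mem a₁ a' b' b₁ y.2
  have h2 := clamp_mem (2 * y.1 - 1)
  exact ⟨mul_nonneg hL (mul_nonneg h1.1 h2.1), mul_le_of_le_one_right hL (mul_le_one₀ h1.2 h2.1 h2.2)⟩

theorem progress_eq_zero (ha : a₁ < a') (hb : b' < b₁) (h : y.1 ≤ 1 / 2 ∨ y.2 ≤ a₁ ∨ b₁ ≤ y.2) :
    progress L a₁ a' b' b₁ y = 0 := by
  rcases h with h | h
  · rw [progress, clamp_of_le (by linarith), mul_zero, mul_zero]
  · rw [progress, cutoff_eq_zero ha hb h, zero_mul, mul_zero]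

theorem progress_one (ha : a₁ < a') (hb : b' < b₁) {t : ℝ} (h : t ∈ Icc a' b') :
    progress L a₁ a' b' b₁ (1, t) = L := by
  rw [progress, cutoff_eq_one ha hb h, clamp_of_ge (by norm_num)]
  ring

end Schedule

section Assembly

variable {Γ Ξ P : ℝ → Set M} {t₀ : ℝ} {U' : Set M}

/-- Insert the composite family between the times `a` and `b`. -/
theorem Composite.exists_insert (hn : 1 ≤ n) (h : ContFamily n (Icc 0 1) Γ Ξ P) (ht₀ : t₀ ∈ Icc (0 : ℝ) 1)
    (K : Composite n Γ Ξ P t₀ U') {a a₁ b₁ b : ℝ} (ha : a < a₁) (hb : b₁ < b)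
    (hnear : Icc a b ⊆ near t₀ K.η) {μ : ℝ × ℝ → ℝ} (hμ : Continuous μ)
    (hμ0 : ∀ y, y.2 ≤ a₁ ∨ b₁ ≤ y.2 → μ y = 0) : ∃ G Θ Q : ℝ × ℝ → Set M, ContFamily n unitSquare G Θ Q ∧
      (∀ y, y.2 ∈ Icc a b → G y = K.G (y.2, μ y) ∧ Θ y = K.Θ (y.2, μ y)) ∧
      (∀ y, y.2 ≤ a₁ ∨ b₁ ≤ y.2 → G y = Γ y.2 ∧ Θ y = Ξ y.2) := by
  classical
  set G : ℝ × ℝ → Set M := fun y => if y.2 ∈ Icc a b then K.G (y.2, μ y) else Γ y.2 with hG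
  set Θ : ℝ × ℝ → Set M := fun y => if y.2 ∈ Icc a b then K.Θ (y.2, μ y) else Ξ y.2 with hΘ
  set Q : ℝ × ℝ → Set M := fun y => if y.2 ∈ Icc a b then K.Q (y.2, μ y) ∪ P y.2 else P y.2 with hQ
  have hin : ∀ y : ℝ × ℝ, y.2 ∈ Icc a b → G y = K.G (y.2, μ y) ∧ Θ y = K.Θ (y.2, μ y) := fun y hy =>
    ⟨if_pos hy, if_pos hy⟩
  have hout : ∀ y : ℝ × ℝ, y.2 ≤ a₁ ∨ b₁ ≤ y.2 → G y = Γ y.2 ∧ Θ y = Ξ y.2 := by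
    intro y hy
    by_cases hyI : y.2 ∈ Icc a b
    · rw [(hin y hyI).1, (hin y hyI).2]
      exact Composite.eq_of_nonpos (hμ0 y hy).le
    · exact ⟨if_neg hyI, if_neg hyI⟩
  have k1 := K.contFamily hn ht₀
  have hD₁ : IsClosed (unitSquare ∩ Prod.snd ⁻¹' Icc a b) :=
    (isClosed_Icc.prod isClosed_Icc).inter (isClosed_Icc.preimage continuous_snd)
  have hD₂ : IsClosed (unitSquare ∩ {y : ℝ × ℝ | y.2 ≤ a₁ ∨ b₁ ≤ y.2}) :=
    (isClosed_Icc.prod isClosed_Icc).inter ((isClosed_le continuous_snd continuous_const).union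
      (isClosed_le continuous_const continuous_snd))
  have f1 : ContFamily n (unitSquare ∩ Prod.snd ⁻¹' Icc a b) G Θ Q := by
    have hmaps : MapsTo (fun y : ℝ × ℝ => (y.2, μ y)) (unitSquare ∩ Prod.snd ⁻¹' Icc a b)
        (near t₀ K.η ×ˢ univ) := fun y hy => ⟨hnear hy.2, mem_univ _⟩
    refine ((k1.comp (D' := unitSquare ∩ Prod.snd ⁻¹' Icc a b) (φ := fun y : ℝ × ℝ => (y.2, μ y))
      (by fun_prop) hmaps).congr (fun y hy => (hin y hy.2).1.symm) (fun y hy => (hin y hy.2).2.symm)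
      (fun y _ => rfl)).mono_exc hn (fun y hy => ?_) fun y hy => ?_
    · rw [hQ]
      simp only [if_pos (show y.2 ∈ Icc a b from hy.2)]
      exact subset_union_left
    · rw [hQ]
      simp only [if_pos (show y.2 ∈ Icc a b from hy.2)]
      exact (k1.finite _ (hmaps hy)).union (h.finite _ hy.1.2)
  have f2 : ContFamily n (unitSquare ∩ {y : ℝ × ℝ | y.2 ≤ a₁ ∨ b₁ ≤ y.2}) G Θ Q := by
    have hmaps : MapsTo (fun y : ℝ × ℝ => y.2) (unitSquare ∩ {y : ℝ × ℝ | y.2 ≤ a₁ ∨ b₁ ≤ y.2})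
        (Icc 0 1) := fun y hy => hy.1.2
    refine ((h.comp (D' := unitSquare ∩ {y : ℝ × ℝ | y.2 ≤ a₁ ∨ b₁ ≤ y.2}) (φ := fun y : ℝ × ℝ => y.2)
      (by fun_prop) hmaps).congr (fun y hy => (hout y hy.2).1.symm) (fun y hy => (hout y hy.2).2.symm)
      (fun y _ => rfl)).mono_exc hn (fun y hy => ?_) fun y hy => ?_
    · rw [hQ]
      dsimp only
      split_ifs
      exacts [subset_union_right, subset_rfl]
    · rw [hQ]
      dsimp only
      split_ifs with hyI
      exacts [(k1.finite _ ⟨hnear hyI, mem_univ _⟩).union (h.finite _ hy.1.2), h.finite _ hy.1.2]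
  refine ⟨G, Θ, Q, (f1.union f2 hD₁ hD₂).mono fun y hy => ?_, hin, hout⟩
  by_cases hyI : y.2 ∈ Icc a b
  · exact Or.inl ⟨hy, hyI⟩
  · refine Or.inr ⟨hy, ?_⟩
    rw [mem_ofPred_eq]
    by_contra! hcon
    exact hyI ⟨by linarith [hcon.1], by linarith [hcon.2]⟩

/-- The composite family depends smoothly on its parameters, after adding spheres. -/
theorem Composite.exists_modified (hn : 1 ≤ n) (hΓ : IsGeneralizedSmoothFamily n (Icc (0 : ℝ) 1) Γ P)
    (h : ContFamily n (Icc 0 1) Γ Ξ P) (ht₀ : t₀ ∈ Icc (0 : ℝ) 1)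
    (K : Composite n Γ Ξ P t₀ U') {N : ℕ} (hN : 0 < N) (T : ℕ → Site n K.W)
    (hgood : ∀ k < N, ∀ t ∈ near t₀ K.η, ∀ m, (k = 0 ∨ 2 * (k : ℝ) - 1 ≤ m - 2) → m - 2 ≤ 2 * k + 2 →
        (T k).Good (K.G (t, m)))
    (hsep : ∃ ρ₀ > 0, ∀ k, k + 1 < N → ∀ t ∈ near t₀ K.η, ∀ m, 2 * (k : ℝ) + 1 ≤ m - 2 → m - 2 ≤ 2 * k + 2 →
        ∀ ρ ρ', 0 ≤ ρ → 0 ≤ ρ' → ρ ≤ ρ₀ → ρ' ≤ ρ₀ →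
        Disjoint ((T k).cb (K.G (t, m)) ρ) ((T (k + 1)).cb (K.G (t, m)) ρ'))
    {a a' b' b δ : ℝ} (haa : a < a') (hbb : b' < b) (hnear : Icc a b ⊆ near t₀ K.η)
    (hδ : 0 < δ) : ∃ G Θ Q : ℝ × ℝ → Set M, ContFamily n unitSquare G Θ Q ∧
      (∀ y ∈ unitSquare, ∀ x ∉ K.F.C ∪ closure K.W, (x ∈ G y ↔ x ∈ Γ y.2) ∧ (x ∈ Θ y ↔ x ∈ Ξ y.2)) ∧
      (∀ y ∈ unitSquare, y.1 = 0 ∨ y.2 ≤ a ∨ b ≤ y.2 → G y = Γ y.2 ∧ Θ y = Ξ y.2) ∧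
      ContDiffOn ℝ ∞ (fun y => area n (G y)) unitSquare ∧
      ∀ t ∈ Icc a b, ∃ m ∈ Icc (0 : ℝ) (2 * N + 1), area n (G (1, t)) ≤ area n (K.G (t, m)) + δ ∧
        (t ∈ Icc a' b' → m = 2 * N + 1) := by
  set a₁ := (a + a') / 2 with ha₁
  set b₁ := (b + b') / 2 with hb₁
  have haa₁ : a < a₁ := by rw [ha₁]; linarith
  have ha₁a : a₁ < a' := by rw [ha₁]; linarith
  have hbb₁ : b₁ < b := by rw [hb₁]; linarith
  have hb₁b : b' < b₁ := by rw [hb₁]; linarith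
  have hL : (0 : ℝ) ≤ 2 * N + 1 := by positivity
  set μ : ℝ × ℝ → ℝ := progress (2 * N + 1) a₁ a' b' b₁ with hμdef
  have hμc : Continuous μ := continuous_progress _ _ _ _ _
  obtain ⟨G, Θ, Q, hG, hin, hout⟩ := K.exists_insert hn h ht₀ haa₁ hbb₁ hnear hμc
    fun y hy => progress_eq_zero ha₁a hb₁b (Or.inr hy)
  have hC : IsCompact (K.F.C ∪ closure K.W) := K.F.isCompact.union K.isCompact_W
  have hoff : ∀ y, ∀ x ∉ K.F.C ∪ closure K.W, (x ∈ G y ↔ x ∈ Γ y.2) ∧ (x ∈ Θ y ↔ x ∈ Ξ y.2) := by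
    intro y x hx
    by_cases hy : y.2 ∈ Icc a b
    · rw [(hin y hy).1, (hin y hy).2]
      exact Composite.mem_iff_of_notMem (y := (y.2, μ y)) (hnear hy) hx
    · have hy' : y.2 ≤ a₁ ∨ b₁ ≤ y.2 := by
        by_contra! hcon
        exact hy ⟨by linarith [hcon.1], by linarith [hcon.2]⟩
      rw [(hout y hy').1, (hout y hy').2]
      exact ⟨Iff.rfl, Iff.rfl⟩
  have hstart : ∀ y : ℝ × ℝ, y.1 ≤ 1 / 2 ∨ y.2 ≤ a₁ ∨ b₁ ≤ y.2 → G y = Γ y.2 ∧ Θ y = Ξ y.2 := by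
    rintro y (hy | hy)
    · by_cases hyI : y.2 ∈ Icc a b
      · rw [(hin y hyI).1, (hin y hyI).2]
        exact Composite.eq_of_nonpos (progress_eq_zero ha₁a hb₁b (Or.inl hy)).le
      · refine hout y ?_
        by_contra! hcon
        exact hyI ⟨by linarith [hcon.1], by linarith [hcon.2]⟩
    · exact hout y hy
  obtain ⟨hfin, harea⟩ := hG.continuousOn_area hn hΓ (T := Prod.snd) (by fun_prop) (fun y hy => hy.2) hC
    fun y _ x hx => (hoff y x hx).1
  have hΓarea : ContDiffOn ℝ ∞ (fun y : ℝ × ℝ => area n (Γ y.2)) unitSquare :=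
    hΓ.area_smooth.comp contDiff_snd.contDiffOn fun y hy => hy.2
  let Z : ℕ → Set (ℝ × ℝ) := fun k => Prod.snd ⁻¹' Icc a b ∩
    ({y | k = 0 ∨ 2 * (k : ℝ) - 1 ≤ μ y - 2} ∩ {y | μ y - 2 ≤ 2 * k + 2})
  have hZ : ∀ k, IsClosed (Z k) := by
    intro k
    refine (isClosed_Icc.preimage continuous_snd).inter (IsClosed.inter ?_
      (isClosed_le (by fun_prop) continuous_const))
    by_cases hk : k = 0
    · simp [hk]
    · simp only [hk, false_or]
      exact isClosed_le continuous_const (by fun_prop)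
  obtain ⟨ρ₀, hρ₀, hsep⟩ := hsep
  obtain ⟨H, hH, hbub⟩ := exists_bubbles hn hG hN T Z hZ
    (fun k hk y hy => by
      rw [(hin y hy.2.1).1]
      exact hgood k hk _ (hnear hy.2.1) _ hy.2.2.1 hy.2.2.2)
    (fun k y => stairWeight k (μ y - 2)) (fun k => by fun_prop) (fun k y _ => stairWeight_mem k _)
    ⟨ρ₀, hρ₀, fun k hk j hj y hy hyj hyk hwj hwk ρ ρ' h0 h0' hρ hρ' => by
      have h1 := (stairWeight_pos hwj).2
      have h2 := (stairWeight_pos hwk).1.resolve_left (by omega)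
      have hkj : k = j + 1 := by
        have h3 : (k : ℝ) < j + 2 := by linarith
        have h4 : k < j + 2 := by exact_mod_cast h3
        omega
      subst hkj
      rw [(hin y hyj.1).1]
      push_cast at h2
      exact hsep j hk _ (hnear hyj.1) _ (by linarith) h1.le ρ ρ' h0 h0' hρ hρ'⟩
  obtain ⟨E, hE, hEd⟩ := exists_contDiff_majorant (d := fun y => area n (G y) - area n (Γ y.2))
    (harea.sub hΓarea.continuousOn) (lt_min hδ hH) haa₁ hbb₁ fun y _ hy => by
      rw [(hstart y hy).1, sub_self]
  set f : ℝ × ℝ → ℝ := fun y => E y - (area n (G y) - area n (Γ y.2)) with hf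
  have hf0 : ∀ y ∈ unitSquare, y.1 = 0 ∨ y.2 ≤ a ∨ b ≤ y.2 → f y = 0 := by
    intro y hy hcase
    have h1 : y.1 ≤ 1 / 2 ∨ y.2 ≤ a₁ ∨ b₁ ≤ y.2 := by
      rcases hcase with h | h | h
      · exact Or.inl (by rw [h]; norm_num)
      · exact Or.inr (Or.inl (by linarith))
      · exact Or.inr (Or.inr (by linarith))
    simp only [hf]
    rw [(hEd y hy).2 hcase, (hstart y h1).1]
    ring
  obtain ⟨G', Θ', Q', hG', hprop⟩ := hbub f (hE.continuous.continuousOn.sub (harea.sub hΓarea.continuousOn))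
    (fun y hy => ⟨(hEd y hy).1.1, (hEd y hy).1.2.trans (min_le_right _ _)⟩) fun y hy hpos => by
      have hm := progress_mem (L := 2 * (N : ℝ) + 1) (a₁ := a₁) (a' := a') (b' := b') (b₁ := b₁) (y := y) hL
      refine ⟨sum_stairWeight hN (by have := hm.2; rw [hμdef]; linarith), fun k hk hw => ⟨?_, ?_, ?_⟩⟩
      · by_contra hcon
        refine hpos.ne' (hf0 y hy (Or.inr ?_))
        by_contra! hc
        exact hcon ⟨hc.1.le, hc.2.le⟩
      · exact (stairWeight_pos hw).1.imp id le_of_lt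
      · exact (stairWeight_pos hw).2.le
  have hareaG' : ∀ y ∈ unitSquare, area n (G' y) = area n (Γ y.2) + E y := by
    intro y hy
    have h1 : 0 ≤ f y := (hEd y hy).1.1
    rw [area, (hprop y hy).2.2, ENNReal.toReal_add (hfin y hy).ne ENNReal.ofReal_ne_top, ENNReal.toReal_ofReal h1]
    simp only [hf, area]
    ring
  refine ⟨G', Θ', Q', hG', fun y hy x hx => ?_, fun y hy hcase => ?_, ?_, fun t ht => ?_⟩
  · have h1 := (hprop y hy).1 x fun hW => hx (Or.inr (subset_closure hW))
    exact ⟨h1.1.trans (hoff y x hx).1, h1.2.trans (hoff y x hx).2⟩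
  · have h1 := (hprop y hy).2.1 (hf0 y hy hcase)
    rw [h1.1, h1.2]
    refine hstart y ?_
    rcases hcase with h | h | h
    · exact Or.inl (by rw [h]; norm_num)
    · exact Or.inr (Or.inl (by linarith))
    · exact Or.inr (Or.inr (by linarith))
  · exact (hΓarea.add hE.contDiffOn).congr hareaG'
  · have hy : ((1, t) : ℝ × ℝ) ∈ unitSquare := ⟨⟨zero_le_one, le_rfl⟩, (hnear ht).1⟩
    refine ⟨μ (1, t), progress_mem hL, ?_, fun h => progress_one ha₁a hb₁b h⟩
    rw [hareaG' _ hy]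
    have h1 := (hEd _ hy).1.2.trans (min_le_left _ _)
    have h2 := (hin (1, t) ht).1
    simp only at h1 h2
    rw [← h2]
    linarith

/-- For times close to `t₀`, the composite surfaces have almost the same areas as at `t₀`. -/
theorem Composite.exists_radius (hn : 1 ≤ n) (hΓ : IsGeneralizedSmoothFamily n (Icc (0 : ℝ) 1) Γ P)
    (ht₀ : t₀ ∈ Icc (0 : ℝ) 1) (K : Composite n Γ Ξ P t₀ U') (L : ℝ) {δ : ℝ} (hδ : 0 < δ) :
    ∃ η > 0, η ≤ K.η ∧ ∀ t ∈ near t₀ η, |area n (Γ t) - area n (Γ t₀)| < δ ∧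
      ∀ m ∈ Icc 0 L, |area n (K.G (t, m)) - area n (K.S (K.sch m))| < δ := by
  have hc := ((K.contFamily hn ht₀).continuousOn_area hn hΓ (T := Prod.fst) (by fun_prop)
    (fun y hy => hy.1.1) (K.F.isCompact.union K.isCompact_W)
    fun y hy x hx => (Composite.mem_iff_of_notMem hy.1 hx).1).2
  have ht₀n : t₀ ∈ near t₀ K.η := ⟨ht₀, mem_closedBall_self K.η_pos.le⟩
  have hcS : Continuous fun m => area n (K.S (K.sch m)) := by
    rw [← continuousOn_univ]
    refine (hc.comp (t := near t₀ K.η ×ˢ univ) (f := fun m : ℝ => (t₀, m)) (by fun_prop)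
      fun m _ => ⟨ht₀n, mem_univ _⟩).congr fun m _ => ?_
    simp only [Function.comp, eq_base]
  have h1 : ∀ᶠ t in 𝓝[near t₀ K.η] t₀, ∀ m ∈ Icc 0 L,
      |area n (K.G (t, m)) - area n (K.S (K.sch m))| < δ := by
    refine isCompact_Icc.eventually_forall_filter
      (Q := fun t m => |area n (K.G (t, m)) - area n (K.S (K.sch m))| < δ) fun m _ => ?_
    have h2 : Tendsto (fun y : ℝ × ℝ => area n (K.G y)) (𝓝[near t₀ K.η] t₀ ×ˢ 𝓝 m)
        (𝓝 (area n (K.S (K.sch m)))) := by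
      have := hc (t₀, m) ⟨ht₀n, mem_univ _⟩
      rwa [ContinuousWithinAt, nhdsWithin_prod_eq, nhdsWithin_univ, eq_base] at this
    have h3 := (h2.sub ((hcS.tendsto m).comp tendsto_snd)).abs
    rw [sub_self, abs_zero] at h3
    exact h3.eventually (gt_mem_nhds hδ)
  have h2 : ∀ᶠ t in 𝓝[near t₀ K.η] t₀, |area n (Γ t) - area n (Γ t₀)| < δ := by
    have h3 := ((hΓ.area_smooth.continuousOn.mono inter_subset_left : ContinuousOn _ (near t₀ K.η)) t₀ ht₀n).eventually
      (ball_mem_nhds _ hδ)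
    exact h3
  obtain ⟨r, hr, hsub⟩ := mem_nhdsWithin_iff.1 (h2.and h1)
  refine ⟨min (r / 2) K.η, lt_min (half_pos hr) K.η_pos, min_le_right _ _, fun t ht => hsub ⟨?_, ?_⟩⟩
  · exact closedBall_subset_ball (lt_of_le_of_lt (min_le_left _ _) (half_lt_self hr)) ht.2
  · exact ⟨ht.1, closedBall_subset_closedBall (min_le_right _ _) ht.2⟩

theorem area_eq_zero_of_frontier_eq_empty (hn : 1 ≤ n) {Γ Ω P : Set M} (hP : P.Finite)
    (hfr : Γ \ frontier Ω ⊆ P) (hΩ : frontier Ω = ∅) : area n Γ = 0 := by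
  rw [hΩ, sdiff_empty] at hfr
  rw [area, area_finite hn (hP.subset hfr), ENNReal.toReal_zero]

/-- A family of boundaries obtained from another one by changes in a compact set. -/
theorem ContFamily.isBoundaryFamily (hn : 1 ≤ n) (h : IsBoundaryFamily n Γ Ξ) {G Θ Q : ℝ → Set M}
    (hG : ContFamily n (Icc 0 1) G Θ Q) {C : Set M} (hC : IsCompact C)
    (hoff : ∀ t ∈ Icc (0 : ℝ) 1, ∀ x ∉ C, (x ∈ G t ↔ x ∈ Γ t) ∧ (x ∈ Θ t ↔ x ∈ Ξ t))
    (harea : ContDiffOn ℝ ∞ (fun t => area n (G t)) (Icc 0 1)) : IsBoundaryFamily n G Θ := by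
  obtain ⟨P, hΓ, -, -, hvol⟩ := h
  have hsm := hG.isGeneralizedSmoothFamily hn hΓ (τ := id) continuousOn_id (fun t ht => ht) hC
    (fun t ht x hx => (hoff t ht x hx).1) harea
  refine ⟨Q, hsm, fun t ht => hG.isOpen ht, fun t ht => ⟨fun x hx => (hG.bd t ht x).frontier_subset hx,
    fun x hx => ?_⟩, fun t ht => hG.tendsto_volume ht (hsm.measure_lt_top t ht) (hvol t ht) hC
    fun s hs x hx => (hoff s hs x hx).2⟩
  by_contra hxQ
  exact hx.2 ((hG.bd t ht x).subset_frontier hx.1 hxQ)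

end Assembly

end Riemannian

end MinMax

end

theorem lemma4p1 (n : ℕ)
    {M : Type*} [EMetricSpace M] [MeasurableSpace M] [BorelSpace M]
    [ChartedSpace (EuclideanSpace ℝ (Fin (n + 1))) M]
    [IsManifold (𝓡 (n + 1)) ∞ M]
    [Bundle.RiemannianBundle (fun x : M => TangentSpace (𝓡 (n + 1)) x)]
    [IsContMDiffRiemannianBundle (𝓡 (n + 1)) ∞ (EuclideanSpace ℝ (Fin (n + 1)))
      (fun x : M => TangentSpace (𝓡 (n + 1)) x)]
    [IsRiemannianManifold (𝓡 (n + 1)) M]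
    (U U' : Set M) (hU : IsOpen U) (hU' : IsOpen U')
    (hUc : IsCompact (closure U)) (hUU' : closure U ⊆ U')
    (Γ Ξ : ℝ → Set M) (hsweep : MinMax.IsSweepout n Γ Ξ)
    (ε : ℝ) (hε : 0 < ε) (t₀ : ℝ) (ht₀ : t₀ ∈ Icc (0 : ℝ) 1)
    (S Ω : ℝ → Set M)
    (hdef : MinMax.IsLoweringDeformation n U ε (Γ t₀) (Ξ t₀) S Ω) :
    ∃ η : ℝ, 0 < η ∧
      ∀ a a' b' b : ℝ, t₀ - η ≤ a → a < a' → a' < b' → b' < b → b ≤ t₀ + η →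
        ∃ Γ' Ξ' : ℝ → Set M,
          MinMax.IsSweepout n Γ' Ξ' ∧
          (∀ t ∈ Icc (0 : ℝ) a ∪ Icc b 1, Ξ' t = Ξ t ∧ Γ' t = Γ t) ∧
          (∀ t ∈ Ioo a b, Ξ' t \ U' = Ξ t \ U' ∧ Γ' t \ U' = Γ t \ U') ∧
          (∀ t ∈ Icc (0 : ℝ) 1,
            MinMax.area n (Γ' t) ≤ MinMax.area n (Γ t) + ε / 4) ∧
          (∀ t ∈ Ioo a' b',
            MinMax.area n (Γ' t) ≤ MinMax.area n (Γ t) - ε / 2) ∧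
          MinMax.AreHomotopic n Γ Γ' := by
  obtain ⟨hbd, hΞ0, hΞ1⟩ := hsweep
  rcases Nat.eq_zero_or_pos n with rfl | hn
  · obtain ⟨_, hS, -⟩ := hdef.isBoundaryFamily
    have h1 := MinMax.area_zero_eq_of_continuousOn hS.area_smooth.continuousOn
    rw [hdef.start_surface] at h1
    linarith [hdef.area_end]
  obtain ⟨P, hΓ, hfam⟩ := hbd.exists_contFamily hn
  have hpos : 0 < MinMax.area n (Γ t₀) := by
    have h1 : 0 ≤ MinMax.area n (S 1) := ENNReal.toReal_nonneg
    linarith [hdef.area_end]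
  have hend : ∀ t ∈ Icc (0 : ℝ) 1, frontier (Ξ t) = ∅ → MinMax.area n (Γ t) = 0 := fun t ht hfr =>
    MinMax.area_eq_zero_of_frontier_eq_empty hn (hfam.finite t ht) (fun x hx => by
      by_contra hxP
      exact hx.2 ((hfam.bd t ht x).subset_frontier hx.1 hxP)) hfr
  have h0 : 0 < t₀ := lt_of_le_of_ne ht₀.1 fun h => by
    rw [← h, hend 0 ⟨le_rfl, zero_le_one⟩ (by rw [hΞ0, frontier_empty])] at hpos
    exact lt_irrefl _ hpos
  have h1 : t₀ < 1 := lt_of_le_of_ne ht₀.2 fun h => by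
    rw [h, hend 1 ⟨zero_le_one, le_rfl⟩ (by rw [hΞ1, frontier_univ])] at hpos
    exact lt_irrefl _ hpos
  obtain ⟨S', Ω', PS', hS'⟩ := hdef.exists_nonempty hn hε
  obtain ⟨N, hN, K, hKS, hKsch, hWU', T, hgood, hsep⟩ :=
    MinMax.exists_composite hn hfam ht₀ hU' hUc hUU' hS'
  obtain ⟨η, hη, hηK, hrad⟩ := K.exists_radius hn hΓ ht₀ (2 * N + 1) (δ := ε / 64) (by positivity)
  refine ⟨min η (min (t₀ / 2) ((1 - t₀) / 2)), lt_min hη (lt_min (by linarith) (by linarith)), ?_⟩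
  intro a a' b' b ha haa hab hbb hb
  have e1 := min_le_left η (min (t₀ / 2) ((1 - t₀) / 2))
  have e2 := (min_le_right η (min (t₀ / 2) ((1 - t₀) / 2))).trans (min_le_left _ _)
  have e3 := (min_le_right η (min (t₀ / 2) ((1 - t₀) / 2))).trans (min_le_right _ _)
  have ha0 : 0 ≤ a := by linarith
  have hb1 : b ≤ 1 := by linarith
  have hnear : Icc a b ⊆ MinMax.near t₀ η := fun t ht =>
    ⟨⟨ha0.trans ht.1, ht.2.trans hb1⟩, Metric.mem_closedBall.2 (abs_le.2 ⟨by linarith [ht.1], by linarith [ht.2]⟩)⟩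
  have hnearK : Icc a b ⊆ MinMax.near t₀ K.η := fun t ht =>
    ⟨(hnear ht).1, Metric.closedBall_subset_closedBall hηK (hnear ht).2⟩
  obtain ⟨G, Θ, Q, hG, hoff, hout, harea, hbound⟩ := K.exists_modified hn hΓ hfam ht₀ hN T hgood hsep
    haa hbb hnearK (δ := ε / 64) (by positivity)
  have hC : IsCompact (K.F.C ∪ closure K.W) := K.F.isCompact.union K.isCompact_W
  have hCU' : K.F.C ∪ closure K.W ⊆ U' := union_subset K.F.subset hWU'
  have hsq : ∀ t ∈ Icc (0 : ℝ) 1, ((1, t) : ℝ × ℝ) ∈ MinMax.unitSquare := fun t ht =>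
    ⟨⟨zero_le_one, le_rfl⟩, ht⟩
  have hout1 : ∀ t ∈ Icc (0 : ℝ) 1, t ≤ a ∨ b ≤ t → G (1, t) = Γ t ∧ Θ (1, t) = Ξ t := fun t ht h =>
    hout (1, t) (hsq t ht) (Or.inr h)
  have hfam' : MinMax.ContFamily n (Icc (0 : ℝ) 1) (fun t => G (1, t)) (fun t => Θ (1, t)) (fun t => Q (1, t)) :=
    hG.comp (φ := fun t : ℝ => ((1 : ℝ), t)) (by fun_prop) hsq
  have hsch : ∀ m, K.sch m ∈ Icc (0 : ℝ) 1 := K.sch_mem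
  have hkey : ∀ t ∈ Icc a b, MinMax.area n (G (1, t)) ≤ MinMax.area n (Γ t) + ε / 4 ∧
      (t ∈ Icc a' b' → MinMax.area n (G (1, t)) ≤ MinMax.area n (Γ t) - ε / 2) := by
    intro t ht
    obtain ⟨m, hm, hle, hmid⟩ := hbound t ht
    obtain ⟨r1, r2⟩ := hrad t (hnear ht)
    have r3 := abs_lt.1 r1
    have r4 := abs_lt.1 (r2 m hm)
    rw [hKS] at r4
    have r5 := hS'.area_le (K.sch m) (hsch m)
    refine ⟨by linarith [r3.1, r4.2], fun htm => ?_⟩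
    have r6 : K.sch m = 1 := by
      rw [hKsch, hmid htm]
      exact MinMax.stair_end hN (by ring)
    rw [r6] at r4
    linarith [r3.1, r4.2, hS'.area_end]
  refine ⟨fun t => G (1, t), fun t => Θ (1, t), ⟨?_, ?_, ?_⟩, fun t ht => ?_, fun t ht => ?_, fun t ht => ?_,
    fun t ht => (hkey t ⟨haa.le.trans ht.1.le, ht.2.le.trans hbb.le⟩).2 ⟨ht.1.le, ht.2.le⟩, ?_⟩
  · exact hfam'.isBoundaryFamily hn hbd hC (fun t ht x hx => hoff (1, t) (hsq t ht) x hx)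
      (harea.comp (contDiff_const.prodMk contDiff_id).contDiffOn hsq)
  · show Θ (1, 0) = ∅
    rw [(hout1 0 ⟨le_rfl, zero_le_one⟩ (Or.inl ha0)).2, hΞ0]
  · show Θ (1, 1) = univ
    rw [(hout1 1 ⟨zero_le_one, le_rfl⟩ (Or.inr hb1)).2, hΞ1]
  · have h2 : t ∈ Icc (0 : ℝ) 1 ∧ (t ≤ a ∨ b ≤ t) := by
      rcases ht with ht | ht
      · exact ⟨⟨ht.1, by linarith [ht.2]⟩, Or.inl ht.2⟩
      · exact ⟨⟨by linarith [ht.1], ht.2⟩, Or.inr ht.1⟩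
    exact (hout1 t h2.1 h2.2).symm
  · have htI : t ∈ Icc (0 : ℝ) 1 := ⟨by linarith [ht.1], by linarith [ht.2]⟩
    have h2 := fun x (hx : x ∉ U') => hoff (1, t) (hsq t htI) x fun h => hx (hCU' h)
    exact ⟨Set.ext fun x => and_congr_left fun hx => (h2 x hx).2,
      Set.ext fun x => and_congr_left fun hx => (h2 x hx).1⟩
  · by_cases htI : t ∈ Icc a b
    · exact (hkey t htI).1
    · have h2 : t ≤ a ∨ b ≤ t := by
        by_contra! hcon
        exact htI ⟨hcon.1.le, hcon.2.le⟩
      show MinMax.area n (G (1, t)) ≤ _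
      rw [(hout1 t ht h2).1]
      linarith
  · refine ⟨G, Q, hG.isGeneralizedSmoothFamily hn hΓ (τ := Prod.snd) (by fun_prop) (fun y hy => hy.2) hC
      (fun y hy x hx => (hoff y hy x hx).1) harea, fun t ht => ⟨?_, rfl⟩⟩
    exact (hout (0, t) ⟨⟨le_rfl, zero_le_one⟩, ht⟩ (Or.inl rfl)).1
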